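/- Let $(M,J,g)$ be a Hermitian manifold, i.e. a smooth manifold $M$ with an integrable almost complex structure $J$ and a Riemannian metric $g$ with $g(J\cdot,J\cdot)=g$. Let $\nabla^c$ be its Chern connection (the unique connection with $\nabla g=0$, $\nabla J=0$ whose torsion has vanishing $(1,1)$-part) and $\nabla^b$ its Bismut connection (the unique connection with $\nabla g=0$, $\nabla J=0$ whose torsion is totally skew-symmetric). For $s\in\mathbb R$ let $$\nabla^s=\left(1-\tfrac s2\right)\nabla^c+\tfrac s2\,\nabla^b$$ be the Gauduchon connections and let $R^s(X,Y)=[\nabla^s_X,\nabla^s_Y]-\nabla^s_{[X,Y]}$ be the curvature of $\nabla^s$. The connection $\nabla^s$ is called *Kähler-like* if $$R^s(X,Y)Z+R^s(Y,Z)X+R^s(Z,X)Y=0\quad\text{and}\quad R^s(JX,JY)=R^s(X,Y)\qquad\text{for all } X,Y,Z\in TM.$$ Suppose that $\nabla^s$ is Kähler-like for some real number $s\neq 0,2$, and that the group $G$ of biholomorphic isometries of $(M,J,g)$ (the diffeomorphisms of $M$ preserving $J$ and $g$) has a compact fundamental domain, in the sense that there is a compact set $K\subseteq M$ with $\bigcup_{\varphi\in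 G}\varphi(K)=M$. Then $(M,J,g)$ is Kähler, i.e. the fundamental form $\omega=g(J\cdot,\cdot)$ is closed. -/

import Mathlib

open Bundle FiberBundle VectorField
open scoped Manifold ContDiff

noncomputable section

universe u v

/-- A Hermitian structure `(J, g)` on a smooth real manifold `M`: an integrable almost complex
structure `J` together with a smooth Riemannian metric `g` for which `J` is orthogonal. -/
structure HermitianStructure (E : Type u) [NormedAddCommGroup E] [NormedSpace ℝ E]
    (M : Type v) [TopologicalSpace M] [ChartedSpace E M] [IsManifold 𝓘(ℝ, E) ∞ M] where
  /-- The complex structure, a field of endomorphisms of the tangent bundle. -/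
  J : Π x : M, TangentSpace 𝓘(ℝ, E) x →L[ℝ] TangentSpace 𝓘(ℝ, E) x
  contMDiff_J : ContMDiff 𝓘(ℝ, E) (𝓘(ℝ, E).prod 𝓘(ℝ, E →L[ℝ] E)) ∞
    (fun x ↦ TotalSpace.mk' (E →L[ℝ] E)
      (E := fun x : M ↦ TangentSpace 𝓘(ℝ, E) x →L[ℝ] TangentSpace 𝓘(ℝ, E) x) x (J x))
  J_J : ∀ (x : M) (v : TangentSpace 𝓘(ℝ, E) x), J x (J x v) = -v
  /-- The Nijenhuis tensor of `J` vanishes. -/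
  nijenhuis : ∀ (x : M) (X Y : Π x : M, TangentSpace 𝓘(ℝ, E) x),
    MDiffAt (T% X) x → MDiffAt (T% Y) x →
      mlieBracket 𝓘(ℝ, E) (fun y ↦ J y (X y)) (fun y ↦ J y (Y y)) x
        - J x (mlieBracket 𝓘(ℝ, E) (fun y ↦ J y (X y)) Y x)
        - J x (mlieBracket 𝓘(ℝ, E) X (fun y ↦ J y (Y y)) x)
        - mlieBracket 𝓘(ℝ, E) X Y x = 0
  /-- The Riemannian metric; the scalar product of `v` and `w` is `g.inner x v w`. -/
  g : ContMDiffRiemannianMetric 𝓘(ℝ, E) ∞ E (fun x : M ↦ TangentSpace 𝓘(ℝ, E) x)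
  g_J_J : ∀ (x : M) (v w : TangentSpace 𝓘(ℝ, E) x),
    g.inner x (J x v) (J x w) = g.inner x v w

namespace HermitianStructure

variable {E : Type u} [NormedAddCommGroup E] [NormedSpace ℝ E]
  {M : Type v} [TopologicalSpace M] [ChartedSpace E M] [IsManifold 𝓘(ℝ, E) ∞ M]
  (H : HermitianStructure E M)

/-! ### Basic facts -/

variable {H} in
lemma mdiffAt_J {x : M} {Y : Π x : M, TangentSpace 𝓘(ℝ, E) x} (hY : MDiffAt (T% Y) x) :
    MDiffAt (T% (fun y ↦ H.J y (Y y))) x :=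
  MDifferentiableAt.clm_bundle_apply (b := id) (F₁ := E) (F₂ := E)
    (H.contMDiff_J.mdifferentiable (by simp) x) hY

variable {H} in
lemma mdiffAt_g {x : M} {Y Z : Π x : M, TangentSpace 𝓘(ℝ, E) x}
    (hY : MDiffAt (T% Y) x) (hZ : MDiffAt (T% Z) x) :
    MDiffAt (fun y ↦ H.g.inner y (Y y) (Z y)) x := by
  have : MDifferentiableAt 𝓘(ℝ, E) (𝓘(ℝ, E).prod 𝓘(ℝ, ℝ))
      (fun m ↦ TotalSpace.mk' ℝ (E := Bundle.Trivial M ℝ) m (H.g.inner m (Y m) (Z m))) x := by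
    apply MDifferentiableAt.clm_bundle_apply₂ (b := id) (F₁ := E) (F₂ := E)
    · exact H.g.contMDiff.mdifferentiable (by simp) x
    · exact hY
    · exact hZ
  simp only [mdifferentiableAt_totalSpace] at this
  exact this.2

lemma g_J_left (x : M) (v w : TangentSpace 𝓘(ℝ, E) x) :
    H.g.inner x (H.J x v) w = -H.g.inner x v (H.J x w) := by
  rw [← H.g_J_J x v (H.J x w), H.J_J]; simp

lemma g_nondeg (x : M) {v w : TangentSpace 𝓘(ℝ, E) x}
    (h : ∀ z, H.g.inner x v z = H.g.inner x w z) : v = w := by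
  by_contra hne
  have h1 := H.g.pos x (v - w) (sub_ne_zero.2 hne)
  have h2 := h (v - w)
  simp only [map_sub, sub_apply] at h1 h2
  linarith

lemma exists_sharp [FiniteDimensional ℝ E] (x : M) :
    ∃ S : (TangentSpace 𝓘(ℝ, E) x →L[ℝ] ℝ) →L[ℝ] TangentSpace 𝓘(ℝ, E) x,
      ∀ f w, H.g.inner x (S f) w = f w := by
  have h : Function.Injective (H.g.inner x) := fun v w hvw ↦
    H.g_nondeg x fun z ↦ by rw [hvw]
  let B : E →ₗ[ℝ] (E →L[ℝ] ℝ) := (H.g.inner x).toLinearMap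
  have hB : Function.Injective B := h
  have hd : Module.finrank ℝ E = Module.finrank ℝ (E →L[ℝ] ℝ) := by
    rw [← (LinearMap.toContinuousLinearMap (𝕜 := ℝ) (E := E) (F' := ℝ)).finrank_eq]
    exact Subspace.dual_finrank_eq.symm
  let e := LinearEquiv.ofInjectiveOfFinrankEq B hB hd
  let S : (E →L[ℝ] ℝ) →L[ℝ] E := LinearMap.toContinuousLinearMap e.symm.toLinearMap
  refine ⟨S, fun f w ↦ ?_⟩
  have : B (e.symm f) = f := e.apply_symm_apply f
  exact congrArg (fun φ : E →L[ℝ] ℝ ↦ φ w) this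


/-! ### Hermitian, Chern and Bismut connections -/

/-- An affine connection is Hermitian if `∇g = 0` and `∇J = 0`. (In the argument order of
`CovariantDerivative`, `D Y x v` is `∇_v Y` at the point `x`.) -/
structure IsHermitianConnection
    (D : CovariantDerivative 𝓘(ℝ, E) E (fun x : M ↦ TangentSpace 𝓘(ℝ, E) x)) : Prop where
  metric : ∀ (x : M) (Y Z : Π x : M, TangentSpace 𝓘(ℝ, E) x),
    MDiffAt (T% Y) x → MDiffAt (T% Z) x → ∀ v : TangentSpace 𝓘(ℝ, E) x,
      mvfderiv 𝓘(ℝ, E) (fun y ↦ H.g.inner y (Y y) (Z y)) x v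
        = H.g.inner x (D Y x v) (Z x) + H.g.inner x (Y x) (D Z x v)
  complex : ∀ (x : M) (Y : Π x : M, TangentSpace 𝓘(ℝ, E) x), MDiffAt (T% Y) x →
    ∀ v : TangentSpace 𝓘(ℝ, E) x, D (fun y ↦ H.J y (Y y)) x v = H.J x (D Y x v)

/-- The Chern connection is the Hermitian connection for which the `(1,1)`-part
`(T(v, w) + T(Jv, Jw)) / 2` of the torsion `T` vanishes. -/
structure IsChernConnection [FiniteDimensional ℝ E]
    (D : CovariantDerivative 𝓘(ℝ, E) E (fun x : M ↦ TangentSpace 𝓘(ℝ, E) x)) : Prop where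
  hermitian : H.IsHermitianConnection D
  torsion : ∀ (x : M) (v w : TangentSpace 𝓘(ℝ, E) x),
    D.torsion x v w + D.torsion x (H.J x v) (H.J x w) = 0

/-- The (Strominger-)Bismut connection is the Hermitian connection whose torsion `T` is totally
skew-symmetric, i.e. `g(T(v, w), z)` is (besides in `v, w`) skew-symmetric in `w, z`. -/
structure IsBismutConnection [FiniteDimensional ℝ E]
    (D : CovariantDerivative 𝓘(ℝ, E) E (fun x : M ↦ TangentSpace 𝓘(ℝ, E) x)) : Prop where
  hermitian : H.IsHermitianConnection D
  torsion : ∀ (x : M) (v w z : TangentSpace 𝓘(ℝ, E) x),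
    H.g.inner x (D.torsion x v w) z = -H.g.inner x (D.torsion x v z) w

/-! ### Existence of the Chern connection -/

/-- `[X, Y] + J[JX, Y]`, which equals `∇_X Y + J∇_{JX} Y` for the Chern connection. -/
def chernBracket (X Y : Π x : M, TangentSpace 𝓘(ℝ, E) x) (x : M) : TangentSpace 𝓘(ℝ, E) x :=
  mlieBracket 𝓘(ℝ, E) X Y x + H.J x (mlieBracket 𝓘(ℝ, E) (fun y ↦ H.J y (X y)) Y x)

/-- The Koszul-type expression for `g(∇_X Y, Z)`, with `∇` the Chern connection. -/
def chernKoszul (X Y Z : Π x : M, TangentSpace 𝓘(ℝ, E) x) (x : M) : ℝ :=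
  (mvfderiv 𝓘(ℝ, E) (fun y ↦ H.g.inner y (Y y) (Z y)) x (X x)
    + mvfderiv 𝓘(ℝ, E) (fun y ↦ H.g.inner y (Y y) (H.J y (Z y))) x (H.J x (X x))
    - H.g.inner x (Y x) (H.chernBracket X Z x)
    + H.g.inner x (H.chernBracket X Y x) (Z x)) / 2

section Chern

variable {H} {x : M} {X X' Y Y' Z Z' : Π x : M, TangentSpace 𝓘(ℝ, E) x}

lemma J_add : (fun y ↦ H.J y ((X + X') y)) = (fun y ↦ H.J y (X y)) + fun y ↦ H.J y (X' y) := by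
  ext y; simp

lemma J_smul {f : M → ℝ} : (fun y ↦ H.J y ((f • X) y)) = f • fun y ↦ H.J y (X y) := by
  ext y; simp

lemma chernBracket_J_right (hX : MDiffAt (T% X) x) (hY : MDiffAt (T% Y) x) :
    H.chernBracket X (fun y ↦ H.J y (Y y)) x = H.J x (H.chernBracket X Y x) := by
  have h := congrArg (H.J x) (H.nijenhuis x X Y hX hY)
  simp only [map_sub, H.J_J, map_zero] at h
  simp only [chernBracket, map_add, H.J_J]
  rw [← sub_eq_zero, ← h]
  abel

lemma mvfderiv_g_add_left (hY : MDiffAt (T% Y) x) (hY' : MDiffAt (T% Y') x)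
    (hZ : MDiffAt (T% Z) x) (v : TangentSpace 𝓘(ℝ, E) x) :
    mvfderiv 𝓘(ℝ, E) (fun y ↦ H.g.inner y ((Y + Y') y) (Z y)) x v
      = mvfderiv 𝓘(ℝ, E) (fun y ↦ H.g.inner y (Y y) (Z y)) x v
        + mvfderiv 𝓘(ℝ, E) (fun y ↦ H.g.inner y (Y' y) (Z y)) x v := by
  have := mvfderiv_fun_add (mdiffAt_g (H := H) hY hZ) (mdiffAt_g (H := H) hY' hZ)
  simpa using congrArg (fun L ↦ L v) this

lemma mvfderiv_g_smul_left {f : M → ℝ} (hf : MDiffAt f x) (hY : MDiffAt (T% Y) x)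
    (hZ : MDiffAt (T% Z) x) (v : TangentSpace 𝓘(ℝ, E) x) :
    mvfderiv 𝓘(ℝ, E) (fun y ↦ H.g.inner y ((f • Y) y) (Z y)) x v
      = f x * mvfderiv 𝓘(ℝ, E) (fun y ↦ H.g.inner y (Y y) (Z y)) x v
        + mvfderiv 𝓘(ℝ, E) f x v * H.g.inner x (Y x) (Z x) := by
  have := mvfderiv_fun_mul hf (mdiffAt_g (H := H) hY hZ)
  simpa [mul_comm] using congrArg (fun L ↦ L v) this

lemma mvfderiv_g_symm (v : TangentSpace 𝓘(ℝ, E) x) :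
    mvfderiv 𝓘(ℝ, E) (fun y ↦ H.g.inner y (Y y) (Z y)) x v
      = mvfderiv 𝓘(ℝ, E) (fun y ↦ H.g.inner y (Z y) (Y y)) x v := by
  simp only [H.g.symm _ (Y _) (Z _)]

lemma mvfderiv_g_J_left (v : TangentSpace 𝓘(ℝ, E) x) :
    mvfderiv 𝓘(ℝ, E) (fun y ↦ H.g.inner y (H.J y (Y y)) (Z y)) x v
      = -mvfderiv 𝓘(ℝ, E) (fun y ↦ H.g.inner y (Y y) (H.J y (Z y))) x v := by
  simp only [H.g_J_left, mvfderiv_fun_neg, neg_apply]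

variable [FiniteDimensional ℝ E]

lemma chernBracket_add_left (hX : MDiffAt (T% X) x) (hX' : MDiffAt (T% X') x) :
    H.chernBracket (X + X') Y x = H.chernBracket X Y x + H.chernBracket X' Y x := by
  have : CompleteSpace E := FiniteDimensional.complete ℝ E
  simp only [chernBracket, J_add]
  rw [mlieBracket_add_left hX hX', mlieBracket_add_left (mdiffAt_J hX) (mdiffAt_J hX'), map_add]
  abel

lemma chernBracket_add_right (hX : MDiffAt (T% Y) x) (hX' : MDiffAt (T% Y') x) :
    H.chernBracket X (Y + Y') x = H.chernBracket X Y x + H.chernBracket X Y' x := by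
  have : CompleteSpace E := FiniteDimensional.complete ℝ E
  simp only [chernBracket]
  rw [mlieBracket_add_right hX hX', mlieBracket_add_right hX hX', map_add]
  abel

lemma chernBracket_smul_left {f : M → ℝ} (hf : MDiffAt f x) (hX : MDiffAt (T% X) x) :
    H.chernBracket (f • X) Y x = f x • H.chernBracket X Y x := by
  have : CompleteSpace E := FiniteDimensional.complete ℝ E
  simp only [chernBracket, J_smul]
  rw [mlieBracket_smul_left hf hX, mlieBracket_smul_left hf (mdiffAt_J hX)]
  simp only [map_add, map_smul, H.J_J]
  module

lemma chernBracket_smul_right {f : M → ℝ} (hf : MDiffAt f x) (hY : MDiffAt (T% Y) x) :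
    H.chernBracket X (f • Y) x = f x • H.chernBracket X Y x
      + mvfderiv 𝓘(ℝ, E) f x (X x) • Y x
      + mvfderiv 𝓘(ℝ, E) f x (H.J x (X x)) • H.J x (Y x) := by
  have : CompleteSpace E := FiniteDimensional.complete ℝ E
  simp only [chernBracket]
  rw [mlieBracket_smul_right hf hY, mlieBracket_smul_right hf hY]
  simp only [map_add, map_smul]
  module

lemma chernBracket_J_left (hX : MDiffAt (T% X) x) :
    H.chernBracket (fun y ↦ H.J y (X y)) Y x = -H.J x (H.chernBracket X Y x) := by
  have : CompleteSpace E := FiniteDimensional.complete ℝ E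
  have h : (fun y ↦ H.J y (H.J y (X y))) = (-1 : ℝ) • X := by ext y; simp [H.J_J]
  simp only [chernBracket, h]
  rw [mlieBracket_const_smul_left hX]
  simp only [map_add, map_smul, H.J_J]
  module

lemma chernKoszul_add_left (hX : MDiffAt (T% X) x) (hX' : MDiffAt (T% X') x) :
    H.chernKoszul (X + X') Y Z x = H.chernKoszul X Y Z x + H.chernKoszul X' Y Z x := by
  simp only [chernKoszul, chernBracket_add_left hX hX', Pi.add_apply, map_add, add_apply]
  ring

lemma chernKoszul_smul_left {f : M → ℝ} (hf : MDiffAt f x) (hX : MDiffAt (T% X) x) :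
    H.chernKoszul (f • X) Y Z x = f x • H.chernKoszul X Y Z x := by
  simp only [chernKoszul, chernBracket_smul_left hf hX, Pi.smul_apply', map_smul, smul_apply,
    smul_eq_mul]
  ring

lemma chernKoszul_add_middle (hY : MDiffAt (T% Y) x) (hY' : MDiffAt (T% Y') x)
    (hZ : MDiffAt (T% Z) x) :
    H.chernKoszul X (Y + Y') Z x = H.chernKoszul X Y Z x + H.chernKoszul X Y' Z x := by
  simp only [chernKoszul, chernBracket_add_right hY hY', mvfderiv_g_add_left hY hY' hZ,
    mvfderiv_g_add_left hY hY' (mdiffAt_J hZ)]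
  simp only [Pi.add_apply, map_add, add_apply]
  ring

lemma chernKoszul_smul_middle {f : M → ℝ} (hf : MDiffAt f x) (hY : MDiffAt (T% Y) x)
    (hZ : MDiffAt (T% Z) x) :
    H.chernKoszul X (f • Y) Z x = f x * H.chernKoszul X Y Z x
      + mvfderiv 𝓘(ℝ, E) f x (X x) * H.g.inner x (Y x) (Z x) := by
  simp only [chernKoszul, chernBracket_smul_right hf hY, mvfderiv_g_smul_left hf hY hZ,
    mvfderiv_g_smul_left hf hY (mdiffAt_J hZ)]
  simp only [Pi.smul_apply', map_smul, smul_apply, smul_eq_mul, map_add, add_apply, g_J_left]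
  ring

lemma chernKoszul_add_right (hY : MDiffAt (T% Y) x)
    (hZ : MDiffAt (T% Z) x) (hZ' : MDiffAt (T% Z') x) :
    H.chernKoszul X Y (Z + Z') x = H.chernKoszul X Y Z x + H.chernKoszul X Y Z' x := by
  have h1 (v : TangentSpace 𝓘(ℝ, E) x) := mvfderiv_g_add_left (H := H) hZ hZ' hY v
  have h2 (v : TangentSpace 𝓘(ℝ, E) x) :=
    mvfderiv_g_add_left (H := H) (mdiffAt_J (H := H) hZ) (mdiffAt_J (H := H) hZ') hY v
  rw [← J_add] at h2
  simp only [chernKoszul, chernBracket_add_right hZ hZ', mvfderiv_g_symm (Y := Y), h1, h2]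
  simp only [Pi.add_apply, map_add]
  ring

lemma chernKoszul_smul_right {f : M → ℝ} (hf : MDiffAt f x) (hY : MDiffAt (T% Y) x)
    (hZ : MDiffAt (T% Z) x) :
    H.chernKoszul X Y (f • Z) x = f x • H.chernKoszul X Y Z x := by
  have h1 (v : TangentSpace 𝓘(ℝ, E) x) := mvfderiv_g_smul_left (H := H) hf hZ hY v
  have h2 (v : TangentSpace 𝓘(ℝ, E) x) :=
    mvfderiv_g_smul_left (H := H) hf (mdiffAt_J (H := H) hZ) hY v
  rw [← J_smul] at h2
  simp only [chernKoszul, chernBracket_smul_right hf hZ, mvfderiv_g_symm (Y := Y), h1, h2]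
  simp only [Pi.smul_apply', map_smul, smul_eq_mul, map_add, H.g.symm x (Y x),
    add_apply, smul_apply]
  ring

variable (H) in
lemma exists_chernKoszul (Y : Π x : M, TangentSpace 𝓘(ℝ, E) x) (x : M) :
    ∃ L : TangentSpace 𝓘(ℝ, E) x →L[ℝ] TangentSpace 𝓘(ℝ, E) x, MDiffAt (T% Y) x →
      ∀ X Z : Π x : M, TangentSpace 𝓘(ℝ, E) x, MDiffAt (T% X) x → MDiffAt (T% Z) x →
        H.g.inner x (L (X x)) (Z x) = H.chernKoszul X Y Z x := by
  by_cases hY : MDiffAt (T% Y) x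
  swap
  · exact ⟨0, fun h ↦ absurd h hY⟩
  obtain ⟨S, hS⟩ := H.exists_sharp x
  have h1 (Z : Π x : M, TangentSpace 𝓘(ℝ, E) x) (_ : MDiffAt (T% Z) x) :
      TensorialAt 𝓘(ℝ, E) E (fun X ↦ H.chernKoszul X Y Z x) x :=
    ⟨fun hf hX ↦ chernKoszul_smul_left hf hX, fun hX hX' ↦ chernKoszul_add_left hX hX'⟩
  have h2 (X : Π x : M, TangentSpace 𝓘(ℝ, E) x) (_ : MDiffAt (T% X) x) :
      TensorialAt 𝓘(ℝ, E) E (fun Z ↦ H.chernKoszul X Y Z x) x :=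
    ⟨fun hf hZ ↦ chernKoszul_smul_right hf hY hZ, fun hZ hZ' ↦ chernKoszul_add_right hY hZ hZ'⟩
  refine ⟨S ∘L TensorialAt.mkHom₂ (fun X Z ↦ H.chernKoszul X Y Z x) x h1 h2, fun _ X Z hX hZ ↦ ?_⟩
  rw [ContinuousLinearMap.comp_apply, hS]
  exact TensorialAt.mkHom₂_apply h1 h2 hX hZ

variable (H) in
lemma exists_chernConnection_aux :
    ∃ D : CovariantDerivative 𝓘(ℝ, E) E (fun x : M ↦ TangentSpace 𝓘(ℝ, E) x),
      ∀ (x : M) (X Y Z : Π x : M, TangentSpace 𝓘(ℝ, E) x), MDiffAt (T% X) x → MDiffAt (T% Y) x →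
        MDiffAt (T% Z) x → H.g.inner x (D Y x (X x)) (Z x) = H.chernKoszul X Y Z x := by
  choose L hL using H.exists_chernKoszul
  refine ⟨⟨L, ⟨fun {Y Y' x} hY hY' _ ↦ ?_, fun {Y f x} hY hf _ ↦ ?_⟩⟩,
    fun x X Y Z hX hY hZ ↦ hL Y x hY X Z hX hZ⟩
  · ext v
    refine H.g_nondeg x fun w ↦ ?_
    have hv := mdifferentiableAt_extend 𝓘(ℝ, E) E v
    have hw := mdifferentiableAt_extend 𝓘(ℝ, E) E w
    have h1 := hL (Y + Y') x (mdifferentiableAt_add_section hY hY') _ _ hv hw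
    have h2 := hL Y x hY _ _ hv hw
    have h3 := hL Y' x hY' _ _ hv hw
    simp only [extend_apply_self] at h1 h2 h3
    rw [h1, add_apply, map_add, add_apply, h2, h3, chernKoszul_add_middle hY hY' hw]
  · ext v
    refine H.g_nondeg x fun w ↦ ?_
    have hv := mdifferentiableAt_extend 𝓘(ℝ, E) E v
    have hw := mdifferentiableAt_extend 𝓘(ℝ, E) E w
    have h1 := hL (f • Y) x (hf.smul_section hY) _ _ hv hw
    have h2 := hL Y x hY _ _ hv hw
    simp only [extend_apply_self] at h1 h2
    rw [h1, chernKoszul_smul_middle hf hY hw, add_apply, map_add, add_apply, smul_apply, map_smul,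
      smul_apply, h2]
    simp

variable (H) in
lemma exists_chern_strong :
    ∃ D : CovariantDerivative 𝓘(ℝ, E) E (fun x : M ↦ TangentSpace 𝓘(ℝ, E) x),
      H.IsHermitianConnection D ∧ ∀ (x : M) (v w : TangentSpace 𝓘(ℝ, E) x),
        D.torsion x (H.J x v) w = H.J x (D.torsion x v w) := by
  have : CompleteSpace E := FiniteDimensional.complete ℝ E
  obtain ⟨D, hD⟩ := H.exists_chernConnection_aux
  have hJ (x : M) (Y : Π x : M, TangentSpace 𝓘(ℝ, E) x) (hY : MDiffAt (T% Y) x)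
      (v : TangentSpace 𝓘(ℝ, E) x) : D (fun y ↦ H.J y (Y y)) x v = H.J x (D Y x v) := by
    refine H.g_nondeg x fun w ↦ ?_
    have hv := mdifferentiableAt_extend 𝓘(ℝ, E) E v
    have hw := mdifferentiableAt_extend 𝓘(ℝ, E) E w
    have h1 := hD x _ _ _ hv (mdiffAt_J (H := H) hY) hw
    have h2 := hD x _ _ _ hv hY (mdiffAt_J (H := H) hw)
    simp only [extend_apply_self] at h1 h2
    rw [g_J_left, h1, h2]
    simp only [chernKoszul, chernBracket_J_right (H := H) hv hY,
      chernBracket_J_right (H := H) hv hw, H.g_J_left, H.J_J, map_neg, mvfderiv_fun_neg,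
      neg_apply, neg_neg]
    ring
  refine ⟨D, ⟨fun x Y Z hY hZ v ↦ ?_, hJ⟩, fun x v w ↦ ?_⟩
  · have hv := mdifferentiableAt_extend 𝓘(ℝ, E) E v
    have h1 := hD x _ _ _ hv hY hZ
    have h2 := hD x _ _ _ hv hZ hY
    have h3 : mvfderiv 𝓘(ℝ, E) (fun y ↦ H.g.inner y (Z y) (H.J y (Y y))) x (H.J x v)
        = -mvfderiv 𝓘(ℝ, E) (fun y ↦ H.g.inner y (Y y) (H.J y (Z y))) x (H.J x v) := by
      rw [mvfderiv_g_symm, mvfderiv_g_J_left]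
    simp only [extend_apply_self] at h1 h2
    rw [H.g.symm x (Y x), h1, h2]
    simp only [chernKoszul, extend_apply_self, h3, mvfderiv_g_symm (Y := Z) (Z := Y),
      H.g.symm x (H.chernBracket _ _ x)]
    ring
  · have hv := mdifferentiableAt_extend 𝓘(ℝ, E) E v
    have hw := mdifferentiableAt_extend 𝓘(ℝ, E) E w
    have h1 := D.torsion_apply (mdiffAt_J (H := H) hv) hw
    have h2 := D.torsion_apply hv hw
    rw [hJ x _ hv] at h1
    simp only [extend_apply_self] at h1 h2
    rw [h1, h2]
    refine H.g_nondeg x fun z ↦ ?_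
    have hz := mdifferentiableAt_extend 𝓘(ℝ, E) E z
    have h3 := hD x _ _ _ (mdiffAt_J (H := H) hv) hw hz
    have h4 := hD x _ _ _ hv hw (mdiffAt_J (H := H) hz)
    simp only [extend_apply_self] at h3 h4
    have h5 : H.g.inner x (H.chernBracket (extend E v) (extend E w) x) (H.J x z)
        = -H.g.inner x (H.J x (mlieBracket 𝓘(ℝ, E) (extend E v) (extend E w) x)) z
          + H.g.inner x (mlieBracket 𝓘(ℝ, E) (fun y ↦ H.J y (extend E v y)) (extend E w) x) z := by
      rw [← neg_neg (H.g.inner x _ (H.J x z)), ← H.g_J_left]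
      simp only [chernBracket, map_add, H.J_J, map_neg, add_apply, neg_apply]
      ring
    simp only [map_sub, sub_apply, h3, H.g_J_left x (D _ x v), h4]
    simp only [chernKoszul, mvfderiv_fun_neg, chernBracket_J_right (H := H) hv hz,
      chernBracket_J_left (H := H) hv, H.J_J, map_neg, neg_apply, extend_apply_self,
      H.g_J_left x (H.chernBracket _ _ x), h5]
    ring

variable (H) in
theorem exists_isChernConnection :
    ∃ D : CovariantDerivative 𝓘(ℝ, E) E (fun x : M ↦ TangentSpace 𝓘(ℝ, E) x),
      H.IsChernConnection D := by
  have : CompleteSpace E := FiniteDimensional.complete ℝ E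
  obtain ⟨D, hD, hT⟩ := H.exists_chern_strong
  refine ⟨D, hD, fun x v w ↦ ?_⟩
  rw [hT, D.torsion_antisymm v (H.J x w), hT, map_neg, H.J_J, D.torsion_antisymm v w]
  simp

variable (H) in
theorem exists_isBismutConnection :
    ∃ D : CovariantDerivative 𝓘(ℝ, E) E (fun x : M ↦ TangentSpace 𝓘(ℝ, E) x),
      H.IsBismutConnection D := by
  have : CompleteSpace E := FiniteDimensional.complete ℝ E
  obtain ⟨D, hD, hT⟩ := H.exists_chern_strong
  have hT' (x : M) (v w : TangentSpace 𝓘(ℝ, E) x) :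
      D.torsion x v (H.J x w) = H.J x (D.torsion x v w) := by
    rw [D.torsion_antisymm v, hT, D.torsion_antisymm v w, map_neg]
  have hA (x : M) : ∃ A : TangentSpace 𝓘(ℝ, E) x →L[ℝ] TangentSpace 𝓘(ℝ, E) x →L[ℝ]
      TangentSpace 𝓘(ℝ, E) x, ∀ y v z, H.g.inner x (A y v) z
        = -H.g.inner x (D.torsion x v y) z + H.g.inner x (D.torsion x v z) y := by
    have : FiniteDimensional ℝ (TangentSpace 𝓘(ℝ, E) x) := inferInstanceAs (FiniteDimensional ℝ E)
    have : T2Space (TangentSpace 𝓘(ℝ, E) x) := inferInstanceAs (T2Space E)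
    obtain ⟨S, hS⟩ := H.exists_sharp x
    let f (y v : TangentSpace 𝓘(ℝ, E) x) : TangentSpace 𝓘(ℝ, E) x :=
      -D.torsion x v y + S ((H.g.inner x y) ∘L (D.torsion x v))
    have hf (y v z : TangentSpace 𝓘(ℝ, E) x) : H.g.inner x (f y v) z
        = -H.g.inner x (D.torsion x v y) z + H.g.inner x (D.torsion x v z) y := by
      simp only [f, map_add, map_neg, add_apply, neg_apply, hS, ContinuousLinearMap.comp_apply,
        H.g.symm x y]
    let B : TangentSpace 𝓘(ℝ, E) x →ₗ[ℝ] TangentSpace 𝓘(ℝ, E) x →ₗ[ℝ] TangentSpace 𝓘(ℝ, E) x :=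
      LinearMap.mk₂ ℝ f
        (fun y y' v ↦ H.g_nondeg x fun z ↦ by simp only [map_add, add_apply, hf]; ring)
        (fun c y v ↦ H.g_nondeg x fun z ↦ by
          simp only [map_smul, smul_apply, hf, smul_eq_mul]; ring)
        (fun y v v' ↦ H.g_nondeg x fun z ↦ by simp only [map_add, add_apply, hf]; ring)
        (fun c y v ↦ H.g_nondeg x fun z ↦ by
          simp only [map_smul, smul_apply, hf, smul_eq_mul]; ring)
    exact ⟨B.toContinuousBilinearMap, hf⟩
  choose A hA using hA
  refine ⟨D.addOneForm A, ⟨fun x Y Z hY hZ v ↦ ?_, fun x Y hY v ↦ ?_⟩, fun x v w z ↦ ?_⟩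
  · have h := hD.metric x Y Z hY hZ v
    change _ = H.g.inner x (D Y x v + A x (Y x) v) (Z x) + H.g.inner x (Y x) (D Z x v + A x (Z x) v)
    rw [h, map_add, map_add, add_apply, hA, H.g.symm x (Y x) (A x (Z x) v), hA]
    ring
  · change D _ x v + A x (H.J x (Y x)) v = H.J x (D Y x v + A x (Y x) v)
    rw [hD.complex x Y hY v, map_add]
    congr 1
    refine H.g_nondeg x fun z ↦ ?_
    rw [hA, H.g_J_left, hA, hT', hT', H.g_J_left, H.g_J_left]
    ring
  · have ht (v w : TangentSpace 𝓘(ℝ, E) x) :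
        (D.addOneForm A).torsion x v w = D.torsion x v w + A x w v - A x v w := by
      rw [CovariantDerivative.torsion_apply_eq_extend, D.torsion_apply_eq_extend]
      change (D (extend E w) x (extend E v x) + A x (extend E w x) (extend E v x))
        - (D (extend E v) x (extend E w x) + A x (extend E v x) (extend E w x)) - _ = _
      simp only [extend_apply_self]
      abel
    simp only [ht, map_add, map_sub, add_apply, sub_apply, hA]
    rw [D.torsion_antisymm w v, D.torsion_antisymm z v, D.torsion_antisymm z w]
    simp only [map_neg, neg_apply]
    ring

end Chern

/-! ### Gauduchon connections, curvature, and the Kähler condition -/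

section Gauduchon

variable [FiniteDimensional ℝ E]

/-- The Chern connection `∇^c`. -/
def chernConnection : CovariantDerivative 𝓘(ℝ, E) E (fun x : M ↦ TangentSpace 𝓘(ℝ, E) x) :=
  Classical.choose H.exists_isChernConnection

theorem isChernConnection_chernConnection : H.IsChernConnection H.chernConnection :=
  Classical.choose_spec H.exists_isChernConnection

/-- The Bismut connection `∇^b`. -/
def bismutConnection : CovariantDerivative 𝓘(ℝ, E) E (fun x : M ↦ TangentSpace 𝓘(ℝ, E) x) :=
  Classical.choose H.exists_isBismutConnection

theorem isBismutConnection_bismutConnection : H.IsBismutConnection H.bismutConnection :=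
  Classical.choose_spec H.exists_isBismutConnection

/-- The Gauduchon connection `∇^s = (1 - s/2) ∇^c + (s/2) ∇^b`. -/
def gauduchonConnection (s : ℝ) :
    CovariantDerivative 𝓘(ℝ, E) E (fun x : M ↦ TangentSpace 𝓘(ℝ, E) x) :=
  CovariantDerivative.affineCombination H.chernConnection H.bismutConnection (fun _ ↦ 1 - s / 2)

theorem gauduchonConnection_apply (s : ℝ) (Y : Π x : M, TangentSpace 𝓘(ℝ, E) x) (x : M)
    (v : TangentSpace 𝓘(ℝ, E) x) :
    H.gauduchonConnection s Y x v
      = (1 - s / 2) • H.chernConnection Y x v + (s / 2) • H.bismutConnection Y x v := by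
  simp [gauduchonConnection]

end Gauduchon

/-- The curvature `R(X, Y) Z = ∇_X ∇_Y Z - ∇_Y ∇_X Z - ∇_{[X, Y]} Z` of an affine connection. -/
def curvature (D : CovariantDerivative 𝓘(ℝ, E) E (fun x : M ↦ TangentSpace 𝓘(ℝ, E) x))
    (X Y Z : Π x : M, TangentSpace 𝓘(ℝ, E) x) (x : M) : TangentSpace 𝓘(ℝ, E) x :=
  D (fun y ↦ D Z y (Y y)) x (X x) - D (fun y ↦ D Z y (X y)) x (Y x)
    - D Z x (mlieBracket 𝓘(ℝ, E) X Y x)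

/-- A connection is Kähler-like if its curvature satisfies the torsion-less first Bianchi identity
and the type condition `R(JX, JY) = R(X, Y)`. Since the curvature is a tensor, it is tested at each
point on the vector fields that are smooth there. -/
structure IsKahlerLike
    (D : CovariantDerivative 𝓘(ℝ, E) E (fun x : M ↦ TangentSpace 𝓘(ℝ, E) x)) : Prop where
  bianchi : ∀ (x : M) (X Y Z : Π x : M, TangentSpace 𝓘(ℝ, E) x),
    CMDiffAt ∞ (T% X) x → CMDiffAt ∞ (T% Y) x → CMDiffAt ∞ (T% Z) x →
      curvature D X Y Z x + curvature D Y Z X x + curvature D Z X Y x = 0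
  type : ∀ (x : M) (X Y Z : Π x : M, TangentSpace 𝓘(ℝ, E) x),
    CMDiffAt ∞ (T% X) x → CMDiffAt ∞ (T% Y) x → CMDiffAt ∞ (T% Z) x →
      curvature D (fun y ↦ H.J y (X y)) (fun y ↦ H.J y (Y y)) Z x = curvature D X Y Z x

/-- The fundamental form `ω = g(J·, ·)`. -/
def fundamentalForm (x : M) (v w : TangentSpace 𝓘(ℝ, E) x) : ℝ :=
  H.g.inner x (H.J x v) w

/-- The exterior derivative of the fundamental form, evaluated on three vector fields:
`dω(X, Y, Z) = X ω(Y, Z) + Y ω(Z, X) + Z ω(X, Y) - ω([X, Y], Z) - ω([Y, Z], X) - ω([Z, X], Y)`. -/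
def dFundamentalForm (X Y Z : Π x : M, TangentSpace 𝓘(ℝ, E) x) (x : M) : ℝ :=
  mvfderiv 𝓘(ℝ, E) (fun y ↦ H.fundamentalForm y (Y y) (Z y)) x (X x)
    + mvfderiv 𝓘(ℝ, E) (fun y ↦ H.fundamentalForm y (Z y) (X y)) x (Y x)
    + mvfderiv 𝓘(ℝ, E) (fun y ↦ H.fundamentalForm y (X y) (Y y)) x (Z x)
    - H.fundamentalForm x (mlieBracket 𝓘(ℝ, E) X Y x) (Z x)
    - H.fundamentalForm x (mlieBracket 𝓘(ℝ, E) Y Z x) (X x)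
    - H.fundamentalForm x (mlieBracket 𝓘(ℝ, E) Z X x) (Y x)

/-- A Hermitian manifold is Kähler if its fundamental form is closed. -/
def IsKahler : Prop :=
  ∀ (x : M) (X Y Z : Π x : M, TangentSpace 𝓘(ℝ, E) x),
    MDiffAt (T% X) x → MDiffAt (T% Y) x → MDiffAt (T% Z) x → H.dFundamentalForm X Y Z x = 0

/-- A biholomorphic isometry: a diffeomorphism whose differential commutes with `J` and
preserves `g`. -/
structure IsBiholomorphicIsometry (φ : Diffeomorph 𝓘(ℝ, E) 𝓘(ℝ, E) M M ∞) : Prop where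
  holomorphic : ∀ (x : M) (v : TangentSpace 𝓘(ℝ, E) x),
    mfderiv 𝓘(ℝ, E) 𝓘(ℝ, E) φ x (H.J x v) = H.J (φ x) (mfderiv 𝓘(ℝ, E) 𝓘(ℝ, E) φ x v)
  isometry : ∀ (x : M) (v w : TangentSpace 𝓘(ℝ, E) x),
    H.g.inner (φ x) (mfderiv 𝓘(ℝ, E) 𝓘(ℝ, E) φ x v) (mfderiv 𝓘(ℝ, E) 𝓘(ℝ, E) φ x w)
      = H.g.inner x v w

/-- The group of biholomorphic isometries has a compact fundamental domain: there is a compact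
set whose translates under the group cover `M`. -/
def HasCompactFundamentalDomain : Prop :=
  ∃ K : Set M, IsCompact K ∧
    ⋃ φ ∈ {φ : Diffeomorph 𝓘(ℝ, E) 𝓘(ℝ, E) M M ∞ | H.IsBiholomorphicIsometry φ}, φ '' K = Set.univ

end HermitianStructure

end

/-! Put `a = s / 2` and let `T` be the Chern torsion, which is complex bilinear. Since `dω` is a
contraction of `T`, it suffices to prove `T = 0`. The torsion `T^s` of `∇^s` is `(1 - 2a) T` plus
`a` times metric transposes of `T`. For any connection the cyclic sum of `R(X, Y)Z` equals that of
`(∇_X T^s)(Y, Z) + T^s(T^s(X, Y), Z)`, so the torsion-less Bianchi identity becomes, in a unitary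
frame, a linear system for the components of `∇T` with right-hand side quadratic in `T`
(`TorsionArray.FirstOrder`). It yields `∇^{1,0} T = (1 - a) T∘T`. If `a ≠ 1/2`, then `T` satisfies
the Jacobi identity, so every tangent space is a complex Lie algebra. If also `a ≠ 1/4`, then
`∇^{0,1} T` is an explicit combination of products of `T` and its conjugate
(`FirstOrder.antiholo_eq`).

Let `η` be the trace `η_j = T_{ij}^i`. The double trace of the system reads `(4a - 1) div η = a²
|T|² + a (1 - 3a) |η|²` (`FirstOrder.trace_trace`). For `a = 1/4` the right side is a positive
combination of squares, so `T = 0` at once. For other `a`, the vanishing of `η` everywhere implies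
`T = 0`. It remains to kill `η`, by a maximum argument: `|η|²` and `|T|²` are invariant under
biholomorphic isometries, so combinations of them attain their maxima.

Let `x` be the vector dual to `η` and `A = T(x, ·)`. As `tr A = -|η|²`, it is enough that `tr (A A*)
= 0`. Write `Φ` and `Ψ` for the Gram matrices of `T` in the upper and in a lower index.

Case `a ≠ 1/2`. The numbers `Y = tr (A Ψᵗ)`, `S = tr (A A*)` and `W = tr (A²)` satisfy three linear
equations at a maximum of `|η|² + θ |T|²`: one from differentiating `η ∘ T = 0`, one from
contracting `d(dη) = 0`, one from the critical point equation. For suitable arbitrarily small `θ ≥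
0` they force `S = 0` (`exists_isGeneric`), so `η = 0` at the maximum. Hence `|η|² ≤ θ max |T|²`
everywhere, and `θ → 0` gives `η = 0`.

Case `a = 1/2`. One part of `∇^{0,1} T` is no longer determined; the corresponding equation becomes
a quadratic identity, which makes `A` self-adjoint, `Φ = Ψᵗ` and `Y = 0`. At a maximum of `|η|²` the
complex Laplacian equals a quarter of the squared norm of the Killing form plus the squared norm of
`∇^{0,1} η` shifted by the conjugate of `A`. Being nonpositive, it vanishes. So the Killing form `B`
of `T` is zero and `S = W = B(x, x) = 0` (`normSqEta_eq_zero_half`).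

All derivatives are taken in local unitary frames that are parallel at the point considered
(`exists_unitary_gauge`), where derivatives of components are components of covariant derivatives.
-/

set_option synthInstance.maxHeartbeats 200000
set_option maxHeartbeats 1000000
set_option maxSynthPendingDepth 3
set_option linter.unusedSectionVars false

/-! ### Pointwise algebra: solving the Bianchi system for the derivatives of the torsion. -/

noncomputable section

open scoped ComplexConjugate

namespace TorsionArray

variable {ι : Type*} [Fintype ι]

/-! ### Contractions of a torsion array -/

/-- The trace `T_{ij}^i`. -/
def eta (T : ι → ι → ι → ℂ) (j : ι) : ℂ := ∑ i, T i j i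

/-- The endomorphism `w ↦ T(x, w)`, where `x` is the vector dual to `eta T`. -/
def ad (T : ι → ι → ι → ℂ) (l j : ι) : ℂ := ∑ r, conj (eta T r) * T r j l

/-- The Gram matrix of the array with respect to a lower index. -/
def gramLower (T : ι → ι → ι → ℂ) (j k : ι) : ℂ := ∑ p, ∑ m, T p j m * conj (T p k m)

/-- The Gram matrix of the array with respect to the upper index. -/
def gramUpper (T : ι → ι → ι → ℂ) (k j : ι) : ℂ := ∑ p, ∑ q, T p q k * conj (T p q j)

/-- The Killing form of the bracket `T`. -/
def killing (T : ι → ι → ι → ℂ) (i j : ι) : ℂ := ∑ k, ∑ m, T k j m * T m i k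

/-- The composition `T(T(e_i, e_j), e_k)`. -/
def comp (T : ι → ι → ι → ℂ) (i j k l : ι) : ℂ := ∑ m, T i j m * T m k l

def normSqEta (T : ι → ι → ι → ℂ) : ℝ := ∑ i, Complex.normSq (eta T i)

def normSq (T : ι → ι → ι → ℂ) : ℝ := ∑ i, ∑ j, ∑ k, Complex.normSq (T i j k)

/-- The equations satisfied by the torsion `T` of the Chern connection and its covariant
derivatives `D l i j k = ∇_l T_{ij}^k` and `U l i j k = ∇_{\bar l} T_{ij}^k` for the Gauduchon
connection with parameter `2a`, if that connection satisfies the torsion-less first Bianchi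
identity. -/
structure FirstOrder (a : ℝ) (T : ι → ι → ι → ℂ) (D U : ι → ι → ι → ι → ℂ) : Prop where
  skew : ∀ i j k, T i j k = -T j i k
  skewD : ∀ l i j k, D l i j k = -D l j i k
  skewU : ∀ l i j k, U l i j k = -U l j i k
  holo : ∀ i j k l, (1 - 2 * a : ℂ) * (D i j k l + D j k i l + D k i j l)
    + (1 - 2 * a : ℂ) ^ 2 * (comp T i j k l + comp T j k i l + comp T k i j l) = 0
  mixed : ∀ i j l k, D i j l k - D j i l k
    = -(1 - 2 * a : ℂ) * comp T i j l k + a * (comp T j l i k + comp T l i j k)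
  antiholo : ∀ i j l k, (1 - 2 * a : ℂ) * U k i j l - a * conj (U i k l j) + a * conj (U j k l i)
    = a * (1 - 2 * a) * (∑ m, T i j m * conj (T k l m))
      - a ^ 2 * ((∑ m, T i m k * conj (T l m j)) - ∑ m, T j m k * conj (T l m i))
      - a * (1 - 2 * a) * ((∑ m, T i m l * conj (T k m j)) - ∑ m, T j m l * conj (T k m i))

namespace FirstOrder

variable {a : ℝ} {T : ι → ι → ι → ℂ} {D U : ι → ι → ι → ι → ℂ}

/-- The Koszul trick: `mixed` prescribes the part of `D` skew in its first two indices, and `D` is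
skew in the second and third. An alternating sum of three instances isolates `2 D`. -/
lemma deriv_eq (h : FirstOrder a T D U) (i j l k : ι) :
    2 * D i j l k = comp T j l i k
      - (1 - 2 * a : ℂ) * (comp T l i j k + comp T i j l k) := by
  have h1 := h.mixed i j l k
  have h2 := h.mixed j l i k
  have h3 := h.mixed l i j k
  have s1 := h.skewD j i l k
  have s2 := h.skewD l j i k
  have s3 := h.skewD i l j k
  linear_combination h1 - h2 + h3 + s1 - s2 + s3

/-- Inserting `deriv_eq` into twice the cyclic equation `holo` gives the Jacobi sum the coefficient
`(1 - 2a) ((4a - 1) + 2 (1 - 2a)) = 1 - 2a`. -/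
lemma jacobi (h : FirstOrder a T D U) (ha : (1 - 2 * a : ℂ) ≠ 0) (i j k l : ι) :
    comp T i j k l + comp T j k i l + comp T k i j l = 0 := by
  have h0 := h.holo i j k l
  have h1 := h.deriv_eq i j k l
  have h2 := h.deriv_eq j k i l
  have h3 := h.deriv_eq k i j l
  refine (mul_eq_zero.1 ?_).resolve_left ha
  linear_combination 2 * h0 - (1 - 2 * a) * (h1 + h2 + h3)

/-- The formula holds for every `a`: the two extra terms of `deriv_eq` are rewritten by the Jacobi
identity, or their coefficient vanishes when `a = 1/2`. -/
lemma deriv_eq_comp (h : FirstOrder a T D U) (i j l k : ι) :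
    D i j l k = (1 - a) * comp T j l i k := by
  have h1 := h.deriv_eq i j l k
  by_cases ha : (1 - 2 * a : ℂ) = 0
  · linear_combination h1 / 2 - ha / 2 * (comp T l i j k + comp T i j l k + comp T j l i k)
  · have h2 := h.jacobi ha i j l k
    linear_combination h1 / 2 - (1 - 2 * a : ℂ) / 2 * h2

/-- The component of the `(0,1)`-derivative of the torsion that is skew in the upper index and the
direction of differentiation. -/
lemma antiholo_skew (h : FirstOrder a T D U) (i j k l : ι) :
    (4 * a - 1 : ℂ) * (U l i j k - U k i j l) = 2 * a * (1 - 2 * a) * (∑ m, T i j m * conj (T k l m))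
      + a * (1 - 3 * a) * ((∑ m, T i m k * conj (T l m j)) - (∑ m, T i m l * conj (T k m j))
        - (∑ m, T j m k * conj (T l m i)) + ∑ m, T j m l * conj (T k m i)) := by
  have h1 := h.antiholo i j l k
  have h2 := h.antiholo i j k l
  have h3 := congrArg conj (h.antiholo k l i j)
  have h4 := congrArg conj (h.antiholo k l j i)
  have e (u v w z : ι) : ∑ m, conj (T u v m) * T w z m = ∑ m, T w z m * conj (T u v m) :=
    Finset.sum_congr rfl fun _ _ ↦ mul_comm _ _
  have e' (u v w z : ι) : ∑ m, conj (T u m v) * T w m z = ∑ m, T w m z * conj (T u m v) :=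
    Finset.sum_congr rfl fun _ _ ↦ mul_comm _ _
  have s : ∑ m, T i j m * conj (T l k m) = -∑ m, T i j m * conj (T k l m) := by
    rw [← Finset.sum_neg_distrib]
    exact Finset.sum_congr rfl fun m _ ↦ by rw [h.skew l k m]; simp
  have s' : ∑ m, T j i m * conj (T k l m) = -∑ m, T i j m * conj (T k l m) := by
    rw [← Finset.sum_neg_distrib]
    exact Finset.sum_congr rfl fun m _ ↦ by rw [h.skew j i m]; simp
  rw [h.skewU i l k j, h.skewU j l k i, s] at h2
  simp only [map_add, map_sub, map_mul, map_pow, map_sum, Complex.conj_conj,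
    Complex.conj_ofReal, map_one, map_ofNat, e, e'] at h3 h4
  rw [h.skewU k j i l, h.skewU l j i k, s'] at h3
  simp only [map_neg] at h2
  -- The equation skewed in `k, l` and its conjugate with the pairs `(i, j)` and `(k, l)` exchanged
  -- form a two-by-two system with determinant `(1 - 2a)² - (2a)² = 1 - 4a`.
  linear_combination (1 - 2 * a : ℂ) * (h1 - h2) - 2 * a * (h3 - h4)

/-- The component of the `(0,1)`-derivative of the torsion that is symmetric in the upper index and
the direction of differentiation. -/
lemma antiholo_symm (h : FirstOrder a T D U) (i j k l : ι) :
    (1 - 2 * a : ℂ) * (U l i j k + U k i j l) = -(a * (1 - a)) *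
      ((∑ m, T i m k * conj (T l m j)) + (∑ m, T i m l * conj (T k m j))
        - (∑ m, T j m k * conj (T l m i)) - ∑ m, T j m l * conj (T k m i)) := by
  have h1 := h.antiholo i j l k
  have h2 := h.antiholo i j k l
  have s : ∑ m, T i j m * conj (T l k m) = -∑ m, T i j m * conj (T k l m) := by
    rw [← Finset.sum_neg_distrib]
    exact Finset.sum_congr rfl fun m _ ↦ by rw [h.skew l k m]; simp
  rw [h.skewU i l k j, h.skewU j l k i, s] at h2
  simp only [map_neg] at h2
  linear_combination h1 + h2

/-- The skew and symmetric halves are recombined. Their leading coefficients explain the exceptional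
parameters: at `a = 1/4` the skew half, at `a = 1/2` the symmetric half is undetermined. -/
lemma antiholo_eq (h : FirstOrder a T D U) (i j k l : ι) :
    2 * (1 - 2 * a) * (4 * a - 1 : ℂ) * U k i j l
      = -2 * a * (1 - 2 * a) ^ 2 * (∑ m, T i j m * conj (T k l m))
        + 2 * a * (5 * a ^ 2 - 5 * a + 1) *
          ((∑ m, T i m l * conj (T k m j)) - ∑ m, T j m l * conj (T k m i))
        - 2 * a ^ 3 * ((∑ m, T i m k * conj (T l m j)) - ∑ m, T j m k * conj (T l m i)) := by
  linear_combination (4 * a - 1 : ℂ) * h.antiholo_symm i j k l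
    - (1 - 2 * a : ℂ) * h.antiholo_skew i j k l

end FirstOrder

end TorsionArray

end

/-! ### Trace identities for a torsion array that is a Lie bracket. -/

noncomputable section

open scoped ComplexConjugate

namespace TorsionArray

variable {ι : Type*} [Fintype ι]

section Swap

variable {R : Type*} [AddCommMonoid R]

lemma sum_swap₃₀ (f : ι → ι → ι → R) :
    ∑ a, ∑ b, ∑ c, f a b c = ∑ b, ∑ a, ∑ c, f a b c := Finset.sum_comm

lemma sum_swap₃₁ (f : ι → ι → ι → R) :
    ∑ a, ∑ b, ∑ c, f a b c = ∑ a, ∑ c, ∑ b, f a b c :=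
  Finset.sum_congr rfl fun _ _ ↦ Finset.sum_comm

lemma sum_swap₄₀ (f : ι → ι → ι → ι → R) :
    ∑ a, ∑ b, ∑ c, ∑ d, f a b c d = ∑ b, ∑ a, ∑ c, ∑ d, f a b c d := Finset.sum_comm

lemma sum_swap₄₁ (f : ι → ι → ι → ι → R) :
    ∑ a, ∑ b, ∑ c, ∑ d, f a b c d = ∑ a, ∑ c, ∑ b, ∑ d, f a b c d :=
  Finset.sum_congr rfl fun _ _ ↦ Finset.sum_comm

lemma sum_swap₄₂ (f : ι → ι → ι → ι → R) :
    ∑ a, ∑ b, ∑ c, ∑ d, f a b c d = ∑ a, ∑ b, ∑ d, ∑ c, f a b c d :=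
  Finset.sum_congr rfl fun _ _ ↦ Finset.sum_congr rfl fun _ _ ↦ Finset.sum_comm

lemma sum_congr₂ {f g : ι → ι → R} (h : ∀ a b, f a b = g a b) :
    ∑ a, ∑ b, f a b = ∑ a, ∑ b, g a b := by simp only [h]

lemma sum_congr₃ {f g : ι → ι → ι → R}
    (h : ∀ a b c, f a b c = g a b c) :
    ∑ a, ∑ b, ∑ c, f a b c = ∑ a, ∑ b, ∑ c, g a b c := by simp only [h]

lemma sum_mul_sum_mul (x : ι → ℂ) (f : ι → ι → ℂ) (g : ι → ℂ) :
    ∑ i, x i * ∑ m, f i m * g m = ∑ m, (∑ i, x i * f i m) * g m := by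
  simp only [Finset.mul_sum, Finset.sum_mul]
  rw [Finset.sum_comm]
  exact sum_congr₂ fun _ _ ↦ by ring

lemma sum_mul_sum_mul' (x : ι → ℂ) (f : ι → ι → ℂ) (g : ι → ℂ) :
    ∑ i, x i * ∑ m, g m * f i m = ∑ m, g m * ∑ i, x i * f i m := by
  simp only [Finset.mul_sum]
  rw [Finset.sum_comm]
  exact sum_congr₂ fun _ _ ↦ by ring

lemma sum_congr₄ {f g : ι → ι → ι → ι → R} (h : ∀ a b c d, f a b c d = g a b c d) :
    ∑ a, ∑ b, ∑ c, ∑ d, f a b c d = ∑ a, ∑ b, ∑ c, ∑ d, g a b c d := by simp only [h]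

lemma sum_mul_sum_mul₂ (x y : ι → ℂ) (f g : ι → ι → ι → ℂ) :
    ∑ j, ∑ i, x j * (y i * ∑ p, ∑ m, f p j m * g p i m)
      = ∑ p, ∑ m, (∑ j, x j * f p j m) * ∑ i, y i * g p i m := by
  simp only [Finset.mul_sum, Finset.sum_mul]
  conv_lhs => rw [sum_swap₄₁, sum_swap₄₀, sum_swap₄₂, sum_swap₄₁, sum_swap₄₂]
  exact sum_congr₄ fun _ _ _ _ ↦ by ring

/-- Contraction of an array that is skew in two indices with one that is symmetric in them. -/
lemma sum_skew_mul_symm {f g : ι → ι → ℂ} (hf : ∀ i j, f i j = -f j i) (hg : ∀ i j, g i j = g j i) :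
    ∑ i, ∑ j, f i j * g i j = 0 := by
  have h : ∑ i, ∑ j, f i j * g i j = -∑ i, ∑ j, f i j * g i j := by
    conv_lhs => rw [Finset.sum_comm]
    simp only [← Finset.sum_neg_distrib]
    exact sum_congr₂ fun i j ↦ by rw [hf j i, hg j i]; ring
  linear_combination h / 2

end Swap

variable {T : ι → ι → ι → ℂ}

lemma conj_gramLower (j k : ι) : conj (gramLower T j k) = gramLower T k j := by
  simp only [gramLower, map_sum, map_mul, Complex.conj_conj]
  exact sum_congr₂ fun _ _ ↦ mul_comm _ _

lemma conj_gramUpper (j k : ι) : conj (gramUpper T j k) = gramUpper T k j := by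
  simp only [gramUpper, map_sum, map_mul, Complex.conj_conj]
  exact sum_congr₂ fun _ _ ↦ mul_comm _ _

lemma sum_eta_mul_conj' (k m : ι) : ∑ r, eta T r * conj (T r k m) = conj (ad T m k) := by
  simp [ad]

/-- `tr (A Φ)`. -/
def trUpper (T : ι → ι → ι → ℂ) : ℂ := ∑ l, ∑ m, ad T l m * gramUpper T m l

/-- `tr (A Ψᵗ)`. -/
def trLower (T : ι → ι → ι → ℂ) : ℂ := ∑ l, ∑ m, ad T l m * gramLower T l m

/-- `tr (A A^*)`. -/
def trAdAdj (T : ι → ι → ι → ℂ) : ℂ := ∑ l, ∑ m, ad T l m * conj (ad T l m)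

/-- `tr (A²)`. -/
def trAdAd (T : ι → ι → ι → ℂ) : ℂ := ∑ l, ∑ m, ad T l m * ad T m l

lemma conj_trAdAdj : conj (trAdAdj T) = trAdAdj T := by
  simp only [trAdAdj, map_sum, map_mul, Complex.conj_conj]
  exact sum_congr₂ fun _ _ ↦ mul_comm _ _

lemma ad_eq_zero_of_trAdAdj (h : trAdAdj T = 0) (l m : ι) : ad T l m = 0 := by
  have h1 : trAdAdj T = ((∑ l, ∑ m, Complex.normSq (ad T l m) : ℝ) : ℂ) := by
    simp [trAdAdj, Complex.mul_conj]
  rw [h1, Complex.ofReal_eq_zero,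
    Finset.sum_eq_zero_iff_of_nonneg fun _ _ ↦ Finset.sum_nonneg fun _ _ ↦ Complex.normSq_nonneg _]
    at h
  have h2 := (Finset.sum_eq_zero_iff_of_nonneg fun _ _ ↦ Complex.normSq_nonneg _).1
    (h l (Finset.mem_univ _)) m (Finset.mem_univ _)
  exact Complex.normSq_eq_zero.1 h2

section Basic

variable (hT : ∀ i j k, T i j k = -T j i k)
include hT

lemma sum_conj_eta_mul (p m : ι) : ∑ i, conj (eta T i) * T p i m = -ad T m p := by
  simp only [ad, ← Finset.sum_neg_distrib]
  exact Finset.sum_congr rfl fun i _ ↦ by rw [hT p i m]; ring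

lemma sum_eta_mul_conj (p m : ι) : ∑ i, eta T i * conj (T p i m) = -conj (ad T m p) := by
  have h := congrArg conj (sum_conj_eta_mul hT p m)
  simpa using h

/-- This is why killing `tr (A A*)` is enough: `A = 0` makes the trace of `A`, hence `η`, vanish. -/
lemma trace_ad : ∑ l, ad T l l = -(normSqEta T : ℂ) := by
  simp only [ad, normSqEta, Complex.ofReal_sum, Complex.normSq_eq_conj_mul_self]
  rw [Finset.sum_comm, ← Finset.sum_neg_distrib]
  refine Finset.sum_congr rfl fun r _ ↦ ?_
  rw [← Finset.mul_sum, ← mul_neg]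
  congr 1
  simp only [eta, ← Finset.sum_neg_distrib]
  exact Finset.sum_congr rfl fun s _ ↦ hT _ _ _

lemma normSqEta_eq_zero (h : trAdAdj T = 0) : normSqEta T = 0 := by
  have h1 := trace_ad hT
  simp only [ad_eq_zero_of_trAdAdj h, Finset.sum_const_zero] at h1
  exact_mod_cast neg_eq_zero.1 h1.symm

/-- In invariant terms `A x = T(x, x) = 0`. -/
lemma ad_conj_eta (l : ι) : ∑ j, ad T l j * conj (eta T j) = 0 := by
  have h : ∑ j, ad T l j * conj (eta T j) = -∑ j, ad T l j * conj (eta T j) := by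
    simp only [ad, Finset.sum_mul, ← Finset.sum_neg_distrib]
    rw [Finset.sum_comm]
    exact sum_congr₂ fun i j ↦ by rw [hT i j l]; ring
  linear_combination h / 2

lemma gramLower_eq (j k : ι) : gramLower T j k = ∑ r, ∑ i, T j r i * conj (T k r i) := by
  simp only [gramLower]
  exact sum_congr₂ fun p m ↦ by rw [hT p j, hT p k]; simp

/-- Contraction of the lower Gram matrix with `conj (eta T)`. -/
lemma eta_gramLower :
    ∑ j, ∑ i, conj (eta T j) * (eta T i * gramLower T j i) = trAdAdj T := by
  simp only [gramLower]
  rw [sum_mul_sum_mul₂, Finset.sum_comm]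
  simp only [sum_conj_eta_mul hT, sum_eta_mul_conj hT, neg_mul_neg]
  rfl

section Lie

variable (hJ : ∀ i j k l, comp T i j k l + comp T j k i l + comp T k i j l = 0)
include hJ

/-- The trace form of a Lie algebra vanishes on commutators. -/
lemma sum_eta_mul (i j : ι) : ∑ m, eta T m * T i j m = 0 := by
  have h : ∑ s, (comp T i j s s + comp T j s i s + comp T s i j s) = 0 :=
    Finset.sum_eq_zero fun s _ ↦ hJ i j s s
  have h1 : ∑ s, comp T s i j s = -∑ s, comp T j s i s := by
    simp only [comp]
    rw [Finset.sum_comm, ← Finset.sum_neg_distrib]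
    refine Finset.sum_congr rfl fun s _ ↦ ?_
    rw [← Finset.sum_neg_distrib]
    exact Finset.sum_congr rfl fun m _ ↦ by rw [hT s j m]; ring
  have h2 : ∑ s, comp T i j s s = -∑ m, eta T m * T i j m := by
    simp only [comp, eta, Finset.sum_mul]
    rw [Finset.sum_comm, ← Finset.sum_neg_distrib]
    refine Finset.sum_congr rfl fun s _ ↦ ?_
    rw [← Finset.sum_neg_distrib]
    exact Finset.sum_congr rfl fun m _ ↦ by rw [hT s m m]; ring
  simp only [Finset.sum_add_distrib, h1, h2] at h
  linear_combination -h

lemma sum_conj_eta_mul_conj (i j : ι) : ∑ m, conj (eta T m) * conj (T i j m) = 0 := by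
  have h := congrArg conj (sum_eta_mul hT hJ i j)
  simpa using h

/-- The image of `A` consists of brackets, and `η` vanishes on brackets. The same fact gives
`eta_gramUpper`. -/
lemma eta_ad (m : ι) : ∑ i, eta T i * ad T i m = 0 := by
  simp only [ad]
  rw [sum_mul_sum_mul']
  simp [sum_eta_mul hT hJ]

lemma conj_eta_ad (m : ι) : ∑ i, conj (eta T i) * conj (ad T i m) = 0 := by
  have h := congrArg conj (eta_ad hT hJ m)
  simpa using h

lemma eta_gramUpper (m : ι) : ∑ i, eta T i * gramUpper T i m = 0 := by
  simp only [gramUpper, Finset.mul_sum]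
  rw [sum_swap₃₀, sum_swap₃₁]
  simp only [← mul_assoc, ← Finset.sum_mul, sum_eta_mul hT hJ]
  simp

/-- The adjoint action of the vector dual to `eta T` is a derivation. -/
lemma ad_derivation (p q l : ι) :
    ∑ m, ad T l m * T p q m = ∑ m, ad T m p * T m q l + ∑ m, ad T m q * T p m l := by
  have h : ∑ r, conj (eta T r) * (comp T p q r l + comp T q r p l + comp T r p q l) = 0 :=
    Finset.sum_eq_zero fun r _ ↦ by rw [hJ, mul_zero]
  simp only [mul_add, Finset.sum_add_distrib, comp] at h
  rw [sum_mul_sum_mul, sum_mul_sum_mul, sum_mul_sum_mul'] at h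
  simp only [sum_conj_eta_mul hT] at h
  have h1 : ∑ m, T p q m * -ad T l m = -∑ m, ad T l m * T p q m := by
    rw [← Finset.sum_neg_distrib]; exact Finset.sum_congr rfl fun _ _ ↦ by ring
  have h2 : ∑ m, -ad T m q * T m p l = ∑ m, ad T m q * T p m l :=
    Finset.sum_congr rfl fun m _ ↦ by rw [hT m p l]; ring
  change _ + _ + ∑ m, ad T m p * T m q l = 0 at h
  linear_combination -h + h1 + h2

/-- Pair the derivation identity for `A` with the conjugate of `T`. The left side gives `tr (A Φ)`,
and each of the two lower slots contributes `tr (A Ψᵗ)`. -/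
lemma trUpper_eq : trUpper T = 2 * trLower T := by
  have h : trUpper T = ∑ l, ∑ p, ∑ q, (∑ m, ad T l m * T p q m) * conj (T p q l) := by
    simp only [trUpper, gramUpper, Finset.mul_sum, Finset.sum_mul]
    conv_lhs => rw [sum_swap₄₁, sum_swap₄₂]
    exact sum_congr₄ fun _ _ _ _ ↦ by ring
  have h1 : ∑ l, ∑ p, ∑ q, (∑ m, ad T m p * T m q l) * conj (T p q l) = trLower T := by
    simp only [trLower, gramLower_eq hT, Finset.mul_sum, Finset.sum_mul]
    conv_lhs => rw [sum_swap₄₂, sum_swap₄₁, sum_swap₄₀, sum_swap₄₁, sum_swap₄₂]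
    exact sum_congr₄ fun _ _ _ _ ↦ by ring
  have h2 : ∑ l, ∑ p, ∑ q, (∑ m, ad T m q * T p m l) * conj (T p q l) = trLower T := by
    simp only [trLower, gramLower, Finset.mul_sum, Finset.sum_mul]
    conv_lhs => rw [sum_swap₄₂, sum_swap₄₁, sum_swap₄₀, sum_swap₄₁, sum_swap₄₂, sum_swap₄₁]
    exact sum_congr₄ fun _ _ _ _ ↦ by ring
  rw [h]
  simp only [ad_derivation hT hJ, add_mul, Finset.sum_add_distrib]
  rw [h1, h2]
  ring

end Lie

end Basic

end TorsionArray

end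

/-! ### Linearized contractions and traces of the antiholomorphic derivative. -/

noncomputable section

open scoped ComplexConjugate

namespace TorsionArray

variable {ι : Type*} [Fintype ι]

/-! ### First derivatives of contractions -/

section Deriv

variable (T : ι → ι → ι → ℂ) (D U : ι → ι → ι → ι → ℂ)

/-- The `(1,0)`-derivative of `normSqEta`. -/
def dNormSqEta (i : ι) : ℂ :=
  ∑ j, ((∑ s, D i s j s) * conj (eta T j) + eta T j * conj (∑ s, U i s j s))

/-- The `(1,0)`-derivative of `normSq`. -/
def dNormSq (l : ι) : ℂ :=
  ∑ i, ∑ j, ∑ k, (D l i j k * conj (T i j k) + T i j k * conj (U l i j k))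

/-- The `(1,0)`-derivative of `gramLower`. -/
def dGramLower (i j k : ι) : ℂ :=
  ∑ p, ∑ m, (D i p j m * conj (T p k m) + T p j m * conj (U i p k m))

/-- The `(1,0)`-derivative of `gramUpper`. -/
def dGramUpper (i k j : ι) : ℂ :=
  ∑ p, ∑ q, (D i p q k * conj (T p q j) + T p q k * conj (U i p q j))

/-- The `(1,0)`-derivative of `ad`. -/
def dAd (i l j : ι) : ℂ :=
  ∑ r, (conj (∑ s, U i s r s) * T r j l + conj (eta T r) * D i r j l)

/-- The `(1,0)`-derivative of the conjugate of `ad`. -/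
def dConjAd (i l j : ι) : ℂ :=
  ∑ r, ((∑ s, D i s r s) * conj (T r j l) + eta T r * conj (U i r j l))

variable (a : ℝ)

/-- Up to a factor, the exterior derivative of `eta T`. -/
def beta (j k : ι) : ℂ :=
  (1 - a) * gramLower T j k - (1 - 3 * a) * conj (ad T j k) - a * gramUpper T k j - a * ad T k j

/-- The `(1,0)`-derivative of `beta`. -/
def dBeta (i j k : ι) : ℂ :=
  (1 - a) * dGramLower T D U i j k - (1 - 3 * a) * dConjAd T D U i j k
    - a * dGramUpper T D U i k j - a * dAd T D U i k j

/-- The exterior derivative of `beta`. -/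
def extDerivBeta (i j k : ι) : ℂ :=
  dBeta T D U a i j k - dBeta T D U a j i k + (1 - 2 * a) * ∑ m, T i j m * beta T a m k
    - a * ∑ l, T j l k * beta T a i l + a * ∑ l, T i l k * beta T a j l

lemma dGramLower_trace (i : ι) : ∑ k, dGramLower T D U i k k = dNormSq T D U i := by
  simp only [dGramLower, dNormSq]
  rw [sum_swap₃₀]

lemma dGramUpper_trace (i : ι) : ∑ k, dGramUpper T D U i k k = dNormSq T D U i := by
  simp only [dGramUpper, dNormSq]
  rw [sum_swap₃₀, sum_swap₃₁]

variable {T D U}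

lemma dAd_trace (hT : ∀ i j k, T i j k = -T j i k) (hD : ∀ l i j k, D l i j k = -D l j i k)
    (i : ι) : ∑ k, dAd T D U i k k = -dNormSqEta T D U i := by
  simp only [dAd, dNormSqEta]
  rw [Finset.sum_comm, ← Finset.sum_neg_distrib]
  refine Finset.sum_congr rfl fun r _ ↦ ?_
  rw [Finset.sum_add_distrib, ← Finset.mul_sum, ← Finset.mul_sum,
    show ∑ k, T r k k = -eta T r by
      rw [eta, ← Finset.sum_neg_distrib]; exact Finset.sum_congr rfl fun k _ ↦ hT _ _ _,
    show ∑ k, D i r k k = -∑ s, D i s r s by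
      rw [← Finset.sum_neg_distrib]; exact Finset.sum_congr rfl fun k _ ↦ hD _ _ _ _]
  ring

lemma dConjAd_trace (hT : ∀ i j k, T i j k = -T j i k) (hU : ∀ l i j k, U l i j k = -U l j i k)
    (i : ι) : ∑ k, dConjAd T D U i k k = -dNormSqEta T D U i := by
  simp only [dConjAd, dNormSqEta]
  rw [Finset.sum_comm, ← Finset.sum_neg_distrib]
  refine Finset.sum_congr rfl fun r _ ↦ ?_
  rw [Finset.sum_add_distrib, ← Finset.mul_sum, ← Finset.mul_sum, ← map_sum, ← map_sum,
    show ∑ k, T r k k = -eta T r by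
      rw [eta, ← Finset.sum_neg_distrib]; exact Finset.sum_congr rfl fun k _ ↦ hT _ _ _,
    show ∑ k, U i r k k = -∑ s, U i s r s by
      rw [← Finset.sum_neg_distrib]; exact Finset.sum_congr rfl fun k _ ↦ hU _ _ _ _]
  simp only [map_neg]
  ring

/-- Both Gram matrices have trace `|T|²` and `A` has trace `-|η|²`, so `beta` has trace `(1 - 2a)
(|T|² + |η|²)`; this is the derivative of that identity. -/
lemma dBeta_trace (hT : ∀ i j k, T i j k = -T j i k) (hD : ∀ l i j k, D l i j k = -D l j i k)
    (hU : ∀ l i j k, U l i j k = -U l j i k) (i : ι) :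
    ∑ k, dBeta T D U a i k k = (1 - 2 * a) * (dNormSq T D U i + dNormSqEta T D U i) := by
  simp only [dBeta, Finset.sum_sub_distrib, ← Finset.mul_sum, dGramLower_trace, dGramUpper_trace,
    dAd_trace hT hD, dConjAd_trace hT hU]
  ring

end Deriv

variable {T : ι → ι → ι → ℂ} {D U : ι → ι → ι → ι → ℂ}

/-! ### Contractions of the explicit formula for the `(0,1)`-derivative -/

section Explicit

variable {al be ga : ℝ} (hT : ∀ i j k, T i j k = -T j i k)
    (hU : ∀ i j k l, U k i j l = al * ∑ m, T i j m * conj (T k l m)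
      + be * ((∑ m, T i m l * conj (T k m j)) - ∑ m, T j m l * conj (T k m i))
      + ga * ((∑ m, T i m k * conj (T l m j)) - ∑ m, T j m k * conj (T l m i)))
include hT hU

/-- These are the components of `∇^{0,1} η`, and hence of `dη`. -/
lemma trace_left (m k : ι) : ∑ i, U k i m i = -(al + be) * gramLower T m k
    - be * conj (ad T m k) + ga * (gramUpper T k m + ad T k m) := by
  simp only [hU, Finset.sum_add_distrib, ← Finset.mul_sum, Finset.sum_sub_distrib]
  have h1 : ∑ i, ∑ r, T i m r * conj (T k i r) = -gramLower T m k := by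
    simp only [gramLower, ← Finset.sum_neg_distrib]
    exact sum_congr₂ fun i r ↦ by rw [hT k i r]; simp
  have h2 : ∑ i, ∑ r, T i r i * conj (T k r m) = -conj (ad T m k) := by
    rw [Finset.sum_comm, ← sum_eta_mul_conj hT]
    simp only [← Finset.sum_mul, eta]
  have h3 : ∑ i, ∑ r, T m r i * conj (T k r i) = gramLower T m k := by
    rw [gramLower_eq hT, Finset.sum_comm]
  have h4 : ∑ i, ∑ r, T i r k * conj (T i r m) = gramUpper T k m := rfl
  have h5 : ∑ i, ∑ r, T m r k * conj (T i r i) = -ad T k m := by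
    rw [Finset.sum_comm, ← sum_conj_eta_mul hT]
    simp only [← Finset.mul_sum, eta, map_sum]
    exact Finset.sum_congr rfl fun _ _ ↦ mul_comm _ _
  rw [h1, h2, h3, h4, h5]
  ring

/-- The other trace: the direction of differentiation is contracted with a lower index. It appears
when the exterior derivative of `beta` is traced. -/
lemma trace_right (p m : ι) : ∑ k, U k p k m = (ga - al) * gramLower T p m
    - be * (ad T m p + gramUpper T m p) + ga * conj (ad T p m) := by
  simp only [hU, Finset.sum_add_distrib, ← Finset.mul_sum, Finset.sum_sub_distrib]
  have h1 : ∑ k, ∑ r, T p k r * conj (T k m r) = -gramLower T p m := by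
    simp only [gramLower, ← Finset.sum_neg_distrib]
    exact sum_congr₂ fun i r ↦ by rw [hT p i r]; simp
  have h2 : ∑ k, ∑ r, T p r m * conj (T k r k) = -ad T m p := by
    rw [Finset.sum_comm, ← sum_conj_eta_mul hT]
    simp only [← Finset.mul_sum, eta, map_sum]
    exact Finset.sum_congr rfl fun _ _ ↦ mul_comm _ _
  have h3 : ∑ k, ∑ r, T k r m * conj (T k r p) = gramUpper T m p := rfl
  have h4 : ∑ k, ∑ r, T p r k * conj (T m r k) = gramLower T p m := by
    rw [gramLower_eq hT, Finset.sum_comm]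
  have h5 : ∑ k, ∑ r, T k r k * conj (T m r p) = -conj (ad T p m) := by
    rw [Finset.sum_comm, ← sum_eta_mul_conj hT]
    simp only [← Finset.sum_mul, eta]
  rw [h1, h2, h3, h4, h5]
  ring

variable (hJ : ∀ i j k l, comp T i j k l + comp T j k i l + comp T k i j l = 0)
include hJ

/-- The terms with coefficient `ga` drop out, since there `η` meets the upper index of `T`;
elsewhere it meets a conjugated `T` and produces the conjugate of `A`. In `eta_mul_up` the roles of
`be` and `ga` are exchanged. -/
lemma eta_mul_dir (i j l : ι) : ∑ k, eta T k * U k i j l = al * ∑ m, T i j m * conj (ad T m l)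
    + be * ((∑ m, T i m l * conj (ad T j m)) - ∑ m, T j m l * conj (ad T i m)) := by
  have h (i l j : ι) : ∑ k, eta T k * ∑ m, T i m l * conj (T k m j)
      = ∑ m, T i m l * conj (ad T j m) := by
    rw [sum_mul_sum_mul']
    simp only [sum_eta_mul_conj']
  have h1 : ∑ k, eta T k * ∑ m, T i j m * conj (T k l m) = ∑ m, T i j m * conj (ad T m l) := by
    rw [sum_mul_sum_mul']
    simp only [sum_eta_mul_conj']
  have h2 (i j l : ι) : ∑ k, eta T k * ∑ m, T i m k * conj (T l m j) = 0 := by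
    rw [sum_mul_sum_mul]
    simp [sum_eta_mul hT hJ]
  calc _ = al * ∑ k, eta T k * (∑ m, T i j m * conj (T k l m))
      + be * ((∑ k, eta T k * ∑ m, T i m l * conj (T k m j))
        - ∑ k, eta T k * ∑ m, T j m l * conj (T k m i))
      + ga * ((∑ k, eta T k * ∑ m, T i m k * conj (T l m j))
        - ∑ k, eta T k * ∑ m, T j m k * conj (T l m i)) := by
        simp only [hU, Finset.mul_sum, mul_add, mul_sub, Finset.sum_add_distrib,
          Finset.sum_sub_distrib]
        simp only [mul_left_comm]
    _ = _ := by rw [h, h, h1, h2, h2]; ring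

lemma eta_mul_up (i j k : ι) : ∑ l, eta T l * U k i j l = -al * ∑ m, T i j m * conj (ad T m k)
    + ga * ((∑ m, T i m k * conj (ad T j m)) - ∑ m, T j m k * conj (ad T i m)) := by
  have h (i j k : ι) : ∑ l, eta T l * ∑ m, T i m k * conj (T l m j)
      = ∑ m, T i m k * conj (ad T j m) := by
    rw [sum_mul_sum_mul']
    simp only [sum_eta_mul_conj']
  have h1 : ∑ l, eta T l * ∑ m, T i j m * conj (T k l m)
      = -∑ m, T i j m * conj (ad T m k) := by
    rw [sum_mul_sum_mul']
    simp only [sum_eta_mul_conj hT, mul_neg, Finset.sum_neg_distrib]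
  have h2 (i j k : ι) : ∑ l, eta T l * ∑ m, T i m l * conj (T k m j) = 0 := by
    rw [sum_mul_sum_mul]
    simp [sum_eta_mul hT hJ]
  calc _ = al * ∑ l, eta T l * (∑ m, T i j m * conj (T k l m))
      + be * ((∑ l, eta T l * ∑ m, T i m l * conj (T k m j))
        - ∑ l, eta T l * ∑ m, T j m l * conj (T k m i))
      + ga * ((∑ l, eta T l * ∑ m, T i m k * conj (T l m j))
        - ∑ l, eta T l * ∑ m, T j m k * conj (T l m i)) := by
        simp only [hU, Finset.mul_sum, mul_add, mul_sub, Finset.sum_add_distrib,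
          Finset.sum_sub_distrib]
        simp only [mul_left_comm]
    _ = _ := by rw [h, h, h1, h2, h2]; ring

end Explicit

end TorsionArray

end

/-! ### Scalar identities obtained by contraction with the vector dual to the trace. -/

noncomputable section

open scoped ComplexConjugate

namespace TorsionArray

variable {ι : Type*} [Fintype ι] {T : ι → ι → ι → ℂ} {D U : ι → ι → ι → ι → ℂ}

lemma sum_sum_mul_left (x : ι → ℂ) (f : ι → ι → ℂ) :
    ∑ i, x i * ∑ k, f i k = ∑ k, ∑ i, x i * f i k := by
  simp only [Finset.mul_sum]
  rw [Finset.sum_comm]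

lemma sum_mul_sum_sum (x : ι → ℂ) (f : ι → ι → ι → ℂ) (g : ι → ι → ℂ) :
    ∑ i, x i * ∑ p, ∑ m, f i p m * g p m = ∑ p, ∑ m, (∑ i, x i * f i p m) * g p m := by
  simp only [Finset.mul_sum, Finset.sum_mul]
  rw [sum_swap₃₀, sum_swap₃₁]
  exact sum_congr₃ fun _ _ _ ↦ by ring

lemma sum_mul_sum_sum' (x : ι → ℂ) (f : ι → ι → ι → ℂ) (g : ι → ι → ℂ) :
    ∑ i, x i * ∑ p, ∑ m, g p m * f i p m = ∑ p, ∑ m, g p m * ∑ i, x i * f i p m := by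
  simp only [Finset.mul_sum]
  rw [sum_swap₃₀, sum_swap₃₁]
  exact sum_congr₃ fun _ _ _ ↦ by ring

section Contract

variable {c : ℂ} (hT : ∀ i j k, T i j k = -T j i k)
  (hD : ∀ i j l k, D i j l k = c * comp T j l i k)
include hT

lemma conj_eta_comp (j l k : ι) :
    ∑ i, conj (eta T i) * comp T j l i k = -∑ m, T j l m * ad T k m := by
  simp only [comp]
  rw [sum_mul_sum_mul', ← Finset.sum_neg_distrib]
  exact Finset.sum_congr rfl fun m _ ↦ by rw [sum_conj_eta_mul hT]; ring

lemma conj_eta_comp_mid (j i k : ι) :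
    ∑ l, conj (eta T l) * comp T j l i k = -∑ m, ad T m j * T m i k := by
  simp only [comp]
  rw [sum_mul_sum_mul, ← Finset.sum_neg_distrib]
  exact Finset.sum_congr rfl fun m _ ↦ by rw [sum_conj_eta_mul hT]; ring

/-- The Killing form at `(x, x)` is `tr (ad x ∘ ad x)`, and `ad x = A`. -/
lemma killing_conj_eta :
    ∑ i, conj (eta T i) * ∑ j, killing T i j * conj (eta T j) = trAdAd T := by
  simp only [trAdAd]
  have h (k m : ι) : ad T k m * ad T m k
      = (∑ i, conj (eta T i) * T k i m) * ∑ j, T m j k * conj (eta T j) := by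
    rw [sum_conj_eta_mul hT, Finset.sum_congr rfl fun j _ ↦ mul_comm (T m j k) _,
      sum_conj_eta_mul hT]
    ring
  simp only [h, killing, Finset.mul_sum, Finset.sum_mul]
  conv_lhs => rw [sum_swap₄₁, sum_swap₄₀, sum_swap₄₂, sum_swap₄₁]
  exact sum_congr₄ fun i j k m ↦ by ring

include hD

lemma conj_eta_deriv (j l k : ι) :
    ∑ i, conj (eta T i) * D i j l k = -c * ∑ m, T j l m * ad T k m := by
  simp only [hD, mul_left_comm _ c]
  rw [← Finset.mul_sum, conj_eta_comp hT]
  ring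

lemma conj_eta_deriv_mid (i j k : ι) :
    ∑ l, conj (eta T l) * D i j l k = -c * ∑ m, ad T m j * T m i k := by
  simp only [hD, mul_left_comm _ c]
  rw [← Finset.mul_sum, conj_eta_comp_mid hT]
  ring

omit hT in
lemma trace_deriv (i r : ι) : ∑ s, D i s r s = c * killing T i r := by
  simp only [hD, ← Finset.mul_sum, killing, comp]

end Contract

lemma killing_symm (i j : ι) : killing T i j = killing T j i := by
  simp only [killing]
  rw [Finset.sum_comm]
  exact sum_congr₂ fun _ _ ↦ mul_comm _ _

lemma sum_conj_eta_mul_conj_eq (f : ι → ℂ) :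
    ∑ i, conj (eta T i) * conj (f i) = conj (∑ i, eta T i * f i) := by
  simp

lemma sum_gramLower_mul_ad : ∑ m, ∑ k, gramLower T m k * ad T m k = trLower T :=
  sum_congr₂ fun _ _ ↦ mul_comm _ _

lemma sum_gramUpper_mul_ad : ∑ m, ∑ k, gramUpper T k m * ad T m k = trUpper T :=
  sum_congr₂ fun _ _ ↦ mul_comm _ _

lemma sum_conj_ad_mul_ad : ∑ m, ∑ k, conj (ad T m k) * ad T m k = trAdAdj T :=
  sum_congr₂ fun _ _ ↦ mul_comm _ _

lemma sum_ad_mul_ad : ∑ m, ∑ k, ad T k m * ad T m k = trAdAd T :=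
  sum_congr₂ fun _ _ ↦ mul_comm _ _

section Explicit

variable {al be ga : ℝ} {a : ℝ} {c : ℂ} (hT : ∀ i j k, T i j k = -T j i k)
    (hU : ∀ i j k l, U k i j l = al * ∑ m, T i j m * conj (T k l m)
      + be * ((∑ m, T i m l * conj (T k m j)) - ∑ m, T j m l * conj (T k m i))
      + ga * ((∑ m, T i m k * conj (T l m j)) - ∑ m, T j m k * conj (T l m i)))
  (hD : ∀ i j l k, D i j l k = c * comp T j l i k)
  (hJ : ∀ i j k l, comp T i j k l + comp T j k i l + comp T k i j l = 0)
include hT hU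

lemma sum_trace_left_mul_ad : ∑ m, ∑ k, (∑ i, U k i m i) * ad T m k
    = -(al + be) * trLower T - be * trAdAdj T + ga * (trUpper T + trAdAd T) := by
  simp only [trace_left hT hU, add_mul, sub_mul, mul_assoc, Finset.sum_add_distrib,
    Finset.sum_sub_distrib, ← Finset.mul_sum, sum_gramLower_mul_ad, sum_gramUpper_mul_ad,
    sum_conj_ad_mul_ad, sum_ad_mul_ad]

include hJ

/-- The contraction of the `(0,1)`-derivative of the equation `∑ m, eta T m * T i j m = 0`. -/
lemma contract_deriv_sum_eta_mul
    (h : ∀ i j k, ∑ m, ((∑ s, U k s m s) * T i j m + eta T m * U k i j m) = 0) :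
    -(al + be) * trLower T - be * trAdAdj T + ga * (trUpper T + trAdAd T)
      - al * trAdAdj T + ga * trAdAdj T = 0 := by
  have h0 : ∑ k, ∑ i, conj (eta T i) * ∑ m, ((∑ s, U k s m s) * T i k m + eta T m * U k i k m)
      = 0 := by simp [h]
  simp only [Finset.sum_add_distrib, mul_add] at h0
  have h1 : ∑ k, ∑ i, conj (eta T i) * ∑ m, (∑ s, U k s m s) * T i k m
      = -(al + be) * trLower T - be * trAdAdj T + ga * (trUpper T + trAdAd T) := by
    rw [← sum_trace_left_mul_ad hT hU, Finset.sum_comm (f := fun m k ↦ _ * ad T m k)]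
    refine Finset.sum_congr rfl fun k _ ↦ ?_
    rw [sum_mul_sum_mul']
    rfl
  have h2 : ∑ k, ∑ i, conj (eta T i) * ∑ m, eta T m * U k i k m
      = (ga - al) * trAdAdj T := by
    have e1 (k : ι) : ∑ i, conj (eta T i) * ∑ m, T i k m * conj (ad T m k)
        = ∑ m, ad T m k * conj (ad T m k) := by
      rw [sum_mul_sum_mul]; rfl
    have e2 (k : ι) : ∑ i, conj (eta T i) * ∑ m, T i m k * conj (ad T k m)
        = ∑ m, ad T k m * conj (ad T k m) := by
      rw [sum_mul_sum_mul]; rfl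
    have e3 (k : ι) : ∑ i, conj (eta T i) * ∑ m, T k m k * conj (ad T i m) = 0 := by
      rw [sum_mul_sum_mul']
      simp [conj_eta_ad hT hJ]
    have e4 (k : ι) : ∑ i, conj (eta T i) * ∑ m, eta T m * U k i k m
        = -al * ∑ m, ad T m k * conj (ad T m k) + ga * ∑ m, ad T k m * conj (ad T k m) := by
      simp only [eta_mul_up hT hU hJ, mul_add, mul_sub, mul_left_comm _ (-al : ℂ),
        mul_left_comm _ (ga : ℂ), Finset.sum_add_distrib, Finset.sum_sub_distrib,
        ← Finset.mul_sum, e1, e2, e3]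
      ring
    simp only [e4, Finset.sum_add_distrib, ← Finset.mul_sum]
    rw [Finset.sum_comm]
    simp only [trAdAdj]
    ring
  linear_combination h0 - h1 - h2

omit hU in
lemma conj_eta_conj_ad (j : ι) : ∑ i, conj (eta T i) * conj (ad T i j) = 0 := by
  rw [sum_conj_eta_mul_conj_eq, eta_ad hT hJ, map_zero]

omit hU in
lemma conj_eta_eta_conj_ad : ∑ i, conj (eta T i) * ∑ j, eta T j * conj (ad T i j) = 0 := by
  rw [sum_mul_sum_mul']
  simp [conj_eta_conj_ad hT hJ]

omit hU hJ in
lemma eta_gramLower' :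
    ∑ i, conj (eta T i) * ∑ j, eta T j * gramLower T i j = trAdAdj T := by
  rw [← eta_gramLower hT]
  simp only [Finset.mul_sum]

omit hT hU hJ in
lemma sum_mul_conj_upper : ∑ i, ∑ j, ∑ k, T i j k * ∑ m, conj (T i j m) * ad T m k
    = trUpper T := by
  simp only [trUpper, gramUpper, Finset.mul_sum]
  conv_rhs => rw [sum_swap₄₁, sum_swap₄₀, sum_swap₄₂, sum_swap₄₁, sum_swap₄₂]
  exact sum_congr₄ fun _ _ _ _ ↦ by ring

omit hT hU hJ in
lemma sum_mul_conj_lower : ∑ i, ∑ j, ∑ k, T i j k * ∑ m, conj (T i m k) * ad T j m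
    = trLower T := by
  simp only [trLower, gramLower, Finset.mul_sum]
  conv_rhs => rw [sum_swap₄₁, sum_swap₄₀, sum_swap₄₂]
  exact sum_congr₄ fun _ _ _ _ ↦ by ring

omit hU hJ in
lemma sum_mul_conj_lower' : ∑ i, ∑ j, ∑ k, T i j k * ∑ m, conj (T j m k) * ad T i m
    = -trLower T := by
  rw [← sum_mul_conj_lower, Finset.sum_comm]
  simp only [← Finset.sum_neg_distrib]
  exact sum_congr₃ fun i j k ↦ by rw [hT j i k]; ring

include hD

/-- The derivative of `normSqEta` in the direction dual to `eta T`. -/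
lemma contract_dNormSqEta : ∑ i, conj (eta T i) * dNormSqEta T D U i
    = c * trAdAd T - (al + be) * trAdAdj T := by
  have h1 : ∑ i, conj (eta T i) * ∑ j, (∑ s, D i s j s) * conj (eta T j) = c * trAdAd T := by
    simp only [trace_deriv hD, mul_assoc, ← Finset.mul_sum, mul_left_comm _ c,
      killing_conj_eta hT]
  have h2 : ∑ i, conj (eta T i) * ∑ j, eta T j * conj (∑ s, U i s j s)
      = -(al + be) * trAdAdj T := by
    have e1 (i : ι) : ∑ j, eta T j * conj (∑ s, U i s j s)
        = -(al + be) * ∑ j, eta T j * gramLower T i j + ga * ∑ j, eta T j * conj (ad T i j) := by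
      have (j : ι) : eta T j * conj (∑ s, U i s j s) = -(al + be) * (eta T j * gramLower T i j)
          - be * (eta T j * ad T j i) + ga * (eta T j * gramUpper T j i)
          + ga * (eta T j * conj (ad T i j)) := by
        rw [trace_left hT hU]
        simp only [map_add, map_sub, map_mul, map_neg, Complex.conj_ofReal, conj_gramLower,
          conj_gramUpper, Complex.conj_conj]
        ring
      simp only [this, Finset.sum_add_distrib, Finset.sum_sub_distrib, ← Finset.mul_sum,
        eta_ad hT hJ, eta_gramUpper hT hJ]
      ring
    simp only [e1, mul_add, mul_left_comm _ (-(al + be) : ℂ), mul_left_comm _ (ga : ℂ),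
      Finset.sum_add_distrib, ← Finset.mul_sum, conj_eta_eta_conj_ad hT hJ, eta_gramLower' hT]
    ring
  simp only [dNormSqEta, Finset.sum_add_distrib, mul_add, h1, h2]
  ring

omit hU hJ in
lemma contract_deriv_normSq :
    ∑ l, conj (eta T l) * ∑ i, ∑ j, ∑ k, D l i j k * conj (T i j k) = -c * trUpper T := by
  have (i j k : ι) : (-c * ∑ m, T i j m * ad T k m) * conj (T i j k)
      = -c * (conj (T i j k) * ∑ m, T i j m * ad T k m) := by
    ring
  rw [sum_sum_mul_left]
  simp only [sum_mul_sum_sum, conj_eta_deriv hT hD, this, ← Finset.mul_sum]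
  congr 1
  simp only [trUpper, gramUpper, Finset.mul_sum]
  conv_rhs => rw [sum_swap₄₁, sum_swap₄₀, sum_swap₄₂, sum_swap₄₁]
  exact sum_congr₄ fun _ _ _ _ ↦ by ring

omit hU hJ in
lemma contract_deriv_gramLower :
    ∑ k, ∑ i, conj (eta T i) * ∑ p, ∑ m, D k p i m * conj (T p k m) = -c * trLower T := by
  have h1 (k : ι) : ∑ i, conj (eta T i) * ∑ p, ∑ m, D k p i m * conj (T p k m)
      = ∑ p, ∑ m, (-c * ∑ r, ad T r p * T r k m) * conj (T p k m) := by
    rw [sum_mul_sum_sum]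
    simp only [conj_eta_deriv_mid hT hD]
  simp only [h1]
  simp only [trLower, gramLower_eq hT, Finset.mul_sum, Finset.sum_mul]
  conv_lhs => rw [sum_swap₄₂, sum_swap₄₁, sum_swap₄₀, sum_swap₄₁]
  exact sum_congr₄ fun _ _ _ _ ↦ by ring

lemma contract_dNormSq : ∑ i, conj (eta T i) * dNormSq T D U i
    = (al - c) * trUpper T + 2 * be * trLower T := by
  have h1 := contract_deriv_normSq hT hD
  have h2 : ∑ l, conj (eta T l) * ∑ i, ∑ j, ∑ k, T i j k * conj (U l i j k)
      = al * trUpper T + 2 * be * trLower T := by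
    rw [sum_sum_mul_left]
    simp only [sum_mul_sum_sum', sum_conj_eta_mul_conj_eq, eta_mul_dir hT hU hJ, map_add, map_sub,
      map_mul, map_sum, Complex.conj_conj, Complex.conj_ofReal, mul_add, mul_sub,
      mul_left_comm _ (al : ℂ), mul_left_comm _ (be : ℂ), Finset.sum_add_distrib,
      Finset.sum_sub_distrib]
    simp only [← Finset.mul_sum, sum_mul_conj_upper, sum_mul_conj_lower, sum_mul_conj_lower' hT]
    ring
  simp only [dNormSq, Finset.sum_add_distrib, mul_add, h1, h2]
  ring

/-! #### The contraction of the exterior derivative of `beta` -/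

omit hJ in
lemma contract_dGramLower : ∑ k, ∑ i, conj (eta T i) * dGramLower T D U k i k
    = -c * trLower T - (ga - al) * trLower T + be * trAdAdj T + be * trUpper T
      - ga * trAdAd T := by
  have h1 := contract_deriv_gramLower hT hD
  have h3 (k : ι) : ∑ i, conj (eta T i) * ∑ p, ∑ m, T p i m * conj (U k p k m)
      = ∑ p, ∑ m, -ad T m p * conj (U k p k m) := by
    rw [sum_mul_sum_sum]
    simp only [sum_conj_eta_mul hT]
  have h4 : ∑ k, ∑ p, ∑ m, -ad T m p * conj (U k p k m)
      = - (ga - al) * trLower T + be * trAdAdj T + be * trUpper T - ga * trAdAd T := by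
    have e (m p : ι) : -ad T m p * conj (∑ k, U k p k m)
        = -(ga - al) * (gramLower T m p * ad T m p) + be * (conj (ad T m p) * ad T m p)
          + be * (gramUpper T p m * ad T m p) - ga * (ad T p m * ad T m p) := by
      rw [trace_right hT hU]
      simp only [map_add, map_sub, map_mul, Complex.conj_ofReal, conj_gramLower,
        conj_gramUpper, Complex.conj_conj]
      ring
    rw [sum_swap₃₀, sum_swap₃₁]
    simp only [← Finset.mul_sum, ← map_sum]
    rw [Finset.sum_comm]
    simp only [e, Finset.sum_add_distrib, Finset.sum_sub_distrib, ← Finset.mul_sum,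
      sum_gramLower_mul_ad, sum_gramUpper_mul_ad, sum_conj_ad_mul_ad, sum_ad_mul_ad]
  simp only [dGramLower, Finset.sum_add_distrib, mul_add, h1, h3, h4]
  ring

omit hD in
lemma contract_dConjAd : ∑ k, ∑ i, conj (eta T i) * dConjAd T D U k i k
    = (ga - al) * trAdAdj T := by
  have h1 (k : ι) : ∑ i, conj (eta T i) * ∑ r, (∑ s, D k s r s) * conj (T r k i) = 0 := by
    rw [sum_mul_sum_mul']
    simp [sum_conj_eta_mul_conj hT hJ]
  have h2 : ∑ k, ∑ i, conj (eta T i) * ∑ r, eta T r * conj (U k r k i)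
      = (ga - al) * trAdAdj T := by
    have e1 (i : ι) : ∑ r, eta T r * conj (∑ k, U k r k i)
        = (ga - al) * ∑ r, eta T r * gramLower T i r
          - be * ∑ r, eta T r * conj (ad T i r) := by
      have (r : ι) : eta T r * conj (∑ k, U k r k i) = (ga - al) * (eta T r * gramLower T i r)
          - be * (eta T r * conj (ad T i r)) - be * (eta T r * gramUpper T r i)
          + ga * (eta T r * ad T r i) := by
        rw [trace_right hT hU]
        simp only [map_add, map_sub, map_mul, Complex.conj_ofReal, conj_gramLower,
          conj_gramUpper, Complex.conj_conj]
        ring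
      simp only [this, Finset.sum_add_distrib, Finset.sum_sub_distrib, ← Finset.mul_sum,
        eta_ad hT hJ, eta_gramUpper hT hJ]
      ring
    have e2 : ∑ k, ∑ i, conj (eta T i) * ∑ r, eta T r * conj (U k r k i)
        = ∑ i, conj (eta T i) * ∑ r, eta T r * conj (∑ k, U k r k i) := by
      simp only [Finset.mul_sum, map_sum]
      rw [sum_swap₃₀, sum_swap₃₁]
    simp only [e2, e1, mul_sub, mul_left_comm _ (ga - al : ℂ), mul_left_comm _ (be : ℂ),
      Finset.sum_sub_distrib, ← Finset.mul_sum, conj_eta_eta_conj_ad hT hJ, eta_gramLower' hT]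
    ring
  simp only [dConjAd, Finset.sum_add_distrib, mul_add, h1, h2, Finset.sum_const_zero]
  ring

omit hD in
lemma contract_dGramUpper : ∑ k, ∑ i, conj (eta T i) * dGramUpper T D U k k i
    = -al * trUpper T + 2 * ga * trLower T := by
  have h1 (k : ι) : ∑ i, conj (eta T i) * ∑ p, ∑ q, D k p q k * conj (T p q i) = 0 := by
    rw [sum_mul_sum_sum']
    simp [sum_conj_eta_mul_conj hT hJ]
  have h2 : ∑ k, ∑ i, conj (eta T i) * ∑ p, ∑ q, T p q k * conj (U k p q i)
      = -al * trUpper T + 2 * ga * trLower T := by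
    simp only [sum_mul_sum_sum', sum_conj_eta_mul_conj_eq, eta_mul_up hT hU hJ, map_add, map_sub,
      map_mul, map_neg, map_sum, Complex.conj_conj, Complex.conj_ofReal, mul_add, mul_sub,
      mul_left_comm _ (-al : ℂ), mul_left_comm _ (ga : ℂ)]
    rw [sum_swap₃₀, sum_swap₃₁]
    simp only [Finset.sum_add_distrib, Finset.sum_sub_distrib]
    simp only [← Finset.mul_sum, sum_mul_conj_upper, sum_mul_conj_lower, sum_mul_conj_lower' hT]
    ring
  simp only [dGramUpper, Finset.sum_add_distrib, mul_add, h1, h2, Finset.sum_const_zero]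
  ring

omit hJ in
lemma contract_dAd : ∑ k, ∑ i, conj (eta T i) * dAd T D U k k i
    = (al + be) * trLower T + be * trAdAd T - ga * trUpper T - ga * trAdAdj T := by
  have h1 : ∑ k, ∑ i, conj (eta T i) * ∑ r, conj (∑ s, U k s r s) * T r i k
      = (al + be) * trLower T + be * trAdAd T - ga * trUpper T - ga * trAdAdj T := by
    have e (k r : ι) : conj (∑ s, U k s r s) * -ad T k r
        = (al + be) * (gramLower T k r * ad T k r) + be * (ad T r k * ad T k r)
          - ga * (gramUpper T r k * ad T k r) - ga * (conj (ad T k r) * ad T k r) := by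
      rw [trace_left hT hU]
      simp only [map_add, map_sub, map_mul, map_neg, Complex.conj_ofReal, conj_gramLower,
        conj_gramUpper, Complex.conj_conj]
      ring
    simp only [sum_mul_sum_mul', sum_conj_eta_mul hT, e, Finset.sum_add_distrib,
      Finset.sum_sub_distrib, ← Finset.mul_sum,
      sum_gramLower_mul_ad, sum_gramUpper_mul_ad, sum_conj_ad_mul_ad, sum_ad_mul_ad]
  have h2 (k : ι) : ∑ i, conj (eta T i) * ∑ r, conj (eta T r) * D k r i k = 0 := by
    rw [sum_mul_sum_mul']
    simp only [conj_eta_deriv_mid hT hD, mul_left_comm _ (-c)]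
    rw [← Finset.mul_sum, sum_mul_sum_mul]
    simp only [mul_comm (conj (eta T _)), ad_conj_eta hT]
    simp
  simp only [dAd, Finset.sum_add_distrib, mul_add, h1, h2, Finset.sum_const_zero]
  ring

end Explicit

end TorsionArray

end

/-! ### Vanishing of the trace at a critical point, for generic parameters. -/

noncomputable section

open scoped ComplexConjugate

namespace TorsionArray

variable {ι : Type*} [Fintype ι] {T : ι → ι → ι → ℂ} {D U : ι → ι → ι → ι → ℂ}

lemma contract_beta (a : ℝ) : ∑ m, ∑ k, ad T m k * beta T a m k
    = (1 - a) * trLower T - (1 - 3 * a) * trAdAdj T - a * trUpper T - a * trAdAd T := by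
  have h (m k : ι) : ad T m k * beta T a m k = (1 - a) * (gramLower T m k * ad T m k)
      - (1 - 3 * a) * (conj (ad T m k) * ad T m k) - a * (gramUpper T k m * ad T m k)
      - a * (ad T k m * ad T m k) := by
    simp only [beta]; ring
  simp only [h, Finset.sum_sub_distrib, ← Finset.mul_sum, sum_gramLower_mul_ad,
    sum_gramUpper_mul_ad, sum_conj_ad_mul_ad, sum_ad_mul_ad]

/-- The three-index equation `d beta = 0` is traced over its last two indices and evaluated on `x`
in the first. What remains is one linear relation between `tr (A Φ)`, `tr (A Ψᵗ)`, `tr (A A*)` and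
`tr (A²)`, with coefficients in `a` and the constants of the formula for `U`. -/
lemma contract_extDerivBeta {al be ga a : ℝ} {c : ℂ} (hT : ∀ i j k, T i j k = -T j i k)
    (hU : ∀ i j k l, U k i j l = al * ∑ m, T i j m * conj (T k l m)
      + be * ((∑ m, T i m l * conj (T k m j)) - ∑ m, T j m l * conj (T k m i))
      + ga * ((∑ m, T i m k * conj (T l m j)) - ∑ m, T j m k * conj (T l m i)))
    (hD : ∀ i j l k, D i j l k = c * comp T j l i k)
    (hJ : ∀ i j k l, comp T i j k l + comp T j k i l + comp T k i j l = 0)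
    (hsD : ∀ l i j k, D l i j k = -D l j i k) (hsU : ∀ l i j k, U l i j k = -U l j i k)
    (hE : ∀ i j k, extDerivBeta T D U a i j k = 0) :
    (1 - 2 * a) * ((al - c) * trUpper T + 2 * be * trLower T
        + (c * trAdAd T - (al + be) * trAdAdj T))
      - ((1 - a) * (-c * trLower T - (ga - al) * trLower T + be * trAdAdj T + be * trUpper T
          - ga * trAdAd T) - (1 - 3 * a) * ((ga - al) * trAdAdj T)
        - a * (-al * trUpper T + 2 * ga * trLower T)
        - a * ((al + be) * trLower T + be * trAdAd T - ga * trUpper T - ga * trAdAdj T))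
      + (1 - a) * ((1 - a) * trLower T - (1 - 3 * a) * trAdAdj T - a * trUpper T - a * trAdAd T)
      - a * (1 - a) * trAdAdj T = 0 := by
  have h0 : ∑ k, ∑ i, conj (eta T i) * extDerivBeta T D U a i k k = 0 := by simp [hE]
  have h1 : ∑ k, ∑ i, conj (eta T i) * dBeta T D U a i k k
      = (1 - 2 * a) * ((al - c) * trUpper T + 2 * be * trLower T
        + (c * trAdAd T - (al + be) * trAdAdj T)) := by
    rw [← sum_sum_mul_left]
    simp only [dBeta_trace a hT hsD hsU, mul_left_comm _ (1 - 2 * a : ℂ), mul_add,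
      Finset.sum_add_distrib]
    simp only [← Finset.mul_sum, contract_dNormSq hT hU hD hJ, contract_dNormSqEta hT hU hD hJ]
    ring
  have h2 : ∑ k, ∑ i, conj (eta T i) * dBeta T D U a k i k
      = (1 - a) * (-c * trLower T - (ga - al) * trLower T + be * trAdAdj T + be * trUpper T
          - ga * trAdAd T) - (1 - 3 * a) * ((ga - al) * trAdAdj T)
        - a * (-al * trUpper T + 2 * ga * trLower T)
        - a * ((al + be) * trLower T + be * trAdAd T - ga * trUpper T - ga * trAdAdj T) := by
    rw [← contract_dGramLower hT hU hD, ← contract_dConjAd (D := D) hT hU hJ,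
      ← contract_dGramUpper (D := D) hT hU hJ, ← contract_dAd hT hU hD]
    simp only [Finset.mul_sum, ← Finset.sum_sub_distrib]
    exact sum_congr₂ fun k i ↦ by simp only [dBeta]; ring
  have h3 : ∑ k, ∑ i, conj (eta T i) * ∑ m, T i k m * beta T a m k
      = (1 - a) * trLower T - (1 - 3 * a) * trAdAdj T - a * trUpper T - a * trAdAd T := by
    rw [← contract_beta, Finset.sum_comm (f := fun m k ↦ ad T m k * _)]
    refine Finset.sum_congr rfl fun k _ ↦ ?_
    rw [sum_mul_sum_mul]
    rfl
  have h4 : ∑ k, ∑ i, conj (eta T i) * ∑ l, T k l k * beta T a i l = (1 - a) * trAdAdj T := by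
    have e (i : ι) : ∑ l, eta T l * beta T a i l = (1 - a) * ∑ l, eta T l * gramLower T i l
        - (1 - 3 * a) * ∑ l, eta T l * conj (ad T i l) := by
      have (l : ι) : eta T l * beta T a i l = (1 - a) * (eta T l * gramLower T i l)
          - (1 - 3 * a) * (eta T l * conj (ad T i l)) - a * (eta T l * gramUpper T l i)
          - a * (eta T l * ad T l i) := by
        simp only [beta]; ring
      simp only [this, Finset.sum_sub_distrib, ← Finset.mul_sum, eta_gramUpper hT hJ,
        eta_ad hT hJ]
      ring
    have e2 : ∑ k, ∑ i, conj (eta T i) * ∑ l, T k l k * beta T a i l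
        = ∑ i, conj (eta T i) * ∑ l, eta T l * beta T a i l := by
      have (i : ι) : ∑ l, eta T l * beta T a i l = ∑ k, ∑ l, T k l k * beta T a i l := by
        simp only [eta, Finset.sum_mul]
        exact Finset.sum_comm
      simp only [this, Finset.mul_sum]
      exact Finset.sum_comm
    simp only [e2, e, mul_sub, mul_left_comm _ (1 - a : ℂ), mul_left_comm _ (1 - 3 * a : ℂ),
      Finset.sum_sub_distrib, ← Finset.mul_sum, conj_eta_eta_conj_ad hT hJ, eta_gramLower' hT]
    ring
  have h5 : ∑ k, ∑ i, conj (eta T i) * ∑ l, T i l k * beta T a k l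
      = (1 - a) * trLower T - (1 - 3 * a) * trAdAdj T - a * trUpper T - a * trAdAd T := by
    rw [← contract_beta]
    refine Finset.sum_congr rfl fun k _ ↦ ?_
    rw [sum_mul_sum_mul]
    rfl
  have h6 : ∑ k, ∑ i, conj (eta T i) * extDerivBeta T D U a i k k
      = ∑ k, ∑ i, conj (eta T i) * dBeta T D U a i k k
        - ∑ k, ∑ i, conj (eta T i) * dBeta T D U a k i k
        + (1 - 2 * a) * ∑ k, ∑ i, conj (eta T i) * ∑ m, T i k m * beta T a m k
        - a * ∑ k, ∑ i, conj (eta T i) * ∑ l, T k l k * beta T a i l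
        + a * ∑ k, ∑ i, conj (eta T i) * ∑ l, T i l k * beta T a k l := by
    rw [Finset.mul_sum (a := (1 - 2 * a : ℂ)), Finset.mul_sum (a := (a : ℂ)),
      Finset.mul_sum (a := (a : ℂ))]
    simp only [← Finset.sum_sub_distrib, ← Finset.sum_add_distrib]
    refine Finset.sum_congr rfl fun k _ ↦ ?_
    rw [Finset.mul_sum (a := (1 - 2 * a : ℂ)), Finset.mul_sum (a := (a : ℂ)),
      Finset.mul_sum (a := (a : ℂ))]
    simp only [← Finset.sum_sub_distrib, ← Finset.sum_add_distrib]
    exact Finset.sum_congr rfl fun i _ ↦ by simp only [extDerivBeta]; ring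
  rw [h6, h1, h2, h3, h4, h5] at h0
  linear_combination h0

/-- The scalar equations satisfied by `trLower T`, `trAdAdj T` and `trAdAd T` at a critical point of
`normSqEta + θ normSq` force `trAdAdj T` to vanish. -/
def IsGeneric (a θ : ℝ) : Prop := ∀ Y S W : ℂ,
  (1 - 3 * a) * Y = a * W - (1 - 2 * a) * S →
  (1 - 7 * a + 15 * a ^ 2 - 7 * a ^ 3) * S = (1 - 9 * a + 26 * a ^ 2 - 22 * a ^ 3) * W →
  (1 - 2 * a) * (4 * a - 1) * W + a ^ 2 * S
    + 2 * θ * ((7 * a ^ 2 - 6 * a + 1) * Y) = 0 → S = 0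

/-- Elimination of `Y` and `W` leaves `(1 - 3a) (G - 2θK) S = 0` with polynomials `G`, `K` in `a`
that have no common zero. If `G ≠ 0` then `θ = 0` works, otherwise any positive `θ` does. The zeros
of `R` and the value `a = 1/3` are treated directly. -/
lemma exists_isGeneric (a : ℝ) {ε : ℝ} (hε : 0 < ε) : ∃ θ, 0 ≤ θ ∧ θ < ε ∧ IsGeneric a θ := by
  set L := 1 - 7 * a + 15 * a ^ 2 - 7 * a ^ 3 with hL
  set R := 1 - 9 * a + 26 * a ^ 2 - 22 * a ^ 3 with hR
  by_cases hR0 : R = 0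
  · refine ⟨0, le_rfl, hε, fun Y S W _ h2 _ ↦ ?_⟩
    have hL0 : L ≠ 0 := fun hL0 ↦ by
      -- `L` and `R` are coprime polynomials in `a`; the coefficients are those of a Bézout
      -- identity.
      have : (1 : ℝ) = 0 := by
        linear_combination (-2779/38 + 8742/19 * a - 9845/19 * a ^ 2) * hL0
          + (2817/38 - 5792/19 * a + 6265/38 * a ^ 2) * hR0
      norm_num at this
    have h2' : (L : ℂ) * S = R * W := by rw [hL, hR]; push_cast; exact h2
    rw [hR0, Complex.ofReal_zero, zero_mul] at h2'
    exact (mul_eq_zero.1 h2').resolve_left (by exact_mod_cast hL0)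
  by_cases he : 1 - 3 * a = 0
  · refine ⟨0, le_rfl, hε, fun Y S W h1 _ h3 ↦ ?_⟩
    have ha : (a : ℂ) = 1 / 3 := by
      rw [show a = 1 / 3 by linarith]; norm_num
    rw [ha] at h1 h3
    norm_num at h1 h3
    linear_combination (9 / 2 : ℂ) * h3 + 3 / 2 * h1
  set G := (1 - 2 * a) * (4 * a - 1) * L + a ^ 2 * R with hG
  set K := (7 * a ^ 2 - 6 * a + 1) * (1 - 9 * a + 24 * a ^ 2 - 17 * a ^ 3) with hK
  have key (θ : ℝ) (hθ : G - 2 * θ * K ≠ 0) : IsGeneric a θ := fun Y S W h1 h2 h3 ↦ by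
    -- Multiply the third equation by `(1 - 3a) R`, then replace `(1 - 3a) Y` by the first equation
    -- and `R W` by `L S`. The factor `1 - 3a` in the part with `θ` comes from `a L - (1 - 2a) R =
    -- -(1 - 3a) (1 - 9a + 24a² - 17a³)`.
    have : ((1 - 3 * a : ℝ) : ℂ) * ((G - 2 * θ * K : ℝ) : ℂ) * S = 0 := by
      rw [hG, hK, hL, hR]
      push_cast
      linear_combination (1 - 3 * a) * (1 - 9 * a + 26 * a ^ 2 - 22 * a ^ 3) * h3
        - 2 * θ * (7 * a ^ 2 - 6 * a + 1) * (1 - 9 * a + 26 * a ^ 2 - 22 * a ^ 3) * h1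
        + ((1 - 3 * a) * (1 - 2 * a) * (4 * a - 1) + 2 * θ * (7 * a ^ 2 - 6 * a + 1) * a) * h2
    rcases mul_eq_zero.1 this with h | h
    · rcases mul_eq_zero.1 h with h | h
      · exact absurd (by exact_mod_cast h) he
      · exact absurd (by exact_mod_cast h) hθ
    · exact h
  by_cases hG0 : G = 0
  · refine ⟨ε / 2, by positivity, by linarith, key _ ?_⟩
    rw [hG0]
    have hK0 : K ≠ 0 := fun hK0 ↦ by
      -- `G` is coprime to either factor of `K`; again Bézout coefficients.
      have : (1 : ℝ) = 0 := by
        rcases mul_eq_zero.1 hK0 with h | h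
        · linear_combination (-6733/14 + 1513/2 * a) * hG0 + (-6719/14 + 4129 * a
            - 87363/7 * a ^ 2 + 97189/7 * a ^ 3 - 25721/7 * a ^ 4) * h
        · linear_combination (-27996/19 + 135937/19 * a - 117181/19 * a ^ 2) * hG0
            + (-27977/19 + 248092/19 * a - 771830/19 * a ^ 2 + 878458/19 * a ^ 3
              - 234362/19 * a ^ 4) * h
      norm_num at this
    have : ε * K ≠ 0 := mul_ne_zero hε.ne' hK0
    intro h
    apply this
    linarith
  · exact ⟨0, le_rfl, hε, key _ (by simpa using hG0)⟩

/-- The coefficients are rational functions of `a`. They are kept as abstract reals subject to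
equations without denominators, so that the later eliminations are polynomial identities. -/
lemma FirstOrder.exists_antiholo_eq {a : ℝ} (h : FirstOrder a T D U) (ha2 : 1 - 2 * a ≠ 0)
    (ha4 : 4 * a - 1 ≠ 0) : ∃ al be ga : ℝ, (al : ℂ) * (4 * a - 1) = -a * (1 - 2 * a) ∧
      (be : ℂ) * ((1 - 2 * a) * (4 * a - 1)) = a * (5 * a ^ 2 - 5 * a + 1) ∧
      (ga : ℂ) * ((1 - 2 * a) * (4 * a - 1)) = -a ^ 3 ∧
      ∀ i j k l, U k i j l = al * ∑ m, T i j m * conj (T k l m)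
      + be * ((∑ m, T i m l * conj (T k m j)) - ∑ m, T j m l * conj (T k m i))
      + ga * ((∑ m, T i m k * conj (T l m j)) - ∑ m, T j m k * conj (T l m i)) := by
  have ha2' : (1 - 2 * a : ℂ) ≠ 0 := by exact_mod_cast ha2
  have ha4' : (4 * a - 1 : ℂ) ≠ 0 := by exact_mod_cast ha4
  obtain ⟨al, hal⟩ : ∃ x : ℝ, x * (4 * a - 1) = -a * (1 - 2 * a) :=
    ⟨_, div_mul_cancel₀ _ ha4⟩
  obtain ⟨be, hbe⟩ : ∃ x : ℝ, x * ((1 - 2 * a) * (4 * a - 1)) = a * (5 * a ^ 2 - 5 * a + 1) :=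
    ⟨_, div_mul_cancel₀ _ (mul_ne_zero ha2 ha4)⟩
  obtain ⟨ga, hga⟩ : ∃ x : ℝ, x * ((1 - 2 * a) * (4 * a - 1)) = -a ^ 3 :=
    ⟨_, div_mul_cancel₀ _ (mul_ne_zero ha2 ha4)⟩
  have hal' : (al : ℂ) * (4 * a - 1) = -a * (1 - 2 * a) := by exact_mod_cast hal
  have hbe' : (be : ℂ) * ((1 - 2 * a) * (4 * a - 1)) = a * (5 * a ^ 2 - 5 * a + 1) := by
    exact_mod_cast hbe
  have hga' : (ga : ℂ) * ((1 - 2 * a) * (4 * a - 1)) = -a ^ 3 := by exact_mod_cast hga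
  refine ⟨al, be, ga, hal', hbe', hga', fun i j k l ↦ ?_⟩
  have h1 := h.antiholo_eq i j k l
  refine mul_left_cancel₀ (mul_ne_zero ha2' ha4') ?_
  linear_combination h1 / 2 - (1 - 2 * a : ℂ) * hal' * (∑ m, T i j m * conj (T k l m))
      - hbe' * ((∑ m, T i m l * conj (T k m j)) - ∑ m, T j m l * conj (T k m i))
      - hga' * ((∑ m, T i m k * conj (T l m j)) - ∑ m, T j m k * conj (T l m i))

/-- At a critical point of `normSqEta + θ normSq` the trace of the torsion vanishes. -/
theorem FirstOrder.normSqEta_eq_zero {a θ : ℝ} (h : FirstOrder a T D U) (ha0 : a ≠ 0)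
    (ha1 : a ≠ 1) (ha2 : 1 - 2 * a ≠ 0) (ha4 : 4 * a - 1 ≠ 0) (hθ : IsGeneric a θ)
    (hlin : ∀ i j k, ∑ m, ((∑ s, U k s m s) * T i j m + eta T m * U k i j m) = 0)
    (hE : ∀ i j k, extDerivBeta T D U a i j k = 0)
    (hcrit : ∀ i, dNormSqEta T D U i + θ * dNormSq T D U i = 0) : normSqEta T = 0 := by
  have ha0' : (a : ℂ) ≠ 0 := by exact_mod_cast ha0
  have ha1' : (1 - a : ℂ) ≠ 0 := by exact_mod_cast sub_ne_zero.2 ha1.symm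
  have ha2' : (1 - 2 * a : ℂ) ≠ 0 := by exact_mod_cast ha2
  have ha4' : (4 * a - 1 : ℂ) ≠ 0 := by exact_mod_cast ha4
  obtain ⟨al, be, ga, hal', hbe', hga', hU⟩ := h.exists_antiholo_eq ha2 ha4
  have hJ := h.jacobi ha2'
  have hD : ∀ i j l k, D i j l k = (1 - a : ℂ) * comp T j l i k := h.deriv_eq_comp
  have e1 := contract_deriv_sum_eta_mul h.skew hU hJ hlin
  have e2 := contract_extDerivBeta h.skew hU hD hJ h.skewD h.skewU hE
  have e3 : ∑ i, conj (eta T i) * (dNormSqEta T D U i + θ * dNormSq T D U i) = 0 := by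
    simp [hcrit]
  simp only [mul_add, Finset.sum_add_distrib, mul_left_comm _ (θ : ℂ)] at e3
  rw [← Finset.mul_sum, contract_dNormSqEta h.skew hU hD hJ, contract_dNormSq h.skew hU hD hJ]
    at e3
  rw [trUpper_eq h.skew hJ] at e1 e2 e3
  -- The first equation of `IsGeneric`, from the linearization of `η ∘ T = 0`, after cancelling
  -- `a²`.
  have g1 : (1 - 3 * a) * trLower T = a * trAdAd T - (1 - 2 * a) * trAdAdj T := by
    refine mul_left_cancel₀ (pow_ne_zero 2 ha0') ?_
    linear_combination (1 - 2 * a) * (4 * a - 1) * e1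
      + (trLower T + trAdAdj T) * ((1 - 2 * a) * hal' + hbe')
      - (2 * trLower T + trAdAd T + trAdAdj T) * hga'
  refine TorsionArray.normSqEta_eq_zero h.skew (hθ (trLower T) _ (trAdAd T) g1 ?_ ?_)
  -- The contracted exterior derivative and the critical point equation both carry the factor `1 -
  -- a`; cancelling it is where the Bismut parameter is excluded.
  · refine mul_left_cancel₀ ha1' ?_
    linear_combination (1 - 2 * a) * (4 * a - 1) * e2
      - ((1 - 2 * a) * (2 * trLower T - trAdAdj T) - ((1 - a) * trLower T
        + (1 - 3 * a) * trAdAdj T + a * trLower T)) * (1 - 2 * a) * hal'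
      - ((1 - 2 * a) * (2 * trLower T - trAdAdj T) - ((1 - a) * (trAdAdj T + 2 * trLower T)
        - a * (trLower T + trAdAd T))) * hbe'
      + ((1 - a) * (-trLower T - trAdAd T) - (1 - 3 * a) * trAdAdj T + a * trAdAdj T) * hga'
      + a * (1 - 2 * a) ^ 2 * g1
  · refine (mul_eq_zero.1 ?_).resolve_left ha1'
    linear_combination (1 - 2 * a) * (4 * a - 1) * e3
      - (-trAdAdj T + 2 * θ * trLower T) * ((1 - 2 * a) * hal' + hbe')

lemma sum_eta_mul_conj_eta : ∑ i, ∑ j, ∑ m, T i m i * conj (T j m j) = normSqEta T := by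
  simp only [normSqEta, eta, Complex.ofReal_sum, Complex.normSq_eq_conj_mul_self, map_sum,
    Finset.sum_mul, Finset.mul_sum]
  rw [sum_swap₃₁, sum_swap₃₀]
  exact sum_congr₃ fun _ _ _ ↦ mul_comm _ _

/-- The double trace of `antiholo_skew`, a formula for the divergence of `η`. It makes `T` vanish
where `η` vanishes identically, and for `a = 1/4` its left side disappears. -/
lemma FirstOrder.trace_trace {a : ℝ} (h : FirstOrder a T D U) :
    (4 * a - 1) * ∑ k, ∑ i, U k i k i
      = a ^ 2 * normSq T + a * (1 - 3 * a) * normSqEta T := by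
  have h1 : ∑ i, ∑ j, (4 * a - 1 : ℂ) * (U j i j i - U i i j j)
      = 2 * (4 * a - 1) * ∑ k, ∑ i, U k i k i := by
    have : ∑ i, ∑ j, U i i j j = -∑ k, ∑ i, U k i k i := by
      simp only [← Finset.sum_neg_distrib]
      exact sum_congr₂ fun i j ↦ h.skewU i i j j
    simp only [← Finset.mul_sum, Finset.sum_sub_distrib, this]
    rw [Finset.sum_comm]
    ring
  have e1 : ∑ i, ∑ j, ∑ m, T i j m * conj (T i j m) = normSq T := by
    simp [normSq, Complex.mul_conj]
  have e2 : ∑ i, ∑ j, ∑ m, T i m j * conj (T i m j) = normSq T := by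
    rw [← e1, sum_swap₃₁]
  have e3 : ∑ i, ∑ j, ∑ m, T j m i * conj (T j m i) = normSq T := by
    rw [← e2, sum_swap₃₀]
  have e4 : ∑ i, ∑ j, ∑ m, T j m j * conj (T i m i) = normSqEta T := by
    rw [← sum_eta_mul_conj_eta, sum_swap₃₀]
  simp only [h.antiholo_skew, Finset.sum_add_distrib, Finset.sum_sub_distrib, ← Finset.mul_sum,
    e1, e2, e3, e4, sum_eta_mul_conj_eta] at h1
  linear_combination -h1 / 2

/-- This identifies the components of `dη` with a nonzero multiple of `beta`, so `d(dη) = 0` becomes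
an equation for an array quadratic in `T`. -/
lemma FirstOrder.beta_eq {a : ℝ} (h : FirstOrder a T D U) (ha2 : 1 - 2 * a ≠ 0)
    (ha4 : 4 * a - 1 ≠ 0) (j k : ι) :
    (1 - 2 * a) * (4 * a - 1) * ((∑ i, U k i j i) - a * conj (ad T j k))
      = a ^ 2 * beta T a j k := by
  obtain ⟨al, be, ga, hal, hbe, hga, hU⟩ := h.exists_antiholo_eq ha2 ha4
  have h1 := trace_left h.skew hU j k
  simp only [beta]
  linear_combination (1 - 2 * a) * (4 * a - 1) * h1 - gramLower T j k * ((1 - 2 * a) * hal + hbe)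
    - conj (ad T j k) * hbe + (gramUpper T k j + ad T k j) * hga

end TorsionArray

end

/-! ### The exceptional parameter `a = 1/2`. -/

noncomputable section

open scoped ComplexConjugate

namespace TorsionArray

variable {ι : Type*} [Fintype ι] {T : ι → ι → ι → ℂ} {D U : ι → ι → ι → ι → ℂ}

/-- The contraction `eta (T (e_i, e_j))`. -/
def etaT (T : ι → ι → ι → ℂ) (i j : ι) : ℂ := ∑ k, eta T k * T i j k

section Half

variable (h : FirstOrder (1 / 2) T D U)
include h

namespace FirstOrder

/-- The coefficient `1 - 2a` of `U` in `antiholo_symm` vanishes, which leaves a constraint on `T`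
alone. It replaces the Jacobi identity, whose proof needs `a ≠ 1/2`. -/
lemma symm_half (i j k l : ι) : (∑ m, T i m k * conj (T l m j)) + (∑ m, T i m l * conj (T k m j))
    - (∑ m, T j m k * conj (T l m i)) - ∑ m, T j m l * conj (T k m i) = 0 := by
  have := h.antiholo_symm i j k l
  push_cast at this
  linear_combination 4 * this

lemma skew_half (i j k l : ι) : U l i j k - U k i j l = -(1 / 4) *
    ((∑ m, T i m k * conj (T l m j)) - (∑ m, T i m l * conj (T k m j))
        - (∑ m, T j m k * conj (T l m i)) + ∑ m, T j m l * conj (T k m i)) := by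
  have := h.antiholo_skew i j k l
  push_cast at this
  linear_combination this

lemma trace_symm_half (l j : ι) :
    ad T l j - conj (ad T j l) + gramUpper T l j - gramLower T j l = 0 := by
  have h0 : ∑ i, ((∑ m, T i m i * conj (T l m j)) + (∑ m, T i m l * conj (T i m j))
    - (∑ m, T j m i * conj (T l m i)) - ∑ m, T j m l * conj (T i m i)) = 0 :=
    Finset.sum_eq_zero fun i _ ↦ h.symm_half i j i l
  simp only [Finset.sum_add_distrib, Finset.sum_sub_distrib] at h0
  have h1 : ∑ i, ∑ m, T i m i * conj (T l m j) = -conj (ad T j l) := by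
    rw [Finset.sum_comm, ← sum_eta_mul_conj h.skew]
    simp only [← Finset.sum_mul, eta]
  have h2 : ∑ i, ∑ m, T i m l * conj (T i m j) = gramUpper T l j := rfl
  have h3 : ∑ i, ∑ m, T j m i * conj (T l m i) = gramLower T j l := by
    rw [gramLower_eq h.skew, Finset.sum_comm]
  have h4 : ∑ i, ∑ m, T j m l * conj (T i m i) = -ad T l j := by
    rw [Finset.sum_comm, ← sum_conj_eta_mul h.skew]
    simp only [← Finset.mul_sum, eta, map_sum]
    exact Finset.sum_congr rfl fun _ _ ↦ mul_comm _ _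
  rw [h1, h2, h3, h4] at h0
  linear_combination h0

/-- In the traced constraint the Gram matrices form a Hermitian matrix and the `A`-terms a
skew-Hermitian one, so the two parts vanish separately. The second part is `ad_conj`. -/
lemma gramUpper_eq_gramLower (l j : ι) : gramUpper T l j = gramLower T j l := by
  have h1 := h.trace_symm_half l j
  have h2 := congrArg conj (h.trace_symm_half j l)
  simp only [map_add, map_sub, Complex.conj_conj, map_zero, conj_gramLower, conj_gramUpper] at h2
  linear_combination (h1 + h2) / 2

lemma ad_conj (l j : ι) : ad T l j = conj (ad T j l) := by
  have h1 := h.trace_symm_half l j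
  have h2 := h.gramUpper_eq_gramLower l j
  linear_combination h1 - h2

lemma trAdAd_eq : trAdAd T = trAdAdj T :=
  sum_congr₂ fun l m ↦ by rw [h.ad_conj m l]

lemma eta_ad_half (l : ι) : ∑ j, eta T j * ad T j l = 0 := by
  have h1 := congrArg conj (ad_conj_eta h.skew l)
  simp only [map_sum, map_mul, Complex.conj_conj, map_zero, ← h.ad_conj _ l] at h1
  simpa only [mul_comm] using h1

lemma conj_eta_conj_ad_half (l : ι) : ∑ j, conj (eta T j) * conj (ad T j l) = 0 := by
  rw [sum_conj_eta_mul_conj_eq, h.eta_ad_half, map_zero]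

lemma etaT_skew (i j : ι) : etaT T i j = -etaT T j i := by
  simp only [etaT, ← Finset.sum_neg_distrib]
  exact Finset.sum_congr rfl fun k _ ↦ by rw [h.skew i j]; ring

lemma etaT_killing : ∑ i, ∑ m, etaT T i m * conj (killing T i m) = 0 :=
  sum_skew_mul_symm h.etaT_skew fun i j ↦ by rw [killing_symm]

/-- Without the Jacobi identity `η ∘ T` need not vanish. Its contraction with two copies of `T` is,
however, a skew form paired with the symmetric Killing form. -/
lemma etaT_contract :
    ∑ i, ∑ j, ∑ l, conj (T i j l) * ∑ m, etaT T i m * conj (T l m j) = 0 := by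
  rw [← neg_eq_zero, ← h.etaT_killing]
  simp only [killing, map_sum, map_mul, Finset.mul_sum, ← Finset.sum_neg_distrib]
  conv_lhs => rw [sum_swap₄₂, sum_swap₄₁, sum_swap₄₂]
  exact sum_congr₄ fun i m l j ↦ by rw [h.skew i j l]; simp; ring

lemma etaT_contract' :
    ∑ i, ∑ j, ∑ l, conj (T i j l) * ∑ m, etaT T j m * conj (T l m i) = 0 := by
  rw [← neg_eq_zero, ← h.etaT_contract, Finset.sum_comm]
  simp only [← Finset.sum_neg_distrib]
  exact sum_congr₃ fun i j l ↦ by rw [h.skew j i l]; simp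

lemma conj_etaT_contract :
    ∑ i, ∑ j, ∑ l, T i j l * ∑ m, conj (etaT T i m) * T l m j = 0 := by
  simpa using congrArg conj h.etaT_contract

lemma conj_etaT_contract' :
    ∑ i, ∑ j, ∑ l, T i j l * ∑ m, conj (etaT T j m) * T l m i = 0 := by
  simpa using congrArg conj h.etaT_contract'

omit h in
lemma conj_sum_mul_conj_lower : ∑ i, ∑ j, ∑ k, conj (T i j k) * ∑ m, T i m k * conj (ad T j m)
    = conj (trLower T) := by
  rw [← sum_mul_conj_lower]; simp

lemma conj_sum_mul_conj_lower' : ∑ i, ∑ j, ∑ k, conj (T i j k) * ∑ m, T j m k * conj (ad T i m)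
    = -conj (trLower T) := by
  rw [← map_neg, ← sum_mul_conj_lower' h.skew]; simp

/-- Contract `symm_half` with `η` in `k` and with the conjugate of `T`. The terms containing `etaT`
disappear by `etaT_contract`, and the other two add up to twice the conjugate of `tr (A Ψᵗ)`. -/
lemma trLower_eq_zero : trLower T = 0 := by
  have h0 (i j l : ι) : (∑ m, etaT T i m * conj (T l m j)) + (∑ m, T i m l * conj (ad T j m))
      - (∑ m, etaT T j m * conj (T l m i)) - ∑ m, T j m l * conj (ad T i m) = 0 := by
    have e1 (i j l : ι) : ∑ k, eta T k * ∑ m, T i m k * conj (T l m j)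
        = ∑ m, etaT T i m * conj (T l m j) := by
      rw [sum_mul_sum_mul]; rfl
    have e2 (i j l : ι) : ∑ k, eta T k * ∑ m, T i m l * conj (T k m j)
        = ∑ m, T i m l * conj (ad T j m) := by
      rw [sum_mul_sum_mul']; simp only [sum_eta_mul_conj']
    rw [← e1, ← e1, ← e2, ← e2]
    simp only [← Finset.sum_add_distrib, ← Finset.sum_sub_distrib, ← mul_add, ← mul_sub]
    refine Finset.sum_eq_zero fun k _ ↦ ?_
    have := h.symm_half i j k l
    simp only [← Finset.sum_add_distrib, ← Finset.sum_sub_distrib] at this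
    rw [this, mul_zero]
  have h1 : ∑ i, ∑ j, ∑ l, conj (T i j l) * ((∑ m, etaT T i m * conj (T l m j))
      + (∑ m, T i m l * conj (ad T j m)) - (∑ m, etaT T j m * conj (T l m i))
      - ∑ m, T j m l * conj (ad T i m)) = 0 := by simp [h0]
  simp only [mul_add, mul_sub, Finset.sum_add_distrib, Finset.sum_sub_distrib, h.etaT_contract,
    h.etaT_contract', conj_sum_mul_conj_lower, h.conj_sum_mul_conj_lower'] at h1
  have h2 : conj (trLower T) = 0 := by linear_combination h1 / 2
  simpa using h2

lemma trUpper_eq_zero : trUpper T = 0 := by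
  rw [← h.trLower_eq_zero]
  exact sum_congr₂ fun l m ↦ by rw [h.gramUpper_eq_gramLower]

/-- Only the part of `U` skew in direction and upper index is known here. Its trace still determines
one trace of `U` from the other, which is `∇^{0,1} η`. -/
lemma trace_right_half (i k : ι) : ∑ j, U j i j k
    = (ad T k i + gramUpper T k i) / 2 - ∑ s, U k s i s := by
  have h0 : ∑ j, (U j i j k - U k i j j) = ∑ j, -(1 / 4) *
    ((∑ m, T i m k * conj (T j m j)) - (∑ m, T i m j * conj (T k m j))
        - (∑ m, T j m k * conj (T j m i)) + ∑ m, T j m j * conj (T k m i)) :=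
    Finset.sum_congr rfl fun j _ ↦ h.skew_half i j k j
  have h1 : ∑ j, ∑ m, T i m k * conj (T j m j) = -ad T k i := by
    rw [Finset.sum_comm, ← sum_conj_eta_mul h.skew]
    simp only [← Finset.mul_sum, eta, map_sum]
    exact Finset.sum_congr rfl fun _ _ ↦ mul_comm _ _
  have h2 : ∑ j, ∑ m, T i m j * conj (T k m j) = gramLower T i k := by
    rw [gramLower_eq h.skew, Finset.sum_comm]
  have h3 : ∑ j, ∑ m, T j m k * conj (T j m i) = gramUpper T k i := rfl
  have h4 : ∑ j, ∑ m, T j m j * conj (T k m i) = -conj (ad T i k) := by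
    rw [Finset.sum_comm, ← sum_eta_mul_conj h.skew]
    simp only [← Finset.sum_mul, eta]
  have h5 : ∑ j, U k i j j = -∑ s, U k s i s := by
    rw [← Finset.sum_neg_distrib]
    exact Finset.sum_congr rfl fun j _ ↦ h.skewU _ _ _ _
  simp only [Finset.sum_sub_distrib, Finset.sum_add_distrib, ← Finset.mul_sum, h1, h2, h3, h4, h5,
    ← h.gramUpper_eq_gramLower, ← h.ad_conj] at h0
  linear_combination h0

lemma deriv_half (i j l k : ι) : D i j l k = (1 / 2 : ℂ) * comp T j l i k := by
  have := h.deriv_eq_comp i j l k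
  push_cast at this
  linear_combination this

/-! #### Consequences of the linearized identities at a critical point of `normSqEta` -/

lemma normSq_etaT : ∑ p, ∑ q, etaT T p q * conj (etaT T p q) = trAdAdj T := by
  rw [← eta_gramLower' h.skew]
  simp only [← h.gramUpper_eq_gramLower, gramUpper, etaT, map_sum, Finset.mul_sum, Finset.sum_mul,
    map_mul]
  conv_rhs => rw [sum_swap₄₁, sum_swap₄₀, sum_swap₄₂, sum_swap₄₁]
  exact sum_congr₄ fun _ _ _ _ ↦ by ring

section Critical

variable (hcrit : ∀ i, dNormSqEta T D U i = 0)
include hcrit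

lemma eta_trace_left_half :
    ∑ j, conj (eta T j) * ∑ r, eta T r * conj (∑ s, U j s r s) = -trAdAdj T / 2 := by
  have h0 : ∑ j, conj (eta T j) * dNormSqEta T D U j = 0 := by simp [hcrit]
  have h1 : ∑ i, conj (eta T i) * ∑ j, (∑ s, D i s j s) * conj (eta T j)
      = (1 / 2 : ℂ) * trAdAd T := by
    simp only [trace_deriv h.deriv_half, mul_assoc, ← Finset.mul_sum,
      mul_left_comm _ (1 / 2 : ℂ), killing_conj_eta h.skew]
  simp only [dNormSqEta, mul_add, Finset.sum_add_distrib, h1, h.trAdAd_eq] at h0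
  linear_combination h0

/-- The terms with `D` contract the skew `T` with the symmetric Killing form and vanish. In those
with `U`, `trace_right_half` leaves a Gram term and a trace term, and each contributes `tr (A A*) /
2`, the latter by the critical point equation. -/
lemma contract_dConjAd_half :
    ∑ i, ∑ j, conj (eta T j) * dConjAd T D U i j i = trAdAdj T := by
  have h1 : ∑ i, ∑ j, conj (eta T j) * ∑ r, (∑ s, D i s r s) * conj (T r i j) = 0 := by
    rw [Finset.sum_comm]
    refine Finset.sum_eq_zero fun j _ ↦ ?_
    rw [← Finset.mul_sum]
    refine mul_eq_zero_of_right _ ?_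
    rw [Finset.sum_comm]
    simp only [trace_deriv h.deriv_half, mul_comm _ (conj (T _ _ _))]
    refine sum_skew_mul_symm (fun r i ↦ ?_) fun r i ↦ by rw [killing_symm]
    rw [h.skew r i, map_neg]
  have h2 : ∑ i, ∑ j, conj (eta T j) * ∑ r, eta T r * conj (U i r i j) = trAdAdj T := by
    have e1 : ∑ i, ∑ j, conj (eta T j) * ∑ r, eta T r * conj (U i r i j)
        = ∑ j, conj (eta T j) * ∑ r, eta T r * conj (∑ i, U i r i j) := by
      simp only [Finset.mul_sum, map_sum]
      rw [sum_swap₃₀, sum_swap₃₁]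
    have e2 (j : ι) : ∑ r, eta T r * conj (∑ i, U i r i j)
        = (1 / 2 : ℂ) * (∑ r, eta T r * gramLower T j r)
          - ∑ r, eta T r * conj (∑ s, U j s r s) := by
      have (r : ι) : eta T r * conj (∑ i, U i r i j) = (1 / 2 : ℂ) * (eta T r * ad T r j)
          + (1 / 2 : ℂ) * (eta T r * gramLower T j r) - eta T r * conj (∑ s, U j s r s) := by
        rw [h.trace_right_half]
        simp only [map_add, map_sub, map_div₀, map_ofNat, ← h.ad_conj,
          h.gramUpper_eq_gramLower, conj_gramLower]
        ring
      simp only [this, Finset.sum_add_distrib, Finset.sum_sub_distrib, ← Finset.mul_sum,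
        h.eta_ad_half]
      ring
    simp only [e1, e2, mul_sub, mul_left_comm _ (1 / 2 : ℂ), Finset.sum_sub_distrib,
      ← Finset.mul_sum, eta_gramLower' h.skew, h.eta_trace_left_half hcrit]
    ring
  simp only [dConjAd, mul_add, Finset.sum_add_distrib, h1, h2]
  ring

variable (hA : ∀ i l j, dAd T D U i l j = dConjAd T D U i j l)
include hA

/-- The contraction of `ad T` with the trace of `U`. -/
lemma ad_trace_left_half : ∑ r, ∑ i, ad T r i * ∑ s, U i s r s = -trAdAdj T := by
  have h0 : ∑ i, ∑ j, conj (eta T j) * dAd T D U i i j = trAdAdj T := by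
    simp only [hA, h.contract_dConjAd_half hcrit]
  have h1 (i : ι) : ∑ j, conj (eta T j) * ∑ r, conj (∑ s, U i s r s) * T r j i
      = -∑ r, conj (∑ s, U i s r s) * conj (ad T r i) := by
    rw [sum_mul_sum_mul', ← Finset.sum_neg_distrib]
    exact Finset.sum_congr rfl fun r _ ↦ by
      rw [sum_conj_eta_mul h.skew, ← h.ad_conj i r]; ring
  have h2 (k : ι) : ∑ i, conj (eta T i) * ∑ r, conj (eta T r) * D k r i k = 0 := by
    rw [sum_mul_sum_mul']
    simp only [conj_eta_deriv_mid h.skew h.deriv_half, mul_left_comm _ (-(1 / 2) : ℂ)]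
    rw [← Finset.mul_sum, sum_mul_sum_mul]
    simp only [mul_comm (conj (eta T _)), ad_conj_eta h.skew]
    simp
  simp only [dAd, mul_add, Finset.sum_add_distrib, h1, h2, Finset.sum_neg_distrib] at h0
  have h3 := congrArg conj h0
  simp only [map_neg, map_sum, map_mul, Complex.conj_conj, conj_trAdAdj,
    Finset.sum_const_zero, add_zero] at h3
  rw [Finset.sum_comm, ← h3, neg_neg]
  exact sum_congr₂ fun i r ↦ mul_comm _ _

/-- Take the divergence of the identity `Φ = Ψᵗ`. On the left the differentiation index and the
upper index are exchanged; the error is the skew part of `U`, and its contraction with `T` vanishes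
by `conj_etaT_contract` and `trLower_eq_zero`. This produces the derivative of `|T|²` along `x`. -/
lemma contract_dNormSq_half
    (hG : ∀ i l j, dGramUpper T D U i l j = dGramLower T D U i j l) :
    ∑ j, conj (eta T j) * dNormSq T D U j = -trAdAdj T := by
  have h0 : ∑ i, ∑ j, conj (eta T j) * dGramUpper T D U i i j
      = ∑ i, ∑ j, conj (eta T j) * dGramLower T D U i j i := by simp only [hG]
  have h1 : ∑ i, ∑ j, conj (eta T j) * ∑ p, ∑ q, D i p q i * conj (T p q j)
      = -trAdAdj T / 2 := by
    have e1 (i : ι) : ∑ j, conj (eta T j) * ∑ p, ∑ q, D i p q i * conj (T p q j)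
        = ∑ p, ∑ q, D i p q i * conj (etaT T p q) := by
      rw [sum_mul_sum_sum']
      simp only [sum_conj_eta_mul_conj_eq, etaT]
    have e2 (p q : ι) : ∑ i, D i p q i = -(1 / 2) * etaT T p q := by
      simp only [h.deriv_half, ← Finset.mul_sum, comp]
      rw [Finset.sum_comm]
      have e (m : ι) : ∑ i, T m i i = -eta T m := by
        rw [eta, ← Finset.sum_neg_distrib]
        exact Finset.sum_congr rfl fun i _ ↦ h.skew _ _ _
      simp only [← Finset.mul_sum, e, mul_neg, Finset.sum_neg_distrib, etaT]
      simp only [mul_comm (T p q _)]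
      ring
    simp only [e1]
    rw [sum_swap₃₀, sum_swap₃₁]
    simp only [← Finset.sum_mul, e2, mul_assoc, ← Finset.mul_sum, h.normSq_etaT]
    ring
  have h2 : ∑ i, ∑ j, conj (eta T j) * ∑ p, ∑ q, T p q i * conj (U i p q j)
      = ∑ j, conj (eta T j) * ∑ p, ∑ q, ∑ i, T p q i * conj (U j p q i) := by
    have e1 (p q i : ι) : ∑ j, eta T j * (U i p q j - U j p q i) = -(1 / 4) *
        ((∑ m, etaT T p m * conj (T i m q)) - (∑ m, T p m i * conj (ad T q m))
          - (∑ m, etaT T q m * conj (T i m p)) + ∑ m, T q m i * conj (ad T p m)) := by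
      have e2 (p q i : ι) : ∑ j, eta T j * ∑ m, T p m j * conj (T i m q)
          = ∑ m, etaT T p m * conj (T i m q) := by
        rw [sum_mul_sum_mul]; rfl
      have e3 (p q i : ι) : ∑ j, eta T j * ∑ m, T p m i * conj (T j m q)
          = ∑ m, T p m i * conj (ad T q m) := by
        rw [sum_mul_sum_mul']; simp only [sum_eta_mul_conj']
      simp only [h.skew_half p q _ _, mul_left_comm _ (-(1 / 4) : ℂ), ← Finset.mul_sum]
      simp only [mul_add, mul_sub, Finset.sum_add_distrib, Finset.sum_sub_distrib, e2, e3]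
    have e2 : ∑ p, ∑ q, ∑ i, T p q i * conj (∑ j, eta T j * (U i p q j - U j p q i)) = 0 := by
      simp only [e1]
      simp only [map_mul, map_add, map_sub, map_sum, Complex.conj_conj, map_neg, map_div₀,
        map_one, map_ofNat, mul_left_comm _ (-(1 / 4) : ℂ), mul_add, mul_sub,
        Finset.sum_add_distrib, Finset.sum_sub_distrib]
      simp only [← Finset.mul_sum, h.conj_etaT_contract, h.conj_etaT_contract',
        sum_mul_conj_lower, sum_mul_conj_lower' h.skew, h.trLower_eq_zero]
      ring
    rw [← sub_eq_zero, ← e2]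
    have e3 : ∑ j, conj (eta T j) * ∑ p, ∑ q, ∑ i, T p q i * conj (U j p q i)
        = ∑ i, ∑ j, conj (eta T j) * ∑ p, ∑ q, T p q i * conj (U j p q i) := by
      simp only [Finset.mul_sum]
      rw [Finset.sum_comm (s := (Finset.univ : Finset ι)) (t := (Finset.univ : Finset ι))
        (f := fun i j ↦ ∑ p, ∑ q, conj (eta T j) * (T p q i * conj (U j p q i)))]
      refine Finset.sum_congr rfl fun j _ ↦ ?_
      conv_rhs => rw [sum_swap₃₀, sum_swap₃₁]
    rw [e3, ← Finset.sum_sub_distrib]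
    have e4 (i : ι) : ∑ j, conj (eta T j) * ∑ p, ∑ q, T p q i * conj (U i p q j)
        - ∑ j, conj (eta T j) * ∑ p, ∑ q, T p q i * conj (U j p q i)
        = ∑ p, ∑ q, T p q i * conj (∑ j, eta T j * (U i p q j - U j p q i)) := by
      simp only [sum_mul_sum_sum', sum_conj_eta_mul_conj_eq, ← Finset.sum_sub_distrib, ← mul_sub,
        ← map_sub]
    simp only [e4]
    rw [sum_swap₃₀, sum_swap₃₁]
  have h3 : ∑ k, ∑ i, conj (eta T i) * ∑ p, ∑ m, T p i m * conj (U k p k m)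
      = -(3 / 2) * trAdAdj T := by
    have e1 (k : ι) : ∑ i, conj (eta T i) * ∑ p, ∑ m, T p i m * conj (U k p k m)
        = ∑ p, ∑ m, -ad T m p * conj (U k p k m) := by
      rw [sum_mul_sum_sum]
      simp only [sum_conj_eta_mul h.skew]
    have e2 (m p : ι) : -ad T m p * conj (∑ k, U k p k m)
        = -(1 / 2) * (conj (ad T m p) * ad T m p) - (1 / 2) * (gramUpper T p m * ad T m p)
          + conj (ad T p m * ∑ s, U m s p s) := by
      rw [h.trace_right_half]
      simp only [map_add, map_sub, map_div₀, map_ofNat, map_mul, conj_gramUpper, ← h.ad_conj]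
      ring
    simp only [e1]
    rw [sum_swap₃₀, sum_swap₃₁]
    simp only [← Finset.mul_sum, ← map_sum]
    rw [Finset.sum_comm]
    simp only [e2, Finset.sum_add_distrib, Finset.sum_sub_distrib, ← Finset.mul_sum,
      sum_gramUpper_mul_ad, sum_conj_ad_mul_ad, h.trUpper_eq_zero, ← map_sum]
    rw [Finset.sum_comm (f := fun m p ↦ ad T p m * _), h.ad_trace_left_half hcrit hA, map_neg,
      conj_trAdAdj]
    ring
  have h4 : ∑ l, conj (eta T l) * ∑ i, ∑ j, ∑ k, D l i j k * conj (T i j k) = 0 := by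
    rw [contract_deriv_normSq h.skew h.deriv_half, h.trUpper_eq_zero, mul_zero]
  simp only [dGramUpper, dGramLower, mul_add, Finset.sum_add_distrib, h1, h2, h3,
    contract_deriv_gramLower h.skew h.deriv_half, h.trLower_eq_zero] at h0
  simp only [dNormSq, mul_add, Finset.sum_add_distrib, h4]
  linear_combination h0

variable {dN : ι → ι → ι → ℂ}

/-- The contraction of the derivative of the trace of `U`. -/
lemma contract_deriv_trace_left_half
    (hG : ∀ i l j, dGramUpper T D U i l j = dGramLower T D U i j l)
    (hE : ∀ i j k, (dN i j k - 1 / 2 * dConjAd T D U i j k) - (dN j i k - 1 / 2 * dConjAd T D U j i k)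
      - 1 / 2 * ∑ l, T j l k * ((∑ s, U l s i s) - 1 / 2 * conj (ad T i l))
      + 1 / 2 * ∑ l, T i l k * ((∑ s, U l s j s) - 1 / 2 * conj (ad T j l)) = 0)
    (htr : ∀ i, ∑ k, (dN i k k - 1 / 2 * dConjAd T D U i k k)
      = 1 / 4 * (dNormSq T D U i + dNormSqEta T D U i)) :
    ∑ i, ∑ j, conj (eta T j) * dN i j i = -trAdAdj T / 4 := by
  have h0 : ∑ i, ∑ j, conj (eta T j) * ((dN i j i - 1 / 2 * dConjAd T D U i j i)
      - (dN j i i - 1 / 2 * dConjAd T D U j i i)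
      - 1 / 2 * ∑ l, T j l i * ((∑ s, U l s i s) - 1 / 2 * conj (ad T i l))
      + 1 / 2 * ∑ l, T i l i * ((∑ s, U l s j s) - 1 / 2 * conj (ad T j l))) = 0 := by
    simp only [hE, mul_zero, Finset.sum_const_zero]
  simp only [mul_add, mul_sub (conj (eta T _)), Finset.sum_add_distrib,
    Finset.sum_sub_distrib, mul_left_comm (conj (eta T _)) (1 / 2 : ℂ), ← Finset.mul_sum] at h0
  have h1 := h.contract_dConjAd_half hcrit
  have h2 : ∑ i, ∑ j, conj (eta T j) * dN j i i
      - 1 / 2 * ∑ i, ∑ j, conj (eta T j) * dConjAd T D U j i i = -trAdAdj T / 4 := by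
    have : ∑ j, conj (eta T j) * ∑ k, (dN j k k - 1 / 2 * dConjAd T D U j k k)
        = -trAdAdj T / 4 := by
      simp only [htr, hcrit, add_zero, mul_left_comm _ (1 / 4 : ℂ), ← Finset.mul_sum,
        h.contract_dNormSq_half hcrit hA hG]
      ring
    rw [← this, sum_sum_mul_left]
    simp only [mul_sub, Finset.sum_sub_distrib, mul_left_comm _ (1 / 2 : ℂ), ← Finset.mul_sum]
  have h3 : ∑ i, ∑ j, conj (eta T j) * ∑ l, T j l i * ((∑ s, U l s i s) - 1 / 2 * conj (ad T i l))
      = -(3 / 2) * trAdAdj T := by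
    have e (i : ι) : ∑ j, conj (eta T j) * ∑ l, T j l i *
        ((∑ s, U l s i s) - 1 / 2 * conj (ad T i l)) = ∑ l, ad T i l * (∑ s, U l s i s)
          - 1 / 2 * ∑ l, ad T i l * conj (ad T i l) := by
      rw [sum_mul_sum_mul, Finset.mul_sum, ← Finset.sum_sub_distrib]
      refine Finset.sum_congr rfl fun l _ ↦ ?_
      change ad T i l * _ = _
      ring
    simp only [e, Finset.sum_sub_distrib, ← Finset.mul_sum, h.ad_trace_left_half hcrit hA]
    change _ - 1 / 2 * trAdAdj T = _
    ring
  have h4 : ∑ i, ∑ j, conj (eta T j) * ∑ l, T i l i * ((∑ s, U l s j s) - 1 / 2 * conj (ad T j l))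
      = -trAdAdj T / 2 := by
    have e1 : ∑ i, ∑ j, conj (eta T j) * ∑ l, T i l i *
        ((∑ s, U l s j s) - 1 / 2 * conj (ad T j l))
        = ∑ j, conj (eta T j) * ∑ l, eta T l *
          ((∑ s, U l s j s) - 1 / 2 * conj (ad T j l)) := by
      have (j : ι) : ∑ l, eta T l * ((∑ s, U l s j s) - 1 / 2 * conj (ad T j l))
          = ∑ i, ∑ l, T i l i * ((∑ s, U l s j s) - 1 / 2 * conj (ad T j l)) := by
        simp only [eta, Finset.sum_mul]
        exact Finset.sum_comm
      simp only [this]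
      rw [sum_sum_mul_left]
    have e2 : ∑ j, conj (eta T j) * ∑ l, eta T l * conj (ad T j l) = 0 := by
      rw [sum_mul_sum_mul']
      simp [h.conj_eta_conj_ad_half]
    have e3 : ∑ j, conj (eta T j) * ∑ l, eta T l * ∑ s, U l s j s = -trAdAdj T / 2 := by
      have := congrArg conj (h.eta_trace_left_half hcrit)
      rw [map_div₀, map_neg, conj_trAdAdj, map_ofNat] at this
      rw [← this]
      simp only [Finset.mul_sum, map_sum, map_mul, Complex.conj_conj]
      rw [Finset.sum_comm]
      exact sum_congr₃ fun _ _ _ ↦ by ring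
    rw [e1]
    simp only [mul_sub, Finset.sum_sub_distrib, mul_left_comm _ (1 / 2 : ℂ), ← Finset.mul_sum,
      e2, e3]
    ring
  linear_combination h0 + h1 / 2 + h2 + h3 / 2 - h4 / 2

/-- This is the part of the Laplacian of `|η|²` in which the Killing form is differentiated. The
first product reduces to `trace_right_half`. In the second, skewness of `T` in `l, k` selects the
known skew part of `U`, whose contraction vanishes. -/
lemma contract_deriv_killing_half :
    ∑ l, ∑ i, conj (eta T i) * ∑ k, ∑ m, (U l k l m * T m i k + T k l m * U l m i k)
      = -(3 / 2) * trAdAdj T := by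
  have h1 : ∑ l, ∑ i, conj (eta T i) * ∑ k, ∑ m, U l k l m * T m i k = -(3 / 2) * trAdAdj T := by
    have e1 (l : ι) : ∑ i, conj (eta T i) * ∑ k, ∑ m, U l k l m * T m i k
        = ∑ k, ∑ m, U l k l m * -ad T k m := by
      rw [sum_mul_sum_sum']
      simp only [sum_conj_eta_mul h.skew]
    have e2 (k m : ι) : (∑ l, U l k l m) * -ad T k m = -(1 / 2) * (ad T m k * ad T k m)
        - (1 / 2) * (gramUpper T m k * ad T k m) + ad T k m * ∑ s, U m s k s := by
      rw [h.trace_right_half]; ring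
    simp only [e1]
    rw [sum_swap₃₀, sum_swap₃₁]
    simp only [← Finset.sum_mul, e2, Finset.sum_add_distrib, Finset.sum_sub_distrib,
      ← Finset.mul_sum, h.ad_trace_left_half hcrit hA, sum_gramUpper_mul_ad, sum_ad_mul_ad,
      h.trUpper_eq_zero, h.trAdAd_eq]
    ring
  have h2 : ∑ l, ∑ i, conj (eta T i) * ∑ k, ∑ m, T k l m * U l m i k = 0 := by
    have e1 : ∑ l, ∑ i, conj (eta T i) * ∑ k, ∑ m, T k l m * U l m i k
        = -∑ l, ∑ k, ∑ m, T l k m * ∑ i, conj (eta T i) * U l m i k := by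
      simp only [sum_mul_sum_sum', ← Finset.sum_neg_distrib]
      exact sum_congr₃ fun l k m ↦ by rw [h.skew l k m]; ring
    have e2 : ∑ l, ∑ k, ∑ m, T l k m * ∑ i, conj (eta T i) * (U l m i k - U k m i l)
        = 2 * ∑ l, ∑ k, ∑ m, T l k m * ∑ i, conj (eta T i) * U l m i k := by
      have : ∑ l, ∑ k, ∑ m, T l k m * ∑ i, conj (eta T i) * U k m i l
          = -∑ l, ∑ k, ∑ m, T l k m * ∑ i, conj (eta T i) * U l m i k := by
        rw [Finset.sum_comm]
        simp only [← Finset.sum_neg_distrib]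
        exact sum_congr₃ fun l k m ↦ by rw [h.skew k l m]; ring
      simp only [mul_sub, Finset.sum_sub_distrib, this]
      ring
    have e3 (l k m : ι) : ∑ i, conj (eta T i) * (U l m i k - U k m i l) = -(1 / 4) *
        ((∑ r, conj (etaT T l r) * T m r k) - (∑ r, conj (etaT T k r) * T m r l)
          - (∑ r, conj (T l r m) * ad T k r) + ∑ r, conj (T k r m) * ad T l r) := by
      have f1 (l k m : ι) : ∑ i, conj (eta T i) * ∑ r, T m r k * conj (T l r i)
          = ∑ r, conj (etaT T l r) * T m r k := by
        rw [sum_mul_sum_mul']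
        simp only [sum_conj_eta_mul_conj_eq, mul_comm (T m _ k)]
        rfl
      have f2 (l k m : ι) : ∑ i, conj (eta T i) * ∑ r, T i r k * conj (T l r m)
          = ∑ r, conj (T l r m) * ad T k r := by
        rw [sum_mul_sum_mul]
        exact Finset.sum_congr rfl fun r _ ↦ mul_comm _ _
      simp only [h.skew_half m _ _ _, mul_left_comm _ (-(1 / 4) : ℂ), ← Finset.mul_sum]
      simp only [mul_add, mul_sub, Finset.sum_add_distrib, Finset.sum_sub_distrib, f1, f2]
    have e4 : ∑ l, ∑ k, ∑ m, T l k m * ∑ i, conj (eta T i) * (U l m i k - U k m i l) = 0 := by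
      simp only [e3]
      simp only [mul_left_comm _ (-(1 / 4) : ℂ), mul_add, mul_sub,
        Finset.sum_add_distrib, Finset.sum_sub_distrib]
      simp only [← Finset.mul_sum, h.conj_etaT_contract, h.conj_etaT_contract',
        sum_mul_conj_lower, sum_mul_conj_lower' h.skew, h.trLower_eq_zero]
      ring
    linear_combination e1 + e2 / 2 - e4 / 2
  simp only [mul_add, Finset.sum_add_distrib, h1, h2, add_zero]

/-- At a maximum of `normSqEta` the trace of the torsion vanishes. -/
theorem normSqEta_eq_zero_half
    (hG : ∀ i l j, dGramUpper T D U i l j = dGramLower T D U i j l)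
    (hE : ∀ i j k, (dN i j k - 1 / 2 * dConjAd T D U i j k) - (dN j i k - 1 / 2 * dConjAd T D U j i k)
      - 1 / 2 * ∑ l, T j l k * ((∑ s, U l s i s) - 1 / 2 * conj (ad T i l))
      + 1 / 2 * ∑ l, T i l k * ((∑ s, U l s j s) - 1 / 2 * conj (ad T j l)) = 0)
    (htr : ∀ i, ∑ k, (dN i k k - 1 / 2 * dConjAd T D U i k k)
      = 1 / 4 * (dNormSq T D U i + dNormSqEta T D U i))
    (hmax : (∑ l, ∑ i,
      (1 / 2 * ((∑ k, ∑ m, (U l k l m * T m i k + T k l m * U l m i k)) * conj (eta T i)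
        + killing T i l * conj (1 / 2 * killing T i l))
      + ((∑ s, U l s i s) * conj (∑ s, U l s i s) + eta T i * conj (dN l i l)))).re ≤ 0) :
    normSqEta T = 0 := by
  have h1 := h.contract_deriv_killing_half hcrit hA
  have h2 := congrArg conj (h.contract_deriv_trace_left_half hcrit hA hG hE htr)
  simp only [map_sum, map_mul, Complex.conj_conj, map_div₀, map_neg, conj_trAdAdj,
    map_ofNat] at h2
  have h3 : ∑ l, ∑ i, ((∑ s, U l s i s) + conj (ad T i l)) * conj ((∑ s, U l s i s)
      + conj (ad T i l)) = ∑ l, ∑ i, (∑ s, U l s i s) * conj (∑ s, U l s i s) - trAdAdj T := by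
    have e1 := h.ad_trace_left_half hcrit hA
    rw [Finset.sum_comm] at e1
    have e2 := congrArg conj e1
    rw [map_neg, conj_trAdAdj] at e2
    have e3 : ∑ l, ∑ i, ad T i l * conj (ad T i l) = trAdAdj T := by
      rw [Finset.sum_comm]; rfl
    have e4 : ∑ l, ∑ i, ((∑ s, U l s i s) + conj (ad T i l)) * conj ((∑ s, U l s i s)
      + conj (ad T i l)) = ∑ l, ∑ i, (∑ s, U l s i s) * conj (∑ s, U l s i s)
        + ∑ l, ∑ i, ad T i l * ∑ s, U l s i s + conj (∑ l, ∑ i, ad T i l * ∑ s, U l s i s)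
        + ∑ l, ∑ i, ad T i l * conj (ad T i l) := by
      rw [map_sum]
      simp only [map_sum conj (fun i ↦ ad T i _ * ∑ s, U _ s i s) Finset.univ,
        ← Finset.sum_add_distrib]
      exact sum_congr₂ fun l i ↦ by
        simp only [map_add, map_mul, Complex.conj_conj]; ring
    rw [e4, e2, e1, e3]
    ring
  -- Completing the square in `∇^{0,1} η` costs `tr (A A*)`. The Killing term contributes `-3/4` of
  -- it and the derivative of `∇^{0,1} η` another `-1/4`, so the Laplacian is exactly a sum of
  -- squares.
  have h4 : ∑ l, ∑ i,
      (1 / 2 * ((∑ k, ∑ m, (U l k l m * T m i k + T k l m * U l m i k)) * conj (eta T i)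
        + killing T i l * conj (1 / 2 * killing T i l))
      + ((∑ s, U l s i s) * conj (∑ s, U l s i s) + eta T i * conj (dN l i l)))
      = ((1 / 4 * ∑ l, ∑ i, Complex.normSq (killing T i l) + ∑ l, ∑ i, Complex.normSq
        ((∑ s, U l s i s) + conj (ad T i l)) : ℝ) : ℂ) := by
    have e1 : ((1 / 4 * ∑ l, ∑ i, Complex.normSq (killing T i l) + ∑ l, ∑ i, Complex.normSq
        ((∑ s, U l s i s) + conj (ad T i l)) : ℝ) : ℂ)
        = 1 / 4 * ∑ l, ∑ i, killing T i l * conj (killing T i l)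
          + ∑ l, ∑ i, ((∑ s, U l s i s) + conj (ad T i l)) * conj ((∑ s, U l s i s)
            + conj (ad T i l)) := by
      push_cast [Complex.mul_conj]
      ring
    rw [e1, h3]
    have e2 : ∑ l, ∑ i,
      (1 / 2 * ((∑ k, ∑ m, (U l k l m * T m i k + T k l m * U l m i k)) * conj (eta T i)
        + killing T i l * conj (1 / 2 * killing T i l))
      + ((∑ s, U l s i s) * conj (∑ s, U l s i s) + eta T i * conj (dN l i l)))
      = 1 / 2 * ∑ l, ∑ i, conj (eta T i) *
          ∑ k, ∑ m, (U l k l m * T m i k + T k l m * U l m i k)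
        + 1 / 4 * ∑ l, ∑ i, killing T i l * conj (killing T i l)
        + ∑ l, ∑ i, (∑ s, U l s i s) * conj (∑ s, U l s i s)
        + ∑ l, ∑ i, eta T i * conj (dN l i l) := by
      rw [Finset.mul_sum (a := (1 / 2 : ℂ)), Finset.mul_sum (a := (1 / 4 : ℂ)),
        ← Finset.sum_add_distrib, ← Finset.sum_add_distrib, ← Finset.sum_add_distrib]
      refine Finset.sum_congr rfl fun l _ ↦ ?_
      rw [Finset.mul_sum (a := (1 / 2 : ℂ)), Finset.mul_sum (a := (1 / 4 : ℂ)),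
        ← Finset.sum_add_distrib, ← Finset.sum_add_distrib, ← Finset.sum_add_distrib]
      refine Finset.sum_congr rfl fun i _ ↦ ?_
      rw [map_mul, map_div₀, map_one, map_ofNat]
      ring
    rw [e2, h1, h2]
    ring
  rw [h4, Complex.ofReal_re] at hmax
  have n1 : 0 ≤ ∑ l, ∑ i, Complex.normSq (killing T i l) :=
    Finset.sum_nonneg fun _ _ ↦ Finset.sum_nonneg fun _ _ ↦ Complex.normSq_nonneg _
  have n2 : 0 ≤ ∑ l, ∑ i, Complex.normSq ((∑ s, U l s i s) + conj (ad T i l)) :=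
    Finset.sum_nonneg fun _ _ ↦ Finset.sum_nonneg fun _ _ ↦ Complex.normSq_nonneg _
  have n3 : ∑ l, ∑ i, Complex.normSq (killing T i l) = 0 := by linarith
  have hK (i l : ι) : killing T i l = 0 := by
    rw [Finset.sum_eq_zero_iff_of_nonneg fun _ _ ↦ Finset.sum_nonneg fun _ _ ↦
      Complex.normSq_nonneg _] at n3
    exact Complex.normSq_eq_zero.1 ((Finset.sum_eq_zero_iff_of_nonneg fun _ _ ↦
      Complex.normSq_nonneg _).1 (n3 l (Finset.mem_univ _)) i (Finset.mem_univ _))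
  -- The vanishing Killing form, evaluated on `x`, gives `tr (A²) = 0`, which is `tr (A A*)` because
  -- `A` is self-adjoint.
  have h5 := killing_conj_eta h.skew
  simp only [hK, zero_mul, Finset.sum_const_zero, mul_zero, h.trAdAd_eq] at h5
  exact TorsionArray.normSqEta_eq_zero h.skew h5.symm

end Critical

end FirstOrder

end Half

end TorsionArray

end

/-! ### Unitary frames and the frame independence of `|T|²` and `|η|²`. -/

noncomputable section

open scoped ComplexConjugate

/-! ### Hermitian vector spaces -/

section Pointwise

variable {E : Type*} [NormedAddCommGroup E] [NormedSpace ℝ E] {ι : Type*} [Fintype ι]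

/-- A Hermitian inner product `g` with respect to a complex structure `J`. -/
structure IsHermitianForm (g : E →L[ℝ] E →L[ℝ] ℝ) (J : E →L[ℝ] E) : Prop where
  symm : ∀ v w, g v w = g w v
  pos : ∀ v, v ≠ 0 → 0 < g v v
  J_J : ∀ v, J (J v) = -v
  inner_J_J : ∀ v w, g (J v) (J w) = g v w

namespace IsHermitianForm

variable {g : E →L[ℝ] E →L[ℝ] ℝ} {J : E →L[ℝ] E} (h : IsHermitianForm g J)
include h

lemma inner_J_left (v w : E) : g (J v) w = -g v (J w) := by
  rw [← h.inner_J_J v (J w), h.J_J]; simp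

lemma inner_self_J (v : E) : g v (J v) = 0 := by
  have h1 := h.inner_J_left v v
  rw [h.symm] at h1
  linarith

lemma ext {v w : E} (hvw : ∀ z, g v z = g w z) : v = w := by
  by_contra hne
  have h1 := h.pos (v - w) (sub_ne_zero.2 hne)
  have h2 := hvw (v - w)
  simp only [map_sub, sub_apply] at h1 h2
  linarith

end IsHermitianForm

/-- An orthonormal basis of the complex vector space `(E, J)`. -/
structure IsUnitaryFrame [DecidableEq ι] (g : E →L[ℝ] E →L[ℝ] ℝ) (J : E →L[ℝ] E) (e : ι → E) :
    Prop where
  inner : ∀ i j, g (e i) (e j) = if i = j then 1 else 0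
  inner_J : ∀ i j, g (e i) (J (e j)) = 0
  expand : ∀ v, v = ∑ i, (g v (e i) • e i + g v (J (e i)) • J (e i))

/-- The complex coordinate of a vector with respect to a unitary frame. -/
def unitaryCoord (g : E →L[ℝ] E →L[ℝ] ℝ) (J : E →L[ℝ] E) (e : ι → E) (i : ι) : E →L[ℝ] ℂ :=
  Complex.ofRealCLM ∘L g.flip (e i) + Complex.I • Complex.ofRealCLM ∘L g.flip (J (e i))

omit [Fintype ι] in
lemma unitaryCoord_apply (g : E →L[ℝ] E →L[ℝ] ℝ) (J : E →L[ℝ] E) (e : ι → E) (i : ι) (v : E) :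
    unitaryCoord g J e i v = g v (e i) + Complex.I * g v (J (e i)) := by
  simp [unitaryCoord]

/-- The components of a bilinear map with respect to a unitary frame. -/
def unitaryArray (g : E →L[ℝ] E →L[ℝ] ℝ) (J : E →L[ℝ] E) (T : E →L[ℝ] E →L[ℝ] E) (e : ι → E)
    (i j k : ι) : ℂ := unitaryCoord g J e k (T (e i) (e j))

namespace IsUnitaryFrame

variable [DecidableEq ι] {g : E →L[ℝ] E →L[ℝ] ℝ} {J : E →L[ℝ] E} {e : ι → E}
  (h : IsHermitianForm g J) (he : IsUnitaryFrame g J e)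
include h

omit [Fintype ι] [DecidableEq ι] in
lemma coord_J (i : ι) (v : E) :
    unitaryCoord g J e i (J v) = Complex.I * unitaryCoord g J e i v := by
  simp only [unitaryCoord_apply, h.inner_J_left, h.J_J, map_neg, neg_neg]
  push_cast
  linear_combination -(g v (J (e i)) : ℂ) * Complex.I_sq

include he

omit h in
lemma coord_self (i j : ι) : unitaryCoord g J e i (e j) = if j = i then 1 else 0 := by
  rw [unitaryCoord_apply, he.inner, he.inner_J]
  split_ifs <;> simp

lemma coord_smul_self (i j : ι) (z : ℂ) :
    unitaryCoord g J e i (z.re • e j + z.im • J (e j)) = if j = i then z else 0 := by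
  rw [map_add, map_smul, map_smul, coord_J h, coord_self he]
  split_ifs
  · rw [mul_one, Complex.real_smul, Complex.real_smul, mul_one, Complex.re_add_im]
  · simp

omit h in
lemma expand_coord (v : E) : v = ∑ i, ((unitaryCoord g J e i v).re • e i
    + (unitaryCoord g J e i v).im • J (e i)) := by
  conv_lhs => rw [he.expand v]
  simp [unitaryCoord_apply]

omit h in
lemma ext {v w : E} (hvw : ∀ i, unitaryCoord g J e i v = unitaryCoord g J e i w) : v = w := by
  rw [he.expand_coord v, he.expand_coord w]
  simp only [hvw]

/-- The vector with given complex coordinates. -/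
lemma exists_coord_eq (x : ι → ℂ) : ∃ v, ∀ i, unitaryCoord g J e i v = x i := by
  refine ⟨∑ j, ((x j).re • e j + (x j).im • J (e j)), fun i ↦ ?_⟩
  rw [map_sum]
  simp only [coord_smul_self h he, Finset.sum_ite_eq', Finset.mem_univ, if_true]

omit h in
/-- A complex linear map in coordinates. -/
lemma coord_linear {A : E →L[ℝ] ℂ} (hA : ∀ v, A (J v) = Complex.I * A v) (v : E) :
    A v = ∑ i, A (e i) * unitaryCoord g J e i v := by
  conv_lhs => rw [he.expand_coord v]
  rw [map_sum]
  refine Finset.sum_congr rfl fun i _ ↦ ?_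
  rw [map_add, map_smul, map_smul, hA]
  simp only [Complex.real_smul]
  linear_combination A (e i) * Complex.re_add_im (unitaryCoord g J e i v)

lemma inner_eq (v w : E) :
    g v w = (∑ i, unitaryCoord g J e i v * conj (unitaryCoord g J e i w)).re := by
  conv_lhs => rw [he.expand v]
  simp only [map_sum, map_add, map_smul, sum_apply, add_apply,
    smul_apply, smul_eq_mul, Complex.re_sum]
  refine Finset.sum_congr rfl fun i _ ↦ ?_
  rw [h.symm (e i) w, h.symm (J (e i)) w]
  simp [unitaryCoord_apply]

/-- The left side is the Hermitian form extending `g`, antilinear in `v` and linear in `w`. -/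
lemma inner_add_inner_J (v w : E) : ((g v w : ℝ) : ℂ) + Complex.I * (g (J v) w : ℝ)
    = ∑ i, conj (unitaryCoord g J e i v) * unitaryCoord g J e i w := by
  rw [inner_eq h he, inner_eq h he (J v)]
  have h1 : ∑ i, unitaryCoord g J e i (J v) * conj (unitaryCoord g J e i w)
      = Complex.I * ∑ i, unitaryCoord g J e i v * conj (unitaryCoord g J e i w) := by
    simp only [coord_J h, Finset.mul_sum, mul_assoc]
  have h2 : ∑ i, conj (unitaryCoord g J e i v) * unitaryCoord g J e i w
      = conj (∑ i, unitaryCoord g J e i v * conj (unitaryCoord g J e i w)) := by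
    simp
  rw [h1, h2]
  generalize ∑ i, unitaryCoord g J e i v * conj (unitaryCoord g J e i w) = z
  apply Complex.ext <;> simp

lemma coord_eq_sum {κ : Type*} (e' : κ → E) (a : κ) (v : E) : unitaryCoord g J e' a v
    = ∑ i, unitaryCoord g J e i v * conj (unitaryCoord g J e i (e' a)) := by
  have h1 := congrArg conj (inner_add_inner_J h he v (e' a))
  rw [h.inner_J_left] at h1
  rw [unitaryCoord_apply]
  simpa using h1

lemma sum_normSq_coord (v : E) : ∑ i, Complex.normSq (unitaryCoord g J e i v) = g v v := by
  rw [inner_eq h he, Complex.re_sum]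
  simp [Complex.mul_conj]

/-- The norm of a complex linear functional does not depend on the unitary frame. -/
lemma sum_normSq_linear {κ : Type*} [Fintype κ] [DecidableEq κ] {e' : κ → E}
    (he' : IsUnitaryFrame g J e') {A : E →L[ℝ] ℂ} (hA : ∀ v, A (J v) = Complex.I * A v) :
    ∑ i, Complex.normSq (A (e i)) = ∑ i, Complex.normSq (A (e' i)) := by
  obtain ⟨x, hx⟩ := exists_coord_eq h he fun i ↦ conj (A (e i))
  have h1 (v : E) : A v = ∑ i, unitaryCoord g J e i v * conj (unitaryCoord g J e i x) := by
    rw [coord_linear he hA]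
    exact Finset.sum_congr rfl fun i _ ↦ by rw [hx, Complex.conj_conj, mul_comm]
  have h2 (a : κ) : A (e' a) = conj (unitaryCoord g J e' a x) := by
    rw [h1, coord_eq_sum h he e' a x]
    simp [mul_comm]
  simp only [h2, Complex.normSq_conj]
  rw [sum_normSq_coord h he', ← sum_normSq_coord h he]
  simp [hx]

variable {T : E →L[ℝ] E →L[ℝ] E} (hT : ∀ v w, T v w = -T w v) (hTJ : ∀ v w, T (J v) w = J (T v w))

omit [Fintype ι] [DecidableEq ι] h he in
include hT in
lemma array_skew (i j k : ι) : unitaryArray g J T e i j k = -unitaryArray g J T e j i k := by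
  simp only [unitaryArray, hT (e i) (e j), map_neg]

include hT hTJ in
omit h he in
lemma T_J_right (v w : E) : T v (J w) = J (T v w) := by
  rw [hT, hTJ, hT w v, map_neg, neg_neg]

include hT hTJ

lemma coord_T (v w : E) (k : ι) : unitaryCoord g J e k (T v w) = ∑ i, ∑ j,
    unitaryArray g J T e i j k * unitaryCoord g J e i v * unitaryCoord g J e j w := by
  have h1 := coord_linear he (A := (unitaryCoord g J e k) ∘L (T.flip w))
    (fun v ↦ by simp [hTJ, coord_J h]) v
  have h2 (i : ι) := coord_linear he (A := (unitaryCoord g J e k) ∘L (T (e i)))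
    (fun v ↦ by simp [T_J_right hT hTJ, coord_J h]) w
  simp only [ContinuousLinearMap.comp_apply, ContinuousLinearMap.flip_apply] at h1 h2
  rw [h1]
  refine Finset.sum_congr rfl fun i _ ↦ ?_
  rw [h2, Finset.sum_mul]
  exact Finset.sum_congr rfl fun j _ ↦ by rw [unitaryArray]; ring

/-- The frame is changed in one index at a time: the upper index through the norm of a vector, each
lower index through the norm of a complex linear functional. -/
lemma normSq_eq {κ : Type*} [Fintype κ] [DecidableEq κ] {e' : κ → E}
    (he' : IsUnitaryFrame g J e') :
    TorsionArray.normSq (unitaryArray g J T e) = TorsionArray.normSq (unitaryArray g J T e') := by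
  have h1 (v w : E) : ∑ k, Complex.normSq (unitaryCoord g J e' k (T v w))
      = ∑ k, Complex.normSq (unitaryCoord g J e k (T v w)) := by
    rw [sum_normSq_coord h he, sum_normSq_coord h he']
  have h2 (w : E) (k : ι) : ∑ a, Complex.normSq (unitaryCoord g J e k (T (e' a) w))
      = ∑ i, Complex.normSq (unitaryCoord g J e k (T (e i) w)) :=
    (sum_normSq_linear h he he' (A := (unitaryCoord g J e k) ∘L (T.flip w))
      (fun v ↦ by simp [hTJ, coord_J h])).symm
  have h3 (v : E) (k : ι) : ∑ a, Complex.normSq (unitaryCoord g J e k (T v (e' a)))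
      = ∑ i, Complex.normSq (unitaryCoord g J e k (T v (e i))) :=
    (sum_normSq_linear h he he' (A := (unitaryCoord g J e k) ∘L (T v))
      (fun v ↦ by simp [T_J_right hT hTJ, coord_J h])).symm
  simp only [TorsionArray.normSq, unitaryArray, h1]
  conv_rhs => rw [Finset.sum_comm]
  have h4 (b : κ) : ∑ a, ∑ k, Complex.normSq (unitaryCoord g J e k (T (e' a) (e' b)))
      = ∑ i, ∑ k, Complex.normSq (unitaryCoord g J e k (T (e i) (e' b))) := by
    rw [Finset.sum_comm]
    simp only [h2]
    rw [Finset.sum_comm]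
  simp only [h4]
  conv_rhs => rw [Finset.sum_comm]
  refine Finset.sum_congr rfl fun i _ ↦ ?_
  conv_rhs => rw [Finset.sum_comm]
  simp only [h3]
  rw [Finset.sum_comm]

end IsUnitaryFrame

section Trace

variable [FiniteDimensional ℝ E]

variable (E) in
/-- The trace, as a continuous linear map. -/
def traceL : (E →L[ℝ] E) →L[ℝ] ℝ :=
  LinearMap.toContinuousLinearMap
    ((LinearMap.trace ℝ E) ∘ₗ (ContinuousLinearMap.coeLM ℝ (M := E) (N₃ := E)))

lemma traceL_apply (A : E →L[ℝ] E) : traceL E A = LinearMap.trace ℝ E A := rfl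

variable [DecidableEq ι] {g : E →L[ℝ] E →L[ℝ] ℝ} {J : E →L[ℝ] E} {e : ι → E}

lemma IsUnitaryFrame.traceL_eq (he : IsUnitaryFrame g J e) (A : E →L[ℝ] E) :
    traceL E A = ∑ i, (g (A (e i)) (e i) + g (A (J (e i))) (J (e i))) := by
  have h1 : (A : E →ₗ[ℝ] E) = ∑ i, (((g.flip (e i)).toLinearMap).smulRight (A (e i))
      + ((g.flip (J (e i))).toLinearMap).smulRight (A (J (e i)))) := by
    ext v
    conv_lhs => rw [he.expand v]
    simp
  rw [traceL_apply, h1]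
  simp

/-- The trace of `w ↦ T (w, v)` over `ℂ`. -/
def complexTrace (J : E →L[ℝ] E) (T : E →L[ℝ] E →L[ℝ] E) : E →L[ℝ] ℂ :=
  (1 / 2 : ℂ) • (Complex.ofRealCLM ∘L (traceL E) ∘L T.flip
    - Complex.I • (Complex.ofRealCLM ∘L (traceL E) ∘L T.flip ∘L J))

lemma complexTrace_apply (J : E →L[ℝ] E) (T : E →L[ℝ] E →L[ℝ] E) (v : E) :
    complexTrace J T v = (1 / 2 : ℂ) * ((traceL E (T.flip v) : ℝ)
      - Complex.I * (traceL E (T.flip (J v)) : ℝ)) := by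
  simp [complexTrace]

/-- This exhibits `η` as a frame-free complex linear form built from real traces, so it is as smooth
as `T` and `J`, has an exterior derivative, and has a frame-independent norm. -/
lemma IsUnitaryFrame.complexTrace_eq (h : IsHermitianForm g J) (he : IsUnitaryFrame g J e)
    {T : E →L[ℝ] E →L[ℝ] E} (hT : ∀ v w, T v w = -T w v) (hTJ : ∀ v w, T (J v) w = J (T v w))
    (j : ι) : complexTrace J T (e j) = TorsionArray.eta (unitaryArray g J T e) j := by
  rw [complexTrace_apply, he.traceL_eq, he.traceL_eq, TorsionArray.eta]
  simp only [ContinuousLinearMap.flip_apply, hTJ, T_J_right hT hTJ, h.inner_J_J, unitaryArray,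
    unitaryCoord_apply, h.J_J, map_neg, neg_apply]
  push_cast
  rw [Finset.mul_sum, ← Finset.sum_sub_distrib, Finset.mul_sum]
  refine Finset.sum_congr rfl fun i _ ↦ ?_
  rw [h.inner_J_left]
  push_cast
  ring

lemma complexTrace_J (h : IsHermitianForm g J)
    {T : E →L[ℝ] E →L[ℝ] E} (v : E) :
    complexTrace J T (J v) = Complex.I * complexTrace J T v := by
  have h1 : T.flip (J (J v)) = -T.flip v := by rw [h.J_J, map_neg]
  rw [complexTrace_apply, complexTrace_apply, h1, map_neg]
  push_cast
  linear_combination (1 / 2 * (traceL E (T.flip (J v)) : ℂ)) * Complex.I_sq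

lemma IsUnitaryFrame.normSqEta_eq (h : IsHermitianForm g J) (he : IsUnitaryFrame g J e)
    {T : E →L[ℝ] E →L[ℝ] E} (hT : ∀ v w, T v w = -T w v) (hTJ : ∀ v w, T (J v) w = J (T v w))
    {κ : Type*} [Fintype κ] [DecidableEq κ] {e' : κ → E} (he' : IsUnitaryFrame g J e') :
    TorsionArray.normSqEta (unitaryArray g J T e)
      = TorsionArray.normSqEta (unitaryArray g J T e') := by
  simp only [TorsionArray.normSqEta, ← he.complexTrace_eq h hT hTJ, ← he'.complexTrace_eq h hT hTJ]
  exact sum_normSq_linear h he he' (complexTrace_J h)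

end Trace

section Existence

variable [FiniteDimensional ℝ E] {g : E →L[ℝ] E →L[ℝ] ℝ} {J : E →L[ℝ] E}

/-- A unitary family of maximal length spans: otherwise the normalized component of some vector
orthogonal to all `e i` and `J (e i)` would lengthen it. The real dimension bounds the length. -/
lemma IsHermitianForm.exists_isUnitaryFrame (h : IsHermitianForm g J) :
    ∃ (n : ℕ) (e : Fin n → E), IsUnitaryFrame g J e := by
  let P (n : ℕ) : Prop := ∃ e : Fin n → E, (∀ i j, g (e i) (e j) = if i = j then 1 else 0)
    ∧ ∀ i j, g (e i) (J (e j)) = 0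
  have hP0 : P 0 := ⟨Fin.elim0, fun i ↦ i.elim0, fun i ↦ i.elim0⟩
  have hbd (n : ℕ) (hn : P n) : n ≤ Module.finrank ℝ E := by
    obtain ⟨e, he, -⟩ := hn
    have : LinearIndependent ℝ e := by
      rw [Fintype.linearIndependent_iff]
      intro c hc i
      have h1 := congrArg (fun v ↦ g v (e i)) hc
      simpa [he] using h1
    simpa using this.fintype_card_le_finrank
  classical
  set n := Nat.findGreatest P (Module.finrank ℝ E) with hn
  obtain ⟨e, he, heJ⟩ : P n := Nat.findGreatest_spec (P := P) (Nat.zero_le _) hP0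
  refine ⟨n, e, he, heJ, fun v ↦ ?_⟩
  by_contra hv
  set w := v - ∑ i, (g v (e i) • e i + g v (J (e i)) • J (e i)) with hw
  have hw0 : w ≠ 0 := sub_ne_zero.2 hv
  have h1 (i j : Fin n) : g (J (e i)) (e j) = 0 := by rw [h.inner_J_left, heJ, neg_zero]
  have hwe (j : Fin n) : g w (e j) = 0 := by
    simp [hw, he, h1]
  have hwJ (j : Fin n) : g w (J (e j)) = 0 := by
    simp [hw, he, heJ, h.inner_J_J]
  have hpos := h.pos w hw0
  set x := (Real.sqrt (g w w))⁻¹ • w with hx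
  have hxx : g x x = 1 := by
    simp only [hx, map_smul, smul_apply, smul_eq_mul]
    rw [← mul_assoc, ← mul_inv, Real.mul_self_sqrt hpos.le, inv_mul_cancel₀ hpos.ne']
  have hxe (j : Fin n) : g x (e j) = 0 := by simp [hx, hwe]
  have hxJ (j : Fin n) : g x (J (e j)) = 0 := by simp [hx, hwJ]
  have hPn : P (n + 1) := by
    refine ⟨Fin.snoc e x, fun i j ↦ ?_, fun i j ↦ ?_⟩
    · refine Fin.lastCases ?_ (fun i ↦ ?_) i <;> refine Fin.lastCases ?_ (fun j ↦ ?_) j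
      · simp [hxx]
      · simp [hxe, (Fin.castSucc_lt_last j).ne']
      · simp [h.symm (e i) x, hxe, (Fin.castSucc_lt_last i).ne]
      · simp [he]
    · refine Fin.lastCases ?_ (fun i ↦ ?_) i <;> refine Fin.lastCases ?_ (fun j ↦ ?_) j
      · simp [h.inner_self_J]
      · simp [hxJ]
      · have : g (e i) (J x) = 0 := by
          rw [h.symm, h.inner_J_left, hxJ, neg_zero]
        simp [this]
      · simp [heJ]
  have := Nat.le_findGreatest (hbd _ hPn) hPn
  omega

end Existence

/-- The torsion of the Gauduchon connection in terms of the components of the Chern torsion. -/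
def gauduchonTorsion (a : ℝ) (t : ι → ι → ι → ℂ) (x z : ι → ℂ) (k : ι) : ℂ :=
  (1 - 2 * a) * ∑ i, ∑ j, t i j k * x i * z j
    + a * ∑ i, ∑ j, conj (t i k j) * (conj (x i) * z j - conj (z i) * x j)

-- The transposed terms of the torsion, such as `g (T u z) v` as a function of `z`, are represented
-- by vectors that are antilinear in `u` and linear in `v`. This is the origin of the conjugates in
-- `gauduchonTorsion`.
open IsUnitaryFrame in
lemma IsUnitaryFrame.coord_torsion [DecidableEq ι] {g : E →L[ℝ] E →L[ℝ] ℝ} {J : E →L[ℝ] E}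
    {e : ι → E} (h : IsHermitianForm g J) (he : IsUnitaryFrame g J e)
    {T : E →L[ℝ] E →L[ℝ] E} (hT : ∀ v w, T v w = -T w v) (hTJ : ∀ v w, T (J v) w = J (T v w))
    {a : ℝ} {u v x : E}
    (hx : ∀ z, g x z = (1 - 2 * a) * g (T u v) z + a * (g (T u z) v - g (T v z) u)) (k : ι) :
    unitaryCoord g J e k x = gauduchonTorsion a (unitaryArray g J T e)
      (fun i ↦ unitaryCoord g J e i u) (fun i ↦ unitaryCoord g J e i v) k := by
  have h1 (u v : E) : ((g (T u (e k)) v : ℝ) : ℂ) + Complex.I * (g (T u (J (e k))) v : ℝ)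
      = ∑ i, ∑ j, conj (unitaryArray g J T e i k j) * (conj (unitaryCoord g J e i u)
        * unitaryCoord g J e j v) := by
    have h3 (j : ι) : unitaryCoord g J e j (T u (e k))
        = ∑ i, unitaryArray g J T e i k j * unitaryCoord g J e i u := by
      rw [coord_T h he hT hTJ]
      simp [coord_self he]
    rw [T_J_right hT hTJ, inner_add_inner_J h he]
    simp only [h3, map_sum, map_mul, Finset.sum_mul]
    rw [Finset.sum_comm]
    exact Finset.sum_congr rfl fun i _ ↦ Finset.sum_congr rfl fun j _ ↦ by ring
  have h2 := coord_T h he hT hTJ u v k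
  rw [unitaryCoord_apply] at h2 ⊢
  rw [hx, hx, gauduchonTorsion]
  simp only [mul_sub, Finset.sum_sub_distrib]
  rw [← h1, ← h1, ← h2]
  push_cast
  ring

end Pointwise

end

/-! ### From vector identities to component identities. -/

noncomputable section

open scoped ComplexConjugate

/-! ### Extraction of the components of trilinear identities -/

namespace TorsionArray

lemma linear_coeff {p q : ℂ} (h : ∀ x : ℂ, p * x + q * conj x = 0) : p = 0 ∧ q = 0 := by
  have h0 := h 1
  have h1 := h Complex.I
  simp only [map_one, Complex.conj_I] at h0 h1
  have h2 : p - q = 0 := (mul_eq_zero.1 (by linear_combination h1 :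
    Complex.I * (p - q) = 0)).resolve_left Complex.I_ne_zero
  exact ⟨by linear_combination (h0 + h2) / 2, by linear_combination (h0 - h2) / 2⟩

/-- Repeated use of the independence of a variable and its conjugate. For a cyclic identity the
coefficients `c₁`, `c₂`, `c₇` already represent all types up to cyclic permutation, apart from the
fully conjugate one. -/
lemma trilinear_coeff {c₁ c₂ c₃ c₄ c₅ c₆ c₇ c₈ : ℂ} (h : ∀ x y z : ℂ,
    c₁ * (x * y * z) + c₂ * (x * y * conj z) + c₃ * (x * conj y * z) + c₄ * (conj x * y * z)
      + c₅ * (x * conj y * conj z) + c₆ * (conj x * y * conj z) + c₇ * (conj x * conj y * z)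
      + c₈ * (conj x * conj y * conj z) = 0) : c₁ = 0 ∧ c₂ = 0 ∧ c₇ = 0 := by
  have h1 (y z : ℂ) := linear_coeff (p := c₁ * (y * z) + c₂ * (y * conj z) + c₃ * (conj y * z)
    + c₅ * (conj y * conj z)) (q := c₄ * (y * z) + c₆ * (y * conj z) + c₇ * (conj y * z)
      + c₈ * (conj y * conj z)) fun x ↦ by linear_combination h x y z
  have h2 (z : ℂ) := linear_coeff (p := c₁ * z + c₂ * conj z) (q := c₃ * z + c₅ * conj z)
    fun y ↦ by linear_combination (h1 y z).1
  have h3 (z : ℂ) := linear_coeff (p := c₄ * z + c₆ * conj z) (q := c₇ * z + c₈ * conj z)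
    fun y ↦ by linear_combination (h1 y z).2
  have h4 := linear_coeff fun z ↦ (h2 z).1
  have h5 := linear_coeff fun z ↦ (h3 z).2
  exact ⟨h4.1, h4.2, h5.1⟩

variable {ι : Type*} [Fintype ι] [DecidableEq ι]

lemma gauduchonTorsion_single (a : ℝ) (t : ι → ι → ι → ℂ) (i j k : ι) (x y : ℂ) :
    gauduchonTorsion a t (Pi.single i x) (Pi.single j y) k
      = (1 - 2 * a) * (t i j k * x * y)
        + a * (conj (t i k j) * conj x * y - conj (t j k i) * x * conj y) := by
  have h1 (i j : ι) (x : ℂ) :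
      conj ((Pi.single i x : ι → ℂ) j) = (Pi.single i (conj x) : ι → ℂ) j := by
    by_cases hij : j = i
    · subst hij; simp
    · simp [hij]
  simp only [gauduchonTorsion, h1, mul_sub, Finset.sum_sub_distrib]
  simp [Pi.single_apply]
  ring

lemma gauduchonTorsion_single_right (a : ℝ) (t : ι → ι → ι → ℂ) (l k : ι) (w : ι → ℂ) (z : ℂ) :
    gauduchonTorsion a t w (Pi.single l z) k
      = (1 - 2 * a) * (∑ m, w m * t m l k) * z
        + a * ((∑ m, conj (w m) * conj (t m k l)) * z - (∑ m, w m * conj (t l k m)) * conj z) := by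
  have h1 (i j : ι) (x : ℂ) :
      conj ((Pi.single i x : ι → ℂ) j) = (Pi.single i (conj x) : ι → ℂ) j := by
    by_cases hij : j = i
    · subst hij; simp
    · simp [hij]
  simp only [gauduchonTorsion, h1, mul_sub, Finset.sum_sub_distrib]
  have h2 : ∑ i, ∑ j, conj (t i k j) * ((Pi.single l (conj z) : ι → ℂ) i * w j)
      = (∑ m, w m * conj (t l k m)) * conj z := by
    rw [Finset.sum_comm, Finset.sum_mul]
    refine Finset.sum_congr rfl fun m _ ↦ ?_
    rw [Finset.sum_eq_single l (fun i _ hi ↦ by simp [hi]) (by simp), Pi.single_eq_same]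
    ring
  have h3 : ∑ i, ∑ j, conj (t i k j) * (conj (w i) * (Pi.single l z : ι → ℂ) j)
      = (∑ m, conj (w m) * conj (t m k l)) * z := by
    rw [Finset.sum_mul]
    refine Finset.sum_congr rfl fun m _ ↦ ?_
    rw [Finset.sum_eq_single l (fun i _ hi ↦ by simp [hi]) (by simp), Pi.single_eq_same]
    ring
  have h4 : ∑ i, ∑ j, t i j k * w i * (Pi.single l z : ι → ℂ) j = (∑ m, w m * t m l k) * z := by
    rw [Finset.sum_mul]
    refine Finset.sum_congr rfl fun m _ ↦ ?_
    rw [Finset.sum_eq_single l (fun i _ hi ↦ by simp [hi]) (by simp), Pi.single_eq_same]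
    ring
  rw [h2, h3, h4]
  ring

/-- The iterated torsion on multiples of basis vectors. -/
lemma gauduchonTorsion_gauduchonTorsion_single (a : ℝ) (t : ι → ι → ι → ℂ) (i j l k : ι)
    (x y z : ℂ) :
    gauduchonTorsion a t (gauduchonTorsion a t (Pi.single i x) (Pi.single j y)) (Pi.single l z) k
      = (1 - 2 * a) * z * ((1 - 2 * a) * (x * y) * (∑ m, t i j m * t m l k)
          + a * (conj x * y) * (∑ m, conj (t i m j) * t m l k)
          - a * (x * conj y) * ∑ m, conj (t j m i) * t m l k)
        + a * z * ((1 - 2 * a) * (conj x * conj y) * (∑ m, conj (t i j m) * conj (t m k l))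
          + a * (x * conj y) * (∑ m, t i m j * conj (t m k l))
          - a * (conj x * y) * ∑ m, t j m i * conj (t m k l))
        - a * conj z * ((1 - 2 * a) * (x * y) * (∑ m, t i j m * conj (t l k m))
          + a * (conj x * y) * (∑ m, conj (t i m j) * conj (t l k m))
          - a * (x * conj y) * ∑ m, conj (t j m i) * conj (t l k m)) := by
  rw [gauduchonTorsion_single_right]
  simp only [gauduchonTorsion_single, map_add, map_sub, map_mul, map_one, map_ofNat,
    Complex.conj_conj, Complex.conj_ofReal, add_mul, sub_mul, mul_add, mul_sub, Finset.mul_sum,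
    Finset.sum_mul, Finset.sum_add_distrib, Finset.sum_sub_distrib]
  simp only [← Finset.sum_add_distrib, ← Finset.sum_sub_distrib]
  exact Finset.sum_congr rfl fun m _ ↦ by ring

/-- The derivative of a torsion array in the direction with complex coordinates `x`. -/
def arrayDeriv (D U : ι → ι → ι → ι → ℂ) (x : ι → ℂ) (i j k : ι) : ℂ :=
  ∑ l, (D l i j k * x l + U l i j k * conj (x l))

lemma arrayDeriv_single (D U : ι → ι → ι → ι → ℂ) (l : ι) (x : ℂ) (i j k : ι) :
    arrayDeriv D U (Pi.single l x) i j k = D l i j k * x + U l i j k * conj x := by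
  rw [arrayDeriv, Finset.sum_eq_single l]
  · simp
  · intro j _ hj; simp [hj]
  · simp

/-- The first Bianchi identity in components. -/
theorem FirstOrder.of_bianchi {a : ℝ} (ha : a ≠ 0) {T : ι → ι → ι → ℂ} {D U : ι → ι → ι → ι → ℂ}
    (hT : ∀ i j k, T i j k = -T j i k) (hD : ∀ l i j k, D l i j k = -D l j i k)
    (hU : ∀ l i j k, U l i j k = -U l j i k)
    (h : ∀ (x y z : ι → ℂ) (k : ι),
      gauduchonTorsion a (arrayDeriv D U x) y z k + gauduchonTorsion a (arrayDeriv D U y) z x k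
        + gauduchonTorsion a (arrayDeriv D U z) x y k
        + gauduchonTorsion a T (gauduchonTorsion a T x y) z k
        + gauduchonTorsion a T (gauduchonTorsion a T y z) x k
        + gauduchonTorsion a T (gauduchonTorsion a T z x) y k = 0) : FirstOrder a T D U := by
  have key (k i j l : ι) :
      (1 - 2 * a : ℂ) * (D i j l k + D j l i k + D l i j k) + (1 - 2 * a : ℂ) ^ 2
          * ((∑ m, T i j m * T m l k) + (∑ m, T j l m * T m i k) + ∑ m, T l i m * T m j k) = 0
        ∧ -a * conj (U i l k j) - (1 - 2 * a) * a * (∑ m, T i j m * conj (T l k m))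
          + a * conj (U j l k i) - (1 - 2 * a) * a * (∑ m, conj (T l m j) * T m i k)
          + a ^ 2 * (∑ m, T j m l * conj (T m k i)) + (1 - 2 * a) * U l i j k
          + (1 - 2 * a) * a * (∑ m, conj (T l m i) * T m j k)
          - a ^ 2 * (∑ m, T i m l * conj (T m k j)) = 0
        ∧ a * conj (D i j k l) + (1 - 2 * a) * a * (∑ m, conj (T i j m) * conj (T m k l))
          - a * conj (D j i k l) - a ^ 2 * (∑ m, conj (T j m l) * conj (T i k m))
          + a ^ 2 * (∑ m, conj (T i m l) * conj (T j k m)) = 0 := by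
    -- Coefficients of the non-cyclic expression `(∇_x T^s)(y, z) + T^s(T^s(x, y), z)`; the
    -- subscripts name the variables that occur conjugated.
    let q (i j l : ι) : ℂ := (1 - 2 * a) * D i j l k + (1 - 2 * a) ^ 2 * ∑ m, T i j m * T m l k
    let q₁ (i j l : ι) : ℂ := (1 - 2 * a) * U i j l k
      + (1 - 2 * a) * a * (∑ m, conj (T i m j) * T m l k) - a ^ 2 * ∑ m, T j m i * conj (T m k l)
    let q₂ (i j l : ι) : ℂ := a * conj (U i j k l)
      - (1 - 2 * a) * a * (∑ m, conj (T j m i) * T m l k) + a ^ 2 * ∑ m, T i m j * conj (T m k l)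
    let q₃ (i j l : ι) : ℂ := -a * conj (U i l k j)
      - (1 - 2 * a) * a * ∑ m, T i j m * conj (T l k m)
    let q₁₂ (i j l : ι) : ℂ := a * conj (D i j k l)
      + (1 - 2 * a) * a * ∑ m, conj (T i j m) * conj (T m k l)
    let q₁₃ (i j l : ι) : ℂ := -a * conj (D i l k j) - a ^ 2 * ∑ m, conj (T i m j) * conj (T l k m)
    let q₂₃ (i j l : ι) : ℂ := a ^ 2 * ∑ m, conj (T j m i) * conj (T l k m)
    have := trilinear_coeff (c₁ := q i j l + q j l i + q l i j) (c₂ := q₃ i j l + q₂ j l i + q₁ l i j)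
      (c₃ := q₂ i j l + q₁ j l i + q₃ l i j) (c₄ := q₁ i j l + q₃ j l i + q₂ l i j)
      (c₅ := q₂₃ i j l + q₁₂ j l i + q₁₃ l i j) (c₆ := q₁₃ i j l + q₂₃ j l i + q₁₂ l i j)
      (c₇ := q₁₂ i j l + q₁₃ j l i + q₂₃ l i j) (c₈ := 0) fun x y z ↦ by
        have := h (Pi.single i x) (Pi.single j y) (Pi.single l z) k
        simp only [gauduchonTorsion_single, gauduchonTorsion_gauduchonTorsion_single,
          arrayDeriv_single, map_add, map_mul, Complex.conj_conj] at this
        simp only [q, q₁, q₂, q₃, q₁₂, q₁₃, q₂₃]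
        linear_combination this
    simp only [q, q₁, q₂, q₃, q₁₂, q₁₃, q₂₃] at this
    exact ⟨by linear_combination this.1, by linear_combination this.2.1,
      by linear_combination this.2.2⟩
  have sw (i k : ι) (f : ι → ℂ) : ∑ m, f m * T m i k = -∑ m, f m * T i m k := by
    rw [← Finset.sum_neg_distrib]
    exact Finset.sum_congr rfl fun m _ ↦ by rw [hT m i]; ring
  have swc (i k : ι) (f : ι → ℂ) :
      ∑ m, f m * conj (T m i k) = -∑ m, f m * conj (T i m k) := by
    rw [← Finset.sum_neg_distrib]
    exact Finset.sum_congr rfl fun m _ ↦ by rw [hT m i, map_neg]; ring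
  have cm (f g : ι → ℂ) : ∑ m, f m * g m = ∑ m, g m * f m :=
    Finset.sum_congr rfl fun m _ ↦ mul_comm _ _
  refine ⟨hT, hD, hU, fun i j l k ↦ ?_, fun i j l k ↦ ?_, fun i j l k ↦ ?_⟩
  · simp only [comp]
    linear_combination (key k i j l).1
  -- The component with two conjugated variables carries an overall factor `a`; conjugating and
  -- cancelling it gives `mixed`.
  · have h1 := congrArg conj (key l i j k).2.2
    have ha' : (a : ℂ) ≠ 0 := by exact_mod_cast ha
    simp only [map_add, map_sub, map_mul, map_sum, Complex.conj_conj, map_zero, map_one,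
      map_ofNat, map_pow, Complex.conj_ofReal] at h1
    refine mul_left_cancel₀ ha' ?_
    simp only [comp]
    have e2 := sw i k (fun m ↦ T j l m)
    have e3 := sw j k (fun m ↦ T l i m)
    have e4 := cm (fun m ↦ T j m k) (fun m ↦ T i l m)
    have e5 := cm (fun m ↦ T i m k) (fun m ↦ T j l m)
    have e6 : ∑ m, T l i m * T j m k = -∑ m, T i l m * T j m k := by
      rw [← Finset.sum_neg_distrib]
      exact Finset.sum_congr rfl fun m _ ↦ by rw [hT l i]; ring
    linear_combination h1 - a ^ 2 * (e2 + e3 - e6) + a ^ 2 * (e4 - e5)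
  · have h1 := (key l i j k).2.1
    have e1 := sw i l (fun m ↦ conj (T k m j))
    have e2 := sw j l (fun m ↦ conj (T k m i))
    have e3 := cm (fun m ↦ T i m l) (fun m ↦ conj (T k m j))
    have e4 := cm (fun m ↦ T j m l) (fun m ↦ conj (T k m i))
    have e5 := swc l i (fun m ↦ T j m k)
    have e6 := swc l j (fun m ↦ T i m k)
    linear_combination h1 + a * (1 - 2 * a) * (e1 - e2 + e3 - e4) - a ^ 2 * (e5 - e6)

/-! ### The exterior derivative of the trace -/

/-- The real two-form with components `β` of type `(1, 1)`. -/
def betaForm (β : ι → ι → ℂ) (x y : ι → ℂ) : ℂ :=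
  -∑ j, ∑ k, β j k * (x j * conj (y k) - y j * conj (x k))

lemma betaForm_single_right (β : ι → ι → ℂ) (l : ι) (w : ι → ℂ) (z : ℂ) :
    betaForm β w (Pi.single l z)
      = -((∑ m, β m l * w m) * conj z - (∑ m, β l m * conj (w m)) * z) := by
  have h1 (i j : ι) (x : ℂ) :
      conj ((Pi.single i x : ι → ℂ) j) = (Pi.single i (conj x) : ι → ℂ) j := by
    by_cases hij : j = i
    · subst hij; simp
    · simp [hij]
  simp only [betaForm, h1, mul_sub, Finset.sum_sub_distrib, Finset.sum_mul]
  congr 2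
  · refine Finset.sum_congr rfl fun m _ ↦ ?_
    rw [Finset.sum_eq_single l (fun i _ hi ↦ by simp [hi]) (by simp), Pi.single_eq_same]
    ring
  · rw [Finset.sum_comm]
    refine Finset.sum_congr rfl fun m _ ↦ ?_
    rw [Finset.sum_eq_single l (fun i _ hi ↦ by simp [hi]) (by simp), Pi.single_eq_same]
    ring

/-- The components of the equation `dB = 0` for a two-form `B` of type `(1, 1)`. -/
theorem extDeriv_components {a : ℝ} {T : ι → ι → ι → ℂ}
    {β : ι → ι → ℂ} {d d' : ι → ι → ι → ℂ}
    (h : ∀ x y z : ι → ℂ,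
      betaForm (fun j k ↦ ∑ l, (d l j k * x l + d' l j k * conj (x l))) y z
        + betaForm (fun j k ↦ ∑ l, (d l j k * y l + d' l j k * conj (y l))) z x
        + betaForm (fun j k ↦ ∑ l, (d l j k * z l + d' l j k * conj (z l))) x y
        + betaForm β (gauduchonTorsion a T x y) z
        + betaForm β (gauduchonTorsion a T y z) x
        + betaForm β (gauduchonTorsion a T z x) y = 0) (i j k : ι) :
    d i j k - d j i k + (1 - 2 * a) * (∑ m, T i j m * β m k) - a * (∑ l, T j l k * β i l)
      + a * (∑ l, T i l k * β j l) = 0 := by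
  have h1 (d : ι → ι → ι → ℂ) (l : ι) (x : ℂ) (f : ℂ → ℂ) (hf : f 0 = 0) (j k : ι) :
      ∑ m, d m j k * f ((Pi.single l x : ι → ℂ) m) = d l j k * f x := by
    rw [Finset.sum_eq_single l (fun i _ hi ↦ by simp [hi, hf]) (by simp), Pi.single_eq_same]
  have hb (β : ι → ι → ℂ) (i j : ι) (x y : ℂ) : betaForm β (Pi.single i x) (Pi.single j y)
      = -(β i j * (x * conj y) - β j i * (conj x * y)) := by
    rw [betaForm_single_right]
    rw [Finset.sum_eq_single i (fun i _ hi ↦ by simp [hi]) (by simp), Pi.single_eq_same,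
      Finset.sum_eq_single i (fun i _ hi ↦ by simp [hi]) (by simp), Pi.single_eq_same]
    ring
  have hd (l : ι) (x : ℂ) (j k : ι) : ∑ m, (d m j k * (Pi.single l x : ι → ℂ) m
      + d' m j k * conj ((Pi.single l x : ι → ℂ) m)) = d l j k * x + d' l j k * conj x := by
    rw [Finset.sum_add_distrib, h1 d l x (fun z ↦ z) rfl, h1 d' l x (fun z ↦ conj z) (by simp)]
  have hτ (i j l : ι) (x y z : ℂ) :
      betaForm β (gauduchonTorsion a T (Pi.single i x) (Pi.single j y)) (Pi.single l z)
        = -(conj z * ((1 - 2 * a) * (x * y) * (∑ m, T i j m * β m l)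
            + a * (conj x * y) * (∑ m, conj (T i m j) * β m l)
            - a * (x * conj y) * (∑ m, conj (T j m i) * β m l))
          - z * ((1 - 2 * a) * (conj x * conj y) * (∑ m, conj (T i j m) * β l m)
            + a * (x * conj y) * (∑ m, T i m j * β l m)
            - a * (conj x * y) * (∑ m, T j m i * β l m))) := by
    rw [betaForm_single_right]
    simp only [gauduchonTorsion_single, map_add, map_sub, map_mul, map_one, map_ofNat,
      Complex.conj_conj, Complex.conj_ofReal, add_mul, sub_mul, mul_add, mul_sub, Finset.mul_sum,
      Finset.sum_mul, Finset.sum_add_distrib, Finset.sum_sub_distrib]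
    simp only [← Finset.sum_add_distrib, ← Finset.sum_sub_distrib, ← Finset.sum_neg_distrib]
    exact Finset.sum_congr rfl fun m _ ↦ by ring
  let p₃ (i j l : ι) : ℂ := -(1 - 2 * a) * (∑ m, T i j m * β m l)
  let p₁₂ (i j l : ι) : ℂ := (1 - 2 * a) * (∑ m, conj (T i j m) * β l m)
  let p₁₃ (i j l : ι) : ℂ := -a * (∑ m, conj (T i m j) * β m l)
  let p₂₃ (i j l : ι) : ℂ := a * (∑ m, conj (T j m i) * β m l)
  let p₁ (i j l : ι) : ℂ := -a * (∑ m, T j m i * β l m)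
  let p₂ (i j l : ι) : ℂ := d i l j + a * (∑ m, T i m j * β l m)
  have := (trilinear_coeff (c₁ := 0)
      (c₂ := p₃ i j k - d i j k + p₂ j k i + p₁ k i j)
      (c₃ := p₂ i j k + p₁ j k i + p₃ k i j - d k i j)
      (c₄ := p₁ i j k + p₃ j k i - d j k i + p₂ k i j)
      (c₅ := p₂₃ i j k + p₁₂ j k i + p₁₃ k i j + d' j i k - d' k i j)
      (c₆ := p₁₃ i j k + p₂₃ j k i + p₁₂ k i j - d' i j k + d' k j i)
      (c₇ := p₁₂ i j k + d' i k j + p₁₃ j k i + p₂₃ k i j - d' j k i) (c₈ := 0) fun x y z ↦ by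
        have := h (Pi.single i x) (Pi.single j y) (Pi.single k z)
        simp only [hτ, hb, hd] at this
        simp only [p₃, p₁₂, p₁₃, p₂₃, p₁, p₂]
        linear_combination this).2.1
  simp only [p₃, p₂, p₁] at this
  linear_combination -this

end TorsionArray

end

/-! ### The type of `dη`, and Wirtinger derivatives. -/

noncomputable section

open scoped ComplexConjugate

namespace TorsionArray

variable {ι : Type*} [Fintype ι]

/-- The exterior derivative of the trace of the torsion is of type `(1, 1)`. -/
lemma FirstOrder.extDeriv_eta {a : ℝ} {T : ι → ι → ι → ℂ} {D U : ι → ι → ι → ι → ℂ}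
    (h : FirstOrder a T D U) (u v : ι → ℂ) :
    (∑ j, (∑ l, ((∑ s, D l s j s) * u l + (∑ s, U l s j s) * conj (u l))) * v j)
        - (∑ j, (∑ l, ((∑ s, D l s j s) * v l + (∑ s, U l s j s) * conj (v l))) * u j)
        + ∑ k, eta T k * gauduchonTorsion a T u v k
      = betaForm (fun j k ↦ (∑ s, U k s j s) - a * conj (ad T j k)) u v := by
  have hD : ∀ i j k l, D i j k l = (1 - a : ℂ) * comp T j k i l := fun i j k l ↦
    h.deriv_eq_comp i j k l
  -- `∇^{1,0} η` is a multiple of the Killing form, which is symmetric, so its skew part does not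
  -- contribute.
  have h1 : (∑ j, (∑ l, (∑ s, D l s j s) * u l) * v j)
      = ∑ j, (∑ l, (∑ s, D l s j s) * v l) * u j := by
    simp only [trace_deriv hD, Finset.sum_mul]
    rw [Finset.sum_comm]
    refine sum_congr₂ fun i j ↦ ?_
    rw [killing_symm]
    ring
  -- For `a = 1/2` the factor vanishes; otherwise `η` vanishes on brackets by the Jacobi identity.
  have h2 : (1 - 2 * a : ℂ) * ∑ k, eta T k * ∑ i, ∑ j, T i j k * u i * v j = 0 := by
    by_cases hb : (1 - 2 * a : ℂ) = 0
    · rw [hb, zero_mul]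
    have e1 : ∑ k, eta T k * ∑ i, ∑ j, T i j k * u i * v j
        = ∑ i, ∑ j, (∑ k, eta T k * T i j k) * (u i * v j) := by
      simp only [Finset.mul_sum, Finset.sum_mul]
      rw [Finset.sum_comm]
      refine Finset.sum_congr rfl fun i _ ↦ ?_
      rw [Finset.sum_comm]
      exact sum_congr₂ fun _ _ ↦ by ring
    rw [e1]
    simp only [sum_eta_mul h.skew (h.jacobi hb), zero_mul, Finset.sum_const_zero, mul_zero]
  have h3 (u v : ι → ℂ) : ∑ k, eta T k * ∑ i, ∑ j, conj (T i k j) * (conj (u i) * v j)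
      = -∑ j, ∑ k, conj (ad T j k) * (v j * conj (u k)) := by
    have e1 : ∑ k, eta T k * ∑ i, ∑ j, conj (T i k j) * (conj (u i) * v j)
        = ∑ i, ∑ j, (∑ k, eta T k * conj (T i k j)) * (conj (u i) * v j) := by
      simp only [Finset.mul_sum, Finset.sum_mul]
      rw [Finset.sum_comm]
      refine Finset.sum_congr rfl fun i _ ↦ ?_
      rw [Finset.sum_comm]
      exact sum_congr₂ fun _ _ ↦ by ring
    rw [e1, Finset.sum_comm, ← Finset.sum_neg_distrib]
    refine Finset.sum_congr rfl fun i _ ↦ ?_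
    rw [← Finset.sum_neg_distrib]
    refine Finset.sum_congr rfl fun j _ ↦ ?_
    rw [sum_eta_mul_conj h.skew]
    ring
  have h4 (u v : ι → ℂ) : ∑ j, (∑ l, (∑ s, U l s j s) * conj (u l)) * v j
      = ∑ j, ∑ k, (∑ s, U k s j s) * (v j * conj (u k)) := by
    simp only [Finset.sum_mul]
    exact sum_congr₃ fun _ _ _ ↦ by ring
  have h5 : ∑ k, eta T k * gauduchonTorsion a T u v k
      = (1 - 2 * a : ℂ) * ∑ k, eta T k * ∑ i, ∑ j, T i j k * u i * v j
        + a * ((∑ k, eta T k * ∑ i, ∑ j, conj (T i k j) * (conj (u i) * v j))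
          - ∑ k, eta T k * ∑ i, ∑ j, conj (T i k j) * (conj (v i) * u j)) := by
    simp only [gauduchonTorsion, mul_sub, Finset.sum_sub_distrib, mul_add, Finset.sum_add_distrib,
      Finset.mul_sum]
    simp only [mul_left_comm (eta T _)]
  rw [h5, h2, h3, h3]
  simp only [add_mul, Finset.sum_add_distrib]
  rw [h4, h4, h1]
  simp only [betaForm, mul_sub, sub_mul, Finset.sum_sub_distrib, mul_assoc]
  simp only [← Finset.mul_sum]
  ring

end TorsionArray

/-! ### Derivatives in complex coordinates -/

section Wirtinger

variable {ι : Type*} [Fintype ι] {E : Type*} [NormedAddCommGroup E] [NormedSpace ℝ E]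

/-- The real linear map with `ℂ`-linear coefficients `d` and antilinear coefficients `d'`. -/
def wirtinger (c : ι → E →L[ℝ] ℂ) (d d' : ι → ℂ) : E →L[ℝ] ℂ :=
  ∑ l, (d l • c l + d' l • (Complex.conjCLE : ℂ →L[ℝ] ℂ) ∘L c l)

lemma wirtinger_apply (c : ι → E →L[ℝ] ℂ) (d d' : ι → ℂ) (v : E) :
    wirtinger c d d' v = ∑ l, (d l * c l v + d' l * conj (c l v)) := by
  simp [wirtinger]

/-- `f` is differentiable at `p` with partial derivatives `d l` along `∂ / ∂z_l` and `d' l` along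
`∂ / ∂\bar z_l`. -/
def HasWirtingerAt (c : ι → E →L[ℝ] ℂ) (f : E → ℂ) (d d' : ι → ℂ) (p : E) : Prop :=
  HasFDerivAt f (wirtinger c d d') p

namespace HasWirtingerAt

variable {c : ι → E →L[ℝ] ℂ} {f g : E → ℂ} {d d' e e' : ι → ℂ} {p : E}

lemma congr_deriv (h : HasWirtingerAt c f d d' p) (hd : ∀ l, d l = e l) (hd' : ∀ l, d' l = e' l) :
    HasWirtingerAt c f e e' p := by
  rwa [funext hd, funext hd'] at h

lemma add (hf : HasWirtingerAt c f d d' p) (hg : HasWirtingerAt c g e e' p) :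
    HasWirtingerAt c (fun x ↦ f x + g x) (fun l ↦ d l + e l) (fun l ↦ d' l + e' l) p := by
  refine (HasFDerivAt.add hf hg).congr_fderiv ?_
  ext v
  simp only [add_apply, wirtinger_apply, ← Finset.sum_add_distrib]
  exact Finset.sum_congr rfl fun _ _ ↦ by ring

lemma sub (hf : HasWirtingerAt c f d d' p) (hg : HasWirtingerAt c g e e' p) :
    HasWirtingerAt c (fun x ↦ f x - g x) (fun l ↦ d l - e l) (fun l ↦ d' l - e' l) p := by
  refine (HasFDerivAt.sub hf hg).congr_fderiv ?_
  ext v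
  simp only [sub_apply, wirtinger_apply, ← Finset.sum_sub_distrib]
  exact Finset.sum_congr rfl fun _ _ ↦ by ring

lemma mul (hf : HasWirtingerAt c f d d' p) (hg : HasWirtingerAt c g e e' p) :
    HasWirtingerAt c (fun x ↦ f x * g x) (fun l ↦ d l * g p + f p * e l)
      (fun l ↦ d' l * g p + f p * e' l) p := by
  refine (HasFDerivAt.mul hf hg).congr_fderiv ?_
  ext v
  simp only [add_apply, smul_apply, smul_eq_mul, wirtinger_apply, Finset.mul_sum,
    ← Finset.sum_add_distrib]
  exact Finset.sum_congr rfl fun _ _ ↦ by ring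

lemma const (z : ℂ) : HasWirtingerAt c (fun _ ↦ z) 0 0 p := by
  refine (hasFDerivAt_const z p).congr_fderiv ?_
  ext v
  simp [wirtinger_apply]

lemma const_mul (z : ℂ) (hf : HasWirtingerAt c f d d' p) :
    HasWirtingerAt c (fun x ↦ z * f x) (fun l ↦ z * d l) (fun l ↦ z * d' l) p :=
  ((const z).mul hf).congr_deriv (by simp) (by simp)

lemma star (hf : HasWirtingerAt c f d d' p) :
    HasWirtingerAt c (fun x ↦ starRingEnd ℂ (f x)) (fun l ↦ starRingEnd ℂ (d' l))
      (fun l ↦ starRingEnd ℂ (d l)) p := by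
  refine ((Complex.conjCLE : ℂ →L[ℝ] ℂ).hasFDerivAt.comp p hf).congr_fderiv ?_
  ext v
  simp [wirtinger_apply, map_sum, add_comm]

lemma sum {κ : Type*} [Fintype κ] {f : κ → E → ℂ} {d d' : κ → ι → ℂ}
    (hf : ∀ k, HasWirtingerAt c (f k) (d k) (d' k) p) :
    HasWirtingerAt c (fun x ↦ ∑ k, f k x) (fun l ↦ ∑ k, d k l) (fun l ↦ ∑ k, d' k l) p := by
  refine (HasFDerivAt.fun_sum fun k _ ↦ hf k).congr_fderiv ?_
  ext v
  simp only [sum_apply, wirtinger_apply]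
  rw [Finset.sum_comm]
  exact Finset.sum_congr rfl fun _ _ ↦ by
    rw [Finset.sum_add_distrib, Finset.sum_mul, Finset.sum_mul]

lemma congr_of_eventuallyEq (hf : HasWirtingerAt c f d d' p) (h : g =ᶠ[nhds p] f) :
    HasWirtingerAt c g d d' p :=
  HasFDerivAt.congr_of_eventuallyEq hf h

end HasWirtingerAt

namespace IsUnitaryFrame

variable [DecidableEq ι] {g : E →L[ℝ] E →L[ℝ] ℝ} {J : E →L[ℝ] E} {e : ι → E}
  (h : IsHermitianForm g J) (he : IsUnitaryFrame g J e)
include h he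

omit h in
lemma wirtinger_frame (d d' : ι → ℂ) (l : ι) :
    wirtinger (unitaryCoord g J e) d d' (e l) = d l + d' l := by
  rw [wirtinger_apply, Finset.sum_eq_single l (fun i _ hi ↦ by simp [coord_self he, hi.symm])
    (by simp)]
  simp [coord_self he]

lemma wirtinger_J_frame (d d' : ι → ℂ) (l : ι) :
    wirtinger (unitaryCoord g J e) d d' (J (e l)) = Complex.I * (d l - d' l) := by
  rw [wirtinger_apply, Finset.sum_eq_single l
    (fun i _ hi ↦ by simp [coord_J h, coord_self he, hi.symm]) (by simp)]
  simp only [coord_J h, coord_self he, if_true, mul_one, Complex.conj_I]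
  ring

lemma wirtinger_unique {d d' e₁ e₁' : ι → ℂ}
    (hw : wirtinger (unitaryCoord g J e) d d' = wirtinger (unitaryCoord g J e) e₁ e₁') (l : ι) :
    d l = e₁ l ∧ d' l = e₁' l := by
  have h1 := congrArg (fun L : E →L[ℝ] ℂ ↦ L (e l)) hw
  have h2 := congrArg (fun L : E →L[ℝ] ℂ ↦ L (J (e l))) hw
  simp only [wirtinger_frame he, wirtinger_J_frame h he] at h1 h2
  have h3 := mul_left_cancel₀ Complex.I_ne_zero h2
  exact ⟨by linear_combination (h1 + h3) / 2, by linear_combination (h1 - h3) / 2⟩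

/-- Every real linear map has the form `wirtinger`. -/
lemma eq_wirtinger (L : E →L[ℝ] ℂ) : L = wirtinger (unitaryCoord g J e)
    (fun l ↦ 1 / 2 * (L (e l) - Complex.I * L (J (e l))))
    (fun l ↦ 1 / 2 * (L (e l) + Complex.I * L (J (e l)))) := by
  ext v
  have hv := he.expand_coord v
  rw [hv, map_sum, map_sum]
  refine Finset.sum_congr rfl fun l _ ↦ ?_
  rw [map_add, map_smul, map_smul, map_add, map_smul, map_smul, wirtinger_frame he,
    wirtinger_J_frame h he]
  congr 1
  · congr 1; ring
  · congr 1; linear_combination L (J (e l)) * Complex.I_sq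

lemma _root_.HasWirtingerAt.unique {f : E → ℂ} {d d' e₁ e₁' : ι → ℂ} {p : E}
    (h1 : HasWirtingerAt (unitaryCoord g J e) f d d' p)
    (h2 : HasWirtingerAt (unitaryCoord g J e) f e₁ e₁' p) (l : ι) :
    d l = e₁ l ∧ d' l = e₁' l :=
  wirtinger_unique h he (HasFDerivAt.unique h1 h2) l

end IsUnitaryFrame

end Wirtinger

end

/-! ### Construction of a unitary gauge that is parallel at a point. -/

noncomputable section

open scoped ComplexConjugate Topology

/-! ### Unitary frames adapted to a Hermitian connection -/

/-- The square root near `1` in a Banach algebra. -/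
lemma exists_sqrt_near_one (𝔸 : Type*) [NormedRing 𝔸] [NormedAlgebra ℝ 𝔸] [CompleteSpace 𝔸] :
    ∃ σ : 𝔸 → 𝔸, σ 1 = 1 ∧ DifferentiableAt ℝ σ 1 ∧ (∀ᶠ x in 𝓝 1, σ x * σ x = x)
      ∧ ∀ᶠ x in 𝓝 1, σ (x * x) = x := by
  -- Squaring has derivative `2` at `1`, so the inverse function theorem applies.
  let e : 𝔸 ≃L[ℝ] 𝔸 := ContinuousLinearEquiv.smulLeft (Units.mk0 (2 : ℝ) two_ne_zero)
  have h : HasStrictFDerivAt (fun x : 𝔸 ↦ x * x) (e : 𝔸 →L[ℝ] 𝔸) 1 := by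
    refine ((hasStrictFDerivAt_id (1 : 𝔸)).mul' (hasStrictFDerivAt_id (1 : 𝔸))).congr_fderiv ?_
    ext x
    simp [e, two_smul, Units.smul_def]
  have h1 := h.to_localInverse
  have h2 := h.eventually_right_inverse
  have h3 := h.localInverse_apply_image
  simp only [mul_one] at h1 h2 h3
  exact ⟨h.localInverse _ _ _, h3, h1.hasFDerivAt.differentiableAt, h2, h.eventually_left_inverse⟩

section

variable {E : Type*} [NormedAddCommGroup E] [NormedSpace ℝ E]

lemma hasFDerivAt_pullback_form {p : E} {g : E → E →L[ℝ] E →L[ℝ] ℝ} {C : E → E →L[ℝ] E}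
    {g' : E →L[ℝ] E →L[ℝ] E →L[ℝ] ℝ} {C' : E →L[ℝ] E →L[ℝ] E}
    (hg : HasFDerivAt g g' p) (hC : HasFDerivAt C C' p) :
    ∃ K' : E →L[ℝ] E →L[ℝ] E →L[ℝ] ℝ, HasFDerivAt (fun y ↦
      ((ContinuousLinearMap.compL ℝ E E ℝ).flip (C y)) ∘L (g y ∘L C y)) K' p ∧
      ∀ u v w, K' u v w = g' u (C p v) (C p w) + g p (C' u v) (C p w) + g p (C p v) (C' u w) := by
  let P := (ContinuousLinearMap.compL ℝ E E ℝ).flip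
  have h0 : HasFDerivAt (𝕜 := ℝ) (E := E →L[ℝ] E) (F := (E →L[ℝ] ℝ) →L[ℝ] (E →L[ℝ] ℝ))
    (fun L ↦ P L) P (C p) := by exact ContinuousLinearMap.hasFDerivAt P
  have h1 : HasFDerivAt (fun y ↦ P (C y)) (P ∘L C') p := by
    exact HasFDerivAt.comp (𝕜 := ℝ) (E := E) (F := E →L[ℝ] E)
      (G := (E →L[ℝ] ℝ) →L[ℝ] (E →L[ℝ] ℝ)) (f := C) (g := fun L ↦ P L) (g' := P) (f' := C') p h0 hC
  have h2 := HasFDerivAt.clm_comp (𝕜 := ℝ) h1 (HasFDerivAt.clm_comp (𝕜 := ℝ) hg hC)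
  refine ⟨_, h2, fun u v w ↦ ?_⟩
  simp [P]
  ring

end

section Gauge

variable {E : Type*} [NormedAddCommGroup E] [NormedSpace ℝ E] [FiniteDimensional ℝ E]

lemma IsHermitianForm.exists_equiv {g : E →L[ℝ] E →L[ℝ] ℝ} {J : E →L[ℝ] E}
    (h : IsHermitianForm g J) : ∃ G : E ≃L[ℝ] (E →L[ℝ] ℝ), (G : E →L[ℝ] E →L[ℝ] ℝ) = g := by
  have hd : Module.finrank ℝ E = Module.finrank ℝ (E →L[ℝ] ℝ) := by
    rw [← (LinearMap.toContinuousLinearMap (𝕜 := ℝ) (E := E) (F' := ℝ)).finrank_eq]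
    exact Subspace.dual_finrank_eq.symm
  have hg : Function.Injective g.toLinearMap := fun v w hvw ↦
    h.ext fun z ↦ congrArg (fun φ : E →L[ℝ] ℝ ↦ φ z) hvw
  refine ⟨(LinearEquiv.ofInjectiveOfFinrankEq g.toLinearMap hg hd).toContinuousLinearEquiv, ?_⟩
  ext v w
  rfl

/-- An operator-valued function with `Q p = 1` and derivative `-A` at `p` that carries the Hermitian
structure at `p` to that at nearby points, for `A` the coefficients at `p` of a Hermitian
connection. -/
theorem exists_unitary_gauge {p : E} {g : E → E →L[ℝ] E →L[ℝ] ℝ} {J : E → E →L[ℝ] E}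
    {g' : E →L[ℝ] E →L[ℝ] E →L[ℝ] ℝ} {J' A : E →L[ℝ] E →L[ℝ] E}
    (hg : HasFDerivAt g g' p) (hJ : HasFDerivAt J J' p)
    (hH : ∀ᶠ y in 𝓝 p, IsHermitianForm (g y) (J y))
    (hgA : ∀ u v w, g' u v w = g p (A u v) w + g p v (A u w))
    (hJA : ∀ u v, J' u v = J p (A u v) - A u (J p v)) :
    ∃ Q : E → E →L[ℝ] E, Q p = 1 ∧ HasFDerivAt Q (-A) p ∧ ∀ᶠ y in 𝓝 p,
      (∀ v w, g y (Q y v) (Q y w) = g p v w) ∧ ∀ v, Q y (J p v) = J y (Q y v) := by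
  have hp : IsHermitianForm (g p) (J p) := hH.self_of_nhds
  have hJJ : J p * J p = -1 := by ext v; simp [hp.J_J]
  obtain ⟨G, hG⟩ := hp.exists_equiv
  have hGa (v w : E) : G v w = g p v w := by rw [← hG]; rfl
  obtain ⟨σ, hσ1, hσd, hσr, hσl⟩ := exists_sqrt_near_one (E →L[ℝ] E)
  -- a first approximation, complex linear
  let C (y : E) : E →L[ℝ] E :=
    (1 / 2 : ℝ) • ((1 - A (y - p)) - J y ∘L (1 - A (y - p)) ∘L J p)
  have hC1 : C p = 1 := by
    ext v
    simp only [C, sub_self, map_zero, sub_zero, smul_apply, sub_apply,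
      ContinuousLinearMap.comp_apply, one_apply_eq_self, hp.J_J]
    module
  have hCJ : ∀ᶠ y in 𝓝 p, ∀ v, C y (J p v) = J y (C y v) := by
    filter_upwards [hH] with y hy v
    simp only [C, smul_apply, sub_apply, ContinuousLinearMap.comp_apply, map_smul, map_sub,
      one_apply_eq_self, hp.J_J, hy.J_J, map_neg]
    module
  have hQ1 : HasFDerivAt (fun y ↦ (1 : E →L[ℝ] E) - A (y - p)) (-A) p :=
    ((A.hasFDerivAt.comp p ((hasFDerivAt_id p).sub_const p)).const_sub 1).congr_fderiv (by
      ext; simp)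
  have hCd : HasFDerivAt C (-A) p := by
    refine ((hQ1.sub (hJ.clm_comp (hQ1.clm_comp
      (hasFDerivAt_const (J p) p)))).const_smul (1 / 2 : ℝ)).congr_fderiv ?_
    ext u v
    simp [hJA, hp.J_J]
    module
  -- The pullback of `g y` by `C y`. Its derivative at `p` vanishes because `C' = -A` compensates
  -- the metric condition.
  let K (y : E) : E →L[ℝ] E →L[ℝ] ℝ :=
    ((ContinuousLinearMap.compL ℝ E E ℝ).flip (C y)) ∘L (g y ∘L C y)
  have hKa (y v w : E) : K y v w = g y (C y v) (C y w) := rfl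
  have hKd : HasFDerivAt (𝕜 := ℝ) K 0 p := by
    obtain ⟨K', hK', h⟩ := hasFDerivAt_pullback_form hg hCd
    refine hK'.congr_fderiv ?_
    ext u v w
    simp [h, hgA, hC1]
  -- Polar decomposition: `H` plays the role of `C* C` with respect to `g p`. Correcting `C` by the
  -- inverse of its square root makes it isometric, and does not alter the derivative at `p` since
  -- `H' = 0` there.
  let H (y : E) : E →L[ℝ] E := (G.symm : (E →L[ℝ] ℝ) →L[ℝ] E) ∘L K y
  have hHa (y v w : E) : g p (H y v) w = g y (C y v) (C y w) := by
    rw [← hGa, ← hKa]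
    simp [H]
  have hH1 : H p = 1 := by
    ext v
    refine hp.ext fun w ↦ ?_
    rw [hHa, hC1]
    simp
  have hHd : HasFDerivAt (𝕜 := ℝ) H 0 p := by
    refine ((hasFDerivAt_const (G.symm : (E →L[ℝ] ℝ) →L[ℝ] E) p).clm_comp hKd).congr_fderiv ?_
    ext u v
    simp
  let S (y : E) : E →L[ℝ] E := σ (H y)
  have hS1 : S p = 1 := by simp only [S, hH1, hσ1]
  have hSd : HasFDerivAt (𝕜 := ℝ) S 0 p := by
    have h1 : HasFDerivAt σ (fderiv ℝ σ 1) (H p) := by rw [hH1]; exact hσd.hasFDerivAt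
    exact (h1.comp p hHd).congr_fderiv (by ext; simp)
  have hSc : Filter.Tendsto S (𝓝 p) (𝓝 1) := by
    have := hSd.continuousAt.tendsto; rwa [hS1] at this
  have hHc : Filter.Tendsto H (𝓝 p) (𝓝 1) := by
    have := hHd.continuousAt.tendsto; rwa [hH1] at this
  have hSS : ∀ᶠ y in 𝓝 p, S y * S y = H y := hHc.eventually hσr
  -- Conjugating `S y` by `J p` gives another square root of `H y` near `1`. Local uniqueness of the
  -- root yields commutation. Self-adjointness of `S y` below follows in the same way from its
  -- adjoint.
  have hSJ : ∀ᶠ y in 𝓝 p, S y * J p = J p * S y := by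
    have h1 : Filter.Tendsto (fun y ↦ -(J p * S y * J p)) (𝓝 p) (𝓝 1) := by
      have := ((tendsto_const_nhds (x := J p)).mul hSc).mul (tendsto_const_nhds (x := J p))
      rw [mul_one, hJJ] at this
      simpa using this.neg
    filter_upwards [h1.eventually hσl, hSS, hCJ, hH] with y h2 h3 h4 h5
    have hHJ : H y * J p = J p * H y := by
      ext v
      refine hp.ext fun w ↦ ?_
      simp only [mul_apply_eq_comp]
      rw [hHa, hp.inner_J_left, hHa, h4, h4, h5.inner_J_left]
    have h6 : -(J p * S y * J p) * -(J p * S y * J p) = H y := by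
      have : J p * S y * J p * (J p * S y * J p) = J p * S y * (J p * J p) * (S y * J p) := by
        noncomm_ring
      rw [neg_mul_neg, this, hJJ]
      have : J p * S y * (-1) * (S y * J p) = -(J p * (S y * S y * J p)) := by noncomm_ring
      rw [this, h3, hHJ, ← mul_assoc, hJJ]
      noncomm_ring
    rw [h6] at h2
    calc S y * J p = -(J p * J p) * S y * J p := by rw [hJJ]; noncomm_ring
      _ = J p * -(J p * S y * J p) := by noncomm_ring
      _ = J p * S y := by rw [← h2]
  let adj : (E →L[ℝ] E) → (E →L[ℝ] E) := fun L ↦ (G.symm : (E →L[ℝ] ℝ) →L[ℝ] E) ∘L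
    (((ContinuousLinearMap.compL ℝ E E ℝ).flip L) ∘L (G : E →L[ℝ] E →L[ℝ] ℝ))
  have hadj (L : E →L[ℝ] E) (v w : E) : g p (adj L v) w = g p v (L w) := by
    rw [← hGa, ← hGa]
    simp [adj]
  have hadjc : Continuous adj := by
    simp only [adj]
    fun_prop
  have hSa : ∀ᶠ y in 𝓝 p, ∀ v w, g p (S y v) w = g p v (S y w) := by
    have h1 : Filter.Tendsto (fun y ↦ adj (S y)) (𝓝 p) (𝓝 1) := by
      have h2 : adj 1 = 1 := by
        ext v
        refine hp.ext fun w ↦ ?_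
        rw [hadj]; simp
      have := (hadjc.tendsto 1).comp hSc
      rwa [h2] at this
    filter_upwards [h1.eventually hσl, hSS, hH] with y h2 h3 h4 v w
    have h5 : adj (S y) * adj (S y) = H y := by
      ext v
      refine hp.ext fun w ↦ ?_
      rw [mul_apply_eq_comp, hadj, hadj, ← mul_apply_eq_comp, h3, hp.symm,
        hHa, hHa, h4.symm]
    rw [h5] at h2
    change g p (σ (H y) v) w = _
    rw [h2, hadj]
  let R (y : E) : E →L[ℝ] E := Ring.inverse (S y)
  have hRd : HasFDerivAt (𝕜 := ℝ) R 0 p := by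
    have h1 := hasFDerivAt_ringInverse (𝕜 := ℝ) (1 : (E →L[ℝ] E)ˣ)
    rw [Units.val_one, ← hS1] at h1
    exact (h1.comp p hSd).congr_fderiv (ContinuousLinearMap.comp_zero _)
  have hR1 : R p = 1 := by simp only [R, hS1, Ring.inverse_one]
  have hunit : ∀ᶠ y in 𝓝 p, IsUnit (S y) :=
    hSc.eventually (Units.isOpen.mem_nhds isUnit_one)
  refine ⟨fun y ↦ C y ∘L R y, by simp [hC1, hR1]; rfl, ?_, ?_⟩
  · refine (hCd.clm_comp hRd).congr_fderiv ?_
    ext u v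
    simp [hR1]
  · filter_upwards [hunit, hSS, hSJ, hCJ, hSa] with y h1 h2 h3 h4 h5
    have hSR : S y * R y = 1 := Ring.mul_inverse_cancel _ h1
    have hRS : R y * S y = 1 := Ring.inverse_mul_cancel _ h1
    have hSRv (v : E) : S y (R y v) = v := congrArg (fun L : E →L[ℝ] E ↦ L v) hSR
    have hRSv (v : E) : R y (S y v) = v := congrArg (fun L : E →L[ℝ] E ↦ L v) hRS
    refine ⟨fun v w ↦ ?_, fun v ↦ ?_⟩
    · simp only [ContinuousLinearMap.comp_apply]
      rw [← hHa, ← h2, mul_apply_eq_comp, h5, hSRv, hSRv]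
    · simp only [ContinuousLinearMap.comp_apply]
      rw [← h4]
      congr 1
      have h6 : J p v = S y (J p (R y v)) := by
        have := congrArg (fun L : E →L[ℝ] E ↦ L (R y v)) h3
        simp only [mul_apply_eq_comp, hSRv] at this
        exact this.symm
      rw [h6, hRSv]

end Gauge

end

/-! ### Local Gauduchon data and the covariant derivative of the torsion. -/

noncomputable section

open scoped ComplexConjugate Topology
open TorsionArray

/-! ### Hermitian structures with a Gauduchon connection on open sets -/

variable {E : Type*} [NormedAddCommGroup E] [NormedSpace ℝ E] [FiniteDimensional ℝ E]

/-- A Hermitian structure `(g, J)` on an open set with the torsion `T` of its Chern connection and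
the Christoffel symbols `Γ` of its Gauduchon connection with parameter `2a`, for which the
torsion-less first Bianchi identity holds. -/
structure IsGauduchonChart (a : ℝ) (U : Set E) (g : E → E →L[ℝ] E →L[ℝ] ℝ) (J : E → E →L[ℝ] E)
    (T Γ : E → E →L[ℝ] E →L[ℝ] E) : Prop where
  a_ne_zero : a ≠ 0
  isOpen : IsOpen U
  differentiableAt_g : ∀ y ∈ U, DifferentiableAt ℝ g y
  differentiableAt_Γ : ∀ y ∈ U, DifferentiableAt ℝ Γ y
  contDiffAt_J : ∀ y ∈ U, ContDiffAt ℝ 2 J y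
  contDiffAt_T : ∀ y ∈ U, ContDiffAt ℝ 2 T y
  hermitian : ∀ y ∈ U, IsHermitianForm (g y) (J y)
  metric : ∀ y ∈ U, ∀ u v w, fderiv ℝ g y u v w = g y (Γ y u v) w + g y v (Γ y u w)
  complex : ∀ y ∈ U, ∀ u v, fderiv ℝ J y u v = J y (Γ y u v) - Γ y u (J y v)
  T_skew : ∀ y ∈ U, ∀ v w, T y v w = -T y w v
  T_J : ∀ y ∈ U, ∀ v w, T y (J y v) w = J y (T y v w)
  torsion : ∀ y ∈ U, ∀ u v z, g y (Γ y u v - Γ y v u) z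
    = (1 - 2 * a) * g y (T y u v) z + a * (g y (T y u z) v - g y (T y v z) u)
  bianchi : ∀ y ∈ U, ∀ u v w,
    (fderiv ℝ Γ y u v w - fderiv ℝ Γ y v u w + Γ y u (Γ y v w) - Γ y v (Γ y u w))
    + (fderiv ℝ Γ y v w u - fderiv ℝ Γ y w v u + Γ y v (Γ y w u) - Γ y w (Γ y v u))
    + (fderiv ℝ Γ y w u v - fderiv ℝ Γ y u w v + Γ y w (Γ y u v) - Γ y u (Γ y w v)) = 0

/-- Near `p`, the operators `Q y` are unitary isomorphisms from `(g p, J p)` to `(g y, J y)` that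
are parallel at `p`. -/
structure IsParallelGauge (g : E → E →L[ℝ] E →L[ℝ] ℝ) (J : E → E →L[ℝ] E)
    (Γ : E → E →L[ℝ] E →L[ℝ] E) (p : E) (Q : E → E →L[ℝ] E) : Prop where
  one : Q p = 1
  hasFDerivAt : HasFDerivAt Q (-Γ p) p
  inner : ∀ᶠ y in 𝓝 p, ∀ v w, g y (Q y v) (Q y w) = g p v w
  map_J : ∀ᶠ y in 𝓝 p, ∀ v, Q y (J p v) = J y (Q y v)

/-- The covariant derivative of a tensor of type `(2, 1)`. -/
def covDeriv (Γ T : E → E →L[ℝ] E →L[ℝ] E) (p u : E) : E →L[ℝ] E →L[ℝ] E :=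
  fderiv ℝ T p u + (ContinuousLinearMap.compL ℝ E E E (Γ p u)) ∘L T p - T p ∘L Γ p u
    - ((ContinuousLinearMap.compL ℝ E E E).flip (Γ p u)) ∘L T p

lemma covDeriv_apply (Γ T : E → E →L[ℝ] E →L[ℝ] E) (p u v w : E) : covDeriv Γ T p u v w
    = fderiv ℝ T p u v w + Γ p u (T p v w) - T p (Γ p u v) w - T p v (Γ p u w) := by
  simp [covDeriv]

section Components

variable {ι : Type*}

/-- The components of the `(1, 0)`-part of the covariant derivative of `T`. -/
def covDerivHolo (g : E → E →L[ℝ] E →L[ℝ] ℝ) (J : E → E →L[ℝ] E) (T Γ : E → E →L[ℝ] E →L[ℝ] E)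
    (e : ι → E) (p : E) (l i j k : ι) : ℂ :=
  1 / 2 * (unitaryArray (g p) (J p) (covDeriv Γ T p (e l)) e i j k
    - Complex.I * unitaryArray (g p) (J p) (covDeriv Γ T p (J p (e l))) e i j k)

/-- The components of the `(0, 1)`-part of the covariant derivative of `T`. -/
def covDerivAntiholo (g : E → E →L[ℝ] E →L[ℝ] ℝ) (J : E → E →L[ℝ] E)
    (T Γ : E → E →L[ℝ] E →L[ℝ] E) (e : ι → E) (p : E) (l i j k : ι) : ℂ :=
  1 / 2 * (unitaryArray (g p) (J p) (covDeriv Γ T p (e l)) e i j k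
    + Complex.I * unitaryArray (g p) (J p) (covDeriv Γ T p (J p (e l))) e i j k)

end Components

namespace IsParallelGauge

variable {ι : Type*} [Fintype ι] [DecidableEq ι] {g : E → E →L[ℝ] E →L[ℝ] ℝ} {J : E → E →L[ℝ] E}
  {Γ : E → E →L[ℝ] E →L[ℝ] E} {p : E} {Q : E → E →L[ℝ] E} (hQ : IsParallelGauge g J Γ p Q)
  {e : ι → E}
include hQ

lemma isUnitaryFrame (hH : IsHermitianForm (g p) (J p)) (he : IsUnitaryFrame (g p) (J p) e) :
    ∀ᶠ y in 𝓝 p, IsUnitaryFrame (g y) (J y) fun i ↦ Q y (e i) := by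
  filter_upwards [hQ.inner, hQ.map_J] with y h1 h2
  have hinj : Function.Injective (Q y).toLinearMap := by
    refine (injective_iff_map_eq_zero _).2 fun v hv ↦ hH.ext fun z ↦ ?_
    have hv' : Q y v = 0 := hv
    rw [← h1, hv']
    simp
  have hsurj := LinearMap.injective_iff_surjective.1 hinj
  refine ⟨fun i j ↦ by rw [h1, he.inner], fun i j ↦ by rw [← h2, h1, he.inner_J], fun v ↦ ?_⟩
  obtain ⟨w, rfl⟩ := hsurj v
  change Q y w = ∑ i, (g y (Q y w) (Q y (e i)) • Q y (e i)
    + g y (Q y w) (J y (Q y (e i))) • J y (Q y (e i)))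
  simp only [← h2, h1]
  conv_lhs => rw [he.expand w]
  simp

lemma coord_map : ∀ᶠ y in 𝓝 p, ∀ i v, unitaryCoord (g y) (J y) (fun i ↦ Q y (e i)) i (Q y v)
    = unitaryCoord (g p) (J p) e i v := by
  filter_upwards [hQ.inner, hQ.map_J] with y h1 h2 i v
  simp only [unitaryCoord_apply, ← h2, h1]

/-- In an adapted frame, the derivative of a component is the component of the covariant
derivative. -/
lemma hasFDerivAt_coord (hg : DifferentiableAt ℝ g p)
    (hm : ∀ u v w, fderiv ℝ g p u v w = g p (Γ p u v) w + g p v (Γ p u w))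
    {W : E → E} {W' : E →L[ℝ] E} (hW : HasFDerivAt W W' p) (k : ι) :
    HasFDerivAt (fun y ↦ unitaryCoord (g y) (J y) (fun i ↦ Q y (e i)) k (W y))
      (unitaryCoord (g p) (J p) e k ∘L (W' + (Γ p).flip (W p))) p := by
  have h1 (z : E) : HasFDerivAt (fun y ↦ g y (W y) (Q y z))
      ((g p).flip z ∘L (W' + (Γ p).flip (W p))) p := by
    refine ((hg.hasFDerivAt.clm_apply hW).clm_apply
      (hQ.hasFDerivAt.clm_apply (hasFDerivAt_const z p))).congr_fderiv ?_
    ext u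
    simp [hm, hQ.one]
    ring
  have h2 := (Complex.ofRealCLM.hasFDerivAt.comp p (h1 (e k))).add
    ((Complex.ofRealCLM.hasFDerivAt.comp p (h1 (J p (e k)))).const_mul Complex.I)
  refine (h2.congr_of_eventuallyEq ?_).congr_fderiv ?_
  · filter_upwards [hQ.map_J] with y hy
    simp [unitaryCoord_apply, hy]
  · ext u
    simp [unitaryCoord_apply]
    ring

lemma hasWirtingerAt_array (hH : IsHermitianForm (g p) (J p)) (he : IsUnitaryFrame (g p) (J p) e)
    (hg : DifferentiableAt ℝ g p)
    (hm : ∀ u v w, fderiv ℝ g p u v w = g p (Γ p u v) w + g p v (Γ p u w))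
    {T : E → E →L[ℝ] E →L[ℝ] E} (hT : DifferentiableAt ℝ T p) (i j k : ι) :
    HasWirtingerAt (unitaryCoord (g p) (J p) e)
      (fun y ↦ unitaryArray (g y) (J y) (T y) (fun i ↦ Q y (e i)) i j k)
      (fun l ↦ covDerivHolo g J T Γ e p l i j k) (fun l ↦ covDerivAntiholo g J T Γ e p l i j k)
      p := by
  have h1 (i : ι) := hQ.hasFDerivAt.clm_apply (hasFDerivAt_const (e i) p)
  have h2 := hQ.hasFDerivAt_coord (e := e) hg hm
    ((hT.hasFDerivAt.clm_apply (h1 i)).clm_apply (h1 j)) k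
  rw [IsUnitaryFrame.eq_wirtinger hH he (unitaryCoord (g p) (J p) e k ∘L _)] at h2
  have h3 (u : E) := covDeriv_apply Γ T p u (e i) (e j)
  refine HasWirtingerAt.congr_deriv h2 (fun l ↦ ?_) (fun l ↦ ?_) <;>
  · simp only [covDerivHolo, covDerivAntiholo, unitaryArray, h3]
    simp [hQ.one]
    ring

end IsParallelGauge

namespace IsGauduchonChart

variable {a : ℝ} {U : Set E} {g : E → E →L[ℝ] E →L[ℝ] ℝ} {J : E → E →L[ℝ] E}
  {T Γ : E → E →L[ℝ] E →L[ℝ] E} (h : IsGauduchonChart a U g J T Γ) {p : E} (hp : p ∈ U)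
include h hp

lemma mem_nhds : U ∈ 𝓝 p := h.isOpen.mem_nhds hp

lemma differentiableAt_T : DifferentiableAt ℝ T p :=
  (h.contDiffAt_T p hp).differentiableAt (by simp)

lemma differentiableAt_J : DifferentiableAt ℝ J p :=
  (h.contDiffAt_J p hp).differentiableAt (by simp)

lemma exists_isParallelGauge : ∃ Q, IsParallelGauge g J Γ p Q := by
  have hH : ∀ᶠ y in 𝓝 p, IsHermitianForm (g y) (J y) :=
    Filter.mem_of_superset (h.mem_nhds hp) h.hermitian
  obtain ⟨Q, h1, h2, h3⟩ := exists_unitary_gauge (h.differentiableAt_g p hp).hasFDerivAt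
    (h.differentiableAt_J hp).hasFDerivAt hH (h.metric p hp) (h.complex p hp)
  exact ⟨Q, h1, h2, h3.mono fun _ h ↦ h.1, h3.mono fun _ h ↦ h.2⟩

lemma covDeriv_skew (u v w : E) : covDeriv Γ T p u v w = -covDeriv Γ T p u w v := by
  have hd := (h.differentiableAt_T hp).hasFDerivAt
  have h1 : fderiv ℝ T p u v w = -fderiv ℝ T p u w v := by
    have e1 := ((hd.clm_apply (hasFDerivAt_const v p)).clm_apply (hasFDerivAt_const w p))
    have e2 := ((hd.clm_apply (hasFDerivAt_const w p)).clm_apply (hasFDerivAt_const v p)).neg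
    have e3 := e1.unique (e2.congr_of_eventuallyEq
      (Filter.mem_of_superset (h.mem_nhds hp) fun y hy ↦ h.T_skew y hy v w))
    simpa using congrArg (fun L : E →L[ℝ] E ↦ L u) e3
  rw [covDeriv_apply, covDeriv_apply, h1, h.T_skew p hp v w, h.T_skew p hp (Γ p u v),
    h.T_skew p hp v (Γ p u w), map_neg]
  abel

lemma covDeriv_J (u v w : E) : covDeriv Γ T p u (J p v) w = J p (covDeriv Γ T p u v w) := by
  have hd := (h.differentiableAt_T hp).hasFDerivAt
  have hJ := (h.differentiableAt_J hp).hasFDerivAt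
  have cv := hasFDerivAt_const (𝕜 := ℝ) v p
  have cw := hasFDerivAt_const (𝕜 := ℝ) w p
  have e1 := (hd.clm_apply (hJ.clm_apply cv)).clm_apply cw
  have e2 := hJ.clm_apply ((hd.clm_apply cv).clm_apply cw)
  have e3 := e1.unique (e2.congr_of_eventuallyEq
      (Filter.mem_of_superset (h.mem_nhds hp) fun y hy ↦ h.T_J y hy v w))
  have e4 := congrArg (fun L : E →L[ℝ] E ↦ L u) e3
  simp only [add_apply, ContinuousLinearMap.comp_apply, ContinuousLinearMap.flip_apply,
    zero_apply, map_zero, zero_add, h.complex p hp, map_sub, sub_apply,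
    h.T_J p hp] at e4
  simp only [covDeriv_apply, map_sub, map_add, h.T_J p hp]
  rw [← sub_eq_zero] at e4 ⊢
  rw [← e4]
  abel

/-- The covariant derivative of the torsion of the Gauduchon connection. -/
lemma inner_covDeriv_torsion (u v w z : E) :
    g p (fderiv ℝ Γ p u v w - fderiv ℝ Γ p u w v + Γ p u (Γ p v w - Γ p w v)
        - (Γ p (Γ p u v) w - Γ p w (Γ p u v)) - (Γ p v (Γ p u w) - Γ p (Γ p u w) v)) z
      = (1 - 2 * a) * g p (covDeriv Γ T p u v w) z
        + a * (g p (covDeriv Γ T p u v z) w - g p (covDeriv Γ T p u w z) v) := by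
  have hd := (h.differentiableAt_T hp).hasFDerivAt
  have hg := (h.differentiableAt_g p hp).hasFDerivAt
  have hΓ := (h.differentiableAt_Γ p hp).hasFDerivAt
  have c (v : E) := hasFDerivAt_const (𝕜 := ℝ) v p
  have e1 := (hg.clm_apply (((hΓ.clm_apply (c v)).clm_apply (c w)).sub
    ((hΓ.clm_apply (c w)).clm_apply (c v)))).clm_apply (c z)
  have eT (v w z : E) := (hg.clm_apply ((hd.clm_apply (c v)).clm_apply (c w))).clm_apply (c z)
  have e2 := ((eT v w z).const_mul (1 - 2 * a)).add (((eT v z w).sub (eT w z v)).const_mul a)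
  have e3 := e1.unique (e2.congr_of_eventuallyEq
      (Filter.mem_of_superset (h.mem_nhds hp) fun y hy ↦ h.torsion y hy v w z))
  have e4 := congrArg (fun L : E →L[ℝ] ℝ ↦ L u) e3
  simp only [add_apply, sub_apply, smul_apply, smul_eq_mul, ContinuousLinearMap.comp_apply,
    ContinuousLinearMap.flip_apply, zero_apply, map_zero, zero_add, h.metric p hp, Pi.sub_apply,
    map_sub] at e4
  have t1 := h.torsion p hp (Γ p u v) w z
  have t2 := h.torsion p hp v (Γ p u w) z
  have t3 := h.torsion p hp v w (Γ p u z)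
  simp only [covDeriv_apply, map_sub, map_add, sub_apply, add_apply] at t1 t2 t3 ⊢
  linear_combination e4 - t1 - t2 - t3

variable {ι : Type*} [Fintype ι] [DecidableEq ι] {e : ι → E}
  (he : IsUnitaryFrame (g p) (J p) e)
include he

lemma array_covDeriv (u : E) (i j k : ι) :
    unitaryArray (g p) (J p) (covDeriv Γ T p u) e i j k
      = TorsionArray.arrayDeriv (covDerivHolo g J T Γ e p) (covDerivAntiholo g J T Γ e p)
        (fun l ↦ unitaryCoord (g p) (J p) e l u) i j k := by
  obtain ⟨Q, hQ⟩ := h.exists_isParallelGauge hp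
  have h1 (i : ι) := hQ.hasFDerivAt.clm_apply (hasFDerivAt_const (e i) p)
  have h2 := hQ.hasFDerivAt_coord (e := e) (h.differentiableAt_g p hp) (h.metric p hp)
    (((h.differentiableAt_T hp).hasFDerivAt.clm_apply (h1 i)).clm_apply (h1 j)) k
  have h3 := hQ.hasWirtingerAt_array (h.hermitian p hp) he (h.differentiableAt_g p hp)
    (h.metric p hp) (h.differentiableAt_T hp) i j k
  have h4 := congrArg (fun L : E →L[ℝ] ℂ ↦ L u) (h2.unique h3)
  simp only [wirtinger_apply] at h4
  rw [TorsionArray.arrayDeriv, ← h4, unitaryArray, covDeriv_apply]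
  simp [hQ.one]
  ring

/-- The equations for the torsion of the Chern connection. -/
theorem firstOrder : TorsionArray.FirstOrder a (unitaryArray (g p) (J p) (T p) e)
    (covDerivHolo g J T Γ e p) (covDerivAntiholo g J T Γ e p) := by
  have hH := h.hermitian p hp
  refine .of_bianchi h.a_ne_zero (IsUnitaryFrame.array_skew (h.T_skew p hp))
    (fun l i j k ↦ ?_) (fun l i j k ↦ ?_) fun x y z k ↦ ?_
  · simp only [covDerivHolo, IsUnitaryFrame.array_skew (h.covDeriv_skew hp _) i j]
    ring
  · simp only [covDerivAntiholo, IsUnitaryFrame.array_skew (h.covDeriv_skew hp _) i j]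
    ring
  obtain ⟨u, hu⟩ := IsUnitaryFrame.exists_coord_eq hH he x
  obtain ⟨v, hv⟩ := IsUnitaryFrame.exists_coord_eq hH he y
  obtain ⟨w, hw⟩ := IsUnitaryFrame.exists_coord_eq hH he z
  obtain rfl : (fun i ↦ unitaryCoord (g p) (J p) e i u) = x := funext hu
  obtain rfl : (fun i ↦ unitaryCoord (g p) (J p) e i v) = y := funext hv
  obtain rfl : (fun i ↦ unitaryCoord (g p) (J p) e i w) = z := funext hw
  have h1 (u : E) : arrayDeriv (covDerivHolo g J T Γ e p) (covDerivAntiholo g J T Γ e p)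
      (fun l ↦ unitaryCoord (g p) (J p) e l u) = unitaryArray (g p) (J p) (covDeriv Γ T p u) e := by
    ext i j k
    rw [h.array_covDeriv hp he]
  have h2 (u v : E) (k : ι) := IsUnitaryFrame.coord_torsion hH he (h.T_skew p hp) (h.T_J p hp)
    (h.torsion p hp u v) k
  have h2' (u v : E) := funext (h2 u v)
  -- As `g` is parallel, `∇_u T^s` arises from `∇_u T` by the same formula by which `T^s` arises
  -- from `T`.
  have h3 (u v w : E) (k : ι) := IsUnitaryFrame.coord_torsion hH he (h.covDeriv_skew hp u)
    (h.covDeriv_J hp u) (h.inner_covDeriv_torsion hp u v w) k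
  rw [h1, h1, h1, ← h3, ← h3, ← h3, ← h2' u v, ← h2' v w, ← h2' w u, ← h2 _ w, ← h2 _ u, ← h2 _ v]
  simp only [← map_add]
  -- Expanding covariant derivatives, the cyclic sum of `∇T^s` and `T^s∘T^s` collapses to the cyclic
  -- sum of the curvature.
  rw [show (0 : ℂ) = unitaryCoord (g p) (J p) e k 0 by simp, ← h.bianchi p hp u v w]
  congr 1
  simp only [map_sub, sub_apply]
  abel

end IsGauduchonChart

end

/-! ### Derivatives of contracted components in an adapted frame. -/

noncomputable section

open scoped ComplexConjugate Topology
open TorsionArray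

/-! ### Derivatives of the contractions of a torsion array -/

namespace HasWirtingerAt

variable {ι : Type*} [Fintype ι] {E : Type*} [NormedAddCommGroup E] [NormedSpace ℝ E]
  {c : ι → E →L[ℝ] ℂ} {p : E} {t : E → ι → ι → ι → ℂ} {D U : ι → ι → ι → ι → ℂ}
  (ht : ∀ i j k, HasWirtingerAt c (fun y ↦ t y i j k) (fun l ↦ D l i j k) (fun l ↦ U l i j k) p)
include ht

lemma eta (j : ι) : HasWirtingerAt c (fun y ↦ eta (t y) j) (fun l ↦ ∑ s, D l s j s)
    (fun l ↦ ∑ s, U l s j s) p := .sum fun s ↦ ht s j s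

lemma sum_eta_mul (i j : ι) : HasWirtingerAt c (fun y ↦ ∑ m, TorsionArray.eta (t y) m * t y i j m)
    (fun l ↦ ∑ m, ((∑ s, D l s m s) * t p i j m + TorsionArray.eta (t p) m * D l i j m))
    (fun l ↦ ∑ m, ((∑ s, U l s m s) * t p i j m + TorsionArray.eta (t p) m * U l i j m)) p :=
  .sum fun m ↦ (eta ht m).mul (ht i j m)

lemma normSqEta : HasWirtingerAt c (fun y ↦ (normSqEta (t y) : ℂ)) (dNormSqEta (t p) D U)
    (fun l ↦ conj (dNormSqEta (t p) D U l)) p := by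
  have h1 : (fun y ↦ (TorsionArray.normSqEta (t y) : ℂ))
      = fun y ↦ ∑ j, TorsionArray.eta (t y) j * conj (TorsionArray.eta (t y) j) := by
    ext y
    simp only [TorsionArray.normSqEta, Complex.ofReal_sum, Complex.mul_conj]
  rw [h1]
  refine (HasWirtingerAt.sum fun j ↦ (eta ht j).mul (eta ht j).star).congr_deriv
    (fun l ↦ rfl) (fun l ↦ ?_)
  simp only [dNormSqEta, map_sum, map_add, map_mul, Complex.conj_conj]
  exact Finset.sum_congr rfl fun _ _ ↦ by ring

lemma normSq : HasWirtingerAt c (fun y ↦ (normSq (t y) : ℂ)) (dNormSq (t p) D U)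
    (fun l ↦ conj (dNormSq (t p) D U l)) p := by
  have h1 : (fun y ↦ (TorsionArray.normSq (t y) : ℂ))
      = fun y ↦ ∑ i, ∑ j, ∑ k, t y i j k * conj (t y i j k) := by
    ext y
    simp only [TorsionArray.normSq, Complex.ofReal_sum, Complex.mul_conj]
  rw [h1]
  refine (HasWirtingerAt.sum fun i ↦ .sum fun j ↦ .sum fun k ↦
    (ht i j k).mul (ht i j k).star).congr_deriv (fun l ↦ rfl) (fun l ↦ ?_)
  simp only [dNormSq, map_sum, map_add, map_mul, Complex.conj_conj]
  exact sum_congr₃ fun _ _ _ ↦ by ring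

lemma gramLower (j k : ι) : ∃ d', HasWirtingerAt c (fun y ↦ gramLower (t y) j k)
    (fun l ↦ dGramLower (t p) D U l j k) d' p :=
  ⟨_, .sum fun q ↦ .sum fun m ↦ (ht q j m).mul (ht q k m).star⟩

lemma gramUpper (k j : ι) : ∃ d', HasWirtingerAt c (fun y ↦ gramUpper (t y) k j)
    (fun l ↦ dGramUpper (t p) D U l k j) d' p :=
  ⟨_, .sum fun q ↦ .sum fun m ↦ (ht q m k).mul (ht q m j).star⟩

lemma ad (l j : ι) : ∃ d', HasWirtingerAt c (fun y ↦ ad (t y) l j)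
    (fun i ↦ dAd (t p) D U i l j) d' p :=
  ⟨_, .sum fun r ↦ (eta ht r).star.mul (ht r j l)⟩

lemma conjAd (l j : ι) : ∃ d', HasWirtingerAt c (fun y ↦ conj (TorsionArray.ad (t y) l j))
    (fun i ↦ dConjAd (t p) D U i l j) d' p := by
  have h1 : (fun y ↦ conj (TorsionArray.ad (t y) l j))
      = fun y ↦ ∑ r, TorsionArray.eta (t y) r * conj (t y r j l) := by
    ext y
    simp [TorsionArray.ad]
  rw [h1]
  exact ⟨_, .sum fun r ↦ (eta ht r).mul (ht r j l).star⟩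

lemma beta (a : ℝ) (j k : ι) : ∃ d', HasWirtingerAt c (fun y ↦ beta (t y) a j k)
    (fun i ↦ dBeta (t p) D U a i j k) d' p := by
  obtain ⟨_, h1⟩ := gramLower ht j k
  obtain ⟨_, h2⟩ := conjAd ht j k
  obtain ⟨_, h3⟩ := gramUpper ht k j
  obtain ⟨_, h4⟩ := ad ht k j
  exact ⟨_, (((h1.const_mul (1 - a)).sub (h2.const_mul (1 - 3 * a))).sub (h3.const_mul a)).sub
    (h4.const_mul a)⟩

lemma killing (i j : ι) : ∃ d, HasWirtingerAt c (fun y ↦ killing (t y) i j) d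
    (fun l ↦ ∑ k, ∑ m, (U l k j m * t p m i k + t p k j m * U l m i k)) p :=
  ⟨_, .sum fun k ↦ .sum fun m ↦ (ht k j m).mul (ht m i k)⟩

end HasWirtingerAt

namespace IsUnitaryFrame

variable {ι : Type*} [Fintype ι] {E : Type*} [NormedAddCommGroup E] [NormedSpace ℝ E]
  [DecidableEq ι] {g : E →L[ℝ] E →L[ℝ] ℝ} {J : E →L[ℝ] E} {e : ι → E}
  (h : IsHermitianForm g J) (he : IsUnitaryFrame g J e)
include h he

lemma deriv_eq_zero_of_isLocalMax {F : E → ℝ} {d d' : ι → ℂ} {p : E}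
    (hF : HasWirtingerAt (unitaryCoord g J e) (fun y ↦ (F y : ℂ)) d d' p) (hmax : IsLocalMax F p)
    (l : ι) : d l = 0 := by
  have h1 : HasFDerivAt F (Complex.reCLM ∘L wirtinger (unitaryCoord g J e) d d') p :=
    Complex.reCLM.hasFDerivAt.comp p hF
  have h2 := hmax.hasFDerivAt_eq_zero h1
  rw [h2] at h1
  have h3 : HasFDerivAt (fun y ↦ (F y : ℂ)) (Complex.ofRealCLM ∘L (0 : E →L[ℝ] ℝ)) p :=
    Complex.ofRealCLM.hasFDerivAt.comp p h1
  have h4 : wirtinger (unitaryCoord g J e) d d' = wirtinger (unitaryCoord g J e) 0 0 := by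
    rw [HasFDerivAt.unique hF h3]
    ext v
    simp [wirtinger_apply]
  exact (wirtinger_unique h he h4 l).1

lemma deriv_eq_of_eventuallyEq {f₁ f₂ : E → ℂ} {d d' e₁ e₁' : ι → ℂ} {p : E}
    (h1 : HasWirtingerAt (unitaryCoord g J e) f₁ d d' p)
    (h2 : HasWirtingerAt (unitaryCoord g J e) f₂ e₁ e₁' p) (h3 : f₁ =ᶠ[𝓝 p] f₂) (l : ι) :
    d l = e₁ l ∧ d' l = e₁' l :=
  h1.unique h he (h2.congr_of_eventuallyEq h3) l

end IsUnitaryFrame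

/-! ### The exterior derivative of the trace of the torsion -/

section Trace

variable {E : Type*} [NormedAddCommGroup E] [NormedSpace ℝ E] [FiniteDimensional ℝ E]

/-- The exterior derivative of a complex-valued one-form. -/
def extDerivForm (η : E → E →L[ℝ] ℂ) (y u v : E) : ℂ := fderiv ℝ η y u v - fderiv ℝ η y v u

lemma contDiffAt_complexTrace {J : E → E →L[ℝ] E} {T : E → E →L[ℝ] E →L[ℝ] E} {p : E}
    (hJ : ContDiffAt ℝ 2 J p) (hT : ContDiffAt ℝ 2 T p) :
    ContDiffAt ℝ 2 (fun y ↦ complexTrace (J y) (T y)) p := by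
  have h1 : ContDiffAt ℝ 2 (fun y ↦ (T y).flip) p := by
    have := (ContinuousLinearMap.flipₗᵢ ℝ E E E).toContinuousLinearEquiv.contDiff (n := 2)
    exact this.contDiffAt.comp p hT
  have h2 : ContDiffAt ℝ 2 (fun y ↦ Complex.ofRealCLM ∘L (traceL E) ∘L (T y).flip) p :=
    contDiffAt_const.clm_comp (contDiffAt_const.clm_comp h1)
  have h3 : ContDiffAt ℝ 2 (fun y ↦ Complex.ofRealCLM ∘L (traceL E) ∘L (T y).flip ∘L J y) p :=
    contDiffAt_const.clm_comp (contDiffAt_const.clm_comp (h1.clm_comp hJ))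
  exact (h2.sub (h3.const_smul Complex.I)).const_smul (1 / 2 : ℂ)

end Trace

end

/-! ### The identity `d(dη) = 0` in an adapted frame. -/

noncomputable section

open scoped ComplexConjugate Topology
open TorsionArray

variable {E : Type*} [NormedAddCommGroup E] [NormedSpace ℝ E] [FiniteDimensional ℝ E]

/-- The components of the exterior derivative of the trace of the torsion. -/
def extDerivTrace {ι : Type*} [Fintype ι] (a : ℝ) (g : E → E →L[ℝ] E →L[ℝ] ℝ) (J : E → E →L[ℝ] E)
    (T Γ : E → E →L[ℝ] E →L[ℝ] E) (e : ι → E) (y : E) (j k : ι) : ℂ :=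
  (∑ s, covDerivAntiholo g J T Γ e y k s j s)
    - a * conj (ad (unitaryArray (g y) (J y) (T y) e) j k)

namespace IsGauduchonChart

variable {a : ℝ} {U : Set E} {g : E → E →L[ℝ] E →L[ℝ] ℝ} {J : E → E →L[ℝ] E}
  {T Γ : E → E →L[ℝ] E →L[ℝ] E} (h : IsGauduchonChart a U g J T Γ) {p : E} (hp : p ∈ U)
include h hp

lemma eventually_isParallelGauge {Q : E → E →L[ℝ] E} (hQ : IsParallelGauge g J Γ p Q)
    {ι : Type*} [Fintype ι] [DecidableEq ι] {e : ι → E} (he : IsUnitaryFrame (g p) (J p) e) :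
    ∀ᶠ y in 𝓝 p, y ∈ U ∧ IsUnitaryFrame (g y) (J y) (fun i ↦ Q y (e i)) :=
  Filter.Eventually.and (h.mem_nhds hp) (hQ.isUnitaryFrame (h.hermitian p hp) he)

/-- Symmetry of the second derivative of `η` gives `d(dη) = 0`. Evaluation on the moving vectors `Q
y v` adds the derivative `-Γ` of the gauge, which in the cyclic sum combines to the torsion. -/
lemma hasFDerivAt_extDerivForm {Q : E → E →L[ℝ] E} (hQ : IsParallelGauge g J Γ p Q) :
    ∃ L : E → E → E →L[ℝ] ℂ, (∀ v w, HasFDerivAt (fun y ↦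
      extDerivForm (fun y ↦ complexTrace (J y) (T y)) y (Q y v) (Q y w)) (L v w) p) ∧
      ∀ u v w, L v w u + L w u v + L u v w
        + extDerivForm (fun y ↦ complexTrace (J y) (T y)) p (Γ p u v - Γ p v u) w
        + extDerivForm (fun y ↦ complexTrace (J y) (T y)) p (Γ p v w - Γ p w v) u
        + extDerivForm (fun y ↦ complexTrace (J y) (T y)) p (Γ p w u - Γ p u w) v = 0 := by
  set η : E → E →L[ℝ] ℂ := fun y ↦ complexTrace (J y) (T y) with hη
  have hη2 : ContDiffAt ℝ 2 η p :=
    contDiffAt_complexTrace (h.contDiffAt_J p hp) (h.contDiffAt_T p hp)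
  have hd : HasFDerivAt (fderiv ℝ η) (fderiv ℝ (fderiv ℝ η) p) p :=
    ((hη2.fderiv_right (m := 1) (by norm_num)).differentiableAt (by simp)).hasFDerivAt
  have hs : ∀ u v, fderiv ℝ (fderiv ℝ η) p u v = fderiv ℝ (fderiv ℝ η) p v u := fun u v ↦
    (hη2.isSymmSndFDerivAt (by simp)).eq u v
  have hQv (v : E) := hQ.hasFDerivAt.clm_apply (hasFDerivAt_const (𝕜 := ℝ) v p)
  have h1 (v w : E) := ((hd.clm_apply (hQv v)).clm_apply (hQv w)).sub
    ((hd.clm_apply (hQv w)).clm_apply (hQv v))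
  refine ⟨_, h1, fun u v w ↦ ?_⟩
  simp only [extDerivForm, add_apply, sub_apply, ContinuousLinearMap.comp_apply,
    ContinuousLinearMap.flip_apply, zero_apply, map_zero, zero_add, hQ.one, neg_apply, map_neg,
    one_apply_eq_self, map_sub]
  rw [hs u v, hs v w, hs w u]
  ring

variable {ι : Type*} [Fintype ι] [DecidableEq ι] {e : ι → E}
  (he : IsUnitaryFrame (g p) (J p) e)
include he

lemma hasWirtingerAt_array {Q : E → E →L[ℝ] E} (hQ : IsParallelGauge g J Γ p Q) (i j k : ι) :
    HasWirtingerAt (unitaryCoord (g p) (J p) e)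
      (fun y ↦ unitaryArray (g y) (J y) (T y) (fun i ↦ Q y (e i)) i j k)
      (fun l ↦ covDerivHolo g J T Γ e p l i j k) (fun l ↦ covDerivAntiholo g J T Γ e p l i j k)
      p :=
  hQ.hasWirtingerAt_array (h.hermitian p hp) he (h.differentiableAt_g p hp)
    (h.metric p hp) (h.differentiableAt_T hp) i j k

lemma complexTrace_eq (v : E) : complexTrace (J p) (T p) v
    = ∑ j, eta (unitaryArray (g p) (J p) (T p) e) j * unitaryCoord (g p) (J p) e j v := by
  rw [IsUnitaryFrame.coord_linear he (complexTrace_J (h.hermitian p hp))]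
  exact Finset.sum_congr rfl fun j _ ↦ by
    rw [he.complexTrace_eq (h.hermitian p hp) (h.T_skew p hp) (h.T_J p hp)]

/-- Apply `dη(u, v) = (∇_u η) v - (∇_v η) u + η(T^s(u, v))`. The covariant derivatives are read off
in the adapted frame, and `FirstOrder.extDeriv_eta` shows that only the `(1, 1)`-part survives. -/
lemma extDerivForm_eq (u v : E) : extDerivForm (fun y ↦ complexTrace (J y) (T y)) p u v
    = betaForm (extDerivTrace a g J T Γ e p) (fun i ↦ unitaryCoord (g p) (J p) e i u)
      (fun i ↦ unitaryCoord (g p) (J p) e i v) := by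
  obtain ⟨Q, hQ⟩ := h.exists_isParallelGauge hp
  have hη : DifferentiableAt ℝ (fun y ↦ complexTrace (J y) (T y)) p :=
    (contDiffAt_complexTrace (h.contDiffAt_J p hp) (h.contDiffAt_T p hp)).differentiableAt
      (by simp)
  have key (u v : E) : fderiv ℝ (fun y ↦ complexTrace (J y) (T y)) p u v
      - complexTrace (J p) (T p) (Γ p u v)
      = ∑ j, (∑ l, ((∑ s, covDerivHolo g J T Γ e p l s j s) * unitaryCoord (g p) (J p) e l u
        + (∑ s, covDerivAntiholo g J T Γ e p l s j s) * conj (unitaryCoord (g p) (J p) e l u)))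
          * unitaryCoord (g p) (J p) e j v := by
    have h1 := hη.hasFDerivAt.clm_apply
      (hQ.hasFDerivAt.clm_apply (hasFDerivAt_const (𝕜 := ℝ) v p))
    have h2 : HasFDerivAt (fun y ↦ ∑ j, eta (unitaryArray (g y) (J y) (T y) (fun i ↦ Q y (e i))) j
        * unitaryCoord (g p) (J p) e j v) _ p := HasFDerivAt.fun_sum fun j _ ↦
      HasFDerivAt.mul_const (HasWirtingerAt.eta (h.hasWirtingerAt_array hp he hQ) j)
        (unitaryCoord (g p) (J p) e j v)
    have h3 := h1.unique (h2.congr_of_eventuallyEq (by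
      filter_upwards [h.eventually_isParallelGauge hp hQ he, hQ.coord_map (e := e)] with y hy hc
      rw [h.complexTrace_eq hy.1 hy.2]
      simp only [hc]))
    have h4 := congrArg (fun L : E →L[ℝ] ℂ ↦ L u) h3
    simp only [add_apply, ContinuousLinearMap.comp_apply, ContinuousLinearMap.flip_apply,
      zero_apply, map_zero, zero_add, hQ.one, neg_apply, map_neg, one_apply_eq_self, sum_apply,
      smul_apply, smul_eq_mul, wirtinger_apply] at h4
    rw [sub_eq_add_neg, add_comm, h4]
    exact Finset.sum_congr rfl fun j _ ↦ mul_comm _ _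
  have h1 := (h.firstOrder hp he).extDeriv_eta (fun i ↦ unitaryCoord (g p) (J p) e i u)
    (fun i ↦ unitaryCoord (g p) (J p) e i v)
  rw [← key, ← key] at h1
  have h2 : ∑ k, eta (unitaryArray (g p) (J p) (T p) e) k
      * gauduchonTorsion a (unitaryArray (g p) (J p) (T p) e)
        (fun i ↦ unitaryCoord (g p) (J p) e i u) (fun i ↦ unitaryCoord (g p) (J p) e i v) k
      = complexTrace (J p) (T p) (Γ p u v - Γ p v u) := by
    rw [h.complexTrace_eq hp he]
    exact Finset.sum_congr rfl fun k _ ↦ by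
      rw [IsUnitaryFrame.coord_torsion (h.hermitian p hp) he (h.T_skew p hp) (h.T_J p hp)
        (h.torsion p hp u v) k]
  rw [h2, map_sub] at h1
  rw [extDerivForm]
  change _ = betaForm (fun j k ↦ extDerivTrace a g J T Γ e p j k) _ _
  simp only [extDerivTrace]
  rw [← h1]
  ring

/-- The components of the equation `d(dη) = 0`. -/
lemma extDeriv_extDerivTrace {Q : E → E →L[ℝ] E} (hQ : IsParallelGauge g J Γ p Q)
    {b : E → ι → ι → ℂ} {d d' : ι → ι → ι → ℂ}
    (hb : ∀ᶠ y in 𝓝 p, ∀ j k, b y j k = extDerivTrace a g J T Γ (fun i ↦ Q y (e i)) y j k)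
    (hd : ∀ j k, HasWirtingerAt (unitaryCoord (g p) (J p) e) (fun y ↦ b y j k)
      (fun l ↦ d l j k) (fun l ↦ d' l j k) p) (i j k : ι) :
    d i j k - d j i k
      + (1 - 2 * a) * (∑ m, unitaryArray (g p) (J p) (T p) e i j m * b p m k)
      - a * (∑ l, unitaryArray (g p) (J p) (T p) e j l k * b p i l)
      + a * (∑ l, unitaryArray (g p) (J p) (T p) e i l k * b p j l) = 0 := by
  have hH := h.hermitian p hp
  obtain ⟨L, hL, hL0⟩ := h.hasFDerivAt_extDerivForm hp hQ
  have hbp : b p = extDerivTrace a g J T Γ e p := by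
    ext j k
    rw [hb.self_of_nhds, hQ.one]
    rfl
  refine extDeriv_components (T := unitaryArray (g p) (J p) (T p) e) (β := b p) (d := d) (d' := d')
    (fun x y z ↦ ?_) i j k
  obtain ⟨u, hu⟩ := IsUnitaryFrame.exists_coord_eq hH he x
  obtain ⟨v, hv⟩ := IsUnitaryFrame.exists_coord_eq hH he y
  obtain ⟨w, hw⟩ := IsUnitaryFrame.exists_coord_eq hH he z
  obtain rfl : (fun i ↦ unitaryCoord (g p) (J p) e i u) = x := funext hu
  obtain rfl : (fun i ↦ unitaryCoord (g p) (J p) e i v) = y := funext hv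
  obtain rfl : (fun i ↦ unitaryCoord (g p) (J p) e i w) = z := funext hw
  have h2 (u v : E) := funext (IsUnitaryFrame.coord_torsion hH he (h.T_skew p hp) (h.T_J p hp)
    (h.torsion p hp u v))
  have h3 (u v w : E) : L v w u = betaForm (fun j k ↦ ∑ l, (d l j k
      * unitaryCoord (g p) (J p) e l u + d' l j k * conj (unitaryCoord (g p) (J p) e l u)))
      (fun i ↦ unitaryCoord (g p) (J p) e i v) (fun i ↦ unitaryCoord (g p) (J p) e i w) := by
    have e1 : HasFDerivAt (fun y ↦ -∑ j, ∑ k, b y j k * (unitaryCoord (g p) (J p) e j v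
        * conj (unitaryCoord (g p) (J p) e k w) - unitaryCoord (g p) (J p) e j w
        * conj (unitaryCoord (g p) (J p) e k v))) _ p :=
      (HasFDerivAt.fun_sum fun j _ ↦ HasFDerivAt.fun_sum fun k _ ↦
        HasFDerivAt.mul_const (hd j k) _).neg
    have e2 := (hL v w).unique (e1.congr_of_eventuallyEq (by
      filter_upwards [h.eventually_isParallelGauge hp hQ he, hQ.coord_map (e := e), hb]
        with y hy hc hb
      rw [h.extDerivForm_eq hy.1 hy.2]
      simp only [hc, betaForm, hb]))
    rw [e2, betaForm]
    simp only [neg_apply, sum_apply, smul_apply, wirtinger_apply, smul_eq_mul]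
    congr 1
    exact sum_congr₂ fun _ _ ↦ mul_comm _ _
  rw [← h3, ← h3, ← h3, hbp, ← h2 u v, ← h2 v w, ← h2 w u, ← h.extDerivForm_eq hp he,
    ← h.extDerivForm_eq hp he, ← h.extDerivForm_eq hp he]
  exact hL0 u v w

end IsGauduchonChart

end

/-! ### First and second order conditions at a maximum. -/

noncomputable section

open scoped ComplexConjugate Topology
open TorsionArray

/-! ### The maximum principle -/

/-- If the second derivative were positive, the point would also be a local minimum. The function
would then be locally constant, with second derivative zero. -/
lemma IsLocalMax.second_deriv_nonpos {φ φ' : ℝ → ℝ} {x m : ℝ} (h : IsLocalMax φ x)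
    (h1 : ∀ᶠ s in 𝓝 x, HasDerivAt φ (φ' s) s) (h2 : HasDerivAt φ' m x) : m ≤ 0 := by
  by_contra! hm
  have h3 : deriv φ =ᶠ[𝓝 x] φ' := h1.mono fun s hs ↦ hs.deriv
  have h4 : deriv (deriv φ) x = m := by rw [h3.deriv_eq, h2.deriv]
  have h5 : IsLocalMin φ x := isLocalMin_of_deriv_deriv_pos (by rwa [h4]) h.deriv_eq_zero
    h1.self_of_nhds.continuousAt
  have h6 : φ =ᶠ[𝓝 x] fun _ ↦ φ x := by
    filter_upwards [h, h5] with s hs hs' using le_antisymm hs hs'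
  have h7 : deriv (deriv φ) x = 0 := by
    have : deriv φ =ᶠ[𝓝 x] fun _ ↦ 0 := by
      filter_upwards [h6.eventuallyEq_nhds] with s hs
      rw [hs.deriv_eq, deriv_const]
    rw [this.deriv_eq, deriv_const]
  linarith

variable {E : Type*} [NormedAddCommGroup E] [NormedSpace ℝ E] [FiniteDimensional ℝ E]

namespace IsGauduchonChart

variable {a : ℝ} {U : Set E} {g : E → E →L[ℝ] E →L[ℝ] ℝ} {J : E → E →L[ℝ] E}
  {T Γ : E → E →L[ℝ] E →L[ℝ] E} (h : IsGauduchonChart a U g J T Γ) {p : E} (hp : p ∈ U)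
  {ι : Type*} [Fintype ι] [DecidableEq ι] {e : ι → E} (he : IsUnitaryFrame (g p) (J p) e)
include h hp he

/-- At a local maximum the complex Laplacian is nonpositive. -/
lemma re_sum_antiholo_nonpos {Q : E → E →L[ℝ] E} (hQ : IsParallelGauge g J Γ p Q) {F : E → ℝ}
    {G : E → ι → ℂ} {d d' : ι → ι → ℂ}
    (hF : ∀ᶠ y in 𝓝 p, HasWirtingerAt (unitaryCoord (g y) (J y) fun i ↦ Q y (e i))
      (fun y ↦ (F y : ℂ)) (G y) (fun l ↦ conj (G y l)) y)
    (hG : ∀ l, HasWirtingerAt (unitaryCoord (g p) (J p) e) (fun y ↦ G y l) (fun m ↦ d m l)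
      (fun m ↦ d' m l) p)
    (hmax : IsLocalMax F p) : (∑ l, d' l l).re ≤ 0 := by
  have hH := h.hermitian p hp
  have hG0 (l : ι) : G p l = 0 := by
    have h1 := hF.self_of_nhds
    simp only [hQ.one, one_apply_eq_self] at h1
    exact he.deriv_eq_zero_of_isLocalMax hH h1 hmax l
  -- Restrict `F` to the line through `p` in direction `u`. Its first derivative is `2 Re ∑ G_l
  -- u_l`; since `G` vanishes at `p`, differentiating the frame contributes nothing to the second
  -- derivative.
  have key (u : E) : (∑ l, wirtinger (unitaryCoord (g p) (J p) e) (fun m ↦ d m l) (fun m ↦ d' m l) u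
      * unitaryCoord (g p) (J p) e l u).re ≤ 0 := by
    let γ (s : ℝ) : E := p + s • u
    have hγ (s : ℝ) : HasDerivAt γ u s :=
      (((hasDerivAt_id s).smul_const u).const_add p).congr_deriv (one_smul ℝ u)
    have hγ0 : γ 0 = p := by simp [γ]
    have hγc : Filter.Tendsto γ (𝓝 0) (𝓝 p) := by
      have := (hγ 0).continuousAt.tendsto; rwa [hγ0] at this
    let φ' (y : E) : ℝ := (∑ l, (2 : ℂ) * (G y l
      * unitaryCoord (g y) (J y) (fun i ↦ Q y (e i)) l u)).re
    have h1 : ∀ᶠ s in 𝓝 (0 : ℝ), HasDerivAt (fun s ↦ F (γ s)) (φ' (γ s)) s := by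
      filter_upwards [hγc.eventually hF] with s hs
      have e1 : HasFDerivAt F (Complex.reCLM ∘L wirtinger _ _ _) (γ s) :=
        Complex.reCLM.hasFDerivAt.comp (γ s) hs
      refine (e1.comp_hasDerivAt s (hγ s)).congr_deriv ?_
      simp only [φ', ContinuousLinearMap.comp_apply, wirtinger_apply, Complex.reCLM_apply,
        Complex.re_sum]
      exact Finset.sum_congr rfl fun l _ ↦ by simp; ring
    have h2 (l : ι) := HasFDerivAt.const_mul (HasFDerivAt.mul (hG l) (hQ.hasFDerivAt_coord (e := e)
      (h.differentiableAt_g p hp) (h.metric p hp) (hasFDerivAt_const u p) l)) (2 : ℂ)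
    have h3 := Complex.reCLM.hasFDerivAt.comp p (HasFDerivAt.fun_sum fun l (_ : l ∈ Finset.univ) ↦
      h2 l)
    rw [← hγ0] at h3
    have h4 := h3.comp_hasDerivAt (0 : ℝ) (hγ 0)
    have h5 : IsLocalMax (fun s ↦ F (γ s)) 0 := by
      have : ∀ᶠ s in 𝓝 (0 : ℝ), F (γ s) ≤ F p := hγc.eventually hmax
      rw [← hγ0] at this
      exact this
    have h6 := h5.second_deriv_nonpos h1 h4
    rw [hγ0] at h6
    simp only [ContinuousLinearMap.comp_apply, sum_apply, smul_apply, add_apply, hG0,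
      zero_mul, zero_add, hQ.one, one_apply_eq_self, Complex.reCLM_apply, smul_eq_mul, ← Finset.mul_sum] at h6
    rw [Complex.mul_re] at h6
    simp only [Complex.re_ofNat, Complex.im_ofNat, zero_mul, sub_zero] at h6
    have h7 : (∑ l, wirtinger (unitaryCoord (g p) (J p) e) (fun m ↦ d m l) (fun m ↦ d' m l) u
        * unitaryCoord (g p) (J p) e l u) = ∑ l, unitaryCoord (g p) (J p) e l u
          * wirtinger (unitaryCoord (g p) (J p) e) (fun m ↦ d m l) (fun m ↦ d' m l) u :=
      Finset.sum_congr rfl fun _ _ ↦ mul_comm _ _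
    rw [h7]
    linarith
  rw [Complex.re_sum]
  -- Adding the directions `e m` and `J (e m)` cancels the `(2, 0)`-part `d m m` and leaves twice
  -- the real part of `d' m m`.
  refine Finset.sum_nonpos fun m _ ↦ ?_
  have h1 := key (e m)
  have h2 := key (J p (e m))
  simp only [IsUnitaryFrame.coord_J hH, he.coord_self, he.wirtinger_frame,
    IsUnitaryFrame.wirtinger_J_frame hH he, mul_ite, mul_one, mul_zero, Finset.sum_ite_eq,
    Finset.mem_univ, if_true] at h1 h2
  simp at h1 h2
  linarith

/-- A local maximum of `|η|² + θ |T|²` for `a ≠ 1 / 2`. -/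
theorem normSqEta_eq_zero_of_isLocalMax (ha1 : a ≠ 1) (ha2 : 1 - 2 * a ≠ 0)
    (ha4 : 4 * a - 1 ≠ 0) {θ : ℝ} (hθ : IsGeneric a θ) {F : E → ℝ}
    (hF : ∀ y ∈ U, ∀ e' : ι → E, IsUnitaryFrame (g y) (J y) e' →
      F y = normSqEta (unitaryArray (g y) (J y) (T y) e')
        + θ * normSq (unitaryArray (g y) (J y) (T y) e')) (hmax : IsLocalMax F p) :
    normSqEta (unitaryArray (g p) (J p) (T p) e) = 0 := by
  obtain ⟨Q, hQ⟩ := h.exists_isParallelGauge hp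
  have hH := h.hermitian p hp
  have ha2' : (1 - 2 * a : ℂ) ≠ 0 := by exact_mod_cast ha2
  have ha4' : (4 * a - 1 : ℂ) ≠ 0 := by exact_mod_cast ha4
  have hev := h.eventually_isParallelGauge hp hQ he
  have ht := h.hasWirtingerAt_array hp he hQ
  have hQp : (fun i ↦ Q p (e i)) = e := by simp [hQ.one]
  refine (h.firstOrder hp he).normSqEta_eq_zero h.a_ne_zero ha1 ha2 ha4 hθ (fun i j k ↦ ?_)
    (fun i j k ↦ ?_) fun i ↦ ?_
  -- The `(0, 1)`-derivative of `η ∘ T = 0`, which holds in the whole neighbourhood by the Jacobi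
  -- identity.
  · have h1 := he.deriv_eq_of_eventuallyEq hH (HasWirtingerAt.sum_eta_mul ht i j)
      (HasWirtingerAt.const 0) (by
        filter_upwards [hev] with y hy
        exact sum_eta_mul (h.firstOrder hy.1 hy.2).skew ((h.firstOrder hy.1 hy.2).jacobi ha2') i j)
      k
    simp only [hQp] at h1
    exact h1.2
  · have h1 (j k : ι) := HasWirtingerAt.beta ht a j k
    choose d' hd' using h1
    have h2 := h.extDeriv_extDerivTrace hp he hQ
      (b := fun y j k ↦ a ^ 2 / ((1 - 2 * a) * (4 * a - 1))
        * beta (unitaryArray (g y) (J y) (T y) fun i ↦ Q y (e i)) a j k) (by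
        filter_upwards [hev] with y hy j k
        have := (h.firstOrder hy.1 hy.2).beta_eq ha2 ha4 j k
        rw [extDerivTrace, div_mul_eq_mul_div, ← this]
        exact mul_div_cancel_left₀ _ (mul_ne_zero ha2' ha4')) (fun j k ↦ (hd' j k).const_mul _) i j k
    simp only [hQp, mul_left_comm _ ((a : ℂ) ^ 2 / _), ← Finset.mul_sum] at h2
    have h3 : (a : ℂ) ^ 2 / ((1 - 2 * a) * (4 * a - 1)) ≠ 0 :=
      div_ne_zero (pow_ne_zero 2 (by exact_mod_cast h.a_ne_zero)) (mul_ne_zero ha2' ha4')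
    refine (mul_eq_zero.1 ?_).resolve_left h3
    rw [extDerivBeta]
    linear_combination h2
  · have h1 : HasWirtingerAt _ (fun y ↦ (F y : ℂ)) _ _ p :=
      ((HasWirtingerAt.normSqEta ht).add ((HasWirtingerAt.normSq ht).const_mul
        (θ : ℂ))).congr_of_eventuallyEq (by
        filter_upwards [hev] with y hy
        rw [hF y hy.1 _ hy.2]
        push_cast
        rfl)
    simpa only [hQp] using he.deriv_eq_zero_of_isLocalMax hH h1 hmax i

end IsGauduchonChart

end

/-! ### The maximum principle for `a = 1/2`, and the passage from `η = 0` to `T = 0`. -/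

noncomputable section

open scoped ComplexConjugate Topology
open TorsionArray

variable {E : Type*} [NormedAddCommGroup E] [NormedSpace ℝ E] [FiniteDimensional ℝ E]

namespace IsGauduchonChart

section Half

variable {U : Set E} {g : E → E →L[ℝ] E →L[ℝ] ℝ} {J : E → E →L[ℝ] E}
  {T Γ : E → E →L[ℝ] E →L[ℝ] E} (h : IsGauduchonChart (1 / 2) U g J T Γ) {p : E} (hp : p ∈ U)
  {ι : Type*} [Fintype ι] [DecidableEq ι] {e : ι → E} (he : IsUnitaryFrame (g p) (J p) e)
include h hp he

lemma firstOrder_half : FirstOrder (1 / 2) (unitaryArray (g p) (J p) (T p) e)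
    (covDerivHolo g J T Γ e p) (covDerivAntiholo g J T Γ e p) := h.firstOrder hp he

/-- For `a = 1/2` there is no formula for `∇^{0,1} η` in terms of `T` to differentiate. The
components of the `(1, 1)`-form `dη` are instead recovered by polarization from its values on `(e j,
e k)` and `(e j, J (e k))`, which are differentiable because `η` is twice differentiable. -/
lemma exists_hasWirtingerAt_extDerivTrace {Q : E → E →L[ℝ] E} (hQ : IsParallelGauge g J Γ p Q)
    (j k : ι) : ∃ d d' : ι → ℂ, HasWirtingerAt (unitaryCoord (g p) (J p) e)
      (fun y ↦ extDerivTrace (1 / 2) g J T Γ (fun i ↦ Q y (e i)) y j k) d d' p := by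
  have hH := h.hermitian p hp
  obtain ⟨L, hL, -⟩ := h.hasFDerivAt_extDerivForm hp hQ
  have h1 := ((hL (e j) (e k)).neg.sub ((hL (e j) (J p (e k))).const_mul Complex.I)).const_mul
    (1 / 2 : ℂ)
  rw [IsUnitaryFrame.eq_wirtinger hH he ((1 / 2 : ℂ) • _)] at h1
  refine ⟨_, _, HasWirtingerAt.congr_of_eventuallyEq h1 ?_⟩
  filter_upwards [h.eventually_isParallelGauge hp hQ he, hQ.coord_map (e := e)] with y hy hc
  have h2 (j : ι) : (fun i ↦ if j = i then (1 : ℂ) else 0) = Pi.single j 1 := by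
    ext i
    simp [Pi.single_apply, eq_comm]
  have h3 (j : ι) : (fun i ↦ Complex.I * if j = i then (1 : ℂ) else 0) = Pi.single j Complex.I := by
    ext i
    simp [Pi.single_apply, eq_comm]
  have h4 (j k : ι) (x y : ℂ) (β : ι → ι → ℂ) : betaForm β (Pi.single j x) (Pi.single k y)
      = -(β j k * x * conj y - β k j * conj x * y) := by
    rw [betaForm_single_right, Finset.sum_eq_single j (fun i _ hi ↦ by simp [hi]) (by simp),
      Finset.sum_eq_single j (fun i _ hi ↦ by simp [hi]) (by simp), Pi.single_eq_same]
  simp only [Pi.sub_apply, Pi.neg_apply]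
  rw [h.extDerivForm_eq hy.1 hy.2, h.extDerivForm_eq hy.1 hy.2]
  simp only [hc, IsUnitaryFrame.coord_J hH, he.coord_self, h2, h3, h4, map_one, Complex.conj_I]
  linear_combination ((extDerivTrace (1 / 2) g J T Γ (fun i ↦ Q y (e i)) y j k
    + extDerivTrace (1 / 2) g J T Γ (fun i ↦ Q y (e i)) y k j) / 2) * Complex.I_sq

/-- A local maximum of `|η|²` for the Bismut connection. -/
theorem normSqEta_eq_zero_of_isLocalMax_half {F : E → ℝ}
    (hF : ∀ y ∈ U, ∀ e' : ι → E, IsUnitaryFrame (g y) (J y) e' →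
      F y = normSqEta (unitaryArray (g y) (J y) (T y) e')) (hmax : IsLocalMax F p) :
    normSqEta (unitaryArray (g p) (J p) (T p) e) = 0 := by
  obtain ⟨Q, hQ⟩ := h.exists_isParallelGauge hp
  have hH := h.hermitian p hp
  have hev := h.eventually_isParallelGauge hp hQ he
  have ht := h.hasWirtingerAt_array hp he hQ
  have hQp : (fun i ↦ Q p (e i)) = e := by simp [hQ.one]
  have hβ := h.exists_hasWirtingerAt_extDerivTrace hp he hQ
  choose b b' hb using hβ
  have hc := HasWirtingerAt.conjAd ht
  choose c' hc using hc
  set t := fun y ↦ unitaryArray (g y) (J y) (T y) (fun i ↦ Q y (e i)) with htdef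
  have htp : t p = unitaryArray (g p) (J p) (T p) e := by rw [htdef]; simp only [hQp]
  -- the traces of the antiholomorphic derivative
  have hN (i j : ι) : HasWirtingerAt (unitaryCoord (g p) (J p) e)
      (fun y ↦ ∑ s, covDerivAntiholo g J T Γ (fun i ↦ Q y (e i)) y j s i s)
      (fun l ↦ b i j l + 1 / 2 * dConjAd (t p) (covDerivHolo g J T Γ e p)
        (covDerivAntiholo g J T Γ e p) l i j) (fun l ↦ b' i j l + 1 / 2 * c' i j l) p := by
    refine ((hb i j).add ((hc i j).const_mul (1 / 2))).congr_of_eventuallyEq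
      (Filter.Eventually.of_forall fun y ↦ ?_)
    simp only [extDerivTrace]
    push_cast
    ring
  refine (h.firstOrder_half hp he).normSqEta_eq_zero_half (dN := fun l i j ↦ b i j l
    + 1 / 2 * dConjAd (t p) (covDerivHolo g J T Γ e p) (covDerivAntiholo g J T Γ e p) l i j)
    (fun i ↦ ?_) (fun i l j ↦ ?_) (fun i l j ↦ ?_) (fun i j k ↦ ?_) (fun i ↦ ?_) ?_
  · have h1 : HasWirtingerAt _ (fun y ↦ (F y : ℂ)) _ _ p :=
      (HasWirtingerAt.normSqEta ht).congr_of_eventuallyEq (by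
        filter_upwards [hev] with y hy
        rw [hF y hy.1 _ hy.2])
    simpa only [hQp] using he.deriv_eq_zero_of_isLocalMax hH h1 hmax i
  · obtain ⟨_, h1⟩ := HasWirtingerAt.ad ht l j
    have h2 := he.deriv_eq_of_eventuallyEq hH h1 (hc j l) (by
      filter_upwards [hev] with y hy
      exact (h.firstOrder_half hy.1 hy.2).ad_conj l j) i
    simpa only [hQp] using h2.1
  · obtain ⟨_, h1⟩ := HasWirtingerAt.gramUpper ht l j
    obtain ⟨_, h2⟩ := HasWirtingerAt.gramLower ht j l
    have h3 := he.deriv_eq_of_eventuallyEq hH h1 h2 (by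
      filter_upwards [hev] with y hy
      exact (h.firstOrder_half hy.1 hy.2).gramUpper_eq_gramLower l j) i
    simpa only [hQp] using h3.1
  · have h1 := h.extDeriv_extDerivTrace hp he hQ
      (b := fun y j k ↦ extDerivTrace (1 / 2) g J T Γ (fun i ↦ Q y (e i)) y j k)
      (Filter.Eventually.of_forall fun y j k ↦ rfl) (d := fun l j k ↦ b j k l) hb i j k
    simp only [hQp, extDerivTrace] at h1
    push_cast at h1
    simp only [htp]
    linear_combination h1
  -- By `trace_trace` and `tr A = -|η|²`, the trace of these components is `(|T|² + |η|²) / 4`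
  -- throughout the neighbourhood.
  · have h1 := he.deriv_eq_of_eventuallyEq hH (HasWirtingerAt.sum fun k ↦ hb k k)
      (((HasWirtingerAt.normSq ht).add (HasWirtingerAt.normSqEta ht)).const_mul (1 / 4)) (by
      filter_upwards [hev] with y hy
      have e1 := (h.firstOrder_half hy.1 hy.2).trace_trace
      have e2 := congrArg conj (trace_ad (h.firstOrder_half hy.1 hy.2).skew)
      simp only [map_sum, map_neg, Complex.conj_ofReal] at e2
      simp only [extDerivTrace, Finset.sum_sub_distrib, ← Finset.mul_sum]
      push_cast at e1 ⊢
      rw [e2]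
      linear_combination e1) i
    simp only [htp, hQp] at h1 ⊢
    rw [← h1.1]
    exact Finset.sum_congr rfl fun k _ ↦ by ring
  · have hK := HasWirtingerAt.killing ht
    choose kd hk using hK
    have h1 := h.re_sum_antiholo_nonpos hp he hQ (F := F)
      (G := fun y l ↦ ∑ i, (1 / 2 * (killing (t y) i l * conj (eta (t y) i)) + eta (t y) i
        * conj (∑ s, covDerivAntiholo g J T Γ (fun i ↦ Q y (e i)) y l s i s)))
      (by
        filter_upwards [hev, hev.eventually_nhds] with y hy hy'
        -- The gauge `Q` is parallel only at `p`. The first derivative of `|η|²` at the nearby point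
        -- `y` is computed in a gauge parallel at `y` that extends the same frame.
        obtain ⟨Q', hQ'⟩ := h.exists_isParallelGauge hy.1
        have h2 := HasWirtingerAt.normSqEta (h.hasWirtingerAt_array hy.1 hy.2 hQ')
        have hQp' : (fun i ↦ Q' y (Q y (e i))) = fun i ↦ Q y (e i) := by simp [hQ'.one]
        have h3 (l : ι) : dNormSqEta (t y) (covDerivHolo g J T Γ (fun i ↦ Q y (e i)) y)
            (covDerivAntiholo g J T Γ (fun i ↦ Q y (e i)) y) l
            = ∑ i, (1 / 2 * (killing (t y) i l * conj (eta (t y) i)) + eta (t y) i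
              * conj (∑ s, covDerivAntiholo g J T Γ (fun i ↦ Q y (e i)) y l s i s)) := by
          rw [dNormSqEta]
          refine Finset.sum_congr rfl fun i _ ↦ ?_
          rw [trace_deriv (h.firstOrder_half hy.1 hy.2).deriv_half, killing_symm]
          ring
        simp only [hQp'] at h2
        refine (h2.congr_of_eventuallyEq ?_).congr_deriv h3 fun l ↦ by rw [h3]
        filter_upwards [h.eventually_isParallelGauge hy.1 hQ' hy.2] with z hz
        rw [hF z hz.1 _ hz.2])
      (fun l ↦ .sum fun i ↦ (((hk i l).mul (HasWirtingerAt.eta ht i).star).const_mul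
        (1 / 2 : ℂ)).add ((HasWirtingerAt.eta ht i).mul (hN i l).star)) hmax
    convert h1 using 3
    refine Finset.sum_congr rfl fun i _ ↦ ?_
    simp only [htp, hQp, trace_deriv (h.firstOrder_half hp he).deriv_half, killing_symm _ i]

end Half

section Vanishing

variable {a : ℝ} {U : Set E} {g : E → E →L[ℝ] E →L[ℝ] ℝ} {J : E → E →L[ℝ] E}
  {T Γ : E → E →L[ℝ] E →L[ℝ] E} (h : IsGauduchonChart a U g J T Γ) {p : E} (hp : p ∈ U)
  {ι : Type*} [Fintype ι] [DecidableEq ι] {e : ι → E} (he : IsUnitaryFrame (g p) (J p) e)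
include h hp he

/-- If the trace of the torsion vanishes, so does the torsion. -/
theorem normSq_eq_zero (h0 : ∀ y ∈ U, ∀ e' : ι → E, IsUnitaryFrame (g y) (J y) e' →
      normSqEta (unitaryArray (g y) (J y) (T y) e') = 0) :
    normSq (unitaryArray (g p) (J p) (T p) e) = 0 := by
  obtain ⟨Q, hQ⟩ := h.exists_isParallelGauge hp
  have hH := h.hermitian p hp
  have ht := h.hasWirtingerAt_array hp he hQ
  have h1 (j l : ι) : ∑ s, covDerivAntiholo g J T Γ e p l s j s = 0 := by
    refine (he.deriv_eq_of_eventuallyEq hH (HasWirtingerAt.eta ht j)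
      (HasWirtingerAt.const 0) (by
        filter_upwards [h.eventually_isParallelGauge hp hQ he] with y hy
        have := h0 y hy.1 _ hy.2
        rw [normSqEta, Finset.sum_eq_zero_iff_of_nonneg fun _ _ ↦ Complex.normSq_nonneg _] at this
        exact Complex.normSq_eq_zero.1 (this j (Finset.mem_univ j))) l).2
  have h2 := (h.firstOrder hp he).trace_trace
  simp only [h1, h0 p hp e he, Finset.sum_const_zero, mul_zero, Complex.ofReal_zero,
    add_zero] at h2
  have h3 : (a : ℂ) ^ 2 ≠ 0 := pow_ne_zero 2 (by exact_mod_cast h.a_ne_zero)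
  exact_mod_cast (mul_eq_zero.1 h2.symm).resolve_left h3

/-- The torsion vanishes if `a = 1 / 4`. -/
theorem normSq_eq_zero_of_eq (ha : 4 * a - 1 = 0) :
    normSq (unitaryArray (g p) (J p) (T p) e) = 0 := by
  have h2 := (h.firstOrder hp he).trace_trace
  have h3 : (4 * a - 1 : ℂ) = 0 := by exact_mod_cast ha
  rw [h3, zero_mul] at h2
  have h4 : 0 = a ^ 2 * normSq (unitaryArray (g p) (J p) (T p) e)
      + a * (1 - 3 * a) * normSqEta (unitaryArray (g p) (J p) (T p) e) := by exact_mod_cast h2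
  -- Both coefficients `a²` and `a (1 - 3a)` equal `1/16`, so two nonnegative terms add up to zero.
  obtain rfl : a = 1 / 4 := by linarith
  have h5 : 0 ≤ normSq (unitaryArray (g p) (J p) (T p) e) :=
    Finset.sum_nonneg fun _ _ ↦ Finset.sum_nonneg fun _ _ ↦ Finset.sum_nonneg fun _ _ ↦
      Complex.normSq_nonneg _
  have h6 : 0 ≤ normSqEta (unitaryArray (g p) (J p) (T p) e) :=
    Finset.sum_nonneg fun _ _ ↦ Complex.normSq_nonneg _
  linarith

end Vanishing

end IsGauduchonChart

end

/-! ### The Chern torsion on the manifold: bilinearity and relation to `dω`. -/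

noncomputable section

open Bundle FiberBundle VectorField
open scoped Manifold ContDiff Topology

/-! ### The torsion of Hermitian connections -/

namespace HermitianStructure

variable {E : Type*} [NormedAddCommGroup E] [NormedSpace ℝ E] [FiniteDimensional ℝ E]
  {M : Type*} [TopologicalSpace M] [ChartedSpace E M] [IsManifold 𝓘(ℝ, E) ∞ M]
  {H : HermitianStructure E M}
  {D : CovariantDerivative 𝓘(ℝ, E) E (fun x : M ↦ TangentSpace 𝓘(ℝ, E) x)}

/-- With `∇J = 0` the derivative terms cancel, so the Nijenhuis tensor, which vanishes, is minus
this combination of torsions. -/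
lemma IsHermitianConnection.torsion_nijenhuis (hD : H.IsHermitianConnection D) (x : M)
    (v w : TangentSpace 𝓘(ℝ, E) x) :
    D.torsion x (H.J x v) (H.J x w) - H.J x (D.torsion x (H.J x v) w)
      - H.J x (D.torsion x v (H.J x w)) - D.torsion x v w = 0 := by
  have : CompleteSpace E := FiniteDimensional.complete ℝ E
  have hv := mdifferentiableAt_extend 𝓘(ℝ, E) E v
  have hw := mdifferentiableAt_extend 𝓘(ℝ, E) E w
  have h1 := D.torsion_apply hv hw
  have h2 := D.torsion_apply (mdiffAt_J (H := H) hv) hw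
  have h3 := D.torsion_apply hv (mdiffAt_J (H := H) hw)
  have h4 := D.torsion_apply (mdiffAt_J (H := H) hv) (mdiffAt_J (H := H) hw)
  have h5 := H.nijenhuis x _ _ hv hw
  simp only [hD.complex x _ hv, hD.complex x _ hw, extend_apply_self] at h1 h2 h3 h4
  rw [h1, h2, h3, h4, ← neg_eq_zero, ← h5]
  simp only [map_sub, H.J_J]
  abel

/-- Since `∇ω = 0`, the exterior derivative of `ω` only sees the difference between brackets and
covariant derivatives. -/
lemma IsHermitianConnection.dFundamentalForm_eq (hD : H.IsHermitianConnection D) {x : M}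
    {X Y Z : Π x : M, TangentSpace 𝓘(ℝ, E) x} (hX : MDiffAt (T% X) x) (hY : MDiffAt (T% Y) x)
    (hZ : MDiffAt (T% Z) x) :
    H.dFundamentalForm X Y Z x = H.g.inner x (H.J x (D.torsion x (X x) (Y x))) (Z x)
      + H.g.inner x (H.J x (D.torsion x (Y x) (Z x))) (X x)
      + H.g.inner x (H.J x (D.torsion x (Z x) (X x))) (Y x) := by
  have : CompleteSpace E := FiniteDimensional.complete ℝ E
  simp only [dFundamentalForm, fundamentalForm]
  rw [D.torsion_apply hX hY, D.torsion_apply hY hZ, D.torsion_apply hZ hX,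
    hD.metric x _ _ (mdiffAt_J hX) hY, hD.metric x _ _ (mdiffAt_J hY) hZ,
    hD.metric x _ _ (mdiffAt_J hZ) hX, hD.complex x X hX, hD.complex x Y hY, hD.complex x Z hZ]
  simp only [map_sub, sub_apply]
  rw [H.g_J_left x (X x) (D Y x (Z x)), H.g_J_left x (Y x) (D Z x (X x)),
    H.g_J_left x (Z x) (D X x (Y x)), H.g.symm x (X x), H.g.symm x (Y x), H.g.symm x (Z x)]
  ring

variable (H) in
/-- The torsion of the Chern connection. -/
def chernTorsion (x : M) :
    TangentSpace 𝓘(ℝ, E) x →L[ℝ] TangentSpace 𝓘(ℝ, E) x →L[ℝ] TangentSpace 𝓘(ℝ, E) x :=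
  H.chernConnection.torsion x

lemma chernTorsion_skew (x : M) (v w : TangentSpace 𝓘(ℝ, E) x) :
    H.chernTorsion x v w = -H.chernTorsion x w v := by
  have : CompleteSpace E := FiniteDimensional.complete ℝ E
  exact CovariantDerivative.torsion_antisymm _ v w

/-- The vanishing `(1, 1)`-part gives `T(Jv, Jw) = -T(v, w)` and `T(v, Jw) = T(Jv, w)`.
Integrability then rules out the antilinear type. -/
lemma chernTorsion_J_left (x : M) (v w : TangentSpace 𝓘(ℝ, E) x) :
    H.chernTorsion x (H.J x v) w = H.J x (H.chernTorsion x v w) := by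
  have h := H.isChernConnection_chernConnection
  have h1 := h.hermitian.torsion_nijenhuis x v w
  have h2 := h.torsion x v w
  have h3 := h.torsion x v (H.J x w)
  change H.chernTorsion x (H.J x v) (H.J x w) - H.J x (H.chernTorsion x (H.J x v) w)
      - H.J x (H.chernTorsion x v (H.J x w)) - H.chernTorsion x v w = 0 at h1
  change H.chernTorsion x v w + H.chernTorsion x (H.J x v) (H.J x w) = 0 at h2
  change H.chernTorsion x v (H.J x w) + H.chernTorsion x (H.J x v) (H.J x (H.J x w)) = 0 at h3
  rw [H.J_J, map_neg, ← sub_eq_add_neg, sub_eq_zero] at h3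
  rw [h3, eq_neg_of_add_eq_zero_right h2] at h1
  have h4 : H.J x (H.chernTorsion x (H.J x v) w) = -H.chernTorsion x v w := by
    have : (2 : ℝ) • H.J x (H.chernTorsion x (H.J x v) w) = (2 : ℝ) • -H.chernTorsion x v w := by
      rw [← sub_eq_zero, ← neg_eq_zero, ← h1]
      module
    exact smul_right_injective _ two_ne_zero this
  have h5 := congrArg (H.J x) h4
  rw [H.J_J, map_neg] at h5
  exact neg_injective h5

lemma chernTorsion_J_right (x : M) (v w : TangentSpace 𝓘(ℝ, E) x) :
    H.chernTorsion x v (H.J x w) = H.J x (H.chernTorsion x v w) := by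
  rw [chernTorsion_skew, chernTorsion_J_left, ← map_neg, ← chernTorsion_skew]

lemma dFundamentalForm_eq_chernTorsion {x : M}
    {X Y Z : Π x : M, TangentSpace 𝓘(ℝ, E) x} (hX : MDiffAt (T% X) x) (hY : MDiffAt (T% Y) x)
    (hZ : MDiffAt (T% Z) x) :
    H.dFundamentalForm X Y Z x = H.g.inner x (H.J x (H.chernTorsion x (X x) (Y x))) (Z x)
      + H.g.inner x (H.J x (H.chernTorsion x (Y x) (Z x))) (X x)
      + H.g.inner x (H.J x (H.chernTorsion x (Z x) (X x))) (Y x) :=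
  H.isChernConnection_chernConnection.hermitian.dFundamentalForm_eq hX hY hZ

/-- The two brackets are `dω(u, v, w)` and `dω(Ju, Jv, w)`. Thus `T` is determined by `dω`, which
later gives its smoothness and its invariance under biholomorphic isometries. -/
lemma inner_J_chernTorsion (x : M) (u v w : TangentSpace 𝓘(ℝ, E) x) :
    2 * H.g.inner x (H.J x (H.chernTorsion x u v)) w
      = (H.g.inner x (H.J x (H.chernTorsion x u v)) w
        + H.g.inner x (H.J x (H.chernTorsion x v w)) u
        + H.g.inner x (H.J x (H.chernTorsion x w u)) v)
      - (H.g.inner x (H.J x (H.chernTorsion x (H.J x u) (H.J x v))) w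
        + H.g.inner x (H.J x (H.chernTorsion x (H.J x v) w)) (H.J x u)
        + H.g.inner x (H.J x (H.chernTorsion x w (H.J x u))) (H.J x v)) := by
  simp only [chernTorsion_J_left, chernTorsion_J_right, H.J_J, map_neg, neg_apply]
  rw [H.g_J_left x (H.chernTorsion x v w), H.g_J_left x (H.chernTorsion x w u)]
  ring

/-- The torsion of either connection computes `dω`. Comparing at `(Ju, Jv, Jw)`, and using total
skewness together with `torsion_nijenhuis`, determines the Bismut torsion. -/
lemma inner_bismutTorsion (x : M) (u v w : TangentSpace 𝓘(ℝ, E) x) :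
    H.g.inner x (H.bismutConnection.torsion x u v) w
      = -H.g.inner x (H.chernTorsion x u v) w - H.g.inner x (H.chernTorsion x v w) u
        - H.g.inner x (H.chernTorsion x w u) v := by
  have : CompleteSpace E := FiniteDimensional.complete ℝ E
  have hB := H.isBismutConnection_bismutConnection
  set t := H.bismutConnection.torsion x with ht
  have hs (a b : TangentSpace 𝓘(ℝ, E) x) : t a b = -t b a :=
    H.bismutConnection.torsion_antisymm a b
  have hs' (a b c : TangentSpace 𝓘(ℝ, E) x) : H.g.inner x (t a b) c = -H.g.inner x (t a c) b :=
    hB.torsion x a b c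
  have h1 := congrArg (fun z ↦ H.g.inner x z w) (hB.hermitian.torsion_nijenhuis x u v)
  simp only [map_sub, sub_apply, ← ht, map_zero, zero_apply, H.g_J_left] at h1
  obtain ⟨hu, hv, hw⟩ := And.intro (mdifferentiableAt_extend 𝓘(ℝ, E) E (H.J x u))
    (And.intro (mdifferentiableAt_extend 𝓘(ℝ, E) E (H.J x v))
      (mdifferentiableAt_extend 𝓘(ℝ, E) E (H.J x w)))
  have h2 := hB.hermitian.dFundamentalForm_eq hu hv hw
  rw [dFundamentalForm_eq_chernTorsion hu hv hw] at h2
  simp only [extend_apply_self, ← ht, H.g_J_J, chernTorsion_J_left, chernTorsion_J_right, H.J_J,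
    map_neg, neg_apply] at h2
  have hc (a b c : TangentSpace 𝓘(ℝ, E) x) :
      H.g.inner x (t a b) c = H.g.inner x (t b c) a := by
    rw [hs, map_neg, neg_apply, hs', neg_neg]
  rw [← hc u (H.J x v), hc (H.J x w)] at h2
  linarith

end HermitianStructure

end

/-! ### Regularity of the Chern torsion and of the connection coefficients. -/

noncomputable section

open scoped ContDiff Topology

/-! ### Smoothness of tensors characterized by the metric -/

section

variable {E : Type*} [NormedAddCommGroup E] [NormedSpace ℝ E] [FiniteDimensional ℝ E]
  {n : ℕ∞ω} {U : Set E} {g : E → E →L[ℝ] E →L[ℝ] ℝ} {J : E → E →L[ℝ] E}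

lemma IsHermitianForm.isInvertible {g : E →L[ℝ] E →L[ℝ] ℝ} {J : E →L[ℝ] E}
    (h : IsHermitianForm g J) : g.IsInvertible := by
  have hinj : Function.Injective (g : E →ₗ[ℝ] E →L[ℝ] ℝ) := by
    refine (injective_iff_map_eq_zero _).2 fun v hv ↦ ?_
    by_contra hne
    have h1 := h.pos v hne
    have h2 := congrArg (fun f : E →L[ℝ] ℝ ↦ f v) hv
    exact h1.ne' h2
  have hd : Module.finrank ℝ E = Module.finrank ℝ (E →L[ℝ] ℝ) := by
    rw [← (LinearMap.toContinuousLinearMap (𝕜 := ℝ) (E := E) (F' := ℝ)).finrank_eq]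
    exact Subspace.dual_finrank_eq.symm
  exact ⟨(LinearEquiv.ofInjectiveOfFinrankEq _ hinj hd).toContinuousLinearEquiv, by ext; rfl⟩

lemma contDiffOn_of_inner (hg : ContDiffOn ℝ n g U) (hH : ∀ y ∈ U, IsHermitianForm (g y) (J y))
    {β : E → E} (hβ : ∀ w, ContDiffOn ℝ n (fun y ↦ g y (β y) w) U) : ContDiffOn ℝ n β U := by
  have : CompleteSpace E := FiniteDimensional.complete ℝ E
  have h1 : ContDiffOn ℝ n (fun y ↦ g y (β y)) U := contDiffOn_clm_apply.2 hβ
  have h2 : ContDiffOn ℝ n (fun y ↦ (g y).inverse) U := fun y hy ↦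
    ((hH y hy).isInvertible.contDiffAt_map_inverse).comp_contDiffWithinAt y (hg y hy)
  refine (h2.clm_apply h1).congr fun y hy ↦ ?_
  obtain ⟨e, he⟩ := (hH y hy).isInvertible
  rw [← he]
  simp

/-- The exterior derivative of the fundamental form on constant vector fields. -/
def dFundamental (g : E → E →L[ℝ] E →L[ℝ] ℝ) (J : E → E →L[ℝ] E) (y u v w : E) : ℝ :=
  fderiv ℝ (fun z ↦ g z ∘L J z) y u v w + fderiv ℝ (fun z ↦ g z ∘L J z) y v w u
    + fderiv ℝ (fun z ↦ g z ∘L J z) y w u v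

lemma contDiffOn_torsion (hU : IsOpen U) (hg : ContDiffOn ℝ ∞ g U) (hJ : ContDiffOn ℝ ∞ J U)
    (hH : ∀ y ∈ U, IsHermitianForm (g y) (J y)) {T : E → E →L[ℝ] E →L[ℝ] E}
    (hT : ∀ y ∈ U, ∀ u v w, 2 * g y (J y (T y u v)) w
      = dFundamental g J y u v w - dFundamental g J y (J y u) (J y v) w) :
    ContDiffOn ℝ ∞ T U := by
  have hd : ContDiffOn ℝ ∞ (fderiv ℝ (fun z ↦ g z ∘L J z)) U :=
    (hg.clm_comp hJ).fderiv_of_isOpen hU (by simp)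
  have h1 (a b c : E → E) (ha : ContDiffOn ℝ ∞ a U) (hb : ContDiffOn ℝ ∞ b U)
      (hc : ContDiffOn ℝ ∞ c U) : ContDiffOn ℝ ∞ (fun y ↦ dFundamental g J y (a y) (b y) (c y)) U :=
    ((((hd.clm_apply ha).clm_apply hb).clm_apply hc).add
      (((hd.clm_apply hb).clm_apply hc).clm_apply ha)).add
      (((hd.clm_apply hc).clm_apply ha).clm_apply hb)
  have hc (v : E) : ContDiffOn ℝ ∞ (fun _ : E ↦ v) U := contDiffOn_const
  refine contDiffOn_clm_apply.2 fun u ↦ contDiffOn_clm_apply.2 fun v ↦ ?_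
  have h2 : ContDiffOn ℝ ∞ (fun y ↦ J y (T y u v)) U := by
    refine contDiffOn_of_inner hg hH fun w ↦ ?_
    refine (((h1 _ _ _ (hc u) (hc v) (hc w)).sub (h1 _ _ _ (hJ.clm_apply (hc u))
      (hJ.clm_apply (hc v)) (hc w))).div_const 2).congr fun y hy ↦ ?_
    rw [← hT y hy, mul_div_cancel_left₀ _ two_ne_zero]
  refine ((hJ.clm_apply h2).neg).congr fun y hy ↦ ?_
  simp only [(hH y hy).J_J, neg_neg]

/-- The Koszul formula expresses `2 g(Γ_u v, w)` through derivatives of `g` and the torsion.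
Smoothness is obtained this way since the connections are characterized only algebraically and are
not assumed smooth. -/
lemma contDiffOn_connection (hU : IsOpen U) (hg : ContDiffOn ℝ ∞ g U)
    (hH : ∀ y ∈ U, IsHermitianForm (g y) (J y)) {T Γ : E → E →L[ℝ] E →L[ℝ] E}
    (hT : ContDiffOn ℝ ∞ T U) {a : ℝ}
    (metric : ∀ y ∈ U, ∀ u v w, fderiv ℝ g y u v w = g y (Γ y u v) w + g y v (Γ y u w))
    (torsion : ∀ y ∈ U, ∀ u v z, g y (Γ y u v - Γ y v u) z
      = (1 - 2 * a) * g y (T y u v) z + a * (g y (T y u z) v - g y (T y v z) u)) :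
    ContDiffOn ℝ ∞ Γ U := by
  have hd : ContDiffOn ℝ ∞ (fderiv ℝ g) U := hg.fderiv_of_isOpen hU (by simp)
  have hc (v : E) : ContDiffOn ℝ ∞ (fun _ : E ↦ v) U := contDiffOn_const
  have h1 (u v w : E) : ContDiffOn ℝ ∞ (fun y ↦ fderiv ℝ g y u v w) U :=
    ((hd.clm_apply (hc u)).clm_apply (hc v)).clm_apply (hc w)
  have h2 (u v w : E) : ContDiffOn ℝ ∞ (fun y ↦ g y (T y u v) w) U :=
    (hg.clm_apply ((hT.clm_apply (hc u)).clm_apply (hc v))).clm_apply (hc w)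
  have h3 (u v w : E) : ContDiffOn ℝ ∞ (fun y ↦ (1 - 2 * a) * g y (T y u v) w
      + a * (g y (T y u w) v - g y (T y v w) u)) U :=
    (contDiffOn_const.mul (h2 u v w)).add (contDiffOn_const.mul ((h2 u w v).sub (h2 v w u)))
  refine contDiffOn_clm_apply.2 fun u ↦ contDiffOn_clm_apply.2 fun v ↦
    contDiffOn_of_inner hg hH fun w ↦ ?_
  refine (((((((h1 u v w).add (h1 v u w)).sub (h1 w u v)).add (h3 u v w)).sub (h3 u w v)).sub
    (h3 v w u)).div_const 2).congr fun y hy ↦ ?_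
  simp only [← torsion y hy, metric y hy, map_sub, sub_apply]
  have hs := (hH y hy).symm
  rw [hs v, hs u, hs u (Γ y w v)]
  ring

end

end

/-! ### Coordinate vector fields and connection forms. -/

noncomputable section

open Bundle FiberBundle VectorField
open scoped Manifold ContDiff Topology

/-! ### The coordinate vector fields of a chart -/

section ChartField

variable {E : Type*} [NormedAddCommGroup E] [NormedSpace ℝ E]
  {M : Type*} [TopologicalSpace M] [ChartedSpace E M] [IsManifold 𝓘(ℝ, E) ∞ M]

/-- The inverse of the derivative of the chart at `x₀`. -/
def chartInv (x₀ x : M) : E →L[ℝ] TangentSpace 𝓘(ℝ, E) x :=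
  (mfderiv 𝓘(ℝ, E) 𝓘(ℝ, E) (extChartAt 𝓘(ℝ, E) x₀) x).inverse

/-- The derivative of the chart at `x₀`. -/
def chartDeriv (x₀ x : M) : TangentSpace 𝓘(ℝ, E) x →L[ℝ] E :=
  mfderiv 𝓘(ℝ, E) 𝓘(ℝ, E) (extChartAt 𝓘(ℝ, E) x₀) x

/-- The coordinate vector field of the chart at `x₀` in the direction of `v`. -/
def chartField (x₀ : M) (v : E) (x : M) : TangentSpace 𝓘(ℝ, E) x := chartInv x₀ x v

variable {x₀ x : M} (hx : x ∈ (extChartAt 𝓘(ℝ, E) x₀).source)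
include hx

lemma chartDeriv_chartInv (v : E) : chartDeriv x₀ x (chartInv x₀ x v) = v :=
  (isInvertible_mfderiv_extChartAt hx).self_apply_inverse v

lemma chartInv_chartDeriv (v : TangentSpace 𝓘(ℝ, E) x) :
    chartInv x₀ x (chartDeriv x₀ x v) = v :=
  (isInvertible_mfderiv_extChartAt hx).inverse_apply_self v

variable [CompleteSpace E]

lemma contMDiffAt_chartField (v : E) : CMDiffAt ∞ (T% (chartField x₀ v)) x := by
  refine ContMDiffAt.mpullback_vectorField_preimage (n := ∞) (V := fun _ : E ↦ v)
    (I' := 𝓘(ℝ, E)) ?_ ?_ (isInvertible_mfderiv_extChartAt hx) (by simp)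
  · exact contMDiffAt_vectorSpace_iff_contDiffAt.2 contDiffAt_const
  · exact contMDiffAt_extChartAt' (by simpa using hx)

lemma mdifferentiableAt_chartField (v : E) : MDiffAt (T% (chartField x₀ v)) x :=
  (contMDiffAt_chartField hx v).mdifferentiableAt (by simp)

lemma mlieBracket_chartField (v w : E) :
    mlieBracket 𝓘(ℝ, E) (chartField x₀ v) (chartField x₀ w) x = 0 := by
  have : IsManifold 𝓘(ℝ, E) (minSmoothness ℝ 2) M := by
    rw [minSmoothness_of_isRCLikeNormedField]; infer_instance
  let V (v : E) (y : E) : TangentSpace 𝓘(ℝ, E) y := v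
  have hc (v : E) : MDiffAt (T% (V v)) (extChartAt 𝓘(ℝ, E) x₀ x) :=
    (contMDiffAt_vectorSpace_iff_contDiffAt (n := 1).2 contDiffAt_const).mdifferentiableAt (by simp)
  have h := mpullback_mlieBracket (n := ∞) (hc v) (hc w) (f := extChartAt 𝓘(ℝ, E) x₀)
    (contMDiffAt_extChartAt' (by simpa using hx))
    (by rw [minSmoothness_of_isRCLikeNormedField]; exact ENat.LEInfty.out)
  refine h.symm.trans ?_
  rw [mpullback_apply, ← mlieBracketWithin_univ, mlieBracketWithin_eq_lieBracketWithin,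
    lieBracketWithin_univ]
  simp only [lieBracket, fderiv_fun_const, Pi.zero_apply, zero_apply, sub_zero]
  exact map_zero _

omit [CompleteSpace E] in
lemma mvfderiv_chartField {f : M → ℝ} (hf : MDiffAt f x) (u : E) :
    mvfderiv 𝓘(ℝ, E) f x (chartField x₀ u x)
      = fderiv ℝ (f ∘ (extChartAt 𝓘(ℝ, E) x₀).symm) (extChartAt 𝓘(ℝ, E) x₀ x) u := by
  have hx' : x ∈ (chartAt E x₀).source := by simpa using hx
  set φ := extChartAt 𝓘(ℝ, E) x₀
  have h1 : MDiffAt (f ∘ φ.symm) (φ x) := by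
    have h2 : MDiffAt φ.symm (φ x) :=
      ((contMDiffOn_extChartAt_symm (n := ∞) x₀).contMDiffAt
        (extChartAt_target_mem_nhds' (φ.map_source hx))).mdifferentiableAt (by simp)
    refine MDifferentiableAt.comp _ ?_ h2
    rwa [φ.left_inv hx]
  have h3 : f =ᶠ[𝓝 x] (f ∘ φ.symm) ∘ φ := by
    filter_upwards [extChartAt_source_mem_nhds' hx] with y hy
    simp only [Function.comp_apply, φ.left_inv hy]
  have h4 : MDiffAt φ x := (contMDiffAt_extChartAt' (n := ∞) hx').mdifferentiableAt
    (by simp)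
  have h5 : mvfderiv 𝓘(ℝ, E) f x = mvfderiv 𝓘(ℝ, E) ((f ∘ φ.symm) ∘ φ) x := h3.mfderiv_eq
  rw [h5, mvfderiv_comp_apply x h1 h4]
  have h6 := chartDeriv_chartInv hx u
  change mfderiv 𝓘(ℝ, E) 𝓘(ℝ, E) φ x (chartField x₀ u x) = u at h6
  rw [h6]
  exact congrArg (fun L : E →L[ℝ] ℝ ↦ L u) mfderiv_eq_fderiv

end ChartField

/-! ### Connections in a chart -/

namespace CovariantDerivative

variable {E : Type*} [NormedAddCommGroup E] [NormedSpace ℝ E] [FiniteDimensional ℝ E]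
  {M : Type*} [TopologicalSpace M] [ChartedSpace E M] [IsManifold 𝓘(ℝ, E) ∞ M]
  (D : CovariantDerivative 𝓘(ℝ, E) E (fun x : M ↦ TangentSpace 𝓘(ℝ, E) x))

omit [FiniteDimensional ℝ E] in
lemma apply_finset_sum {ι : Type*} (s : Finset ι) {σ : ι → Π x : M, TangentSpace 𝓘(ℝ, E) x} {x : M}
    (hσ : ∀ i, MDiffAt (T% (σ i)) x) : D (∑ i ∈ s, σ i) x = ∑ i ∈ s, D (σ i) x := by
  classical
  induction s using Finset.induction_on with
  | empty => simp [D.zero]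
  | insert i s hi ih =>
    have h : MDiffAt (T% (∑ i ∈ s, σ i)) x := by
      have := MDifferentiableAt.sum_section (s := s) fun i _ ↦ hσ i
      convert this using 2
      simp [Finset.sum_apply]
    rw [Finset.sum_insert hi, Finset.sum_insert hi, D.isCovariantDerivativeOnUniv.add (hσ i) h, ih]

/-- The connection form of `D` in the chart at `x₀`. -/
def christoffel (x₀ x : M) : E →L[ℝ] E →L[ℝ] E :=
  ∑ i, (ContinuousLinearMap.smulRightL ℝ E E
      (LinearMap.toContinuousLinearMap ((Module.finBasis ℝ E).coord i))) ∘L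
    (chartDeriv x₀ x ∘L D (chartField x₀ (Module.finBasis ℝ E i)) x ∘L chartInv x₀ x)

variable {x₀ x : M}

/-- Expand `h` in a basis of `E` and apply the Leibniz rule to the finitely many coordinate fields
of that basis. -/
lemma chart_section (hx : x ∈ (extChartAt 𝓘(ℝ, E) x₀).source) {h : E → E}
    (hh : DifferentiableAt ℝ h (extChartAt 𝓘(ℝ, E) x₀ x)) :
    MDiffAt (T% (fun x : M ↦ chartField x₀ (h (extChartAt 𝓘(ℝ, E) x₀ x)) x)) x ∧
    ∀ u, D (fun x : M ↦ chartField x₀ (h (extChartAt 𝓘(ℝ, E) x₀ x)) x) x (chartField x₀ u x)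
      = chartField x₀ (fderiv ℝ h (extChartAt 𝓘(ℝ, E) x₀ x) u
        + D.christoffel x₀ x u (h (extChartAt 𝓘(ℝ, E) x₀ x))) x := by
  have : CompleteSpace E := FiniteDimensional.complete ℝ E
  set b := Module.finBasis ℝ E
  set φ := extChartAt 𝓘(ℝ, E) x₀ with hφ
  have hx' : x ∈ (chartAt E x₀).source := by simpa [hφ] using hx
  let c (i) : E →L[ℝ] ℝ := LinearMap.toContinuousLinearMap (b.coord i)
  have h1 : (fun x : M ↦ chartField x₀ (h (φ x)) x)
      = ∑ i, (fun x ↦ c i (h (φ x))) • chartField x₀ (b i) := by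
    ext x
    rw [Finset.sum_apply]
    simp only [Pi.smul_apply', chartField, ← map_smul, ← map_sum]
    exact congrArg _ (b.sum_repr _).symm
  have h2 (i) : MDiffAt (fun x ↦ c i (h (φ x))) x :=
    (((c i).differentiableAt.comp _ hh).mdifferentiableAt).comp x
      ((contMDiffAt_extChartAt' (n := ∞) hx').mdifferentiableAt (by simp))
  have h3 (i) := mdifferentiableAt_chartField hx (b i)
  have h4 (i) : MDiffAt (T% ((fun x ↦ c i (h (φ x))) • chartField x₀ (b i))) x :=
    (h2 i).smul_section (h3 i)
  have h5 (i) (u : E) : mvfderiv 𝓘(ℝ, E) (fun x ↦ c i (h (φ x))) x (chartField x₀ u x)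
      = c i (fderiv ℝ h (φ x) u) := by
    rw [mvfderiv_chartField hx (h2 i)]
    have h6 : (fun x ↦ c i (h (φ x))) ∘ φ.symm =ᶠ[𝓝 (φ x)] c i ∘ h := by
      filter_upwards [extChartAt_target_mem_nhds' (φ.map_source hx)] with y hy
      simp only [Function.comp_apply, φ.right_inv hy]
    rw [h6.fderiv_eq, fderiv_comp _ (c i).differentiableAt hh]
    simp
  rw [h1]
  constructor
  · have := MDifferentiableAt.sum_section (s := Finset.univ) fun i _ ↦ h4 i
    convert this using 2
    simpa using congrFun h1 _
  · intro u
    rw [D.apply_finset_sum _ h4]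
    have h7 (i) : D ((fun x ↦ c i (h (φ x))) • chartField x₀ (b i)) x (chartField x₀ u x)
        = b.repr (h (φ x)) i • D (chartField x₀ (b i)) x (chartField x₀ u x)
          + c i (fderiv ℝ h (φ x) u) • chartField x₀ (b i) x := by
      rw [D.isCovariantDerivativeOnUniv.leibniz (h3 i) (h2 i), add_apply, smul_apply,
        ContinuousLinearMap.smulRight_apply, h5]
      rfl
    rw [sum_apply, Finset.sum_congr rfl fun i _ ↦ h7 i, Finset.sum_add_distrib,
      add_comm]
    have h8 : chartField x₀ (fderiv ℝ h (φ x) u + D.christoffel x₀ x u (h (φ x))) x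
        = chartField x₀ (fderiv ℝ h (φ x) u) x
          + chartField x₀ (D.christoffel x₀ x u (h (φ x))) x := map_add _ _ _
    rw [h8]
    congr 1
    · simp only [chartField, ← map_smul, ← map_sum]
      exact congrArg _ (b.sum_repr _)
    · simp only [christoffel, sum_apply, chartField, map_sum,
        ContinuousLinearMap.comp_apply]
      refine Finset.sum_congr rfl fun i _ ↦ ?_
      refine Eq.trans ?_ (map_smul (chartInv x₀ x) _ _).symm
      rw [chartInv_chartDeriv hx]
      rfl

end CovariantDerivative

end

/-! ### The Hermitian structure in coordinates. -/

noncomputable section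

open Bundle FiberBundle VectorField
open scoped Manifold ContDiff Topology

lemma fderiv_apply_const {E F G : Type*} [NormedAddCommGroup E] [NormedSpace ℝ E]
    [NormedAddCommGroup F] [NormedSpace ℝ F] [NormedAddCommGroup G] [NormedSpace ℝ G]
    {A : E → F →L[ℝ] G} {p : E} (hA : DifferentiableAt ℝ A p) (u : E) (v : F) :
    fderiv ℝ A p u v = fderiv ℝ (fun z ↦ A z v) p u := by
  rw [(hA.hasFDerivAt.clm_apply (hasFDerivAt_const v p)).fderiv]
  simp

lemma fderiv_apply_const₂ {E F G K : Type*} [NormedAddCommGroup E] [NormedSpace ℝ E]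
    [NormedAddCommGroup F] [NormedSpace ℝ F] [NormedAddCommGroup G] [NormedSpace ℝ G]
    [NormedAddCommGroup K] [NormedSpace ℝ K]
    {A : E → F →L[ℝ] G →L[ℝ] K} {p : E} (hA : DifferentiableAt ℝ A p) (u : E) (v : F) (w : G) :
    fderiv ℝ A p u v w = fderiv ℝ (fun z ↦ A z v w) p u := by
  rw [fderiv_apply_const hA, fderiv_apply_const (hA.clm_apply (differentiableAt_const v))]

/-! ### A Hermitian structure in a chart -/

namespace HermitianStructure

variable {E : Type*} [NormedAddCommGroup E] [NormedSpace ℝ E] [FiniteDimensional ℝ E]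
  {M : Type*} [TopologicalSpace M] [ChartedSpace E M] [IsManifold 𝓘(ℝ, E) ∞ M]
  (H : HermitianStructure E M) (x₀ : M)

/-- The metric in the chart at `x₀`. -/
def chartMetric (x : M) : E →L[ℝ] E →L[ℝ] ℝ :=
  let B : E →L[ℝ] E →L[ℝ] ℝ := H.g.inner x
  let A : E →L[ℝ] E := chartInv x₀ x
  B.bilinearComp A A

/-- The complex structure in the chart at `x₀`. -/
def chartJ (x : M) : E →L[ℝ] E := chartDeriv x₀ x ∘L H.J x ∘L chartInv x₀ x

/-- The torsion of the Chern connection in the chart at `x₀`. -/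
def chartTorsion (x : M) : E →L[ℝ] E →L[ℝ] E :=
  let B : E →L[ℝ] E →L[ℝ] E := H.chernTorsion x
  let A : E →L[ℝ] E := chartInv x₀ x
  (ContinuousLinearMap.compL ℝ E E E (chartDeriv x₀ x : E →L[ℝ] E)) ∘L B.bilinearComp A A

variable {x₀} {x : M}

omit [FiniteDimensional ℝ E] in
lemma chartMetric_apply (u v : E) : H.chartMetric x₀ x u v
    = H.g.inner x (chartField x₀ u x) (chartField x₀ v x) := rfl

variable (hx : x ∈ (extChartAt 𝓘(ℝ, E) x₀).source)
include hx

omit [FiniteDimensional ℝ E] in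
lemma chartField_injective {u v : E} (h : chartField x₀ u x = chartField x₀ v x) : u = v := by
  rw [← chartDeriv_chartInv hx u, ← chartDeriv_chartInv hx v]
  exact congrArg _ h

omit [FiniteDimensional ℝ E] in
lemma chartField_chartJ (v : E) :
    chartField x₀ (H.chartJ x₀ x v) x = H.J x (chartField x₀ v x) :=
  chartInv_chartDeriv hx _

lemma chartField_chartTorsion (u v : E) : chartField x₀ (H.chartTorsion x₀ x u v) x
    = H.chernTorsion x (chartField x₀ u x) (chartField x₀ v x) :=
  chartInv_chartDeriv hx _

lemma isHermitianForm_chart : IsHermitianForm (H.chartMetric x₀ x) (H.chartJ x₀ x) where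
  symm v w := H.g.symm x _ _
  pos v hv := H.g.pos x _ fun h ↦ hv <| chartField_injective hx (h.trans (map_zero _).symm)
  J_J v := chartField_injective hx <| by
    rw [chartField_chartJ H hx, chartField_chartJ H hx, H.J_J]
    exact (map_neg (chartInv x₀ x) v).symm
  inner_J_J v w := by
    rw [chartMetric_apply, chartField_chartJ H hx, chartField_chartJ H hx, H.g_J_J]; rfl

lemma chartTorsion_skew (v w : E) :
    H.chartTorsion x₀ x v w = -H.chartTorsion x₀ x w v := by
  refine chartField_injective hx ?_
  rw [chartField_chartTorsion H hx, chernTorsion_skew, ← chartField_chartTorsion H hx]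
  exact (map_neg (chartInv x₀ x) _).symm

lemma chartTorsion_J (v w : E) :
    H.chartTorsion x₀ x (H.chartJ x₀ x v) w = H.chartJ x₀ x (H.chartTorsion x₀ x v w) := by
  refine chartField_injective hx ?_
  rw [chartField_chartTorsion H hx, chartField_chartJ H hx, chartField_chartJ H hx,
    chernTorsion_J_left, chartField_chartTorsion H hx]

omit [FiniteDimensional ℝ E] hx in
lemma contMDiffAt_J {Y : Π x : M, TangentSpace 𝓘(ℝ, E) x} (hY : CMDiffAt ∞ (T% Y) x) :
    CMDiffAt ∞ (T% (fun y ↦ H.J y (Y y))) x :=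
  ContMDiffAt.clm_bundle_apply (b := id) (F₁ := E) (F₂ := E) (H.contMDiff_J x) hY

omit [FiniteDimensional ℝ E] hx in
lemma contMDiffAt_g {Y Z : Π x : M, TangentSpace 𝓘(ℝ, E) x}
    (hY : CMDiffAt ∞ (T% Y) x) (hZ : CMDiffAt ∞ (T% Z) x) :
    CMDiffAt ∞ (fun y ↦ H.g.inner y (Y y) (Z y)) x := by
  have : ContMDiffAt 𝓘(ℝ, E) (𝓘(ℝ, E).prod 𝓘(ℝ, ℝ)) ∞
      (fun m ↦ TotalSpace.mk' ℝ (E := Bundle.Trivial M ℝ) m (H.g.inner m (Y m) (Z m))) x := by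
    apply ContMDiffAt.clm_bundle_apply₂ (b := id) (F₁ := E) (F₂ := E)
    · exact H.g.contMDiff x
    · exact hY
    · exact hZ
  simp only [contMDiffAt_totalSpace] at this
  exact this.2

omit [FiniteDimensional ℝ E] hx in
lemma contDiffOn_chart_comp {F : Type*} [NormedAddCommGroup F] [NormedSpace ℝ F] {f : M → F}
    (hf : ∀ x ∈ (extChartAt 𝓘(ℝ, E) x₀).source, CMDiffAt ∞ f x) :
    ContDiffOn ℝ ∞ (fun y ↦ f ((extChartAt 𝓘(ℝ, E) x₀).symm y))
      (extChartAt 𝓘(ℝ, E) x₀).target := by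
  refine contMDiffOn_iff_contDiffOn.1 fun y hy ↦ ?_
  exact (hf _ ((extChartAt 𝓘(ℝ, E) x₀).map_target hy)).comp_contMDiffWithinAt y
    (contMDiffOn_extChartAt_symm (n := ∞) x₀ y hy)

omit hx in
lemma contDiffOn_chartMetric : ContDiffOn ℝ ∞
    (fun y ↦ H.chartMetric x₀ ((extChartAt 𝓘(ℝ, E) x₀).symm y))
      (extChartAt 𝓘(ℝ, E) x₀).target := by
  have : CompleteSpace E := FiniteDimensional.complete ℝ E
  exact contDiffOn_clm_apply.2 fun u ↦ contDiffOn_clm_apply.2 fun v ↦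
    contDiffOn_chart_comp fun x hx ↦
      H.contMDiffAt_g (contMDiffAt_chartField hx u) (contMDiffAt_chartField hx v)

omit hx in
lemma contDiffOn_chartJ : ContDiffOn ℝ ∞
    (fun y ↦ H.chartJ x₀ ((extChartAt 𝓘(ℝ, E) x₀).symm y))
      (extChartAt 𝓘(ℝ, E) x₀).target := by
  have : CompleteSpace E := FiniteDimensional.complete ℝ E
  refine contDiffOn_clm_apply.2 fun v ↦ contDiffOn_of_inner H.contDiffOn_chartMetric
    (fun y hy ↦ H.isHermitianForm_chart ((extChartAt 𝓘(ℝ, E) x₀).map_target hy)) fun w ↦ ?_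
  refine (contDiffOn_chart_comp fun x hx ↦ H.contMDiffAt_g
    (H.contMDiffAt_J (contMDiffAt_chartField hx v)) (contMDiffAt_chartField hx w)).congr
    fun y hy ↦ ?_
  rw [chartMetric_apply, chartField_chartJ H ((extChartAt 𝓘(ℝ, E) x₀).map_target hy)]

end HermitianStructure

end

/-! ### The Gauduchon connection in coordinates. -/

noncomputable section

open Bundle FiberBundle VectorField
open scoped Manifold ContDiff Topology

namespace HermitianStructure

variable {E : Type*} [NormedAddCommGroup E] [NormedSpace ℝ E] [FiniteDimensional ℝ E]
  {M : Type*} [TopologicalSpace M] [ChartedSpace E M] [IsManifold 𝓘(ℝ, E) ∞ M]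
  (H : HermitianStructure E M)
  {D : CovariantDerivative 𝓘(ℝ, E) E (fun x : M ↦ TangentSpace 𝓘(ℝ, E) x)} {x₀ x : M}
  (hx : x ∈ (extChartAt 𝓘(ℝ, E) x₀).source)

include hx in
lemma apply_chartField (u v : E) : D (chartField x₀ v) x (chartField x₀ u x)
    = chartField x₀ (D.christoffel x₀ x u v) x := by
  have h := (D.chart_section hx (h := fun _ ↦ v) (differentiableAt_const v)).2 u
  simpa using h

omit [FiniteDimensional ℝ E] [IsManifold 𝓘(ℝ, E) ∞ M] in
lemma chartField_sub (u v : E) :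
    chartField x₀ (u - v) x = chartField x₀ u x - chartField x₀ v x :=
  map_sub (chartInv x₀ x) u v

variable {H}

include hx in
lemma fderiv_chartMetric (hD : H.IsHermitianConnection D) (u v w : E) :
    fderiv ℝ (fun y ↦ H.chartMetric x₀ ((extChartAt 𝓘(ℝ, E) x₀).symm y))
        (extChartAt 𝓘(ℝ, E) x₀ x) u v w
      = H.chartMetric x₀ x (D.christoffel x₀ x u v) w
        + H.chartMetric x₀ x v (D.christoffel x₀ x u w) := by
  have : CompleteSpace E := FiniteDimensional.complete ℝ E
  have hv := mdifferentiableAt_chartField hx v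
  have hw := mdifferentiableAt_chartField hx w
  have h1 := hD.metric x _ _ hv hw (chartField x₀ u x)
  rw [mvfderiv_chartField hx (mdiffAt_g hv hw)] at h1
  rw [fderiv_apply_const₂ ((H.contDiffOn_chartMetric.contDiffAt
    (extChartAt_target_mem_nhds' ((extChartAt 𝓘(ℝ, E) x₀).map_source hx))).differentiableAt
      (by simp)), chartMetric_apply, chartMetric_apply, ← apply_chartField hx,
      ← apply_chartField hx]
  exact h1

include hx in
lemma fderiv_chartJ (hD : H.IsHermitianConnection D) (u v : E) :
    fderiv ℝ (fun y ↦ H.chartJ x₀ ((extChartAt 𝓘(ℝ, E) x₀).symm y))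
        (extChartAt 𝓘(ℝ, E) x₀ x) u v
      = H.chartJ x₀ x (D.christoffel x₀ x u v) - D.christoffel x₀ x u (H.chartJ x₀ x v) := by
  have : CompleteSpace E := FiniteDimensional.complete ℝ E
  have hd : DifferentiableAt ℝ (fun y ↦ H.chartJ x₀ ((extChartAt 𝓘(ℝ, E) x₀).symm y))
      (extChartAt 𝓘(ℝ, E) x₀ x) := (H.contDiffOn_chartJ.contDiffAt
    (extChartAt_target_mem_nhds' ((extChartAt 𝓘(ℝ, E) x₀).map_source hx))).differentiableAt
      (by simp)
  have h1 := hD.complex x _ (mdifferentiableAt_chartField hx v) (chartField x₀ u x)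
  obtain ⟨h2, h3⟩ := D.chart_section hx
    (h := fun y ↦ H.chartJ x₀ ((extChartAt 𝓘(ℝ, E) x₀).symm y) v)
    (hd.clm_apply (differentiableAt_const v))
  have h4 : ∀ᶠ z in 𝓝 x, H.J z (chartField x₀ v z)
      = chartField x₀ (H.chartJ x₀ ((extChartAt 𝓘(ℝ, E) x₀).symm (extChartAt 𝓘(ℝ, E) x₀ z)) v) z := by
    filter_upwards [extChartAt_source_mem_nhds' hx] with z hz
    rw [(extChartAt 𝓘(ℝ, E) x₀).left_inv hz, chartField_chartJ H hz]
  rw [D.isCovariantDerivativeOnUniv.congr_of_eventuallyEq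
    (mdiffAt_J (mdifferentiableAt_chartField hx v)) h2 Filter.univ_mem h4, h3 u,
    apply_chartField hx, ← chartField_chartJ H hx, (extChartAt 𝓘(ℝ, E) x₀).left_inv hx] at h1
  rw [fderiv_apply_const hd, ← chartField_injective hx h1, add_sub_cancel_right]

include hx in
lemma torsion_chart (u v : E) : D.torsion x (chartField x₀ u x) (chartField x₀ v x)
    = chartField x₀ (D.christoffel x₀ x u v - D.christoffel x₀ x v u) x := by
  have : CompleteSpace E := FiniteDimensional.complete ℝ E
  rw [D.torsion_apply (mdifferentiableAt_chartField hx u) (mdifferentiableAt_chartField hx v),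
    mlieBracket_chartField hx, sub_zero, apply_chartField hx, apply_chartField hx, chartField_sub]

lemma isHermitianConnection_gauduchon (s : ℝ) :
    H.IsHermitianConnection (H.gauduchonConnection s) where
  metric x Y Z hY hZ v := by
    have h1 := H.isChernConnection_chernConnection.hermitian.metric x Y Z hY hZ v
    have h2 := H.isBismutConnection_bismutConnection.hermitian.metric x Y Z hY hZ v
    simp only [gauduchonConnection_apply, map_add, map_smul, add_apply, smul_apply, smul_eq_mul]
    linear_combination (1 - s / 2) * h1 + s / 2 * h2
  complex x Y hY v := by
    simp only [gauduchonConnection_apply, map_add, map_smul,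
      H.isChernConnection_chernConnection.hermitian.complex x Y hY v,
      H.isBismutConnection_bismutConnection.hermitian.complex x Y hY v]

lemma torsion_gauduchon (s : ℝ) (x : M) (v w : TangentSpace 𝓘(ℝ, E) x) :
    (H.gauduchonConnection s).torsion x v w = (1 - s / 2) • H.chernTorsion x v w
      + (s / 2) • H.bismutConnection.torsion x v w := by
  have : CompleteSpace E := FiniteDimensional.complete ℝ E
  rw [chernTorsion, CovariantDerivative.torsion_apply_eq_extend,
    CovariantDerivative.torsion_apply_eq_extend, CovariantDerivative.torsion_apply_eq_extend]
  simp only [gauduchonConnection_apply]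
  module

include hx in
lemma inner_torsion_gauduchon_chart (s : ℝ) (u v z : E) :
    H.chartMetric x₀ x ((H.gauduchonConnection s).christoffel x₀ x u v
        - (H.gauduchonConnection s).christoffel x₀ x v u) z
      = (1 - 2 * (s / 2)) * H.chartMetric x₀ x (H.chartTorsion x₀ x u v) z
        + s / 2 * (H.chartMetric x₀ x (H.chartTorsion x₀ x u z) v
          - H.chartMetric x₀ x (H.chartTorsion x₀ x v z) u) := by
  simp only [chartMetric_apply, ← torsion_chart hx, torsion_gauduchon, chartField_chartTorsion H hx,
    map_add, map_smul, add_apply, smul_apply, smul_eq_mul, inner_bismutTorsion]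
  rw [chernTorsion_skew x (chartField x₀ z x)]
  simp only [map_neg, neg_apply]
  ring

include hx in
lemma dFundamental_chart (u v w : E) :
    dFundamental (fun y ↦ H.chartMetric x₀ ((extChartAt 𝓘(ℝ, E) x₀).symm y))
        (fun y ↦ H.chartJ x₀ ((extChartAt 𝓘(ℝ, E) x₀).symm y)) (extChartAt 𝓘(ℝ, E) x₀ x) u v w
      = H.dFundamentalForm (chartField x₀ u) (chartField x₀ v) (chartField x₀ w) x := by
  have : CompleteSpace E := FiniteDimensional.complete ℝ E
  have hU := extChartAt_target_mem_nhds' (I := 𝓘(ℝ, E)) ((extChartAt 𝓘(ℝ, E) x₀).map_source hx)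
  have hd := ((H.contDiffOn_chartMetric.contDiffAt hU).clm_comp
    (H.contDiffOn_chartJ.contDiffAt hU)).differentiableAt (by simp)
  have h1 (u v w : E) : fderiv ℝ (fun z ↦ H.chartMetric x₀ ((extChartAt 𝓘(ℝ, E) x₀).symm z)
      ∘L H.chartJ x₀ ((extChartAt 𝓘(ℝ, E) x₀).symm z)) (extChartAt 𝓘(ℝ, E) x₀ x) u v w
      = mvfderiv 𝓘(ℝ, E) (fun y ↦ H.fundamentalForm y (chartField x₀ v y) (chartField x₀ w y)) x
        (chartField x₀ u x) := by
    rw [fderiv_apply_const₂ hd, mvfderiv_chartField hx (f := fun y ↦ H.fundamentalForm y _ _) (mdiffAt_g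
      (mdiffAt_J (mdifferentiableAt_chartField hx v)) (mdifferentiableAt_chartField hx w))]
    refine congrArg (fun L : E →L[ℝ] ℝ ↦ L u) (Filter.EventuallyEq.fderiv_eq ?_)
    filter_upwards [hU] with y hy
    rw [ContinuousLinearMap.comp_apply, chartMetric_apply,
      chartField_chartJ H ((extChartAt 𝓘(ℝ, E) x₀).map_target hy)]
    rfl
  simp only [dFundamental, h1, dFundamentalForm, mlieBracket_chartField hx]
  simp [fundamentalForm]

include hx in
lemma inner_chartTorsion (u v w : E) :
    2 * H.chartMetric x₀ x (H.chartJ x₀ x (H.chartTorsion x₀ x u v)) w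
      = dFundamental (fun y ↦ H.chartMetric x₀ ((extChartAt 𝓘(ℝ, E) x₀).symm y))
        (fun y ↦ H.chartJ x₀ ((extChartAt 𝓘(ℝ, E) x₀).symm y)) (extChartAt 𝓘(ℝ, E) x₀ x) u v w
      - dFundamental (fun y ↦ H.chartMetric x₀ ((extChartAt 𝓘(ℝ, E) x₀).symm y))
        (fun y ↦ H.chartJ x₀ ((extChartAt 𝓘(ℝ, E) x₀).symm y)) (extChartAt 𝓘(ℝ, E) x₀ x)
        (H.chartJ x₀ x u) (H.chartJ x₀ x v) w := by
  have : CompleteSpace E := FiniteDimensional.complete ℝ E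
  rw [dFundamental_chart hx, dFundamental_chart hx,
    dFundamentalForm_eq_chernTorsion (mdifferentiableAt_chartField hx _)
      (mdifferentiableAt_chartField hx _) (mdifferentiableAt_chartField hx _),
    dFundamentalForm_eq_chernTorsion (mdifferentiableAt_chartField hx _)
      (mdifferentiableAt_chartField hx _) (mdifferentiableAt_chartField hx _)]
  simp only [chartMetric_apply, chartField_chartJ H hx, chartField_chartTorsion H hx]
  exact inner_J_chernTorsion x _ _ _

lemma contDiffOn_chartTorsion : ContDiffOn ℝ ∞
    (fun y ↦ H.chartTorsion x₀ ((extChartAt 𝓘(ℝ, E) x₀).symm y))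
      (extChartAt 𝓘(ℝ, E) x₀).target := by
  refine contDiffOn_torsion (isOpen_extChartAt_target x₀) H.contDiffOn_chartMetric
    H.contDiffOn_chartJ
    (fun y hy ↦ H.isHermitianForm_chart ((extChartAt 𝓘(ℝ, E) x₀).map_target hy))
    fun y hy u v w ↦ ?_
  have h := inner_chartTorsion (H := H) ((extChartAt 𝓘(ℝ, E) x₀).map_target hy) u v w
  rwa [(extChartAt 𝓘(ℝ, E) x₀).right_inv hy] at h

lemma contDiffOn_christoffel (s : ℝ) : ContDiffOn ℝ ∞
    (fun y ↦ (H.gauduchonConnection s).christoffel x₀ ((extChartAt 𝓘(ℝ, E) x₀).symm y))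
      (extChartAt 𝓘(ℝ, E) x₀).target := by
  refine contDiffOn_connection (isOpen_extChartAt_target x₀) H.contDiffOn_chartMetric
    (fun y hy ↦ H.isHermitianForm_chart ((extChartAt 𝓘(ℝ, E) x₀).map_target hy))
    H.contDiffOn_chartTorsion (a := s / 2) (fun y hy u v w ↦ ?_) (fun y hy u v z ↦
      inner_torsion_gauduchon_chart ((extChartAt 𝓘(ℝ, E) x₀).map_target hy) s u v z)
  have h := fderiv_chartMetric ((extChartAt 𝓘(ℝ, E) x₀).map_target hy)
    (isHermitianConnection_gauduchon (H := H) s) u v w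
  rwa [(extChartAt 𝓘(ℝ, E) x₀).right_inv hy] at h

include hx in
lemma curvature_chartField {Γ : E → E →L[ℝ] E →L[ℝ] E}
    (hΓ : Γ = fun y ↦ D.christoffel x₀ ((extChartAt 𝓘(ℝ, E) x₀).symm y)) {p : E}
    (hp : p = extChartAt 𝓘(ℝ, E) x₀ x) (hd : DifferentiableAt ℝ Γ p) (u v w : E) :
    curvature D (chartField x₀ u) (chartField x₀ v) (chartField x₀ w) x
      = chartField x₀ (fderiv ℝ Γ p u v w - fderiv ℝ Γ p v u w + Γ p u (Γ p v w)
        - Γ p v (Γ p u w)) x := by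
  have : CompleteSpace E := FiniteDimensional.complete ℝ E
  subst hp
  have hΓx : Γ (extChartAt 𝓘(ℝ, E) x₀ x) = D.christoffel x₀ x := by
    simp only [hΓ, (extChartAt 𝓘(ℝ, E) x₀).left_inv hx]
  have h1 (u v : E) : D (fun y ↦ D (chartField x₀ w) y (chartField x₀ v y)) x (chartField x₀ u x)
      = chartField x₀ (fderiv ℝ Γ (extChartAt 𝓘(ℝ, E) x₀ x) u v w
        + D.christoffel x₀ x u (D.christoffel x₀ x v w)) x := by
    obtain ⟨h2, h3⟩ := D.chart_section hx (h := fun y ↦ Γ y v w)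
      ((hd.clm_apply (differentiableAt_const v)).clm_apply (differentiableAt_const w))
    have h4 : ∀ᶠ z in 𝓝 x, D (chartField x₀ w) z (chartField x₀ v z)
        = chartField x₀ (Γ (extChartAt 𝓘(ℝ, E) x₀ z) v w) z := by
      filter_upwards [extChartAt_source_mem_nhds' hx] with z hz
      simp only [hΓ, (extChartAt 𝓘(ℝ, E) x₀).left_inv hz, apply_chartField hz]
    have h5 : MDiffAt (T% (fun y ↦ D (chartField x₀ w) y (chartField x₀ v y))) x :=
      h2.congr_of_eventuallyEq (h4.mono fun z hz ↦ congrArg (TotalSpace.mk z) hz)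
    rw [D.isCovariantDerivativeOnUniv.congr_of_eventuallyEq h5 h2 Filter.univ_mem h4, h3,
      fderiv_apply_const₂ hd, hΓx]
  rw [curvature, h1, h1, mlieBracket_chartField hx, map_zero, sub_zero, ← chartField_sub, hΓx]
  congr 1
  abel

theorem isGauduchonChart {s : ℝ} (hs : s ≠ 0) (hKL : H.IsKahlerLike (H.gauduchonConnection s))
    (x₀ : M) : IsGauduchonChart (s / 2) (extChartAt 𝓘(ℝ, E) x₀).target
      (fun y ↦ H.chartMetric x₀ ((extChartAt 𝓘(ℝ, E) x₀).symm y))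
      (fun y ↦ H.chartJ x₀ ((extChartAt 𝓘(ℝ, E) x₀).symm y))
      (fun y ↦ H.chartTorsion x₀ ((extChartAt 𝓘(ℝ, E) x₀).symm y))
      (fun y ↦ (H.gauduchonConnection s).christoffel x₀ ((extChartAt 𝓘(ℝ, E) x₀).symm y)) := by
  have : CompleteSpace E := FiniteDimensional.complete ℝ E
  have hU := isOpen_extChartAt_target (I := 𝓘(ℝ, E)) x₀
  set φ := extChartAt 𝓘(ℝ, E) x₀ with hφ
  have hs' {y : E} (hy : y ∈ φ.target) : φ.symm y ∈ φ.source := φ.map_target hy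
  have hD := isHermitianConnection_gauduchon (H := H) s
  have hΓ : ∀ y ∈ φ.target, DifferentiableAt ℝ
      (fun y ↦ (H.gauduchonConnection s).christoffel x₀ (φ.symm y)) y := fun y hy ↦
    (contDiffOn_christoffel s |>.contDiffAt (hU.mem_nhds hy)).differentiableAt (by simp)
  refine ⟨div_ne_zero hs two_ne_zero, hU,
    fun y hy ↦ (H.contDiffOn_chartMetric.contDiffAt (hU.mem_nhds hy)).differentiableAt (by simp),
    hΓ, fun y hy ↦ (H.contDiffOn_chartJ.contDiffAt (hU.mem_nhds hy)).of_le ENat.LEInfty.out,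
    fun y hy ↦ (contDiffOn_chartTorsion.contDiffAt (hU.mem_nhds hy)).of_le ENat.LEInfty.out,
    fun y hy ↦ H.isHermitianForm_chart (hs' hy), fun y hy u v w ↦ ?_, fun y hy u v ↦ ?_,
    fun y hy v w ↦ H.chartTorsion_skew (hs' hy) v w,
    fun y hy v w ↦ H.chartTorsion_J (hs' hy) v w,
    fun y hy u v z ↦ inner_torsion_gauduchon_chart (hs' hy) s u v z, fun y hy u v w ↦ ?_⟩
  · have h := fderiv_chartMetric (hs' hy) hD u v w
    rwa [φ.right_inv hy] at h
  · have h := fderiv_chartJ (hs' hy) hD u v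
    rwa [φ.right_inv hy] at h
  · have h1 := hKL.bianchi (φ.symm y) _ _ _ (contMDiffAt_chartField (hs' hy) u)
      (contMDiffAt_chartField (hs' hy) v) (contMDiffAt_chartField (hs' hy) w)
    have h2 := curvature_chartField (D := H.gauduchonConnection s) (hs' hy) rfl
      (φ.right_inv hy).symm (hΓ y hy)
    rw [h2, h2, h2] at h1
    refine chartField_injective (hs' hy) ?_
    refine Eq.trans ?_ (h1.trans (map_zero (chartInv x₀ (φ.symm y))).symm)
    refine (map_add (chartInv x₀ (φ.symm y)) _ _).trans ?_
    congr 1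
    exact map_add (chartInv x₀ (φ.symm y)) _ _

end HermitianStructure

end

/-! ### Naturality of the Chern torsion. -/

noncomputable section

open Bundle FiberBundle VectorField
open scoped Manifold ContDiff Topology

/-! ### Naturality of unitary frames -/

section

variable {E : Type*} [NormedAddCommGroup E] [NormedSpace ℝ E]
  {ι : Type*} {g g' : E →L[ℝ] E →L[ℝ] ℝ} {J J' A : E →L[ℝ] E}
  {T T' : E →L[ℝ] E →L[ℝ] E} {e : ι → E} (hA : Function.Surjective A)
  (hg : ∀ v w, g' (A v) (A w) = g v w) (hJ : ∀ v, J' (A v) = A (J v))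

include hA hg hJ in
lemma IsUnitaryFrame.map [Fintype ι] [DecidableEq ι] (he : IsUnitaryFrame g J e) : IsUnitaryFrame g' J' (fun i ↦ A (e i)) where
  inner i j := by rw [hg, he.inner]
  inner_J i j := by rw [hJ, hg, he.inner_J]
  expand v := by
    obtain ⟨w, rfl⟩ := hA v
    conv_lhs => rw [he.expand w]
    simp only [hJ, hg, map_sum, map_add, map_smul]

include hg hJ in
lemma unitaryArray_map (hT : ∀ v w, T' (A v) (A w) = A (T v w)) :
    unitaryArray g' J' T' (fun i ↦ A (e i)) = unitaryArray g J T e := by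
  ext i j k
  simp [unitaryArray, unitaryCoord, hT, hJ, hg]

end

/-! ### Invariance under biholomorphic isometries -/

namespace HermitianStructure

variable {E : Type*} [NormedAddCommGroup E] [NormedSpace ℝ E] [FiniteDimensional ℝ E]
  {M : Type*} [TopologicalSpace M] [ChartedSpace E M] [IsManifold 𝓘(ℝ, E) ∞ M]
  {H : HermitianStructure E M} {φ : Diffeomorph 𝓘(ℝ, E) 𝓘(ℝ, E) M M ∞}

namespace IsBiholomorphicIsometry

variable (hφ : H.IsBiholomorphicIsometry φ)
include hφ

lemma dFundamentalForm_mpullback {x : M} {X Y Z : Π x : M, TangentSpace 𝓘(ℝ, E) x}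
    (hX : MDiffAt (T% X) (φ x)) (hY : MDiffAt (T% Y) (φ x)) (hZ : MDiffAt (T% Z) (φ x)) :
    H.dFundamentalForm (mpullback 𝓘(ℝ, E) 𝓘(ℝ, E) φ X) (mpullback 𝓘(ℝ, E) 𝓘(ℝ, E) φ Y)
      (mpullback 𝓘(ℝ, E) 𝓘(ℝ, E) φ Z) x = H.dFundamentalForm X Y Z (φ x) := by
  have : CompleteSpace E := FiniteDimensional.complete ℝ E
  have : IsManifold 𝓘(ℝ, E) (minSmoothness ℝ 2) M := by
    rw [minSmoothness_of_isRCLikeNormedField]; infer_instance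
  have hinv (y : M) : (mfderiv 𝓘(ℝ, E) 𝓘(ℝ, E) φ y).IsInvertible :=
    ⟨φ.mfderivToContinuousLinearEquiv (by simp) y, rfl⟩
  have h1 (X : Π x : M, TangentSpace 𝓘(ℝ, E) x) (y : M) :
      mfderiv 𝓘(ℝ, E) 𝓘(ℝ, E) φ y (mpullback 𝓘(ℝ, E) 𝓘(ℝ, E) φ X y) = X (φ y) :=
    (hinv y).self_apply_inverse _
  have h2 (y : M) (v w : TangentSpace 𝓘(ℝ, E) y) : H.fundamentalForm y v w
      = H.fundamentalForm (φ y) (mfderiv 𝓘(ℝ, E) 𝓘(ℝ, E) φ y v)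
        (mfderiv 𝓘(ℝ, E) 𝓘(ℝ, E) φ y w) := by
    rw [fundamentalForm, fundamentalForm, ← hφ.holomorphic, hφ.isometry]
  have h3 (X Y : Π x : M, TangentSpace 𝓘(ℝ, E) x) :
      (fun y ↦ H.fundamentalForm y (mpullback 𝓘(ℝ, E) 𝓘(ℝ, E) φ X y)
        (mpullback 𝓘(ℝ, E) 𝓘(ℝ, E) φ Y y)) = (fun y ↦ H.fundamentalForm y (X y) (Y y)) ∘ φ := by
    ext y
    rw [h2, h1, h1, Function.comp_apply]
  have h4 {X Y : Π x : M, TangentSpace 𝓘(ℝ, E) x} (hX : MDiffAt (T% X) (φ x))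
      (hY : MDiffAt (T% Y) (φ x)) (Z : Π x : M, TangentSpace 𝓘(ℝ, E) x) :
      mvfderiv 𝓘(ℝ, E) ((fun y ↦ H.fundamentalForm y (X y) (Y y)) ∘ φ) x
        (mpullback 𝓘(ℝ, E) 𝓘(ℝ, E) φ Z x)
      = mvfderiv 𝓘(ℝ, E) (fun y ↦ H.fundamentalForm y (X y) (Y y)) (φ x) (Z (φ x)) := by
    rw [mvfderiv_comp_apply x (g := fun y ↦ H.fundamentalForm y (X y) (Y y))
      (mdiffAt_g (mdiffAt_J hX) hY)
      (φ.contMDiff.mdifferentiable (by simp) x), h1]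
  have h5 {X Y : Π x : M, TangentSpace 𝓘(ℝ, E) x} (hX : MDiffAt (T% X) (φ x))
      (hY : MDiffAt (T% Y) (φ x)) (Z : Π x : M, TangentSpace 𝓘(ℝ, E) x) :
      H.fundamentalForm x (mlieBracket 𝓘(ℝ, E) (mpullback 𝓘(ℝ, E) 𝓘(ℝ, E) φ X)
        (mpullback 𝓘(ℝ, E) 𝓘(ℝ, E) φ Y) x) (mpullback 𝓘(ℝ, E) 𝓘(ℝ, E) φ Z x)
      = H.fundamentalForm (φ x) (mlieBracket 𝓘(ℝ, E) X Y (φ x)) (Z (φ x)) := by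
    rw [← mpullback_mlieBracket (n := ∞) hX hY φ.contMDiff.contMDiffAt
      (by rw [minSmoothness_of_isRCLikeNormedField]; exact ENat.LEInfty.out), h2, h1, h1]
  simp only [dFundamentalForm, h3]
  rw [h4 hY hZ, h4 hZ hX, h4 hX hY, h5 hX hY, h5 hY hZ, h5 hZ hX]

/-- The form `dω` is preserved by pullback, and `inner_J_chernTorsion` recovers `T` from `dω`, `g`
and `J`; no naturality of the connection itself is required. -/
lemma chernTorsion_map (x : M) (v w : TangentSpace 𝓘(ℝ, E) x) :
    H.chernTorsion (φ x) (mfderiv 𝓘(ℝ, E) 𝓘(ℝ, E) φ x v) (mfderiv 𝓘(ℝ, E) 𝓘(ℝ, E) φ x w)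
      = mfderiv 𝓘(ℝ, E) 𝓘(ℝ, E) φ x (H.chernTorsion x v w) := by
  have : CompleteSpace E := FiniteDimensional.complete ℝ E
  set A := mfderiv 𝓘(ℝ, E) 𝓘(ℝ, E) φ x with hA
  have hinv : A.IsInvertible := ⟨φ.mfderivToContinuousLinearEquiv (by simp) x, rfl⟩
  have h1 (v : TangentSpace 𝓘(ℝ, E) x) : mpullback 𝓘(ℝ, E) 𝓘(ℝ, E) φ (extend E (A v)) x = v := by
    rw [mpullback_apply, extend_apply_self]
    exact hinv.inverse_apply_self v
  have h2 (u v w : TangentSpace 𝓘(ℝ, E) x) :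
      H.g.inner x (H.J x (H.chernTorsion x u v)) w
        + H.g.inner x (H.J x (H.chernTorsion x v w)) u
        + H.g.inner x (H.J x (H.chernTorsion x w u)) v
      = H.g.inner (φ x) (H.J (φ x) (H.chernTorsion (φ x) (A u) (A v))) (A w)
        + H.g.inner (φ x) (H.J (φ x) (H.chernTorsion (φ x) (A v) (A w))) (A u)
        + H.g.inner (φ x) (H.J (φ x) (H.chernTorsion (φ x) (A w) (A u))) (A v) := by
    have hd (v : TangentSpace 𝓘(ℝ, E) x) := mdifferentiableAt_extend 𝓘(ℝ, E) E (A v)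
    have hd' (v : TangentSpace 𝓘(ℝ, E) x) :
        MDiffAt (T% (mpullback 𝓘(ℝ, E) 𝓘(ℝ, E) φ (extend E (A v)))) x :=
      (hd v).mpullback_vectorField (n := ∞) φ.contMDiff.contMDiffAt hinv ENat.LEInfty.out
    have h3 := hφ.dFundamentalForm_mpullback (hd u) (hd v) (hd w)
    rw [dFundamentalForm_eq_chernTorsion (hd' u) (hd' v) (hd' w),
      dFundamentalForm_eq_chernTorsion (hd u) (hd v) (hd w)] at h3
    simpa only [h1, extend_apply_self] using h3
  have h3 : H.J (φ x) (H.chernTorsion (φ x) (A v) (A w))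
      = H.J (φ x) (A (H.chernTorsion x v w)) := by
    refine H.g_nondeg _ fun z ↦ ?_
    obtain ⟨u, rfl⟩ : ∃ u, A u = z := ⟨_, hinv.self_apply_inverse z⟩
    have h4 := inner_J_chernTorsion (H := H) (φ x) (A v) (A w) (A u)
    have h5 := inner_J_chernTorsion (H := H) x v w u
    have h6 := hφ.holomorphic x
    rw [← hA] at h6
    rw [h2, h2, ← hφ.isometry, ← hA] at h5
    rw [← h6, ← h6, ← h5] at h4
    rw [← h6]
    linarith
  have h4 := congrArg (H.J (φ x)) h3
  rw [H.J_J, H.J_J] at h4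
  exact neg_injective h4

end IsBiholomorphicIsometry

end HermitianStructure

end

/-! ### Global norms of the torsion and the maximum argument. -/

noncomputable section

open Bundle FiberBundle VectorField
open scoped Manifold ContDiff Topology
open TorsionArray

/-! ### The norms of the Chern torsion and of its trace -/

namespace HermitianStructure

variable {E : Type*} [NormedAddCommGroup E] [NormedSpace ℝ E] [FiniteDimensional ℝ E]
  {M : Type*} [TopologicalSpace M] [ChartedSpace E M] [IsManifold 𝓘(ℝ, E) ∞ M]
  (H : HermitianStructure E M)

/-- The metric at `x`, as a bilinear form on the model space. -/
def metricAt (x : M) : E →L[ℝ] E →L[ℝ] ℝ := H.g.inner x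

/-- The complex structure at `x`, as an endomorphism of the model space. -/
def complexAt (x : M) : E →L[ℝ] E := H.J x

/-- The Chern torsion at `x`, as a bilinear map on the model space. -/
def torsionAt (x : M) : E →L[ℝ] E →L[ℝ] E := H.chernTorsion x

omit [FiniteDimensional ℝ E] in
lemma isHermitianForm_at (x : M) : IsHermitianForm (H.metricAt x) (H.complexAt x) where
  symm v w := H.g.symm x v w
  pos v hv := H.g.pos x v hv
  J_J v := H.J_J x v
  inner_J_J v w := H.g_J_J x v w

lemma exists_frame (x : M) : ∃ (n : ℕ) (e : Fin n → E),
    IsUnitaryFrame (H.metricAt x) (H.complexAt x) e :=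
  (H.isHermitianForm_at x).exists_isUnitaryFrame

/-- A unitary frame of the tangent space at `x`. -/
def unitaryFrame (x : M) : Fin (H.exists_frame x).choose → E := (H.exists_frame x).choose_spec.choose

lemma isUnitaryFrame (x : M) :
    IsUnitaryFrame (H.metricAt x) (H.complexAt x) (H.unitaryFrame x) :=
  (H.exists_frame x).choose_spec.choose_spec

/-- The components of the Chern torsion in the frame `e` of the tangent space at `x`. -/
def torsionArray {ι : Type*} (x : M) (e : ι → E) : ι → ι → ι → ℂ :=
  unitaryArray (H.metricAt x) (H.complexAt x) (H.torsionAt x) e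

/-- The squared norm of the Chern torsion. -/
def torsionSq (x : M) : ℝ := normSq (H.torsionArray x (H.unitaryFrame x))

/-- The squared norm of the trace of the Chern torsion. -/
def traceSq (x : M) : ℝ := normSqEta (H.torsionArray x (H.unitaryFrame x))

variable {H} {ι : Type*} [Fintype ι] [DecidableEq ι] {x : M}

lemma torsionSq_eq {e : ι → E} (he : IsUnitaryFrame (H.metricAt x) (H.complexAt x) e) :
    H.torsionSq x = normSq (H.torsionArray x e) :=
  (H.isUnitaryFrame x).normSq_eq (H.isHermitianForm_at x) (chernTorsion_skew x)
    (chernTorsion_J_left x) he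

lemma traceSq_eq {e : ι → E} (he : IsUnitaryFrame (H.metricAt x) (H.complexAt x) e) :
    H.traceSq x = normSqEta (H.torsionArray x e) :=
  (H.isUnitaryFrame x).normSqEta_eq (H.isHermitianForm_at x) (chernTorsion_skew x)
    (chernTorsion_J_left x) he

lemma torsionSq_nonneg (x : M) : 0 ≤ H.torsionSq x := by
  unfold torsionSq normSq
  exact Finset.sum_nonneg fun _ _ ↦ Finset.sum_nonneg fun _ _ ↦ Finset.sum_nonneg fun _ _ ↦
    Complex.normSq_nonneg _

lemma traceSq_nonneg (x : M) : 0 ≤ H.traceSq x := by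
  unfold traceSq normSqEta
  exact Finset.sum_nonneg fun _ _ ↦ Complex.normSq_nonneg _

lemma chernTorsion_eq_zero (h : H.torsionSq x = 0) (v w : TangentSpace 𝓘(ℝ, E) x) :
    H.chernTorsion x v w = 0 := by
  have h0 (i j k) : H.torsionArray x (H.unitaryFrame x) i j k = 0 := by
    unfold torsionSq normSq at h
    have h1 := (Finset.sum_eq_zero_iff_of_nonneg fun _ _ ↦ Finset.sum_nonneg fun _ _ ↦
      Finset.sum_nonneg fun _ _ ↦ Complex.normSq_nonneg _).1 h i (Finset.mem_univ _)
    have h2 := (Finset.sum_eq_zero_iff_of_nonneg fun _ _ ↦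
      Finset.sum_nonneg fun _ _ ↦ Complex.normSq_nonneg _).1 h1 j (Finset.mem_univ _)
    exact Complex.normSq_eq_zero.1 ((Finset.sum_eq_zero_iff_of_nonneg fun _ _ ↦
      Complex.normSq_nonneg _).1 h2 k (Finset.mem_univ _))
  have h1 (v w : E) : H.torsionAt x v w = 0 := by
    refine (H.isUnitaryFrame x).ext fun k ↦ ?_
    rw [IsUnitaryFrame.coord_T (H.isHermitianForm_at x) (H.isUnitaryFrame x)
      (T := H.torsionAt x) (chernTorsion_skew x) (chernTorsion_J_left x) v w k, map_zero]
    refine Finset.sum_eq_zero fun i _ ↦ Finset.sum_eq_zero fun j _ ↦ ?_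
    have h2 := h0 i j k
    rw [torsionArray] at h2
    rw [h2, zero_mul, zero_mul]
  exact h1 v w

section Isometry

variable {φ : Diffeomorph 𝓘(ℝ, E) 𝓘(ℝ, E) M M ∞} (hφ : H.IsBiholomorphicIsometry φ)
include hφ

lemma IsBiholomorphicIsometry.exists_frame (x : M) : ∃ e' : Fin (H.exists_frame x).choose → E,
    IsUnitaryFrame (H.metricAt (φ x)) (H.complexAt (φ x)) e' ∧
    H.torsionArray (φ x) e' = H.torsionArray x (H.unitaryFrame x) := by
  let A : E →L[ℝ] E := mfderiv 𝓘(ℝ, E) 𝓘(ℝ, E) φ x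
  have hA : Function.Surjective A := (φ.mfderivToContinuousLinearEquiv (by simp) x).surjective
  have hg (v w : E) : H.metricAt (φ x) (A v) (A w) = H.metricAt x v w := hφ.isometry x v w
  have hJ (v : E) : H.complexAt (φ x) (A v) = A (H.complexAt x v) := (hφ.holomorphic x v).symm
  exact ⟨fun i ↦ A (H.unitaryFrame x i), (H.isUnitaryFrame x).map hA hg hJ,
    unitaryArray_map hg hJ (hφ.chernTorsion_map x)⟩

lemma IsBiholomorphicIsometry.torsionSq_map (x : M) : H.torsionSq (φ x) = H.torsionSq x := by
  obtain ⟨e', he', h⟩ := hφ.exists_frame x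
  rw [torsionSq_eq he', h, torsionSq]

lemma IsBiholomorphicIsometry.traceSq_map (x : M) : H.traceSq (φ x) = H.traceSq x := by
  obtain ⟨e', he', h⟩ := hφ.exists_frame x
  rw [traceSq_eq he', h, traceSq]

end Isometry

section Chart

variable {x₀ : M} (hx : x ∈ (extChartAt 𝓘(ℝ, E) x₀).source)
include hx

lemma frame_of_chart {e : ι → E} (he : IsUnitaryFrame (H.chartMetric x₀ x) (H.chartJ x₀ x) e) :
    IsUnitaryFrame (H.metricAt x) (H.complexAt x) (fun i ↦ (chartInv x₀ x (e i) : E)) ∧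
    H.torsionArray x (fun i ↦ (chartInv x₀ x (e i) : E))
      = unitaryArray (H.chartMetric x₀ x) (H.chartJ x₀ x) (H.chartTorsion x₀ x) e := by
  let A : E →L[ℝ] E := chartInv x₀ x
  have hA : Function.Surjective A := fun v ↦ ⟨_, chartInv_chartDeriv hx v⟩
  have hg (v w : E) : H.metricAt x (A v) (A w) = H.chartMetric x₀ x v w := rfl
  have hJ (v : E) : H.complexAt x (A v) = A (H.chartJ x₀ x v) :=
    (chartField_chartJ H hx v).symm
  exact ⟨he.map hA hg hJ, unitaryArray_map hg hJ fun v w ↦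
    (chartField_chartTorsion H hx v w).symm⟩

lemma torsionSq_chart {e : ι → E}
    (he : IsUnitaryFrame (H.chartMetric x₀ x) (H.chartJ x₀ x) e) : H.torsionSq x
      = normSq (unitaryArray (H.chartMetric x₀ x) (H.chartJ x₀ x) (H.chartTorsion x₀ x) e) := by
  obtain ⟨h1, h2⟩ := frame_of_chart hx he
  rw [torsionSq_eq h1, h2]

lemma traceSq_chart {e : ι → E}
    (he : IsUnitaryFrame (H.chartMetric x₀ x) (H.chartJ x₀ x) e) : H.traceSq x
      = normSqEta (unitaryArray (H.chartMetric x₀ x) (H.chartJ x₀ x) (H.chartTorsion x₀ x) e) := by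
  obtain ⟨h1, h2⟩ := frame_of_chart hx he
  rw [traceSq_eq h1, h2]

end Chart

section KahlerLike

variable {s : ℝ} (hs : s ≠ 0) (hKL : H.IsKahlerLike (H.gauduchonConnection s))
include hs hKL

/-- The frame chosen at each point need not vary continuously. By frame independence the function
may be computed near a given point in the frames of a parallel gauge, whose components are
differentiable, hence continuous, there. -/
lemma continuous_torsionArray_comp {f : M → ℝ}
    {Φ : ∀ n : ℕ, (Fin n → Fin n → Fin n → ℂ) → ℝ} (hΦ : ∀ n, Continuous (Φ n))
    (hf : ∀ x₀, ∀ x ∈ (extChartAt 𝓘(ℝ, E) x₀).source, ∀ n, ∀ e : Fin n → E,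
      IsUnitaryFrame (H.chartMetric x₀ x) (H.chartJ x₀ x) e → f x = Φ n
        (unitaryArray (H.chartMetric x₀ x) (H.chartJ x₀ x) (H.chartTorsion x₀ x) e)) :
    Continuous f := by
  refine continuous_iff_continuousAt.2 fun x₀ ↦ ?_
  have hC := isGauduchonChart hs hKL x₀
  set φ := extChartAt 𝓘(ℝ, E) x₀ with hφ
  have hx : x₀ ∈ φ.source := mem_extChartAt_source x₀
  have hp : φ x₀ ∈ φ.target := φ.map_source hx
  obtain ⟨n, e, he⟩ := (hC.hermitian _ hp).exists_isUnitaryFrame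
  obtain ⟨Q, hQ⟩ := hC.exists_isParallelGauge hp
  have h1 : ContinuousAt (fun y ↦ f (φ.symm y)) (φ x₀) := by
    have h2 : ContinuousAt (fun y ↦ Φ n (unitaryArray (H.chartMetric x₀ (φ.symm y))
        (H.chartJ x₀ (φ.symm y)) (H.chartTorsion x₀ (φ.symm y)) fun i ↦ Q y (e i))) (φ x₀) := by
      refine (hΦ n).continuousAt.comp ?_
      refine continuousAt_pi.2 fun i ↦ continuousAt_pi.2 fun j ↦ continuousAt_pi.2 fun k ↦ ?_
      have h3 := hC.hasWirtingerAt_array hp he hQ i j k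
      exact HasFDerivAt.continuousAt h3
    refine h2.congr ?_
    filter_upwards [hC.eventually_isParallelGauge hp hQ he] with y hy
    exact (hf x₀ _ (φ.map_target hy.1) n _ hy.2).symm
  refine (h1.comp (continuousAt_extChartAt x₀)).congr ?_
  filter_upwards [extChartAt_source_mem_nhds (I := 𝓘(ℝ, E)) x₀] with y hy
  simp only [Function.comp_apply, φ.left_inv hy]

lemma continuous_torsionSq : Continuous H.torsionSq :=
  continuous_torsionArray_comp hs hKL (Φ := fun _ t ↦ normSq t)
    (fun n ↦ continuous_finsetSum _ fun i _ ↦ continuous_finsetSum _ fun j _ ↦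
      continuous_finsetSum _ fun k _ ↦ Complex.continuous_normSq.comp (by fun_prop))
    fun _ _ hx _ _ he ↦ torsionSq_chart hx he

lemma continuous_traceSq : Continuous H.traceSq :=
  continuous_torsionArray_comp hs hKL (Φ := fun _ t ↦ normSqEta t)
    (fun n ↦ continuous_finsetSum _ fun i _ ↦ Complex.continuous_normSq.comp
      (continuous_finsetSum _ fun k _ ↦ by fun_prop))
    fun _ _ hx _ _ he ↦ traceSq_chart hx he

lemma traceSq_eq_zero_of_isMax (h2 : s ≠ 2) (h12 : 4 * (s / 2) - 1 ≠ 0)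
    (h1 : 1 - 2 * (s / 2) ≠ 0) {θ : ℝ} (hθ : IsGeneric (s / 2) θ) {x₀ : M}
    (hmax : ∀ x, H.traceSq x + θ * H.torsionSq x ≤ H.traceSq x₀ + θ * H.torsionSq x₀) :
    H.traceSq x₀ = 0 := by
  have hC := isGauduchonChart hs hKL x₀
  set φ := extChartAt 𝓘(ℝ, E) x₀
  have hx : x₀ ∈ φ.source := mem_extChartAt_source x₀
  have hp : φ x₀ ∈ φ.target := φ.map_source hx
  obtain ⟨n, e, he⟩ := (hC.hermitian _ hp).exists_isUnitaryFrame
  have h3 := hC.normSqEta_eq_zero_of_isLocalMax hp he (fun h ↦ h2 (by linarith)) h1 h12 hθ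
    (F := fun y ↦ H.traceSq (φ.symm y) + θ * H.torsionSq (φ.symm y))
    (fun y hy e' he' ↦ by
      rw [traceSq_chart (φ.map_target hy) he', torsionSq_chart (φ.map_target hy) he'])
    (Filter.Eventually.of_forall fun y ↦ by
      simp only [φ.left_inv hx]
      exact hmax _)
  have h4 := traceSq_chart (φ.map_target hp) he
  rwa [h3, φ.left_inv hx] at h4

lemma torsionSq_eq_zero (h0 : ∀ x, H.traceSq x = 0) (x₀ : M) : H.torsionSq x₀ = 0 := by
  have hC := isGauduchonChart hs hKL x₀
  set φ := extChartAt 𝓘(ℝ, E) x₀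
  have hx : x₀ ∈ φ.source := mem_extChartAt_source x₀
  have hp : φ x₀ ∈ φ.target := φ.map_source hx
  obtain ⟨n, e, he⟩ := (hC.hermitian _ hp).exists_isUnitaryFrame
  have h3 := hC.normSq_eq_zero hp he fun y hy e' he' ↦ by
    rw [← traceSq_chart (φ.map_target hy) he', h0]
  have h4 := torsionSq_chart (φ.map_target hp) he
  rwa [h3, φ.left_inv hx] at h4

lemma torsionSq_eq_zero_of_eq (h12 : 4 * (s / 2) - 1 = 0) (x₀ : M) : H.torsionSq x₀ = 0 := by
  have hC := isGauduchonChart hs hKL x₀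
  set φ := extChartAt 𝓘(ℝ, E) x₀
  have hx : x₀ ∈ φ.source := mem_extChartAt_source x₀
  have hp : φ x₀ ∈ φ.target := φ.map_source hx
  obtain ⟨n, e, he⟩ := (hC.hermitian _ hp).exists_isUnitaryFrame
  have h3 := hC.normSq_eq_zero_of_eq hp he h12
  have h4 := torsionSq_chart (φ.map_target hp) he
  rwa [h3, φ.left_inv hx] at h4

end KahlerLike

lemma traceSq_eq_zero_of_isMax_one {s : ℝ} (hs : s = 1)
    (hKL : H.IsKahlerLike (H.gauduchonConnection s)) {x₀ : M}
    (hmax : ∀ x, H.traceSq x ≤ H.traceSq x₀) : H.traceSq x₀ = 0 := by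
  have hC := isGauduchonChart (hs.trans_ne one_ne_zero) hKL x₀
  set φ := extChartAt 𝓘(ℝ, E) x₀
  have hx : x₀ ∈ φ.source := mem_extChartAt_source x₀
  have hp : φ x₀ ∈ φ.target := φ.map_source hx
  obtain ⟨n, e, he⟩ := (hC.hermitian _ hp).exists_isUnitaryFrame
  have h1 : s / 2 = 1 / 2 := by rw [hs]
  rw [h1] at hC
  have h3 := hC.normSqEta_eq_zero_of_isLocalMax_half hp he (F := fun y ↦ H.traceSq (φ.symm y))
    (fun y hy e' he' ↦ traceSq_chart (φ.map_target hy) he')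
    (Filter.Eventually.of_forall fun y ↦ by
      simp only [φ.left_inv hx]
      exact hmax _)
  have h4 := traceSq_chart (φ.map_target hp) he
  rwa [h3, φ.left_inv hx] at h4

-- Every value of an invariant function is already taken on `K`, so a maximum over the compact set
-- is global.
omit [FiniteDimensional ℝ E] in
lemma HasCompactFundamentalDomain.exists_isMax [Nonempty M] (hG : H.HasCompactFundamentalDomain)
    {f : M → ℝ} (hf : Continuous f)
    (hinv : ∀ φ, H.IsBiholomorphicIsometry φ → ∀ x, f (φ x) = f x) : ∃ x₀, ∀ x, f x ≤ f x₀ := by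
  obtain ⟨K, hK, hKG⟩ := hG
  have hmem (x : M) : ∃ k ∈ K, f k = f x := by
    have hx : x ∈ ⋃ φ ∈ {φ : Diffeomorph 𝓘(ℝ, E) 𝓘(ℝ, E) M M ∞ | H.IsBiholomorphicIsometry φ},
        φ '' K := hKG ▸ Set.mem_univ x
    simp only [Set.mem_iUnion] at hx
    obtain ⟨φ, hφ, k, hk, rfl⟩ := hx
    exact ⟨k, hk, (hinv φ hφ k).symm⟩
  obtain ⟨k, hk, -⟩ := hmem (Classical.arbitrary M)
  obtain ⟨x₀, -, hx₀⟩ := hK.exists_isMaxOn ⟨k, hk⟩ hf.continuousOn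
  refine ⟨x₀, fun x ↦ ?_⟩
  obtain ⟨k, hk, hkx⟩ := hmem x
  exact hkx ▸ hx₀ hk

theorem torsionSq_eq_zero_of_isKahlerLike {s : ℝ} (hs0 : s ≠ 0) (hs2 : s ≠ 2)
    (hKL : H.IsKahlerLike (H.gauduchonConnection s)) (hG : H.HasCompactFundamentalDomain)
    (x : M) : H.torsionSq x = 0 := by
  have : Nonempty M := ⟨x⟩
  by_cases h12 : 4 * (s / 2) - 1 = 0
  · exact torsionSq_eq_zero_of_eq hs0 hKL h12 x
  refine torsionSq_eq_zero hs0 hKL (fun x ↦ ?_) x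
  by_cases h1 : s = 1
  · obtain ⟨x₀, hx₀⟩ := hG.exists_isMax (continuous_traceSq hs0 hKL)
      fun φ hφ ↦ hφ.traceSq_map
    exact le_antisymm ((hx₀ x).trans_eq (traceSq_eq_zero_of_isMax_one h1 hKL hx₀))
      (traceSq_nonneg x)
  · obtain ⟨x₁, hx₁⟩ := hG.exists_isMax (continuous_torsionSq hs0 hKL)
      fun φ hφ ↦ hφ.torsionSq_map
    have hC : 0 < H.torsionSq x₁ + 1 := by linarith [torsionSq_nonneg (H := H) x₁]
    refine le_antisymm (le_of_forall_pos_le_add fun ε hε ↦ ?_) (traceSq_nonneg x)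
    -- With `θ` below `ε / (max |T|² + 1)`, the maximum of `|η|² + θ |T|²`, where `η` vanishes, is
    -- at most `ε`. The summand `1` keeps the denominator positive.
    obtain ⟨θ, hθ0, hθ1, hθ⟩ := exists_isGeneric (s / 2) (div_pos hε hC)
    obtain ⟨x₀, hx₀⟩ := hG.exists_isMax (f := fun x ↦ H.traceSq x + θ * H.torsionSq x)
      ((continuous_traceSq hs0 hKL).add (continuous_const.mul (continuous_torsionSq hs0 hKL)))
      fun φ hφ x ↦ by rw [hφ.traceSq_map, hφ.torsionSq_map]
    have h3 := traceSq_eq_zero_of_isMax hs0 hKL hs2 h12 (fun h ↦ h1 (by linarith)) hθ hx₀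
    have h4 : θ * H.torsionSq x₀ ≤ ε := by
      calc θ * H.torsionSq x₀ ≤ ε / (H.torsionSq x₁ + 1) * (H.torsionSq x₁ + 1) :=
            mul_le_mul hθ1.le (by linarith [hx₁ x₀]) (torsionSq_nonneg x₀) (by positivity)
        _ = ε := div_mul_cancel₀ _ hC.ne'
    have h5 := hx₀ x
    simp only [h3, zero_add] at h5
    have h6 := mul_nonneg hθ0 (torsionSq_nonneg (H := H) x)
    linarith

end HermitianStructure

end

theorem corollary3p2 {E : Type*} [NormedAddCommGroup E] [NormedSpace ℝ E] [FiniteDimensional ℝ E]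
    {M : Type*} [TopologicalSpace M] [T2Space M] [ChartedSpace E M] [IsManifold 𝓘(ℝ, E) ∞ M]
    (H : HermitianStructure E M) (s : ℝ) (hs0 : s ≠ 0) (hs2 : s ≠ 2)
    (hKL : H.IsKahlerLike (H.gauduchonConnection s))
    (hG : H.HasCompactFundamentalDomain) :
    H.IsKahler := by
  intro x X Y Z hX hY hZ
  have hT := HermitianStructure.chernTorsion_eq_zero
    (HermitianStructure.torsionSq_eq_zero_of_isKahlerLike hs0 hs2 hKL hG x)
  rw [HermitianStructure.dFundamentalForm_eq_chernTorsion hX hY hZ, hT, hT, hT]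
  simp
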